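/- **Setting.** Let $\boldsymbol Y_5=\mathbf C^5$ with coordinates $y=(y_{13},y_{14},y_{24},y_{25},y_{35})$. Let $(\zeta_1,\dots,\zeta_{10})=(y_{13},y_{14},y_{24},y_{25},y_{35},P_1,\dots,P_5)$ with $$P_1=1+y_{25}-y_{24}y_{35},\quad P_2=1+y_{13}-y_{14}y_{35},\quad P_3=1+y_{24}-y_{14}y_{25},\quad P_4=1+y_{35}-y_{13}y_{25},\quad P_5=1+y_{14}-y_{13}y_{24},$$ and let $\boldsymbol Y_5^*=\{y : \zeta_1(y)\cdots\zeta_{10}(y)\neq 0\}$. For $i=1,\dots,10$ let $U_i=(U_{i,1},U_{i,2})$ be $$U_1=(y_{25},\,y_{24}y_{35}),\quad U_2=\Big(\tfrac1{y_{13}},\tfrac{y_{14}y_{35}}{y_{13}}\Big),\quad U_3=(y_{24},\,y_{14}y_{25}),\quad U_4=\Big(\tfrac1{y_{35}},\tfrac{y_{13}y_{25}}{y_{35}}\Big),\quad U_5=(y_{14},\,y_{13}y_{24}),$$ $$U_6=\Big(\tfrac{P_2}{y_{14}P_4},\tfrac{y_{13}P_3}{y_{14}P_4}\Big),\quad U_7=\Big(\tfrac{P_1}{y_{24}P_4},\tfrac{P_3}{y_{24}P_4}\Big),\quad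 U_8=\Big(\tfrac{y_{13}P_1}{P_4},\tfrac{P_2}{P_4}\Big),\quad U_9=\Big(\tfrac{y_{14}P_1}{P_3},\tfrac{y_{24}P_2}{P_3}\Big),\quad U_{10}=\Big(\tfrac{P_1}{y_{35}P_3},\tfrac{y_{25}P_2}{y_{35}P_3}\Big),$$ and set $U_{i,3}=1+U_{i,1}-U_{i,2}$. Each $U_{i,s}$ is a monomial in the $\zeta_k^{\pm1}$. For $i\le 5$ put $\mathcal F_i^{+1}=\mathcal F_{U_i}$ and $\mathcal F_i^{-1}=\mathcal F_{U_{i+5}}$, where $\mathcal F_{U}$ is the foliation with first integral $U$. The web $\mathcal W=\boldsymbol{\mathcal W}^{GM}_{\boldsymbol Y_5}$ is the $10$-web of codimension $2$ on $\boldsymbol Y_5^*$ formed by the $\mathcal F_i^{\pm1}$, $1\le i\le5$. Let $D$ be a nonempty connected open subset of $\boldsymbol Y_5^*$ on which every $\zeta_k$ has a holomorphic logarithm $\mathrm{Log}\,\zeta_k$; fix such logarithms, and let $\mathrm{Log}\,U_{i,s}$ be the corresponding $\mathbf Z$-linear combination of the $\mathrm{Log}\,\zeta_k$. A $k$-abelian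 relation ($k$-AR) on $D$ of a subweb $\mathcal W'$ of $\mathcal W$ is a tuple of holomorphic $k$-forms on $D$, one for each foliation of $\mathcal W'$, of sum zero, such that each component $\eta$ is basic for its foliation: $\iota_v\eta=0$ and $\iota_vd\eta=0$ for every vector $v$ tangent to it. These tuples form a vector space $AR^k(\mathcal W')$, viewed inside $AR^k(\mathcal W)$ by adding zero components; its dimension is the $k$-rank $r^k(\mathcal W')$. The componentwise derivative gives maps $d^k:AR^k\to AR^{k+1}$. A $1$-AR has weight $0$ (resp. weight $1$) if each component is a $\mathbf C$-linear combination of the forms $d\,\mathrm{Log}\,U_{i,s}$ (resp. $\mathrm{Log}\,U_{i,a}\,d\,\mathrm{Log}\,U_{i,b}$) for its index $i$; $W_0$ and $W_1$ denote the spaces of these. $AR^1_{Rat}$ is the space of $1$-ARs with rational components. An AR of $\mathcal W'$ is complete if no component vanishes identically, and irreducible if it is not a sum of ARs of proper subwebs of $\mathcal W'$. $AR^2_C\subset AR^2(\mathcal W)$ is the span of the $2$-ARs of the $5$-subwebs of $\mathcal W$. For $\epsilon\in\{\pm1\}^5$ put $\mathcal W^{\epsilon}=\mathcal W(\mathcal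 F_1^{\epsilon_1},\dots,\mathcal F_5^{\epsilon_5})$; $\epsilon$ is even if $\prod\epsilon_i=1$ and odd otherwise. For $\epsilon$ even, the residue $\mathbf{Res}_\epsilon$ is the following $10$-tuple of $2$-forms. Let $\mathcal P_5$ be the rational map sending an antisymmetric $5\times5$ matrix $(x_{ij})$ to $$\Big(\tfrac{x_{45}x_{13}}{x_{15}x_{34}},\tfrac{x_{23}x_{14}}{x_{34}x_{12}},\tfrac{x_{15}x_{24}}{x_{12}x_{45}},\tfrac{x_{34}x_{25}}{x_{23}x_{45}},\tfrac{x_{12}x_{35}}{x_{15}x_{23}}\Big)\in\boldsymbol Y_5.$$ The sixteen homogeneous coordinates on the spinor tenfold are $1$, the ten $x_{ij}$ ($i<j$) and the five $4\times 4$ sub-Pfaffians; they are indexed by the even subsets $\emptyset$, $\{i,j\}$, $\{i\}^c$ of $\{1,\dots,5\}$, hence by the even $\epsilon$ via $\epsilon\mapsto\{i:\epsilon_i=-1\}$. Each $\zeta_k\circ\mathcal P_5$ is, after homogenization, a monomial of degree $0$ in these coordinates and their inverses. Let $\nu_\epsilon(\zeta_k)$ be the exponent in it of the coordinate indexed by $\epsilon$,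 and extend $\nu_\epsilon$ to the $U_{i,s}$ by additivity. With $(\epsilon_1,\dots,\epsilon_{10})=(1,-1,1,-1,1,1,-1,1,-1,1)$, the $i$-th component of $\mathbf{Res}_\epsilon$ is $$\epsilon_i\Big(\nu_\epsilon(U_{i,1})\tfrac{dU_{i,2}}{U_{i,2}}\wedge\tfrac{dU_{i,3}}{U_{i,3}}-\nu_\epsilon(U_{i,2})\tfrac{dU_{i,1}}{U_{i,1}}\wedge\tfrac{dU_{i,3}}{U_{i,3}}+\nu_\epsilon(U_{i,3})\tfrac{dU_{i,1}}{U_{i,1}}\wedge\tfrac{dU_{i,2}}{U_{i,2}}\Big).$$ **Theorem.** There are coefficients in $\{-1,0,1\}$, which depend neither on $D$ nor on the logarithms, defining the tuples $\mathbf{AR}^1_\epsilon$ and $\mathbf{AR}^1_{ijk}$ below, such that for all such $D$ and $\mathrm{Log}\,\zeta_k$: 1. $r^1(\mathcal W_5)\le 6$ for every $5$-subweb $\mathcal W_5$ of $\mathcal W$, with equality if and only if $\mathcal W_5=\mathcal W^\epsilon$ for some $\epsilon\in\{\pm1\}^5$. 2. If $\epsilon$ is odd, then $AR^1(\mathcal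 W^\epsilon)$ has a basis of six ARs with components $\sum_{s=1}^3c_{i,s}\,d\,\mathrm{Log}\,U_{i,s}$, all $c_{i,s}\in\{-1,0,1\}$. In particular $AR^1(\mathcal W^\epsilon)=W_0(AR^1(\mathcal W^\epsilon))$. 3. If $\epsilon$ is even, then $W_0(AR^1(\mathcal W^\epsilon))$ has dimension $5$ and a basis of ARs of the form in 2. There is moreover a weight $1$ AR $\mathbf{AR}^1_\epsilon$ of $\mathcal W^\epsilon$, not of weight $0$, whose components are linear combinations with coefficients in $\{-1,0,1\}$ of the forms $\frac12(\mathrm{Log}\,U_{j,a}\,d\,\mathrm{Log}\,U_{j,b}-\mathrm{Log}\,U_{j,b}\,d\,\mathrm{Log}\,U_{j,a})$, $1\le a<b\le3$, and such that $d\,\mathbf{AR}^1_\epsilon=\mathbf{Res}_\epsilon$. 4. $W_0(AR^1(\mathcal W))$ has dimension $20$ and a basis of ARs of the form in 2. Moreover $W_0(AR^1(\mathcal W))=AR^1_{Rat}(\mathcal W)\subset\mathrm{Ker}(d^1)$. 5. The sixteen $\mathbf{AR}^1_\epsilon$, $\epsilon$ even, span a space $AR^1_C$ of dimension $10$, and $d^1$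 restricts to an isomorphism $AR^1_C\to AR^2_C$, $\mathbf{AR}^1_\epsilon\mapsto\mathbf{Res}_\epsilon$. 6. For $1\le i<j<k\le5$, the $6$-subweb with first integrals $U_l$, $l\in\{i,j,k,i+5,j+5,k+5\}$, carries a complete and irreducible weight $1$ AR $\mathbf{AR}^1_{ijk}$ whose $l$-th component is a linear combination with coefficients in $\{-1,0,1\}$ of the exact forms $d(\mathrm{Log}\,U_{l,a}\,\mathrm{Log}\,U_{l,b})$, $1\le a<b\le3$; up to sign it is the only AR with these properties. The ten $\mathbf{AR}^1_{ijk}$ span a subspace $AR^1_{Sym}$ of $W_1(AR^1(\mathcal W))\cap\mathrm{Im}(d^0)$, of dimension $5$. 7. $AR^1(\mathcal W)=W_0(AR^1(\mathcal W))\oplus AR^1_{Sym}\oplus AR^1_C$, with summands of dimensions $20$, $5$, $10$; moreover $W_1(AR^1(\mathcal W))=AR^1_{Sym}\oplus AR^1_C$ and $W_0(AR^1(\mathcal W))\oplus AR^1_{Sym}=\mathrm{Im}(d^0)=\mathrm{Ker}(d^1)$. Hence $r^1(\mathcal W)=35$. 8. The generators $s_1,\dots,s_5$ of the Weyl group $W(D_5)$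 (reflections in $e_1-e_2,e_2-e_3,e_3-e_4,e_4-e_5,e_4+e_5$) induce birational automorphisms $\sigma_1,\dots,\sigma_5$ of $\boldsymbol Y_5$ that preserve $\boldsymbol Y_5^*$ and permute the foliations of $\mathcal W$, where $$\begin{aligned}\sigma_1(y)&=\big(\tfrac1{y_{25}},-y_{13}y_{24},-y_{14}y_{25},\tfrac1{y_{13}},-\tfrac{y_{35}}{y_{13}y_{25}}\big),&\sigma_2(y)&=\big(\tfrac1{y_{24}},-\tfrac{y_{14}}{y_{13}y_{24}},\tfrac1{y_{13}},-y_{24}y_{35},-y_{13}y_{25}\big),\\\sigma_3(y)&=\big(-y_{14}y_{35},-y_{13}y_{24},\tfrac1{y_{35}},-\tfrac{y_{25}}{y_{24}y_{35}},\tfrac1{y_{24}}\big),&\sigma_4(y)&=\big(-\tfrac{y_{13}}{y_{14}y_{35}},\tfrac1{y_{35}},-y_{14}y_{25},-y_{24}y_{35},\tfrac1{y_{14}}\big),\\\sigma_5(y)&=\big(-P_2,\tfrac{y_{14}P_1}{P_3},-\tfrac{y_{24}}{P_3},-\tfrac{y_{25}}{P_1},\tfrac{y_{35}P_3}{P_1}\big).\end{aligned}$$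 Replacing $\mathrm{Log}\,\zeta_k$ by $\ln|\zeta_k|$ identifies $AR^1(\mathcal W)$ with a space of tuples of forms on $\boldsymbol Y_5^*$, and restriction to $D$ identifies the space $AR^2_C$ formed on $\boldsymbol Y_5^*$ with that formed on $D$. Through these identifications, the pull-backs by the $\sigma_k$ define actions of $W(D_5)$ on $AR^1(\mathcal W)$ and on $AR^2_C$. The decomposition in 7 is a decomposition into irreducible $W(D_5)$-representations, with $$W_0(AR^1(\mathcal W))\simeq V^{20}_{[2,21]},\qquad AR^1_{Sym}\simeq V^{5}_{[-,221]},\qquad AR^1_C\simeq AR^2_C\simeq V^{10}_{[11,111]},$$ where $V_{[\lambda,\mu]}$ is the irreducible $W(D_5)$-representation labelled by the pair of partitions $[\lambda,\mu]$ of total size $5$. It is realized by the functions on $\mathbf C^5$ spanned by the $W(D_5)$-translates of the Specht polynomials $\prod(x_i^2-x_j^2)\cdot\prod_{m}x_m$: here the boxes of $\lambda$ and $\mu$ are filled bijectively with $1,\dots,5$, the first product runs over pairs with $i$ above $j$ in a common column of $\lambda$ or of $\mu$, and the second over the entries $m$ of $\mu$. -/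

import Mathlib

open scoped BigOperators

noncomputable section

namespace GMWeb

/-! ### The web -/

/-- The affine space `Y₅ = ℂ⁵`, with coordinates
`y 0 = y₁₃`, `y 1 = y₁₄`, `y 2 = y₂₄`, `y 3 = y₂₅`, `y 4 = y₃₅`. -/
abbrev Y5 : Type := Fin 5 → ℂ

/-- Index set of the ten foliations: `(i, 1)` stands for the foliation with first integral
`U_{i+1}` and `(i, -1)` for the one with first integral `U_{i+6}`. -/
abbrev Fol : Type := Fin 5 × ℤˣ

/-- The ten polynomials `ζ₁, …, ζ₁₀ = y₁₃, y₁₄, y₂₄, y₂₅, y₃₅, P₁, …, P₅`. -/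
def zeta (k : Fin 10) (y : Y5) : ℂ :=
  ![y 0, y 1, y 2, y 3, y 4,
    1 + y 3 - y 2 * y 4, 1 + y 0 - y 4 * y 1, 1 + y 2 - y 1 * y 3,
    1 + y 4 - y 0 * y 3, 1 + y 1 - y 0 * y 2] k

/-- The complement `Y₅*` of the hypersurfaces `ζ_k = 0`. -/
def Ystar : Set Y5 := {y | ∀ k, zeta k y ≠ 0}

/-- First components of the first integrals. -/
def U₁ (f : Fol) (y : Y5) : ℂ :=
  if f.2 = 1 then ![y 3, 1 / y 0, y 2, 1 / y 4, y 1] f.1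
  else
    ![(y 1 * y 4 - y 0 - 1) / (y 1 * (y 0 * y 3 - y 4 - 1)),
      (y 2 * y 4 - y 3 - 1) / (y 2 * (y 0 * y 3 - y 4 - 1)),
      y 0 * (y 2 * y 4 - y 3 - 1) / (y 0 * y 3 - y 4 - 1),
      y 1 * (y 2 * y 4 - y 3 - 1) / (y 1 * y 3 - y 2 - 1),
      (y 2 * y 4 - y 3 - 1) / (y 4 * (y 1 * y 3 - y 2 - 1))] f.1

/-- Second components of the first integrals. -/
def U₂ (f : Fol) (y : Y5) : ℂ :=
  if f.2 = 1 then
    ![y 2 * y 4, y 1 * y 4 / y 0, y 1 * y 3, y 0 * y 3 / y 4, y 0 * y 2] f.1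
  else
    ![y 0 * (y 1 * y 3 - y 2 - 1) / (y 1 * (y 0 * y 3 - y 4 - 1)),
      (y 1 * y 3 - y 2 - 1) / (y 2 * (y 0 * y 3 - y 4 - 1)),
      (y 1 * y 4 - y 0 - 1) / (y 0 * y 3 - y 4 - 1),
      y 2 * (y 1 * y 4 - y 0 - 1) / (y 1 * y 3 - y 2 - 1),
      y 3 * (y 1 * y 4 - y 0 - 1) / (y 4 * (y 1 * y 3 - y 2 - 1))] f.1

/-- The first integral of the foliation `f`, completed by its third component
`U_{f,3} = 1 + U_{f,1} - U_{f,2}`. -/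
def U (f : Fol) (y : Y5) : Fin 3 → ℂ := ![U₁ f y, U₂ f y, 1 + U₁ f y - U₂ f y]

/-- The `5`-subweb `W^ε = W(F₁^{ε₁}, …, F₅^{ε₅})`. -/
def signedSubweb (ε : Fin 5 → ℤˣ) : Finset Fol := Finset.univ.image fun i => (i, ε i)

/-- The `6`-subweb `W_{ijk i*j*k*}` for `T = {i, j, k}`. -/
def pairSubweb (T : Finset (Fin 5)) : Finset Fol := T ×ˢ Finset.univ

/-! ### Abelian relations -/

/-- `10`-tuples of differential `k`-forms. -/
abbrev Tuple (k : ℕ) : Type := Fol → Y5 → Y5 [⋀^Fin k]→L[ℂ] ℂ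

/-- The space `AR^k(D)` of `k`-abelian relations, on the open set `D`, of the subweb formed by the
foliations in `I`: tuples of holomorphic `k`-forms `η_f` on `D` (extended by zero outside `D`),
with `η_f = 0` for `f ∉ I`, with `η_f` basic for the foliation `f` (`i_v η_f = 0` and
`i_v dη_f = 0` for every `v` tangent to the foliation), and with `∑ η_f = 0`. -/
def AR (k : ℕ) (D : Set Y5) (I : Finset Fol) : Submodule ℂ (Tuple k) where
  carrier := {η |
    (∀ f, AnalyticOnNhd ℂ (η f) D) ∧
    (∀ f, ∀ x ∉ D, η f x = 0) ∧
    (∀ f ∉ I, η f = 0) ∧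
    (∀ f, ∀ x ∈ D, ∀ v : Fin k → Y5, (∃ j, fderiv ℂ (U f) x (v j) = 0) → η f x v = 0) ∧
    (∀ f, ∀ x ∈ D, ∀ v : Fin (k + 1) → Y5, (∃ j, fderiv ℂ (U f) x (v j) = 0) →
      extDeriv (η f) x v = 0) ∧
    ∀ x, ∑ f, η f x = 0}
  zero_mem' := by
    refine ⟨fun f => analyticOnNhd_const, fun _ _ _ => rfl, fun _ _ => rfl,
      fun _ _ _ _ _ => rfl, fun f x _ v _ => ?_, fun x => ?_⟩
    · have h := extDeriv_smul (𝕜 := ℂ) (0 : ℂ) (0 : Y5 → Y5 [⋀^Fin k]→L[ℂ] ℂ) (x := x)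
      rw [zero_smul, zero_smul] at h
      exact DFunLike.congr_fun h v
    · exact Finset.sum_eq_zero fun _ _ => rfl
  add_mem' := by
    rintro a b ⟨a1, a2, a3, a4, a5, a6⟩ ⟨b1, b2, b3, b4, b5, b6⟩
    refine ⟨fun f => (a1 f).add (b1 f), fun f x hx => ?_, fun f hf => ?_, fun f x hx v hv => ?_,
      fun f x hx v hv => ?_, fun x => ?_⟩
    · simp [a2 f x hx, b2 f x hx]
    · simp [a3 f hf, b3 f hf]
    · simp [a4 f x hx v hv, b4 f x hx v hv]
    · have h := extDeriv_add (a1 f x hx).differentiableAt (b1 f x hx).differentiableAt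
      rw [Pi.add_apply, h]
      simp [a5 f x hx v hv, b5 f x hx v hv]
    · simp [Finset.sum_add_distrib, a6 x, b6 x]
  smul_mem' := by
    rintro c a ⟨a1, a2, a3, a4, a5, a6⟩
    refine ⟨fun f => (analyticOnNhd_const (v := c)).smul (a1 f), fun f x hx => ?_,
      fun f hf => ?_, fun f x hx v hv => ?_, fun f x hx v hv => ?_, fun x => ?_⟩
    · simp [a2 f x hx]
    · simp [a3 f hf]
    · simp [a4 f x hx v hv]
    · rw [Pi.smul_apply, extDeriv_smul]
      simp [a5 f x hx v hv]
    · simp [← Finset.smul_sum, a6 x]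

/-- The total derivative `(η_f) ↦ (dη_f)`, on the open set `D`. -/
def totalD {k : ℕ} (D : Set Y5) (η : Tuple k) : Tuple (k + 1) :=
  fun f => D.indicator (extDeriv (η f))

/-- Restriction of tuples to `D` (followed by extension by zero). -/
def restrictTo {k : ℕ} (D : Set Y5) (η : Tuple k) : Tuple k := fun f => D.indicator (η f)

/-- The tuple is (on `D`) formed of rational forms: its coefficients are quotients of
polynomials. -/
def IsRationalOn {k : ℕ} (D : Set Y5) (η : Tuple k) : Prop :=
  ∀ f (v : Fin k → Y5), ∃ p q : MvPolynomial (Fin 5) ℂ, q ≠ 0 ∧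
    ∀ x ∈ D, MvPolynomial.eval x q * η f x v = MvPolynomial.eval x p

/-- The abelian relation `η` of the subweb `I` is complete: no component is trivial. -/
def IsCompleteAR {k : ℕ} (I : Finset Fol) (η : Tuple k) : Prop := ∀ f ∈ I, η f ≠ 0

/-- The abelian relation `η` of the subweb `I` on `D` is irreducible: it is not a sum of abelian
relations of proper subwebs of `I`. -/
def IsIrreducibleAR {k : ℕ} (D : Set Y5) (I : Finset Fol) (η : Tuple k) : Prop :=
  η ∉ ⨆ J ∈ {J : Finset Fol | J ⊂ I}, AR k D J

/-- The space `AR²_C` of combinatorial `2`-abelian relations on `D`, spanned by the `2`-abelian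
relations of the `5`-subwebs. -/
def AR2C (D : Set Y5) : Submodule ℂ (Tuple 2) :=
  ⨆ I ∈ {I : Finset Fol | I.card = 5}, AR 2 D I

/-! ### Logarithms and weights -/

/-- Each `U_{f,s}` is a monomial in the `ζ_k^{±1}` (see `exp_logU`). If a family `L` gives the values
at the `ζ_k` of some homomorphism to an additive group, `logU L f s` is its value at `U_{f,s}`. -/
def logU {M : Type*} [AddCommGroup M] (L : Fin 10 → M) (f : Fol) : Fin 3 → M :=
  if f.2 = 1 then
    ![![L 3, L 2 + L 4, L 5],
      ![-L 0, L 1 + L 4 - L 0, L 6 - L 0],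
      ![L 2, L 1 + L 3, L 7],
      ![-L 4, L 0 + L 3 - L 4, L 8 - L 4],
      ![L 1, L 0 + L 2, L 9]] f.1
  else
    ![![L 6 - L 1 - L 8, L 0 + L 7 - L 1 - L 8, L 9 - L 1 - L 8],
      ![L 5 - L 2 - L 8, L 7 - L 2 - L 8, L 3 + L 9 - L 2 - L 8],
      ![L 0 + L 5 - L 8, L 6 - L 8, L 4 + L 9 - L 8],
      ![L 1 + L 5 - L 7, L 2 + L 6 - L 7, L 9 - L 7],
      ![L 5 - L 4 - L 7, L 3 + L 6 - L 4 - L 7, L 8 - L 4 - L 7]] f.1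

/-- The table in `logU` is the right one: `exp ∘ logU L = U` as soon as `exp L_k = ζ_k`. -/
theorem exp_logU (L : Fin 10 → ℂ) (y : Y5) (h : ∀ k, Complex.exp (L k) = zeta k y)
    (f : Fol) (s : Fin 3) : Complex.exp (logU L f s) = U f y s := by
  have h0 := h 0
  have h1 := h 1
  have h2 := h 2
  have h3 := h 3
  have h4 := h 4
  have h5 := h 5
  have h6 := h 6
  have h7 := h 7
  have h8 := h 8
  have h9 := h 9
  simp [zeta] at h0 h1 h2 h3 h4 h5 h6 h7 h8 h9
  have n0 := h0 ▸ Complex.exp_ne_zero (L 0)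
  have n1 := h1 ▸ Complex.exp_ne_zero (L 1)
  have n2 := h2 ▸ Complex.exp_ne_zero (L 2)
  have n4 := h4 ▸ Complex.exp_ne_zero (L 4)
  have h7' : Complex.exp (L 7) = -(y 1 * y 3 - y 2 - 1) := by rw [h7]; ring
  have h8' : Complex.exp (L 8) = -(y 0 * y 3 - y 4 - 1) := by rw [h8]; ring
  have m7 : y 1 * y 3 - y 2 - 1 ≠ 0 := by
    intro h; apply Complex.exp_ne_zero (L 7); rw [h7', h, neg_zero]
  have m8 : y 0 * y 3 - y 4 - 1 ≠ 0 := by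
    intro h; apply Complex.exp_ne_zero (L 8); rw [h8', h, neg_zero]
  have m7' : y 3 * y 1 - y 2 - 1 ≠ 0 := by rwa [mul_comm (y 3)]
  have m8' : y 3 * y 0 - y 4 - 1 ≠ 0 := by rwa [mul_comm (y 3)]
  obtain ⟨i, e⟩ := f
  rcases Int.units_eq_one_or e with rfl | rfl <;> fin_cases i <;> fin_cases s <;>
    simp [-neg_sub, logU, U, U₁, U₂, Complex.exp_add, Complex.exp_sub, Complex.exp_neg,
      h0, h1, h2, h3, h4, h5, h6, h7', h8', h9, show (-1 : ℤˣ) ≠ 1 by decide] <;>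
    field_simp <;> ring

/-- A linear form seen as an alternating `1`-form. -/
def oneForm (a : Y5 →L[ℂ] ℂ) : Y5 [⋀^Fin 1]→L[ℂ] ℂ :=
  ContinuousAlternatingMap.ofSubsingleton ℂ Y5 ℂ (0 : Fin 1) a

/-- The wedge product of two linear forms. -/
def wedge (a b : Y5 →L[ℂ] ℂ) : Y5 [⋀^Fin 2]→L[ℂ] ℂ :=
  ContinuousAlternatingMap.alternatizeUncurryFin (a.smulRight (oneForm b))

theorem wedge_apply (a b : Y5 →L[ℂ] ℂ) (v w : Y5) :
    wedge a b ![v, w] = a v * b w - a w * b v := by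
  simp [wedge, oneForm, ContinuousAlternatingMap.alternatizeUncurryFin_apply, Fin.sum_univ_two,
    Fin.removeNth, sub_eq_add_neg]

/-- The logarithmic differential `d Log U_{f,s} = dU_{f,s} / U_{f,s}`. -/
def dlogU (f : Fol) (s : Fin 3) (x : Y5) : Y5 →L[ℂ] ℂ :=
  (U f x s)⁻¹ • fderiv ℂ (fun y => U f y s) x

/-- The tuple on `D` with components `∑ₛ c_{f,s} d Log U_{f,s}`. -/
def tuple0 (D : Set Y5) (c : Fol → Fin 3 → ℂ) : Tuple 1 :=
  fun f => D.indicator fun x => oneForm (∑ s, c f s • dlogU f s x)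

/-- The tuple on `D` with components `∑ c_{f,a,b} Log U_{f,a} d Log U_{f,b}`, the functions
`Log U_{f,a}` being obtained from logarithms `L k` of the `ζ_k`. -/
def tuple1 (D : Set Y5) (L : Fin 10 → Y5 → ℂ) (c : Fol → Fin 3 → Fin 3 → ℂ) : Tuple 1 :=
  fun f => D.indicator fun x =>
    oneForm (∑ a, ∑ b, (c f a b * logU (fun k => L k x) f a) • dlogU f b x)

/-- `1`-abelian relations of weight `0` of a subweb: components in the span of the
`d Log U_{f,s}`. -/
def W0 (D : Set Y5) (I : Finset Fol) : Submodule ℂ (Tuple 1) :=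
  AR 1 D I ⊓ Submodule.span ℂ (Set.range (tuple0 D))

/-- `1`-abelian relations of weight `1` of a subweb: components in the span of the
`Log U_{f,a} d Log U_{f,b}`. -/
def W1 (D : Set Y5) (L : Fin 10 → Y5 → ℂ) (I : Finset Fol) : Submodule ℂ (Tuple 1) :=
  AR 1 D I ⊓ Submodule.span ℂ (Set.range (tuple1 D L))

/-- All the entries are `-1`, `0` or `1`. -/
def IsSmall (c : Fol → Fin 3 → Fin 3 → ℤ) : Prop := ∀ f a b, c f a b ∈ ({-1, 0, 1} : Set ℤ)

/-- Coefficients of `∑_{a<b} c_{f,a,b} ½ (Log U_{f,a} d Log U_{f,b} - Log U_{f,b} d Log U_{f,a})`. -/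
def antiCoef (c : Fol → Fin 3 → Fin 3 → ℤ) : Fol → Fin 3 → Fin 3 → ℂ :=
  fun f a b => if a < b then (c f a b : ℂ) / 2 else if b < a then -(c f b a : ℂ) / 2 else 0

/-- Coefficients of `∑_{a<b} c_{f,a,b} d(Log U_{f,a} Log U_{f,b})
= ∑_{a<b} c_{f,a,b} (Log U_{f,a} d Log U_{f,b} + Log U_{f,b} d Log U_{f,a})`. -/
def symCoef (c : Fol → Fin 3 → Fin 3 → ℤ) : Fol → Fin 3 → Fin 3 → ℂ :=
  fun f a b => if a < b then (c f a b : ℂ) else if b < a then (c f b a : ℂ) else 0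

/-- The space `S` of `1`-forms tuples on `D` has a basis of `n` elements of the form
`(∑ₛ c_{f,s} d Log U_{f,s})_f` with all `c_{f,s}` in `{-1, 0, 1}`. -/
def HasSmallLogBasis (D : Set Y5) (S : Submodule ℂ (Tuple 1)) (n : ℕ) : Prop :=
  ∃ c : Fin n → Fol → Fin 3 → ℤ,
    (∀ j f s, c j f s ∈ ({-1, 0, 1} : Set ℤ)) ∧
    LinearIndependent ℂ (fun j => tuple0 D fun f s => (c j f s : ℂ)) ∧
    Submodule.span ℂ (Set.range fun j => tuple0 D fun f s => (c j f s : ℂ)) = S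

/-- `AR¹_C`: the span of the antisymmetric weight one tuples with coefficients `A ε`, `ε` even. -/
def AR1C (D : Set Y5) (L : Fin 10 → Y5 → ℂ)
    (A : (Fin 5 → ℤˣ) → Fol → Fin 3 → Fin 3 → ℤ) : Submodule ℂ (Tuple 1) :=
  Submodule.span ℂ {η | ∃ ε : Fin 5 → ℤˣ, ∏ i, ε i = 1 ∧ η = tuple1 D L (antiCoef (A ε))}

/-- `AR¹_Sym`: the span of the symmetric weight one tuples with coefficients `B T`,
`T = {i, j, k}`. -/
def AR1Sym (D : Set Y5) (L : Fin 10 → Y5 → ℂ)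
    (B : Finset (Fin 5) → Fol → Fin 3 → Fin 3 → ℤ) : Submodule ℂ (Tuple 1) :=
  Submodule.span ℂ {η | ∃ T : Finset (Fin 5), T.card = 3 ∧ η = tuple1 D L (symCoef (B T))}

/-! ### Residues of the master `2`-abelian relation -/

/-- The birational quotient map `𝒫₅` from antisymmetric matrices `x = (x_{ij})` to `Y₅`. -/
def quotientMap (x : Fin 5 → Fin 5 → ℂ) : Y5 :=
  ![x 3 4 * x 0 2 / (x 0 4 * x 2 3), x 1 2 * x 0 3 / (x 2 3 * x 0 1),
    x 0 4 * x 1 3 / (x 0 1 * x 3 4), x 2 3 * x 1 4 / (x 1 2 * x 3 4),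
    x 0 1 * x 2 4 / (x 0 4 * x 1 2)]

/-- The homogeneous coordinates of the image of `x` in the spinor tenfold are indexed by the even
subsets `S` of `Fin 5`: the `∅`-coordinate is `1`, the `{i, j}`-coordinate is `x_{ij}`, and the
`{i}ᶜ`-coordinate is the Pfaffian of `x` with row and column `i` removed. The functions `ζ_k ∘ 𝒫₅`
are monomials in these coordinates and their inverses (see `exp_zetaWeight`). If `z` gives the
values of a homomorphism to an additive group at these coordinates, `zetaWeight z k` is its value
at `ζ_k`. -/
def zetaWeight {M : Type*} [AddCommGroup M] (z : Finset (Fin 5) → M) : Fin 10 → M :=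
  ![z {3, 4} + z {0, 2} - (z {0, 4} + z {2, 3}),
    z {1, 2} + z {0, 3} - (z {2, 3} + z {0, 1}),
    z {0, 4} + z {1, 3} - (z {0, 1} + z {3, 4}),
    z {2, 3} + z {1, 4} - (z {1, 2} + z {3, 4}),
    z {0, 1} + z {2, 4} - (z {0, 4} + z {1, 2}),
    z {0}ᶜ + z ∅ - (z {1, 2} + z {3, 4}),
    z {1}ᶜ + z ∅ - (z {0, 4} + z {2, 3}),
    z {2}ᶜ + z ∅ - (z {0, 1} + z {3, 4}),
    z {3}ᶜ + z ∅ - (z {0, 4} + z {1, 2}),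
    z {4}ᶜ + z ∅ - (z {0, 1} + z {2, 3})]

/-- The table in `zetaWeight` is the right one. -/
theorem exp_zetaWeight (x : Fin 5 → Fin 5 → ℂ) (z : Finset (Fin 5) → ℂ)
    (h_empty : Complex.exp (z ∅) = 1)
    (h_two : ∀ i j, i < j → Complex.exp (z {i, j}) = x i j)
    (p0 : Complex.exp (z {0}ᶜ) = x 1 2 * x 3 4 - x 1 3 * x 2 4 + x 1 4 * x 2 3)
    (p1 : Complex.exp (z {1}ᶜ) = x 0 2 * x 3 4 - x 0 3 * x 2 4 + x 0 4 * x 2 3)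
    (p2 : Complex.exp (z {2}ᶜ) = x 0 1 * x 3 4 - x 0 3 * x 1 4 + x 0 4 * x 1 3)
    (p3 : Complex.exp (z {3}ᶜ) = x 0 1 * x 2 4 - x 0 2 * x 1 4 + x 0 4 * x 1 2)
    (p4 : Complex.exp (z {4}ᶜ) = x 0 1 * x 2 3 - x 0 2 * x 1 3 + x 0 3 * x 1 2)
    (k : Fin 10) : Complex.exp (zetaWeight z k) = zeta k (quotientMap x) := by
  have t01 := h_two 0 1 (by decide)
  have t02 := h_two 0 2 (by decide)
  have t03 := h_two 0 3 (by decide)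
  have t04 := h_two 0 4 (by decide)
  have t12 := h_two 1 2 (by decide)
  have t13 := h_two 1 3 (by decide)
  have t14 := h_two 1 4 (by decide)
  have t23 := h_two 2 3 (by decide)
  have t24 := h_two 2 4 (by decide)
  have t34 := h_two 3 4 (by decide)
  have n01 := t01 ▸ Complex.exp_ne_zero (z {0, 1})
  have n04 := t04 ▸ Complex.exp_ne_zero (z {0, 4})
  have n12 := t12 ▸ Complex.exp_ne_zero (z {1, 2})
  have n23 := t23 ▸ Complex.exp_ne_zero (z {2, 3})
  have n34 := t34 ▸ Complex.exp_ne_zero (z {3, 4})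
  fin_cases k <;>
    simp [zetaWeight, zeta, quotientMap, Complex.exp_add, Complex.exp_sub,
      h_empty, p0, p1, p2, p3, p4, t01, t02, t03, t04, t12, t13, t14, t23, t24, t34] <;>
    field_simp <;> ring

/-- The order of vanishing of `ζ_k` along the weight divisor `D_w` of the weight `w = ε/2`, that
is, along the vanishing locus of the homogeneous coordinate indexed by `{i | ε_i = -1}`. -/
def ordZeta (ε : Fin 5 → ℤˣ) : Fin 10 → ℤ :=
  zetaWeight fun S => if S = Finset.univ.filter (fun i => ε i = -1) then 1 else 0

/-- The signs `ε_1, …, ε_10 = 1, -1, 1, -1, 1, 1, -1, 1, -1, 1`. -/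
def sgn (f : Fol) : ℂ := ![1, -1, 1, -1, 1] f.1

/-- On `D`, the residue along the weight divisor of `ε` of the `2`-abelian relation
`HLOG = (ε_f U_f^*Ω)_f`, where
`Ω = Log u₁ dLog u₂ ∧ dLog u₃ - Log u₂ dLog u₁ ∧ dLog u₃ + Log u₃ dLog u₁ ∧ dLog u₂`:
each coefficient `Log U_{f,s}` is replaced with the order of `U_{f,s}` along the divisor. -/
def residue (D : Set Y5) (ε : Fin 5 → ℤˣ) : Tuple 2 :=
  fun f => D.indicator fun x => sgn f •
    (((logU (ordZeta ε) f 0 : ℤ) : ℂ) • wedge (dlogU f 1 x) (dlogU f 2 x)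
      - ((logU (ordZeta ε) f 1 : ℤ) : ℂ) • wedge (dlogU f 0 x) (dlogU f 2 x)
      + ((logU (ordZeta ε) f 2 : ℤ) : ℂ) • wedge (dlogU f 0 x) (dlogU f 1 x))

/-! ### The Weyl group of type `D₅` and its action -/

/-- Simple roots of type `D₅`: `e₁-e₂`, `e₂-e₃`, `e₃-e₄`, `e₄-e₅`, `e₄+e₅`. -/
def simpleRoot : Fin 5 → Fin 5 → ℂ :=
  ![![1, -1, 0, 0, 0], ![0, 1, -1, 0, 0], ![0, 0, 1, -1, 0], ![0, 0, 0, 1, -1], ![0, 0, 0, 1, 1]]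

/-- The linear form `x ↦ ⟨α_k, x⟩`, `α_k` the `k`-th simple root. -/
def simpleCoroot (k : Fin 5) : Module.Dual ℂ (Fin 5 → ℂ) :=
  ∑ j, simpleRoot k j • LinearMap.proj j

theorem simpleCoroot_simpleRoot (k : Fin 5) : simpleCoroot k (simpleRoot k) = 2 := by
  fin_cases k <;> simp [simpleCoroot, simpleRoot, Fin.sum_univ_five] <;> norm_num

/-- The simple reflections. -/
def simpleReflection (k : Fin 5) : (Fin 5 → ℂ) ≃ₗ[ℂ] (Fin 5 → ℂ) :=
  Module.reflection (simpleCoroot_simpleRoot k)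

/-- The Weyl group `W(D₅)`, generated by the simple reflections. -/
def WD5 : Subgroup ((Fin 5 → ℂ) ≃ₗ[ℂ] (Fin 5 → ℂ)) :=
  Subgroup.closure (Set.range simpleReflection)

/-- The generators `s_1, …, s_5` of `W(D₅)`. -/
def gen (k : Fin 5) : WD5 := ⟨simpleReflection k, Subgroup.subset_closure ⟨k, rfl⟩⟩

/-- `W(D₅)` acting on the functions on `ℂ⁵` by `(w F)(x) = F (w⁻¹ x)`. -/
def funRep : Representation ℂ WD5 ((Fin 5 → ℂ) → ℂ) where
  toFun w := LinearMap.funLeft ℂ ℂ fun x => (w⁻¹ : WD5).1 x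
  map_one' := by ext F x; simp [LinearMap.funLeft_apply]
  map_mul' w w' := by ext F x; simp [LinearMap.funLeft_apply]

/-- The product of the `x_i² - x_j²` for `i` above `j` in the same column of a filling `T` of the
Young diagram `d`. -/
def columnProduct (d : YoungDiagram) (T : d.cells → Fin 5) (x : Fin 5 → ℂ) : ℂ :=
  ∏ p : d.cells × d.cells,
    if p.1.1.2 = p.2.1.2 ∧ p.1.1.1 < p.2.1.1 then x (T p.1) ^ 2 - x (T p.2) ^ 2 else 1

/-- The Specht polynomial of type `B₅` of a filling `T` of the pair of diagrams `[d, d']` by the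
integers `1, …, 5`, each of them being used once. -/
def spechtPoly (d d' : YoungDiagram) (T : d.cells ⊕ d'.cells ≃ Fin 5) (x : Fin 5 → ℂ) : ℂ :=
  columnProduct d (fun c => T (Sum.inl c)) x * columnProduct d' (fun c => T (Sum.inr c)) x *
    ∏ c, x (T (Sum.inr c))

/-- The `W(D₅)`-module `V_{[d, d']}` attached to a pair of partitions of total size `5`:
the module generated by the Specht polynomials of shape `[d, d']`. -/
def spechtModule (d d' : YoungDiagram) : Subrepresentation funRep where
  toSubmodule := Submodule.span ℂ {F | ∃ (w : WD5) (T : d.cells ⊕ d'.cells ≃ Fin 5),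
    F = funRep w (spechtPoly d d' T)}
  apply_mem_toSubmodule g v hv := by
    induction hv using Submodule.span_induction with
    | mem F hF =>
      obtain ⟨w, T, rfl⟩ := hF
      refine Submodule.subset_span ⟨g * w, T, ?_⟩
      rw [map_mul]; rfl
    | zero => rw [map_zero]; exact Submodule.zero_mem _
    | add a b _ _ ha hb => rw [map_add]; exact Submodule.add_mem _ ha hb
    | smul c a _ ha => rw [map_smul]; exact Submodule.smul_mem _ c ha

/-- The partition with the given weakly decreasing row lengths. -/
abbrev part (l : List ℕ) (h : l.SortedGE := by decide) : YoungDiagram :=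
  YoungDiagram.ofRowLens l h

/-- The birational automorphisms `σ_1, …, σ_5` of `Y₅` induced by `s_1, …, s_5`. -/
def cremona (k : Fin 5) (y : Y5) : Y5 :=
  ![![1 / y 3, -(y 2 * y 0), -(y 1 * y 3), 1 / y 0, -(y 4 / (y 0 * y 3))],
    ![1 / y 2, -(y 1 / (y 2 * y 0)), 1 / y 0, -(y 4 * y 2), -(y 0 * y 3)],
    ![-(y 1 * y 4), -(y 2 * y 0), 1 / y 4, -(y 3 / (y 4 * y 2)), 1 / y 2],
    ![-(y 0 / (y 4 * y 1)), 1 / y 4, -(y 1 * y 3), -(y 2 * y 4), 1 / y 1],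
    ![-zeta 6 y, y 1 * (zeta 5 y / zeta 7 y), -(y 2 / zeta 7 y), -(y 3 / zeta 5 y),
      y 4 * (zeta 7 y / zeta 5 y)]] k

/-- The permutation of the foliations such that `F_f = σ_k^* F_{folPerm k f}`. -/
def folPerm (k : Fin 5) (f : Fol) : Fol :=
  ![(Equiv.swap 0 1 f.1, f.2), (Equiv.swap 1 2 f.1, f.2), (Equiv.swap 2 3 f.1, f.2),
    (Equiv.swap 3 4 f.1, f.2),
    (Equiv.swap 3 4 f.1, if f.1 = 3 ∨ f.1 = 4 then -f.2 else f.2)] k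

open Classical in
/-- The pull-back by `σ_k` of a tuple of forms defined on `Y₅*`. -/
def pullback {n : ℕ} (k : Fin 5) (η : Tuple n) : Tuple n := fun f x =>
  if x ∈ Ystar then
    (η (folPerm k f) (cremona k x)).compContinuousLinearMap (fderiv ℂ (cremona k) x)
  else 0

/-- The single-valued logarithms `ln |ζ_k|`. -/
def lnAbs (k : Fin 10) (y : Y5) : ℂ := (Real.log ‖zeta k y‖ : ℂ)

/-- The single-valued real-analytic version, on the whole of `Y₅*`, of the space of
`1`-abelian relations: logarithmic tuples of weight `≤ 1`, with `ln |ζ_k|` instead of `Log ζ_k`,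
with sum zero. -/
def globalAR1 : Submodule ℂ (Tuple 1) :=
  (Submodule.span ℂ (Set.range (tuple0 Ystar)) ⊔
    Submodule.span ℂ (Set.range (tuple1 Ystar lnAbs))) ⊓
  LinearMap.ker (∑ f : Fol, LinearMap.proj f : Tuple 1 →ₗ[ℂ] Y5 → Y5 [⋀^Fin 1]→L[ℂ] ℂ)

end GMWeb

end

/-!
The abelian relations of degree `1` are first bounded by a prolongation argument, then exhibited.

*Upper bound.* A component of a `1`-abelian relation is `g₀ dlogU f 0 + g₁ dlogU f 1`, where `g₀, g₁`
are constant along the leaves (`isBas_co`), as are the derivatives `θ₀ᵃ θ₁ᵇ g_s` in the coframe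
`dlogU f 0, dlogU f 1`. Differentiating the relation along the vector fields `∑ w_i y_i ∂/∂y_i` gives
linear equations between these functions (`row_identity`), with coefficients polynomial in the `α_k`,
`β_k`, a family stable under these derivations. As soon as the equations
express all the derivatives of order `K` by those of order less than `K`, the derivatives satisfy a
closed linear differential system, so an abelian relation is determined by the values at one point of
finitely many of them (`WordData.rank_le`). Invertibility of the relevant minor is checked at the
point `basePt`, modulo a prime. The components `(i, -1)` are dealt with first, with words of vector
fields killing the components `(i, 1)`: this gives `r¹(W) ≤ 29 + 6 = 35` (`rank_AR_univ_le`).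

*Logarithmic relations.* The forms `dζ_l / ζ_l` and `Log ζ_k dζ_l / ζ_l` are linearly independent:
the logarithms are independent over the rational functions by restriction to coordinate lines, and the
`dζ_l / ζ_l` have different poles. Hence a logarithmic tuple determines its coefficients
(`logTuple_injective`), and its sum vanishes if and only if the coefficients satisfy linear equations
over `ℤ` (`sum_logTuple_eq_zero_iff`), with spaces of solutions `K0` in weight `0` and
`K1 = KS ⊕ KA` in weight `1`, split into symmetric and antisymmetric parts. Explicit independent
solutions, `20`, `5` and `10` in number, reach the bound, so all abelian relations are logarithmic
(`LogDom.mem_AR_iff`), and statements on `AR¹` of a subweb become statements on coefficients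
supported on it. The symmetric relations are exact; `tuple2`, the derivative, is
injective on antisymmetric coefficients, and the residues are the images of the tuples `coefA ε`. In
degree `2`, linear algebra at a generic point shows that five-subwebs other than the even `W^ε` carry
no abelian relation, and that those of the latter are `μ Res_ε`, with `μ` constant on the leaves of
all the foliations, hence constant; this determines `AR²_C` (`AR2C_eq`).

*Representations.* As `ζ_j ∘ σ_k` is up to sign a monomial in the `ζ`, the pull-backs act on
coefficients by integral matrices (`pullback_logTuple`). In the bases `base0`, `baseS`,
`baseA` these are the matrices `mat0`, `matS`, `matA` of the reflections acting on bases `poly0`, `polyS`,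
`polyA` of the spaces of Specht polynomials; this also gives the relations of the Weyl group. Each
representation is irreducible because some element of the group algebra acts with rank one, with an
image which generates everything and a kernel containing no invariant subspace
(`IsInv.eq_bot_or_eq_top`).
-/
noncomputable section

namespace GMWeb

/-! ### Exponents and logarithmic differentials -/

/-- The exponent of `ζ_k` in the monomial `U_{f,s}`. -/
def expo (f : Fol) (s : Fin 3) (k : Fin 10) : ℤ := logU (fun j => if j = k then (1 : ℤ) else 0) f s

theorem map_logU {M N : Type*} [AddCommGroup M] [AddCommGroup N] (φ : M →+ N) (L : Fin 10 → M)
    (f : Fol) (s : Fin 3) : φ (logU L f s) = logU (fun k => φ (L k)) f s := by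
  obtain ⟨i, e⟩ := f
  rcases Int.units_eq_one_or e with rfl | rfl <;> fin_cases i <;> fin_cases s <;>
    simp [logU, show (-1 : ℤˣ) ≠ 1 by decide]

theorem logU_eq_sum {M : Type*} [AddCommGroup M] (L : Fin 10 → M) (f : Fol) (s : Fin 3) :
    logU L f s = ∑ k, expo f s k • L k := by
  let φ : (Fin 10 → ℤ) →+ M :=
    { toFun := fun c => ∑ k, c k • L k
      map_zero' := by simp
      map_add' := fun a b => by simp [add_smul, Finset.sum_add_distrib] }
  have h : L = fun k => φ (Pi.single k 1) := by
    ext j; simp [φ, Pi.single_apply, ite_smul]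
  have e := map_logU φ (fun j => (Pi.single j (1 : ℤ) : Fin 10 → ℤ)) f s
  rw [← h] at e
  rw [← e]
  change ∑ k : Fin 10, (logU (fun j => (Pi.single j (1 : ℤ) : Fin 10 → ℤ)) f s) k • L k = _
  refine Finset.sum_congr rfl fun k _ => ?_
  have := map_logU (Pi.evalAddMonoidHom (fun _ : Fin 10 => ℤ) k)
    (fun j => (Pi.single j (1 : ℤ) : Fin 10 → ℤ)) f s
  simp only [Pi.evalAddMonoidHom_apply] at this
  rw [this, expo]
  congr 2
  ext j
  simp [Pi.single_apply, eq_comm]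

/-- The logarithmic differential `dζ_k / ζ_k`. -/
def dz (k : Fin 10) (x : Y5) : Y5 →L[ℂ] ℂ := (zeta k x)⁻¹ • fderiv ℂ (zeta k) x

theorem analyticOnNhd_zeta (k : Fin 10) (D : Set Y5) : AnalyticOnNhd ℂ (zeta k) D := by
  have h (i : Fin 5) : AnalyticOnNhd ℂ (fun y : Y5 => y i) D :=
    (ContinuousLinearMap.proj (R := ℂ) (φ := fun _ : Fin 5 => ℂ) i).analyticOnNhd D
  fin_cases k
  · exact h 0
  · exact h 1
  · exact h 2
  · exact h 3
  · exact h 4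
  · exact (analyticOnNhd_const.add (h 3)).sub ((h 2).mul (h 4))
  · exact (analyticOnNhd_const.add (h 0)).sub ((h 4).mul (h 1))
  · exact (analyticOnNhd_const.add (h 2)).sub ((h 1).mul (h 3))
  · exact (analyticOnNhd_const.add (h 4)).sub ((h 0).mul (h 3))
  · exact (analyticOnNhd_const.add (h 1)).sub ((h 0).mul (h 2))

theorem differentiableAt_zeta (k : Fin 10) (x : Y5) : DifferentiableAt ℂ (zeta k) x :=
  (analyticOnNhd_zeta k Set.univ x trivial).differentiableAt

theorem isOpen_Ystar : IsOpen Ystar := by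
  have : Ystar = ⋂ k : Fin 10, {y | zeta k y ≠ 0} := by ext; simp [Ystar]
  rw [this]
  exact isOpen_iInter_of_finite fun k => isOpen_ne_fun
    (continuous_iff_continuousAt.2 fun x => (differentiableAt_zeta k x).continuousAt)
    continuous_const

theorem analyticOnNhd_dz (k : Fin 10) : AnalyticOnNhd ℂ (dz k) Ystar := fun x hx =>
  ((analyticOnNhd_zeta k Ystar x hx).inv (hx k)).smul ((analyticOnNhd_zeta k Ystar).fderiv x hx)

/-- A choice of logarithms of the `ζ_k` near `x`. -/
def locLog (x : Y5) (k : Fin 10) (y : Y5) : ℂ :=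
  Complex.log (zeta k y / zeta k x) + Complex.log (zeta k x)

theorem exp_locLog {x y : Y5} (hx : x ∈ Ystar) (hy : y ∈ Ystar) (k : Fin 10) :
    Complex.exp (locLog x k y) = zeta k y := by
  rw [locLog, Complex.exp_add, Complex.exp_log (div_ne_zero (hy k) (hx k)),
    Complex.exp_log (hx k), div_mul_cancel₀ _ (hx k)]

theorem analyticAt_locLog {x : Y5} (hx : x ∈ Ystar) (k : Fin 10) :
    AnalyticAt ℂ (locLog x k) x := by
  refine AnalyticAt.add (AnalyticAt.clog ?_ ?_) analyticAt_const
  · exact (analyticOnNhd_zeta k Set.univ x trivial).div analyticAt_const (hx k)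
  · rw [div_self (hx k)]; exact Complex.one_mem_slitPlane

/-- The differential of a local logarithm of `ζ_k`. -/
theorem fderiv_log_eq {L : Y5 → ℂ} {k : Fin 10} {x : Y5} (hL : DifferentiableAt ℂ L x)
    (h : ∀ᶠ y in nhds x, Complex.exp (L y) = zeta k y) : fderiv ℂ L x = dz k x := by
  have h1 : HasFDerivAt (fun y => Complex.exp (L y)) (Complex.exp (L x) • fderiv ℂ L x) x :=
    hL.hasFDerivAt.cexp
  have h2 : fderiv ℂ (zeta k) x = zeta k x • fderiv ℂ L x := by
    rw [← h.self_of_nhds]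
    exact (h1.congr_of_eventuallyEq (h.mono fun _ hy => hy.symm)).fderiv
  have h3 : zeta k x ≠ 0 := by rw [← h.self_of_nhds]; exact Complex.exp_ne_zero _
  rw [dz, h2, smul_smul, inv_mul_cancel₀ h3, one_smul]

theorem fderiv_locLog {x : Y5} (hx : x ∈ Ystar) (k : Fin 10) :
    ∀ᶠ y in nhds x, fderiv ℂ (locLog x k) y = dz k y := by
  filter_upwards [(analyticAt_locLog hx k).eventually_analyticAt, isOpen_Ystar.mem_nhds hx]
    with y hy hy'
  exact fderiv_log_eq hy.differentiableAt <| by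
    filter_upwards [isOpen_Ystar.mem_nhds hy'] with z hz using exp_locLog hx hz k

/-- The forms `dζ_k / ζ_k` are closed. -/
theorem fderiv_dz_symm {x : Y5} (hx : x ∈ Ystar) (k : Fin 10) (v w : Y5) :
    fderiv ℂ (dz k) x v w = fderiv ℂ (dz k) x w v := by
  have h : dz k =ᶠ[nhds x] fderiv ℂ (locLog x k) := (fderiv_locLog hx k).mono fun _ h => h.symm
  rw [h.fderiv_eq]
  have := ((analyticAt_locLog hx k).contDiffAt (n := 2)).isSymmSndFDerivAt (by simp)
  exact this.eq v w

theorem U_ne_zero {x : Y5} (hx : x ∈ Ystar) (f : Fol) (s : Fin 3) : U f x s ≠ 0 := by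
  rw [← exp_logU (fun k => locLog x k x) x (exp_locLog hx hx) f s]
  exact Complex.exp_ne_zero _

theorem U_eventuallyEq {x : Y5} (hx : x ∈ Ystar) (f : Fol) (s : Fin 3) :
    (fun y => U f y s) =ᶠ[nhds x] fun y => Complex.exp (logU (fun k => locLog x k y) f s) := by
  filter_upwards [isOpen_Ystar.mem_nhds hx] with y hy
  exact (exp_logU _ y (exp_locLog hx hy) f s).symm

theorem analyticAt_logU {L : Fin 10 → Y5 → ℂ} {x : Y5} (hL : ∀ k, AnalyticAt ℂ (L k) x)
    (f : Fol) (s : Fin 3) : AnalyticAt ℂ (fun y => logU (fun k => L k y) f s) x := by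
  simp only [logU_eq_sum, zsmul_eq_mul]
  exact Finset.analyticAt_fun_sum _ fun k _ => analyticAt_const.mul (hL k)

theorem analyticAt_U {x : Y5} (hx : x ∈ Ystar) (f : Fol) (s : Fin 3) :
    AnalyticAt ℂ (fun y => U f y s) x :=
  ((analyticAt_logU (analyticAt_locLog hx) f s).cexp).congr (U_eventuallyEq hx f s).symm

theorem dlogU_eq_sum {x : Y5} (hx : x ∈ Ystar) (f : Fol) (s : Fin 3) :
    dlogU f s x = ∑ k, (expo f s k : ℂ) • dz k x := by
  have h1 : HasFDerivAt (fun y => logU (fun k => locLog x k y) f s)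
      (∑ k, (expo f s k : ℂ) • dz k x) x := by
    simp only [logU_eq_sum, zsmul_eq_mul]
    refine HasFDerivAt.fun_sum fun k _ => ?_
    rw [← (fderiv_locLog hx k).self_of_nhds]
    exact (analyticAt_locLog hx k).differentiableAt.hasFDerivAt.const_mul _
  have h2 := (h1.cexp.congr_of_eventuallyEq (U_eventuallyEq hx f s)).fderiv
  have h3 : U f x s = _ := (U_eventuallyEq hx f s).self_of_nhds
  rw [dlogU, h2, h3, smul_smul,
    inv_mul_cancel₀ (Complex.exp_ne_zero _), one_smul]

theorem analyticOnNhd_dlogU (f : Fol) (s : Fin 3) : AnalyticOnNhd ℂ (dlogU f s) Ystar := by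
  have : AnalyticOnNhd ℂ (fun x => ∑ k, (expo f s k : ℂ) • dz k x) Ystar := fun x hx =>
    Finset.analyticAt_fun_sum _ fun k _ => (analyticAt_const (v := (expo f s k : ℂ))).fun_smul (analyticOnNhd_dz k x hx)
  exact this.congr isOpen_Ystar fun x hx => (dlogU_eq_sum hx f s).symm

theorem fderiv_dlogU_symm {x : Y5} (hx : x ∈ Ystar) (f : Fol) (s : Fin 3) (v w : Y5) :
    fderiv ℂ (dlogU f s) x v w = fderiv ℂ (dlogU f s) x w v := by
  have h : dlogU f s =ᶠ[nhds x] fun x => ∑ k, (expo f s k : ℂ) • dz k x := by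
    filter_upwards [isOpen_Ystar.mem_nhds hx] with y hy using dlogU_eq_sum hy f s
  have h' : HasFDerivAt (fun x => ∑ k, (expo f s k : ℂ) • dz k x)
      (∑ k, (expo f s k : ℂ) • fderiv ℂ (dz k) x) x :=
    HasFDerivAt.fun_sum fun k _ =>
      (analyticOnNhd_dz k x hx).differentiableAt.hasFDerivAt.fun_const_smul _
  rw [h.fderiv_eq, h'.fderiv]
  simp only [sum_apply, smul_apply, fderiv_dz_symm hx _ v w]

/-- Tangent vectors to the foliation `f` at points of `Y₅*`. -/
theorem tangent_iff {x : Y5} (hx : x ∈ Ystar) (f : Fol) (v : Y5) :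
    fderiv ℂ (U f) x v = 0 ↔ dlogU f 0 x v = 0 ∧ dlogU f 1 x v = 0 := by
  have hU (s : Fin 3) : DifferentiableAt ℂ (fun y => U f y s) x := (analyticAt_U hx f s).differentiableAt
  have h0 : fderiv ℂ (U f) x v = fun s => fderiv ℂ (fun y => U f y s) x v := by
    ext s
    have := fderiv_pi (𝕜 := ℂ) (φ := fun s y => U f y s) (x := x) hU
    change fderiv ℂ (fun y s => U f y s) x v s = _
    rw [this]; rfl
  have h2 : fderiv ℂ (fun y => U f y 2) x v
      = fderiv ℂ (fun y => U f y 0) x v - fderiv ℂ (fun y => U f y 1) x v := by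
    have : (fun y => U f y 2) = fun y => 1 + U f y 0 - U f y 1 := rfl
    rw [this, fderiv_fun_sub ((hU 0).const_add 1) (hU 1), fderiv_const_add]; rfl
  have h3 (s : Fin 3) : dlogU f s x v = 0 ↔ fderiv ℂ (fun y => U f y s) x v = 0 := by
    simp [dlogU, U_ne_zero hx f s]
  rw [h3, h3, h0, funext_iff, Fin.forall_fin_succ, Fin.forall_fin_two]
  constructor
  · rintro ⟨a, b, -⟩; exact ⟨a, b⟩
  · rintro ⟨a, b⟩; exact ⟨a, b, by change fderiv ℂ (fun y => U f y 2) x v = 0; rw [h2, a, b, sub_zero]⟩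

/-! ### The adapted frame -/

theorem fderiv_zeta_apply (k : Fin 10) (x v : Y5) : fderiv ℂ (zeta k) x v =
    ![v 0, v 1, v 2, v 3, v 4,
      v 3 - (x 2 * v 4 + x 4 * v 2), v 0 - (x 4 * v 1 + x 1 * v 4), v 2 - (x 1 * v 3 + x 3 * v 1),
      v 4 - (x 0 * v 3 + x 3 * v 0), v 1 - (x 0 * v 2 + x 2 * v 0)] k := by
  have h (i : Fin 5) : HasFDerivAt (fun y : Y5 => y i)
      (ContinuousLinearMap.proj (R := ℂ) (φ := fun _ : Fin 5 => ℂ) i) x := hasFDerivAt_apply i x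
  have hP (a b c : Fin 5) : fderiv ℂ (fun y : Y5 => 1 + y a - y b * y c) x v
      = v a - (x b * v c + x c * v b) := by
    rw [(((h a).const_add 1).fun_sub ((h b).fun_mul (h c))).fderiv]
    simp
  have hQ (a : Fin 5) : fderiv ℂ (fun y : Y5 => y a) x v = v a := by rw [(h a).fderiv]; rfl
  fin_cases k
  · exact hQ 0
  · exact hQ 1
  · exact hQ 2
  · exact hQ 3
  · exact hQ 4
  · exact hP 3 2 4
  · exact hP 0 4 1
  · exact hP 2 1 3
  · exact hP 4 0 3
  · exact hP 1 0 2

/-- The table of the exponents `expo f s k`. -/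
def expoTab (f : Fol) : Fin 3 → Fin 10 → ℤ :=
  if f.2 = 1 then
    ![![![0, 0, 0, 1, 0, 0, 0, 0, 0, 0], ![0, 0, 1, 0, 1, 0, 0, 0, 0, 0], ![0, 0, 0, 0, 0, 1, 0, 0, 0, 0]],
      ![![-1, 0, 0, 0, 0, 0, 0, 0, 0, 0], ![-1, 1, 0, 0, 1, 0, 0, 0, 0, 0], ![-1, 0, 0, 0, 0, 0, 1, 0, 0, 0]],
      ![![0, 0, 1, 0, 0, 0, 0, 0, 0, 0], ![0, 1, 0, 1, 0, 0, 0, 0, 0, 0], ![0, 0, 0, 0, 0, 0, 0, 1, 0, 0]],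
      ![![0, 0, 0, 0, -1, 0, 0, 0, 0, 0], ![1, 0, 0, 1, -1, 0, 0, 0, 0, 0], ![0, 0, 0, 0, -1, 0, 0, 0, 1, 0]],
      ![![0, 1, 0, 0, 0, 0, 0, 0, 0, 0], ![1, 0, 1, 0, 0, 0, 0, 0, 0, 0], ![0, 0, 0, 0, 0, 0, 0, 0, 0, 1]]] f.1
  else
    ![![![0, -1, 0, 0, 0, 0, 1, 0, -1, 0], ![1, -1, 0, 0, 0, 0, 0, 1, -1, 0], ![0, -1, 0, 0, 0, 0, 0, 0, -1, 1]],
      ![![0, 0, -1, 0, 0, 1, 0, 0, -1, 0], ![0, 0, -1, 0, 0, 0, 0, 1, -1, 0], ![0, 0, -1, 1, 0, 0, 0, 0, -1, 1]],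
      ![![1, 0, 0, 0, 0, 1, 0, 0, -1, 0], ![0, 0, 0, 0, 0, 0, 1, 0, -1, 0], ![0, 0, 0, 0, 1, 0, 0, 0, -1, 1]],
      ![![0, 1, 0, 0, 0, 1, 0, -1, 0, 0], ![0, 0, 1, 0, 0, 0, 1, -1, 0, 0], ![0, 0, 0, 0, 0, 0, 0, -1, 0, 1]],
      ![![0, 0, 0, 0, -1, 1, 0, -1, 0, 0], ![0, 0, 0, 1, -1, 0, 1, -1, 0, 0], ![0, 0, 0, 0, -1, 0, 0, -1, 1, 0]]] f.1

theorem expo_eq : ∀ f s k, expo f s k = expoTab f s k := by decide +kernel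

/-- `P_k = 1 + y_{aI k} - y_{bI k} y_{bJ k}`. -/
def aI : Fin 5 → Fin 5 := ![3, 0, 2, 4, 1]

/-- See `aI`. -/
def bI : Fin 5 → Fin 5 := ![2, 4, 1, 0, 0]

/-- See `aI`. -/
def bJ : Fin 5 → Fin 5 := ![4, 1, 3, 3, 2]

/-- The polynomial `P_k`, in any commutative ring. -/
def polP {R : Type*} [CommRing R] (y : Fin 5 → R) (k : Fin 5) : R :=
  1 + y (aI k) - y (bI k) * y (bJ k)

theorem zeta_natAdd (k : Fin 5) (x : Y5) : zeta (Fin.natAdd 5 k) x = polP x k := by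
  fin_cases k <;> rfl

theorem zeta_castAdd (k : Fin 5) (x : Y5) : zeta (Fin.castAdd 5 k) x = x k := by
  fin_cases k <;> rfl

/-- The functions `α_k = y_{aI k} / P_k`. -/
def al (k : Fin 5) (x : Y5) : ℂ := x (aI k) / polP x k

/-- The functions `β_k = y_{bI k} y_{bJ k} / P_k`. -/
def be (k : Fin 5) (x : Y5) : ℂ := x (bI k) * x (bJ k) / polP x k

theorem polP_ne_zero {x : Y5} (hx : x ∈ Ystar) (k : Fin 5) : polP x k ≠ 0 := by
  rw [← zeta_natAdd]; exact hx _

theorem coord_ne_zero {x : Y5} (hx : x ∈ Ystar) (k : Fin 5) : x k ≠ 0 := by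
  have h := hx (Fin.castAdd 5 k)
  rwa [zeta_castAdd] at h

/-- The vector field `∑ w_i y_i ∂/∂y_i`. -/
def logVec (w : Fin 5 → ℤ) (x : Y5) : Y5 := fun i => w i * x i

theorem dz_castAdd_logVec {x : Y5} (hx : x ∈ Ystar) (k : Fin 5) (w : Fin 5 → ℤ) :
    dz (Fin.castAdd 5 k) x (logVec w x) = w k := by
  have h : fderiv ℂ (zeta (Fin.castAdd 5 k)) x (logVec w x) = w k * x k := by
    rw [fderiv_zeta_apply]; fin_cases k <;> rfl
  rw [dz, smul_apply, h, zeta_castAdd, smul_eq_mul]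
  field_simp [coord_ne_zero hx k]

theorem dz_natAdd_logVec {x : Y5} (hx : x ∈ Ystar) (k : Fin 5) (w : Fin 5 → ℤ) :
    dz (Fin.natAdd 5 k) x (logVec w x)
      = (w (aI k) : ℂ) * al k x - ((w (bI k) + w (bJ k) : ℤ) : ℂ) * be k x := by
  have h : fderiv ℂ (zeta (Fin.natAdd 5 k)) x (logVec w x)
      = w (aI k) * x (aI k) - (w (bI k) + w (bJ k)) * (x (bI k) * x (bJ k)) := by
    rw [fderiv_zeta_apply]
    fin_cases k <;> simp [logVec, aI, bI, bJ] <;> ring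
  have hP := polP_ne_zero hx k
  rw [dz, smul_apply, h, zeta_natAdd, smul_eq_mul, al, be]
  push_cast
  field_simp

theorem dlogU_logVec {x : Y5} (hx : x ∈ Ystar) (f : Fol) (s : Fin 3) (w : Fin 5 → ℤ) :
    dlogU f s x (logVec w x) = ∑ k : Fin 5, (expo f s (Fin.castAdd 5 k) : ℂ) * w k
      + ∑ k : Fin 5, (expo f s (Fin.natAdd 5 k) : ℂ)
        * ((w (aI k) : ℂ) * al k x - ((w (bI k) + w (bJ k) : ℤ) : ℂ) * be k x) := by
  rw [dlogU_eq_sum hx, sum_apply]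
  simp only [smul_apply, smul_eq_mul]
  rw [Fin.sum_univ_add (a := 5) (b := 5) (f := fun k => (expo f s k : ℂ) * dz k x (logVec w x))]
  simp only [dz_castAdd_logVec hx, dz_natAdd_logVec hx]

/-- The first coordinate direction of the frame adapted to `f`. -/
def pI (f : Fol) : Fin 5 → ℤ := Pi.single (if f.2 = 1 then ![3, 0, 2, 4, 1] f.1 else ![2, 0, 2, 0, 0] f.1) 1

/-- The second coordinate direction of the frame adapted to `f`. -/
def pJ (f : Fol) : Fin 5 → ℤ := Pi.single (if f.2 = 1 then ![2, 1, 1, 0, 0] f.1 else ![3, 1, 1, 4, 1] f.1) 1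

/-- The minor of the pair `(dlogU f 0, dlogU f 1)` in the directions `pI f`, `pJ f`. -/
def minor (f : Fol) (x : Y5) : ℂ :=
  dlogU f 0 x (logVec (pI f) x) * dlogU f 1 x (logVec (pJ f) x)
    - dlogU f 0 x (logVec (pJ f) x) * dlogU f 1 x (logVec (pI f) x)

theorem al_ne_zero {x : Y5} (hx : x ∈ Ystar) (k : Fin 5) : al k x ≠ 0 :=
  div_ne_zero (coord_ne_zero hx _) (polP_ne_zero hx k)

theorem be_ne_zero {x : Y5} (hx : x ∈ Ystar) (k : Fin 5) : be k x ≠ 0 :=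
  div_ne_zero (mul_ne_zero (coord_ne_zero hx _) (coord_ne_zero hx _)) (polP_ne_zero hx k)

theorem minor_ne_zero {x : Y5} (hx : x ∈ Ystar) (f : Fol) : minor f x ≠ 0 := by
  have a := al_ne_zero hx
  have b := be_ne_zero hx
  simp only [minor, dlogU_logVec hx, expo_eq]
  obtain ⟨i, e⟩ := f
  rcases Int.units_eq_one_or e with rfl | rfl <;> fin_cases i <;>
    simp [pI, pJ, Fin.sum_univ_five, expoTab, aI, bI, bJ,
      show (-1 : ℤˣ) ≠ 1 by decide, Fin.natAdd, Fin.castAdd, Fin.castLE, a, b, -neg_sub]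

/-! ### Basic functions of a foliation -/

/-- The coefficients of a form `φ` killing the tangent vectors of the foliation `f` in the coframe
`dlogU f 0`, `dlogU f 1` of the normal bundle, given by Cramer's rule. -/
def co (f : Fol) (m : Fin 2) (φ : Y5 → Y5 →L[ℂ] ℂ) (x : Y5) : ℂ :=
  ![φ x (logVec (pI f) x) * dlogU f 1 x (logVec (pJ f) x)
      - φ x (logVec (pJ f) x) * dlogU f 1 x (logVec (pI f) x),
    dlogU f 0 x (logVec (pI f) x) * φ x (logVec (pJ f) x)
      - dlogU f 0 x (logVec (pJ f) x) * φ x (logVec (pI f) x)] m / minor f x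

/-- The covector `φ` at `x` kills the tangent space of the foliation `f`. -/
def Kills (f : Fol) (x : Y5) (φ : Y5 →L[ℂ] ℂ) : Prop :=
  ∀ v, dlogU f 0 x v = 0 → dlogU f 1 x v = 0 → φ v = 0

theorem co_spec {f : Fol} {x : Y5} (hx : x ∈ Ystar) {φ : Y5 → Y5 →L[ℂ] ℂ}
    (h : Kills f x (φ x)) (v : Y5) :
    φ x v = co f 0 φ x * dlogU f 0 x v + co f 1 φ x * dlogU f 1 x v := by
  have hm := minor_ne_zero hx f
  set p := logVec (pI f) x
  set q := logVec (pJ f) x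
  have hm' : minor f x = dlogU f 0 x p * dlogU f 1 x q - dlogU f 0 x q * dlogU f 1 x p := rfl
  have := h (minor f x • v - (dlogU f 0 x v * dlogU f 1 x q - dlogU f 0 x q * dlogU f 1 x v) • p
    - (dlogU f 0 x p * dlogU f 1 x v - dlogU f 0 x v * dlogU f 1 x p) • q)
    (by simp only [map_sub, map_smul, smul_eq_mul, hm']; ring)
    (by simp only [map_sub, map_smul, smul_eq_mul, hm']; ring)
  simp only [map_sub, map_smul, smul_eq_mul] at this
  simp only [co, Matrix.cons_val_zero, Matrix.cons_val_one]
  change _ = (φ x p * dlogU f 1 x q - φ x q * dlogU f 1 x p) / minor f x * _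
    + (dlogU f 0 x p * φ x q - dlogU f 0 x q * φ x p) / minor f x * _
  field_simp
  linear_combination this

theorem analyticOnNhd_logVec (w : Fin 5 → ℤ) (D : Set Y5) : AnalyticOnNhd ℂ (logVec w) D := by
  refine fun x _ => AnalyticAt.pi fun i => ?_
  exact analyticAt_const.mul
    ((ContinuousLinearMap.proj (R := ℂ) (φ := fun _ : Fin 5 => ℂ) i).analyticAt x)

theorem analyticAt_apply_logVec {φ : Y5 → Y5 →L[ℂ] ℂ} {x : Y5} (h : AnalyticAt ℂ φ x)
    (w : Fin 5 → ℤ) : AnalyticAt ℂ (fun y => φ y (logVec w y)) x :=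
  ((ContinuousLinearMap.apply ℂ ℂ).analyticAt_bilinear (logVec w x, φ x)).comp₂
    (analyticOnNhd_logVec w Set.univ x trivial) h

theorem analyticAt_minor {x : Y5} (hx : x ∈ Ystar) (f : Fol) : AnalyticAt ℂ (minor f) x := by
  have h (s w) := analyticAt_apply_logVec (analyticOnNhd_dlogU f s x hx) w
  exact ((h 0 _).mul (h 1 _)).sub ((h 0 _).mul (h 1 _))

theorem analyticAt_co {φ : Y5 → Y5 →L[ℂ] ℂ} {x : Y5} (hx : x ∈ Ystar) (f : Fol) (m : Fin 2)
    (h : AnalyticAt ℂ φ x) : AnalyticAt ℂ (co f m φ) x := by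
  have h1 (s w) := analyticAt_apply_logVec (analyticOnNhd_dlogU f s x hx) w
  have h2 (w) := analyticAt_apply_logVec h w
  refine AnalyticAt.div ?_ (analyticAt_minor hx f) (minor_ne_zero hx f)
  fin_cases m
  · exact ((h2 _).mul (h1 1 _)).sub ((h2 _).mul (h1 1 _))
  · exact ((h1 0 _).mul (h2 _)).sub ((h1 0 _).mul (h2 _))

/-- `h` is an analytic function on `D`, constant along the leaves of the foliation `f`. -/
def IsBas (f : Fol) (D : Set Y5) (h : Y5 → ℂ) : Prop :=
  AnalyticOnNhd ℂ h D ∧ ∀ x ∈ D, Kills f x (fderiv ℂ h x)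

theorem eq_zero_of_coframe {f : Fol} {x : Y5} (hx : x ∈ Ystar) {a b : ℂ}
    (h : ∀ w, a * dlogU f 0 x w + b * dlogU f 1 x w = 0) : a = 0 ∧ b = 0 := by
  have hm := minor_ne_zero hx f
  have h1 := h (logVec (pI f) x)
  have h2 := h (logVec (pJ f) x)
  unfold minor at hm
  constructor <;> refine (mul_eq_zero.1 ?_).resolve_right hm
  · linear_combination dlogU f 1 x (logVec (pJ f) x) * h1 - dlogU f 1 x (logVec (pI f) x) * h2
  · linear_combination dlogU f 0 x (logVec (pI f) x) * h2 - dlogU f 0 x (logVec (pJ f) x) * h1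

theorem fderiv_coframe_apply {f : Fol} {D : Set Y5} (hD : IsOpen D) (hDY : D ⊆ Ystar)
    {φ : Y5 → Y5 →L[ℂ] ℂ} (hφ : AnalyticOnNhd ℂ φ D) (hk : ∀ x ∈ D, Kills f x (φ x)) {x : Y5}
    (hx : x ∈ D) (v w : Y5) :
    fderiv ℂ φ x v w = (fderiv ℂ (co f 0 φ) x v * dlogU f 0 x w
      + co f 0 φ x * fderiv ℂ (dlogU f 0) x v w) + (fderiv ℂ (co f 1 φ) x v * dlogU f 1 x w
      + co f 1 φ x * fderiv ℂ (dlogU f 1) x v w) := by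
  have hxY := hDY hx
  have he : φ =ᶠ[nhds x] fun y => co f 0 φ y • dlogU f 0 y + co f 1 φ y • dlogU f 1 y := by
    filter_upwards [hD.mem_nhds hx] with y hy
    ext v
    simpa using co_spec (hDY hy) (hk y hy) v
  have hc (m : Fin 2) := (analyticAt_co hxY f m (hφ x hx)).differentiableAt
  have hd (s : Fin 3) := (analyticOnNhd_dlogU f s x hxY).differentiableAt
  rw [he.fderiv_eq, fderiv_fun_add ((hc 0).fun_smul (hd 0)) ((hc 1).fun_smul (hd 1)),
    fderiv_fun_smul (hc 0) (hd 0), fderiv_fun_smul (hc 1) (hd 1)]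
  simp
  ring

/-- The coefficients of a basic form are basic functions. -/
theorem isBas_co {f : Fol} {D : Set Y5} (hD : IsOpen D) (hDY : D ⊆ Ystar)
    {φ : Y5 → Y5 →L[ℂ] ℂ} (hφ : AnalyticOnNhd ℂ φ D) (hk : ∀ x ∈ D, Kills f x (φ x))
    (hc : ∀ x ∈ D, ∀ v, dlogU f 0 x v = 0 → dlogU f 1 x v = 0 → ∀ w,
      fderiv ℂ φ x v w = fderiv ℂ φ x w v) (m : Fin 2) : IsBas f D (co f m φ) := by
  refine ⟨fun x hx => analyticAt_co (hDY hx) f m (hφ x hx), fun x hx v h0 h1 => ?_⟩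
  have key := eq_zero_of_coframe (f := f) (hDY hx) (a := fderiv ℂ (co f 0 φ) x v)
    (b := fderiv ℂ (co f 1 φ) x v) fun w => by
    have := hc x hx v h0 h1 w
    rw [fderiv_coframe_apply hD hDY hφ hk hx, fderiv_coframe_apply hD hDY hφ hk hx,
      fderiv_dlogU_symm (hDY hx) f 0 v w, fderiv_dlogU_symm (hDY hx) f 1 v w, h0, h1] at this
    linear_combination this
  fin_cases m
  · exact key.1
  · exact key.2

/-- The derivations `θ_m` of the basic functions, defined by
`dh = θ_0 h · dlogU f 0 + θ_1 h · dlogU f 1`. -/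
def theta (f : Fol) (m : Fin 2) (h : Y5 → ℂ) : Y5 → ℂ := co f m (fderiv ℂ h)

theorem theta_congr {f : Fol} {D : Set Y5} (hD : IsOpen D) {h h' : Y5 → ℂ} (m : Fin 2)
    (e : Set.EqOn h h' D) : Set.EqOn (theta f m h) (theta f m h') D := fun x hx => by
  have : fderiv ℂ h x = fderiv ℂ h' x :=
    Filter.EventuallyEq.fderiv_eq (Filter.eventuallyEq_of_mem (hD.mem_nhds hx) e)
  simp only [theta, co, this]

theorem IsBas.theta {f : Fol} {D : Set Y5} (hD : IsOpen D) (hDY : D ⊆ Ystar) {h : Y5 → ℂ}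
    (hh : IsBas f D h) (m : Fin 2) : IsBas f D (theta f m h) :=
  isBas_co hD hDY hh.1.fderiv hh.2 (fun x hx v _ _ w =>
    (((hh.1 x hx).contDiffAt (n := 2)).isSymmSndFDerivAt (by simp)).eq v w) m

theorem IsBas.fderiv_apply {f : Fol} {D : Set Y5} (hDY : D ⊆ Ystar) {h : Y5 → ℂ}
    (hh : IsBas f D h) {x : Y5} (hx : x ∈ D) (v : Y5) :
    fderiv ℂ h x v = GMWeb.theta f 0 h x * dlogU f 0 x v + GMWeb.theta f 1 h x * dlogU f 1 x v :=
  co_spec (hDY hx) (hh.2 x hx) v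

theorem theta_comm {f : Fol} {D : Set Y5} (hD : IsOpen D) (hDY : D ⊆ Ystar) {h : Y5 → ℂ}
    (hh : IsBas f D h) {x : Y5} (hx : x ∈ D) :
    theta f 0 (theta f 1 h) x = theta f 1 (theta f 0 h) x := by
  have h0 := (hh.theta hD hDY 0).fderiv_apply hDY hx
  have h1 := (hh.theta hD hDY 1).fderiv_apply hDY hx
  have hs := (((hh.1 x hx).contDiffAt (n := 2)).isSymmSndFDerivAt (by simp)).eq
    (logVec (pI f) x) (logVec (pJ f) x)
  rw [fderiv_coframe_apply hD hDY hh.1.fderiv hh.2 hx,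
    fderiv_coframe_apply hD hDY hh.1.fderiv hh.2 hx,
    fderiv_dlogU_symm (hDY hx) f 0 (logVec (pJ f) x), fderiv_dlogU_symm (hDY hx) f 1 (logVec (pJ f) x)]
    at hs
  change (fderiv ℂ (theta f 0 h) x _ * _ + _) + (fderiv ℂ (theta f 1 h) x _ * _ + _) =
    (fderiv ℂ (theta f 0 h) x _ * _ + _) + (fderiv ℂ (theta f 1 h) x _ * _ + _) at hs
  rw [h0, h0, h1, h1] at hs
  refine sub_eq_zero.1 ((mul_eq_zero.1 ?_).resolve_right (minor_ne_zero (hDY hx) f))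
  unfold minor
  linear_combination hs

/-- The iterated derivative `θ_0^a θ_1^b h`. -/
def jet (f : Fol) (h : Y5 → ℂ) (a b : ℕ) : Y5 → ℂ := (theta f 0)^[a] ((theta f 1)^[b] h)

theorem isBas_jet {f : Fol} {D : Set Y5} (hD : IsOpen D) (hDY : D ⊆ Ystar) {h : Y5 → ℂ}
    (hh : IsBas f D h) (a b : ℕ) : IsBas f D (jet f h a b) := by
  have h1 (b : ℕ) : IsBas f D ((theta f 1)^[b] h) := by
    induction b with
    | zero => exact hh
    | succ n ih => rw [Function.iterate_succ_apply']; exact ih.theta hD hDY 1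
  induction a with
  | zero => exact h1 b
  | succ n ih => rw [jet, Function.iterate_succ_apply']; exact ih.theta hD hDY 0

theorem theta_zero_jet (f : Fol) (h : Y5 → ℂ) (a b : ℕ) :
    theta f 0 (jet f h a b) = jet f h (a + 1) b := by
  rw [jet, jet, Function.iterate_succ_apply']

theorem theta_one_jet {f : Fol} {D : Set Y5} (hD : IsOpen D) (hDY : D ⊆ Ystar) {h : Y5 → ℂ}
    (hh : IsBas f D h) (a b : ℕ) : Set.EqOn (theta f 1 (jet f h a b)) (jet f h a (b + 1)) D := by
  induction a with
  | zero => intro x _; simp only [jet, Function.iterate_succ_apply', Function.iterate_zero, id]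
  | succ n ih =>
    intro x hx
    rw [← theta_zero_jet, ← theta_zero_jet, ← theta_comm hD hDY (isBas_jet hD hDY hh n b) hx]
    exact theta_congr hD 0 ih hx

theorem fderiv_jet {f : Fol} {D : Set Y5} (hD : IsOpen D) (hDY : D ⊆ Ystar) {h : Y5 → ℂ}
    (hh : IsBas f D h) (a b : ℕ) {x : Y5} (hx : x ∈ D) (v : Y5) :
    fderiv ℂ (jet f h a b) x v
      = jet f h (a + 1) b x * dlogU f 0 x v + jet f h a (b + 1) x * dlogU f 1 x v := by
  rw [(isBas_jet hD hDY hh a b).fderiv_apply hDY hx, theta_zero_jet,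
    theta_one_jet hD hDY hh a b hx]

/-- A form of degree one seen as a field of linear forms. -/
def cov (ω : Y5 → Y5 [⋀^Fin 1]→L[ℂ] ℂ) (x : Y5) : Y5 →L[ℂ] ℂ :=
  (ContinuousAlternatingMap.ofSubsingletonLIE (𝕜 := ℂ) (E := Y5) (F := ℂ) (0 : Fin 1)).symm (ω x)

theorem cov_apply (ω : Y5 → Y5 [⋀^Fin 1]→L[ℂ] ℂ) (x v : Y5) : cov ω x v = ω x ![v] := by
  have : (fun _ : Fin 1 => v) = ![v] := by ext i; fin_cases i; rfl
  rw [← this]; rfl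

/-- The identification of the alternating forms of degree one with the linear forms. -/
def covCLM : (Y5 [⋀^Fin 1]→L[ℂ] ℂ) →L[ℂ] (Y5 →L[ℂ] ℂ) :=
  (ContinuousAlternatingMap.ofSubsingletonLIE (𝕜 := ℂ) (E := Y5) (F := ℂ)
    (0 : Fin 1)).symm.toContinuousLinearEquiv.toContinuousLinearMap

theorem analyticAt_cov {ω : Y5 → Y5 [⋀^Fin 1]→L[ℂ] ℂ} {x : Y5} (h : AnalyticAt ℂ ω x) :
    AnalyticAt ℂ (cov ω) x :=
  (covCLM.analyticAt _).comp h

theorem fderiv_cov_apply {ω : Y5 → Y5 [⋀^Fin 1]→L[ℂ] ℂ} {x : Y5} (h : DifferentiableAt ℂ ω x)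
    (v w : Y5) : fderiv ℂ (cov ω) x v w = fderiv ℂ ω x v ![w] := by
  have h1 : fderiv ℂ (cov ω) x = covCLM.comp (fderiv ℂ ω x) :=
    (covCLM.hasFDerivAt.comp x h.hasFDerivAt).fderiv
  rw [h1]
  exact cov_apply (fun _ => fderiv ℂ ω x v) x w

theorem extDeriv_one_apply {ω : Y5 → Y5 [⋀^Fin 1]→L[ℂ] ℂ} {x : Y5} (h : DifferentiableAt ℂ ω x)
    (v w : Y5) : extDeriv ω x ![v, w] = fderiv ℂ (cov ω) x v w - fderiv ℂ (cov ω) x w v := by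
  have hu (u t : Y5) : fderiv ℂ (fun y => ω y ![u]) x t = fderiv ℂ ω x t ![u] := by
    rw [(h.hasFDerivAt.continuousAlternatingMap_apply_const ![u]).fderiv]; rfl
  have h0 : Fin.removeNth 0 ![v, w] = ![w] := by ext i; fin_cases i; rfl
  have h1 : Fin.removeNth 1 ![v, w] = ![v] := by ext i; fin_cases i; rfl
  rw [fderiv_cov_apply h, fderiv_cov_apply h, extDeriv_apply h, Fin.sum_univ_two, h0, h1, hu, hu]
  simp [sub_eq_add_neg]

/-- The coefficients of the components of an abelian relation in the coframes `dlogU f 0`,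
`dlogU f 1`. -/
def coef (η : Tuple 1) (f : Fol) (s : Fin 2) : Y5 → ℂ := co f s (cov (η f))

theorem kills_of_mem_AR {D : Set Y5} (hDY : D ⊆ Ystar) {I : Finset Fol} {η : Tuple 1}
    (hη : η ∈ AR 1 D I) (f : Fol) {x : Y5} (hx : x ∈ D) : Kills f x (cov (η f) x) := by
  intro v h0 h1
  rw [cov_apply]
  exact hη.2.2.2.1 f x hx ![v] ⟨0, (tangent_iff (hDY hx) f v).2 ⟨h0, h1⟩⟩

theorem isBas_coef {D : Set Y5} (hD : IsOpen D) (hDY : D ⊆ Ystar) {I : Finset Fol} {η : Tuple 1}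
    (hη : η ∈ AR 1 D I) (f : Fol) (s : Fin 2) : IsBas f D (coef η f s) := by
  refine isBas_co hD hDY (fun x hx => analyticAt_cov (hη.1 f x hx))
    (fun x hx => kills_of_mem_AR hDY hη f hx) (fun x hx v h0 h1 w => ?_) s
  have := hη.2.2.2.2.1 f x hx ![v, w] ⟨0, (tangent_iff (hDY hx) f v).2 ⟨h0, h1⟩⟩
  rwa [extDeriv_one_apply (hη.1 f x hx).differentiableAt, sub_eq_zero] at this

theorem apply_eq_coef {D : Set Y5} (hDY : D ⊆ Ystar) {I : Finset Fol} {η : Tuple 1}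
    (hη : η ∈ AR 1 D I) (f : Fol) {x : Y5} (hx : x ∈ D) (v : Y5) :
    η f x ![v] = coef η f 0 x * dlogU f 0 x v + coef η f 1 x * dlogU f 1 x v := by
  rw [← cov_apply]
  exact co_spec (hDY hx) (kills_of_mem_AR hDY hη f hx) v

section

/-! ### Iterated derivatives along logarithmic vector fields -/

/-- A vector `w ∈ ℤ⁵`, standing for the vector field `∑ w_i y_i ∂/∂y_i`. -/
structure Dir where
  (d0 d1 d2 d3 d4 : ℤ)

/-- The components of a direction. -/
def Dir.vec (w : Dir) : Fin 5 → ℤ := ![w.d0, w.d1, w.d2, w.d3, w.d4]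

/-- The list of the components of a direction. -/
def Dir.list (w : Dir) : List ℤ := [w.d0, w.d1, w.d2, w.d3, w.d4]

/-- The weights of the monomials `y_{aI k}`. -/
def Dir.sA (w : Dir) : List ℤ := [w.d3, w.d0, w.d2, w.d4, w.d1]

/-- The weights of the monomials `y_{bI k} y_{bJ k}`. -/
def Dir.sB (w : Dir) : List ℤ := [w.d2 + w.d4, w.d1 + w.d4, w.d1 + w.d3, w.d0 + w.d3, w.d0 + w.d2]

/-- The operations used by the algorithm computing iterated derivatives: it is run in rings of
numbers and of functions, and, with unreduced natural numbers, modulo a prime. -/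
structure Ops (F : Type) where
  /-- Addition. -/
  add : F → F → F
  /-- Multiplication. -/
  mul : F → F → F
  /-- The image of an integer. -/
  sc : ℤ → F

/-- The `2 ^ k` derivatives of a function along the subwords of a word of `k` vector fields. -/
def Tower (F : Type) : ℕ → Type
  | 0 => F
  | k + 1 => Tower F k × Tower F k

/-- The tower with the given halves. -/
def Tower.mk {F : Type} {k : ℕ} (a b : Tower F k) : Tower F (k + 1) := (a, b)

section
variable {F : Type} (o : Ops F)

/-- Sum of towers. -/
def Tower.add (k : ℕ) : Tower F k → Tower F k → Tower F k :=
  Nat.rec (motive := fun k => Tower F k → Tower F k → Tower F k) o.add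
    (fun _ ih a b => (ih a.1 b.1, ih a.2 b.2)) k

/-- Product of towers, given by the Leibniz rule. -/
def Tower.mul (k : ℕ) : Tower F k → Tower F k → Tower F k :=
  Nat.rec (motive := fun k => Tower F k → Tower F k → Tower F k) o.mul
    (fun k ih a b => (ih a.1 b.1, Tower.add o k (ih a.1 b.2) (ih a.2 b.1))) k

/-- Multiplication by a constant. -/
def Tower.smul (c : F) (k : ℕ) : Tower F k → Tower F k :=
  Nat.rec (motive := fun k => Tower F k → Tower F k) (o.mul c) (fun _ ih a => (ih a.1, ih a.2)) k

/-- The tower of a constant function. -/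
def Tower.const (k : ℕ) : F → Tower F k :=
  Nat.rec (motive := fun k => F → Tower F k) (fun a => a) (fun _ ih a => (ih a, ih (o.sc 0))) k

/-- The derivative along the whole word. -/
def Tower.top : (k : ℕ) → Tower F k → F
  | 0, a => a
  | k + 1, a => Tower.top k a.2

/-- Adds a vector field to the word, for the towers of `α_k` and `β_k`. -/
def stepAB (k : ℕ) : List ℤ → List ℤ → List (Tower F k × Tower F k) →
    List (Tower F (k + 1) × Tower F (k + 1))
  | wA :: sA, wB :: sB, ab :: l =>
    let m := Tower.add o k (Tower.smul o (o.sc (-wA)) k ab.1) (Tower.smul o (o.sc wB) k ab.2)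
    ((ab.1, Tower.mul o k ab.1 (Tower.add o k (Tower.const o k (o.sc wA)) m)),
     (ab.2, Tower.mul o k ab.2 (Tower.add o k (Tower.const o k (o.sc wB)) m))) :: stepAB k sA sB l
  | _, _, _ => []

/-- The towers of the `α_k` and `β_k`, computed from their values. -/
def abT (ab : List (F × F)) : (ws : List Dir) → List (Tower F ws.length × Tower F ws.length)
  | [] => ab
  | w :: ws => stepAB o ws.length w.sA w.sB (abT ab ws)

/-- Dot product of lists of integers. -/
def dotZ : List ℤ → List ℤ → ℤ
  | a :: l, b :: m => a * b + dotZ l m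
  | _, _ => 0

/-- Auxiliary accumulation for `eT`. -/
def eGo (k : ℕ) : List ℤ → List ℤ → List ℤ → List (Tower F k × Tower F k) → Tower F k → Tower F k
  | n :: ns, wA :: sA, wB :: sB, ab :: l, acc =>
    if n = 0 then eGo k ns sA sB l acc else
    eGo k ns sA sB l (Tower.add o k acc (Tower.add o k (Tower.smul o (o.sc (n * wA)) k ab.1)
      (Tower.smul o (o.sc (-(n * wB))) k ab.2)))
  | _, _, _, _, acc => acc

/-- The tower of the derivative along `w` of `Log U`, for the monomial `U` of exponents `n`. -/
def eT (k : ℕ) (l : List (Tower F k × Tower F k)) (n : List ℤ) (w : Dir) : Tower F k :=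
  eGo o k (n.drop 5) w.sA w.sB l (Tower.const o k (o.sc (dotZ n w.list)))

/-- Pairs the entries of two lists, the shorter one being completed by `z`. -/
def zipPad (k : ℕ) (z : Tower F k) : List (Tower F k) → List (Tower F k) → List (Tower F (k + 1))
  | [], m => m.map fun b => Tower.mk z b
  | a :: l, m => match m with
    | [] => (a :: l).map fun a => Tower.mk a z
    | b :: m => Tower.mk a b :: zipPad k z l m

/-- The two-dimensional version of `zipPad`. -/
def zipPad2 (k : ℕ) (z : Tower F k) :
    List (List (Tower F k)) → List (List (Tower F k)) → List (List (Tower F (k + 1)))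
  | [], m => m.map fun b => zipPad k z [] b
  | a :: l, m => match m with
    | [] => (a :: l).map fun a => zipPad k z a []
    | b :: m => zipPad k z a b :: zipPad2 k z l m

/-- Adds the entries of two lists. -/
def addL (k : ℕ) : List (Tower F k) → List (Tower F k) → List (Tower F k)
  | [], m => m
  | a :: l, m => match m with
    | [] => a :: l
    | b :: m => Tower.add o k a b :: addL k l m

/-- The two-dimensional version of `addL`. -/
def addL2 (k : ℕ) :
    List (List (Tower F k)) → List (List (Tower F k)) → List (List (Tower F k))
  | [], m => m
  | a :: l, m => match m with
    | [] => a :: l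
    | b :: m => addL o k a b :: addL2 k l m

/-- The coefficients of the tower of a basic function `h` on its derivatives `θ_0^a θ_1^b h`. -/
def cT (ab : List (F × F)) (n : List ℤ × List ℤ) : (ws : List Dir) → List (List (Tower F ws.length))
  | [] => [[o.sc 1]]
  | w :: ws =>
    let k := ws.length
    let l := abT o ab ws
    let e0 := eT o k l n.1 w
    let e1 := eT o k l n.2 w
    let C := cT ab n ws
    let z := Tower.const o k (o.sc 0)
    zipPad2 k z C (addL2 o k ([] :: C.map (fun r => r.map (fun c => Tower.mul o k c e0)))
      (C.map (fun r => z :: r.map (fun c => Tower.mul o k c e1))))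

/-- For a basic form `η = g_0 dlogU f 0 + g_1 dlogU f 1`, the coefficients on the `θ_0^a θ_1^b g_s`
of the derivative along the word `ws` of `η(w)`. -/
def rowF (ab : List (F × F)) (n : List ℤ × List ℤ) (ws : List Dir) (w : Dir) :
    List (List F) × List (List F) :=
  let k := ws.length
  let l := abT o ab ws
  let e0 := eT o k l n.1 w
  let e1 := eT o k l n.2 w
  let C := cT o ab n ws
  (C.map (fun r => r.map (fun c => Tower.top k (Tower.mul o k c e0))),
   C.map (fun r => r.map (fun c => Tower.top k (Tower.mul o k c e1))))

end

/-- The operations of a ring. -/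
def ringOps (R : Type) [Ring R] : Ops R := ⟨(· + ·), (· * ·), fun n => (n : R)⟩

/-! ### Meaning of the coefficients -/

instance Tower.instAddCommGroup : ∀ k, AddCommGroup (Tower ℂ k) :=
  Nat.rec (inferInstanceAs (AddCommGroup ℂ)) fun _ ih => @Prod.instAddCommGroup _ _ ih ih

instance Tower.instModule : ∀ k, Module ℂ (Tower ℂ k) :=
  Nat.rec (inferInstanceAs (Module ℂ ℂ)) fun _ ih => @Prod.instModule ℂ _ _ _ _ _ ih ih

theorem Tower.add_eq (k : ℕ) (a b : Tower ℂ k) : Tower.add (ringOps ℂ) k a b = a + b := by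
  induction k with
  | zero => rfl
  | succ k ih => exact Prod.ext (ih a.1 b.1) (ih a.2 b.2)

theorem Tower.smul_eq (k : ℕ) (c : ℂ) (a : Tower ℂ k) : Tower.smul (ringOps ℂ) c k a = c • a := by
  induction k with
  | zero => rfl
  | succ k ih => exact Prod.ext (ih a.1) (ih a.2)

theorem Tower.const_zero (k : ℕ) : Tower.const (ringOps ℂ) k ((ringOps ℂ).sc 0) = 0 := by
  induction k with
  | zero => exact Int.cast_zero (R := ℂ)
  | succ k ih => exact Prod.ext ih ih

theorem Tower.add_mul (k : ℕ) (a b e : Tower ℂ k) : Tower.mul (ringOps ℂ) k (a + b) e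
    = Tower.mul (ringOps ℂ) k a e + Tower.mul (ringOps ℂ) k b e := by
  induction k with
  | zero => exact _root_.add_mul (R := ℂ) a b e
  | succ k ih =>
    refine Prod.ext (ih a.1 b.1 e.1) ?_
    change Tower.add _ k (Tower.mul _ k (a.1 + b.1) e.2) (Tower.mul _ k (a.2 + b.2) e.1)
      = Tower.add _ k (Tower.mul _ k a.1 e.2) (Tower.mul _ k a.2 e.1)
        + Tower.add _ k (Tower.mul _ k b.1 e.2) (Tower.mul _ k b.2 e.1)
    rw [ih, ih, Tower.add_eq, Tower.add_eq, Tower.add_eq]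
    abel

theorem Tower.smul_mul (k : ℕ) (c : ℂ) (a e : Tower ℂ k) : Tower.mul (ringOps ℂ) k (c • a) e
    = c • Tower.mul (ringOps ℂ) k a e := by
  induction k with
  | zero => exact mul_assoc (G := ℂ) c a e
  | succ k ih =>
    refine Prod.ext (ih a.1 e.1) ?_
    change Tower.add _ k (Tower.mul _ k (c • a.1) e.2) (Tower.mul _ k (c • a.2) e.1)
      = c • Tower.add _ k (Tower.mul _ k a.1 e.2) (Tower.mul _ k a.2 e.1)
    rw [ih, ih, Tower.add_eq, Tower.add_eq, smul_add]

theorem Tower.zero_mul (k : ℕ) (e : Tower ℂ k) : Tower.mul (ringOps ℂ) k 0 e = 0 := by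
  have := Tower.smul_mul k 0 0 e
  rwa [zero_smul, zero_smul] at this

theorem Tower.top_add (k : ℕ) (a b : Tower ℂ k) :
    Tower.top k (a + b) = Tower.top k a + Tower.top k b := by
  induction k with
  | zero => rfl
  | succ k ih => exact ih a.2 b.2

theorem Tower.top_smul (k : ℕ) (c : ℂ) (a : Tower ℂ k) :
    Tower.top k (c • a) = c * Tower.top k a := by
  induction k with
  | zero => rfl
  | succ k ih => exact ih a.2

theorem Tower.top_zero (k : ℕ) : Tower.top k (0 : Tower ℂ k) = 0 := by
  have := Tower.top_smul k 0 0
  rwa [zero_smul, MulZeroClass.zero_mul] at this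

/-- Derivative along `∑ w_i y_i ∂/∂y_i`. -/
def Dv (w : Dir) (c : Y5 → ℂ) (x : Y5) : ℂ := fderiv ℂ c x (logVec w.vec x)

/-- The tower of derivatives of a function along the subwords of a word; the leftmost vector field
is applied first. -/
def tow : (ws : List Dir) → (Y5 → ℂ) → Y5 → Tower ℂ ws.length
  | [], c, x => c x
  | w :: ws, c, x => (tow ws c x, tow ws (Dv w c) x)

section
variable {D : Set Y5} (hD : IsOpen D)
include hD

theorem Dv_congr {c d : Y5 → ℂ} (h : Set.EqOn c d D) (w : Dir) : Set.EqOn (Dv w c) (Dv w d) D :=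
  fun x hx => by
    rw [Dv, Dv, Filter.EventuallyEq.fderiv_eq (Filter.eventuallyEq_of_mem (hD.mem_nhds hx) h)]

theorem tow_congr {x : Y5} (hx : x ∈ D) (ws : List Dir) {c d : Y5 → ℂ} (h : Set.EqOn c d D) :
    tow ws c x = tow ws d x := by
  induction ws generalizing c d with
  | nil => exact h hx
  | cons w ws ih => exact Prod.ext (ih h) (ih (Dv_congr hD h w))

omit hD in
theorem analyticOnNhd_Dv {c : Y5 → ℂ} (h : AnalyticOnNhd ℂ c D) (w : Dir) :
    AnalyticOnNhd ℂ (Dv w c) D :=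
  fun x hx => analyticAt_apply_logVec (h.fderiv x hx) w.vec

theorem tow_add {x : Y5} (hx : x ∈ D) (ws : List Dir) {c d : Y5 → ℂ} (hc : AnalyticOnNhd ℂ c D)
    (hd : AnalyticOnNhd ℂ d D) : tow ws (fun y => c y + d y) x = tow ws c x + tow ws d x := by
  induction ws generalizing c d with
  | nil => rfl
  | cons w ws ih =>
    refine Prod.ext (ih hc hd) ?_
    change tow ws _ x = tow ws _ x + tow ws _ x
    rw [← ih (analyticOnNhd_Dv hc w) (analyticOnNhd_Dv hd w)]
    refine tow_congr hD hx ws fun y hy => ?_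
    simp only [Dv]
    rw [fderiv_fun_add (hc y hy).differentiableAt (hd y hy).differentiableAt]
    rfl

theorem tow_smul {x : Y5} (hx : x ∈ D) (ws : List Dir) (z : ℂ) {c : Y5 → ℂ}
    (hc : AnalyticOnNhd ℂ c D) : tow ws (fun y => z * c y) x = z • tow ws c x := by
  induction ws generalizing c with
  | nil => rfl
  | cons w ws ih =>
    refine Prod.ext (ih hc) ?_
    change tow ws _ x = z • tow ws _ x
    rw [← ih (analyticOnNhd_Dv hc w)]
    refine tow_congr hD hx ws fun y hy => ?_
    simp only [Dv]
    rw [fderiv_const_mul (hc y hy).differentiableAt]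
    rfl

omit hD in
theorem tow_const (x : Y5) (ws : List Dir) (z : ℂ) :
    tow ws (fun _ => z) x = Tower.const (ringOps ℂ) ws.length z := by
  induction ws generalizing z with
  | nil => rfl
  | cons w ws ih =>
    refine Prod.ext (ih z) ?_
    have : Dv w (fun _ => z) = fun _ => ((0 : ℤ) : ℂ) := by
      ext y; simp [Dv]
    change tow ws _ x = Tower.const (ringOps ℂ) ws.length _
    rw [this, ih]; rfl

theorem tow_mul {x : Y5} (hx : x ∈ D) (ws : List Dir) {c d : Y5 → ℂ} (hc : AnalyticOnNhd ℂ c D)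
    (hd : AnalyticOnNhd ℂ d D) : tow ws (fun y => c y * d y) x
      = Tower.mul (ringOps ℂ) ws.length (tow ws c x) (tow ws d x) := by
  induction ws generalizing c d with
  | nil => rfl
  | cons w ws ih =>
    refine Prod.ext (ih hc hd) ?_
    change tow ws _ x = Tower.add _ _ (Tower.mul _ _ (tow ws c x) (tow ws (Dv w d) x))
      (Tower.mul _ _ (tow ws (Dv w c) x) (tow ws d x))
    have hc' := analyticOnNhd_Dv hc w
    have hd' := analyticOnNhd_Dv hd w
    rw [← ih hc hd', ← ih hc' hd, Tower.add_eq, ← tow_add hD hx ws (hc.mul hd') (hc'.mul hd)]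
    refine tow_congr hD hx ws fun y hy => ?_
    simp only [Dv]
    rw [fderiv_fun_mul (hc y hy).differentiableAt (hd y hy).differentiableAt]
    simp [mul_comm]

end

theorem analyticOnNhd_coord (i : Fin 5) (D : Set Y5) : AnalyticOnNhd ℂ (fun y : Y5 => y i) D :=
  (ContinuousLinearMap.proj (R := ℂ) (φ := fun _ : Fin 5 => ℂ) i).analyticOnNhd D

theorem analyticOnNhd_polP (k : Fin 5) (D : Set Y5) :
    AnalyticOnNhd ℂ (fun y : Y5 => polP y k) D :=
  (analyticOnNhd_const.add (analyticOnNhd_coord _ D)).sub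
    ((analyticOnNhd_coord _ D).mul (analyticOnNhd_coord _ D))

theorem analyticOnNhd_al (k : Fin 5) {D : Set Y5} (hDY : D ⊆ Ystar) : AnalyticOnNhd ℂ (al k) D :=
  (analyticOnNhd_coord _ D).div (analyticOnNhd_polP k D) fun _ hx => polP_ne_zero (hDY hx) k

theorem analyticOnNhd_be (k : Fin 5) {D : Set Y5} (hDY : D ⊆ Ystar) : AnalyticOnNhd ℂ (be k) D :=
  ((analyticOnNhd_coord _ D).mul (analyticOnNhd_coord _ D)).div (analyticOnNhd_polP k D)
    fun _ hx => polP_ne_zero (hDY hx) k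

theorem fderiv_coord (i : Fin 5) (x v : Y5) : fderiv ℂ (fun y : Y5 => y i) x v = v i := by
  rw [(hasFDerivAt_apply i x).fderiv]; rfl

theorem fderiv_polP (k : Fin 5) (x v : Y5) : fderiv ℂ (fun y : Y5 => polP y k) x v
    = v (aI k) - (x (bI k) * v (bJ k) + x (bJ k) * v (bI k)) := by
  have h (i : Fin 5) : HasFDerivAt (fun y : Y5 => y i)
      (ContinuousLinearMap.proj (R := ℂ) (φ := fun _ : Fin 5 => ℂ) i) x := hasFDerivAt_apply i x
  unfold polP
  rw [(((h _).const_add 1).fun_sub ((h _).fun_mul (h _))).fderiv]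
  simp

theorem Dv_mul_eq {w : Dir} {c d : Y5 → ℂ} {x : Y5} (hc : DifferentiableAt ℂ c x)
    (hd : DifferentiableAt ℂ d x) :
    Dv w (fun y => c y * d y) x = c x * Dv w d x + Dv w c x * d x := by
  simp only [Dv]
  rw [fderiv_fun_mul hc hd]
  simp [mul_comm]

theorem Dv_al (w : Dir) (k : Fin 5) {x : Y5} (hx : x ∈ Ystar) : Dv w (al k) x
    = al k x * (w.vec (aI k) + (-(w.vec (aI k)) * al k x
      + (w.vec (bI k) + w.vec (bJ k)) * be k x)) := by
  have hP := polP_ne_zero hx k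
  have h1 : (fun y => al k y * polP y k) =ᶠ[nhds x] fun y => y (aI k) := by
    filter_upwards [isOpen_Ystar.mem_nhds hx] with y hy
    exact div_mul_cancel₀ _ (polP_ne_zero hy k)
  have h2 := Dv_mul_eq (w := w) (analyticOnNhd_al k subset_rfl x hx).differentiableAt
    (analyticOnNhd_polP k Ystar x hx).differentiableAt
  have h3 : Dv w (fun y => al k y * polP y k) x = w.vec (aI k) * x (aI k) := by
    rw [Dv, h1.fderiv_eq, fderiv_coord]; rfl
  rw [h3] at h2
  rw [show Dv w (fun y : Y5 => polP y k) x = _ from fderiv_polP k x _] at h2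
  simp only [logVec] at h2
  refine mul_right_cancel₀ hP ?_
  have e1 : al k x * polP x k = x (aI k) := div_mul_cancel₀ _ hP
  have e2 : be k x * polP x k = x (bI k) * x (bJ k) := div_mul_cancel₀ _ hP
  linear_combination -h2 - w.vec (aI k) * e1 + w.vec (aI k) * al k x * e1
    - (w.vec (bI k) + w.vec (bJ k)) * al k x * e2

theorem Dv_be (w : Dir) (k : Fin 5) {x : Y5} (hx : x ∈ Ystar) : Dv w (be k) x
    = be k x * ((w.vec (bI k) + w.vec (bJ k)) + (-(w.vec (aI k)) * al k x
      + (w.vec (bI k) + w.vec (bJ k)) * be k x)) := by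
  have hP := polP_ne_zero hx k
  have h1 : (fun y => be k y * polP y k) =ᶠ[nhds x] fun y => y (bI k) * y (bJ k) := by
    filter_upwards [isOpen_Ystar.mem_nhds hx] with y hy
    exact div_mul_cancel₀ _ (polP_ne_zero hy k)
  have h2 := Dv_mul_eq (w := w) (analyticOnNhd_be k subset_rfl x hx).differentiableAt
    (analyticOnNhd_polP k Ystar x hx).differentiableAt
  have h3 : Dv w (fun y => be k y * polP y k) x
      = (w.vec (bI k) + w.vec (bJ k)) * (x (bI k) * x (bJ k)) := by
    have := Dv_mul_eq (w := w) (analyticOnNhd_coord (bI k) Ystar x hx).differentiableAt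
      (analyticOnNhd_coord (bJ k) Ystar x hx).differentiableAt
    rw [Dv, h1.fderiv_eq]
    refine this.trans ?_
    simp only [Dv, fderiv_coord, logVec]
    ring
  rw [h3] at h2
  rw [show Dv w (fun y : Y5 => polP y k) x = _ from fderiv_polP k x _] at h2
  simp only [logVec] at h2
  refine mul_right_cancel₀ hP ?_
  have e1 : al k x * polP x k = x (aI k) := div_mul_cancel₀ _ hP
  have e2 : be k x * polP x k = x (bI k) * x (bJ k) := div_mul_cancel₀ _ hP
  linear_combination -h2 - (w.vec (bI k) + w.vec (bJ k)) * e2 + w.vec (aI k) * be k x * e1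
    - (w.vec (bI k) + w.vec (bJ k)) * be k x * e2

/-- The values of the `α_k` and `β_k`. -/
def abVal (x : Y5) : List (ℂ × ℂ) := (List.finRange 5).map fun k => (al k x, be k x)

theorem abT_eq {D : Set Y5} (hD : IsOpen D) (hDY : D ⊆ Ystar) {x : Y5} (hx : x ∈ D)
    (ws : List Dir) : abT (ringOps ℂ) (abVal x) ws
      = (List.finRange 5).map fun k => (tow ws (al k) x, tow ws (be k) x) := by
  induction ws with
  | nil => rfl
  | cons w ws ih =>
    have key (k : Fin 5) (a b : ℤ) (ha : a = w.vec (aI k)) (hb : b = w.vec (bI k) + w.vec (bJ k))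
        (c : Y5 → ℂ) (hc : AnalyticOnNhd ℂ c D) (e : ℤ)
        (h : ∀ y ∈ D, Dv w c y = c y * ((e : ℂ) + (((-a : ℤ) : ℂ) * al k y + (b : ℂ) * be k y))) :
        Tower.mul (ringOps ℂ) ws.length (tow ws c x)
          (Tower.add (ringOps ℂ) ws.length (Tower.const (ringOps ℂ) ws.length ((ringOps ℂ).sc e))
          (Tower.add (ringOps ℂ) ws.length
          (Tower.smul (ringOps ℂ) ((ringOps ℂ).sc (-a)) ws.length (tow ws (al k) x))
          (Tower.smul (ringOps ℂ) ((ringOps ℂ).sc b) ws.length (tow ws (be k) x))))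
        = tow ws (Dv w c) x := by
      have h1 := analyticOnNhd_al k hDY
      have h2 := analyticOnNhd_be k hDY
      have h3 (z : ℂ) : AnalyticOnNhd ℂ (fun _ : Y5 => z) D := analyticOnNhd_const
      have h4 (z : ℂ) {d : Y5 → ℂ} (hd : AnalyticOnNhd ℂ d D) :
          AnalyticOnNhd ℂ (fun y => z * d y) D := (h3 z).mul hd
      have h5 {d d' : Y5 → ℂ} (hd : AnalyticOnNhd ℂ d D) (hd' : AnalyticOnNhd ℂ d' D) :
          AnalyticOnNhd ℂ (fun y => d y + d' y) D := hd.add hd'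
      rw [tow_congr hD hx ws h, tow_mul hD hx ws hc (h5 (h3 _) (h5 (h4 _ h1) (h4 _ h2))),
        tow_add hD hx ws (h3 _) (h5 (h4 _ h1) (h4 _ h2)), tow_add hD hx ws (h4 _ h1) (h4 _ h2),
        tow_smul hD hx ws _ h1, tow_smul hD hx ws _ h2, tow_const,
        Tower.add_eq, Tower.add_eq, Tower.smul_eq, Tower.smul_eq]
      rfl
    have keyA (k : Fin 5) (a b : ℤ) (ha : a = w.vec (aI k))
        (hb : b = w.vec (bI k) + w.vec (bJ k)) :=
      key k a b ha hb (al k) (analyticOnNhd_al k hDY) a fun y hy => by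
        rw [Dv_al w k (hDY hy), ha, hb]; push_cast; rfl
    have keyB (k : Fin 5) (a b : ℤ) (ha : a = w.vec (aI k))
        (hb : b = w.vec (bI k) + w.vec (bJ k)) :=
      key k a b ha hb (be k) (analyticOnNhd_be k hDY) b fun y hy => by
        rw [Dv_be w k (hDY hy), ha, hb]; push_cast; rfl
    have step (k : Fin 5) (a b : ℤ) (ha : a = w.vec (aI k))
        (hb : b = w.vec (bI k) + w.vec (bJ k)) (sA sB : List ℤ)
        (l : List (Tower ℂ ws.length × Tower ℂ ws.length)) :
        stepAB (ringOps ℂ) ws.length (a :: sA) (b :: sB) ((tow ws (al k) x, tow ws (be k) x) :: l)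
          = (tow (w :: ws) (al k) x, tow (w :: ws) (be k) x)
            :: stepAB (ringOps ℂ) ws.length sA sB l := by
      have h1 := keyA k a b ha hb
      have h2 := keyB k a b ha hb
      simp only [stepAB]
      rw [h1, h2]
      rfl
    rw [abT, ih]
    exact (step 0 _ _ rfl rfl _ _ _).trans <| congrArg _ <|
      (step 1 _ _ rfl (add_comm _ _) _ _ _).trans <| congrArg _ <|
      (step 2 _ _ rfl rfl _ _ _).trans <| congrArg _ <|
      (step 3 _ _ rfl rfl _ _ _).trans <| congrArg _ <| step 4 _ _ rfl rfl _ _ _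

end

section

theorem eGo_cons (k : ℕ) (n a b : ℤ) (ns sA sB : List ℤ) (ab : Tower ℂ k × Tower ℂ k)
    (l : List (Tower ℂ k × Tower ℂ k)) (acc : Tower ℂ k) :
    eGo (ringOps ℂ) k (n :: ns) (a :: sA) (b :: sB) (ab :: l) acc
      = eGo (ringOps ℂ) k ns sA sB l
        (acc + (((n * a : ℤ) : ℂ) • ab.1 + ((-(n * b) : ℤ) : ℂ) • ab.2)) := by
  rw [eGo]
  split_ifs with h
  · simp [h]
  · rw [Tower.add_eq, Tower.add_eq, Tower.smul_eq, Tower.smul_eq]; rfl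

theorem eGo_nil (k : ℕ) (acc : Tower ℂ k) : eGo (ringOps ℂ) k [] [] [] [] acc = acc := by
  rw [eGo]
  rintro _ _ _ _ _ _ _ _ ⟨⟩

/-- The list of the exponents of `U_{f,s}`. -/
def expoList (f : Fol) (s : Fin 3) : List ℤ := List.ofFn (expoTab f s)

theorem eT_eq {D : Set Y5} (hD : IsOpen D) (hDY : D ⊆ Ystar) {x : Y5} (hx : x ∈ D)
    (ws : List Dir) (f : Fol) (s : Fin 3) (w : Dir) :
    eT (ringOps ℂ) ws.length (abT (ringOps ℂ) (abVal x) ws) (expoList f s) w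
      = tow ws (fun y => dlogU f s y (logVec w.vec y)) x := by
  have h1 (k) := analyticOnNhd_al k hDY
  have h2 (k) := analyticOnNhd_be k hDY
  have h3 (z : ℂ) : AnalyticOnNhd ℂ (fun _ : Y5 => z) D := analyticOnNhd_const
  have h4 (z : ℂ) {d : Y5 → ℂ} (hd : AnalyticOnNhd ℂ d D) :
      AnalyticOnNhd ℂ (fun y => z * d y) D := (h3 z).mul hd
  have h5 {d d' : Y5 → ℂ} (hd : AnalyticOnNhd ℂ d D) (hd' : AnalyticOnNhd ℂ d' D) :
      AnalyticOnNhd ℂ (fun y => d y + d' y) D := hd.add hd'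
  set n := expoTab f s with hn
  have e0 : expoList f s = [n 0, n 1, n 2, n 3, n 4, n 5, n 6, n 7, n 8, n 9] := by
    simp [expoList, List.ofFn_succ, hn]
  have e1 : Set.EqOn (fun y => dlogU f s y (logVec w.vec y)) (fun y =>
      (((((((n 0 * w.d0 + (n 1 * w.d1 + (n 2 * w.d2 + (n 3 * w.d3 + (n 4 * w.d4 + 0)))) : ℤ) : ℂ)
      + (((n 5 * w.d3 : ℤ) : ℂ) * al 0 y + ((-(n 5 * (w.d2 + w.d4)) : ℤ) : ℂ) * be 0 y))
      + (((n 6 * w.d0 : ℤ) : ℂ) * al 1 y + ((-(n 6 * (w.d1 + w.d4)) : ℤ) : ℂ) * be 1 y))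
      + (((n 7 * w.d2 : ℤ) : ℂ) * al 2 y + ((-(n 7 * (w.d1 + w.d3)) : ℤ) : ℂ) * be 2 y))
      + (((n 8 * w.d4 : ℤ) : ℂ) * al 3 y + ((-(n 8 * (w.d0 + w.d3)) : ℤ) : ℂ) * be 3 y))
      + (((n 9 * w.d1 : ℤ) : ℂ) * al 4 y + ((-(n 9 * (w.d0 + w.d2)) : ℤ) : ℂ) * be 4 y))) D := by
    intro y hy
    simp only [dlogU_logVec (hDY hy), expo_eq, ← hn, Fin.sum_univ_five]
    simp only [Dir.vec, aI, bI, bJ]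
    push_cast
    change (n 0 * (w.d0 : ℂ) + n 1 * (w.d1 : ℂ) + n 2 * (w.d2 : ℂ) + n 3 * (w.d3 : ℂ)
      + n 4 * (w.d4 : ℂ)) + (n 5 * ((w.d3 : ℂ) * _ - ((w.d2 : ℂ) + w.d4) * _)
      + n 6 * ((w.d0 : ℂ) * _ - ((w.d4 : ℂ) + w.d1) * _)
      + n 7 * ((w.d2 : ℂ) * _ - ((w.d1 : ℂ) + w.d3) * _)
      + n 8 * ((w.d4 : ℂ) * _ - ((w.d0 : ℂ) + w.d3) * _)
      + n 9 * ((w.d1 : ℂ) * _ - ((w.d0 : ℂ) + w.d2) * _)) = _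
    ring
  have h6 (k : Fin 5) (a b : ℤ) : AnalyticOnNhd ℂ (fun y => (a : ℂ) * al k y + (b : ℂ) * be k y) D :=
    h5 (h4 _ (h1 k)) (h4 _ (h2 k))
  have h7 (k : Fin 5) (a b : ℤ) : tow ws (fun y => (a : ℂ) * al k y + (b : ℂ) * be k y) x
      = (a : ℂ) • tow ws (al k) x + (b : ℂ) • tow ws (be k) x := by
    rw [tow_add hD hx ws (h4 _ (h1 k)) (h4 _ (h2 k)), tow_smul hD hx ws _ (h1 k),
      tow_smul hD hx ws _ (h2 k)]
  rw [tow_congr hD hx ws e1,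
    tow_add hD hx ws (h5 (h5 (h5 (h5 (h3 _) (h6 _ _ _)) (h6 _ _ _)) (h6 _ _ _)) (h6 _ _ _)) (h6 _ _ _),
    tow_add hD hx ws (h5 (h5 (h5 (h3 _) (h6 _ _ _)) (h6 _ _ _)) (h6 _ _ _)) (h6 _ _ _),
    tow_add hD hx ws (h5 (h5 (h3 _) (h6 _ _ _)) (h6 _ _ _)) (h6 _ _ _),
    tow_add hD hx ws (h5 (h3 _) (h6 _ _ _)) (h6 _ _ _),
    tow_add hD hx ws (h3 _) (h6 _ _ _), h7, h7, h7, h7, h7, tow_const, abT_eq hD hDY hx, e0, eT]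
  change eGo _ _ [n 5, n 6, n 7, n 8, n 9] [_, _, _, _, _] [_, _, _, _, _]
    [(tow ws (al 0) x, tow ws (be 0) x), (tow ws (al 1) x, tow ws (be 1) x),
     (tow ws (al 2) x, tow ws (be 2) x), (tow ws (al 3) x, tow ws (be 3) x),
     (tow ws (al 4) x, tow ws (be 4) x)] _ = _
  rw [eGo_cons, eGo_cons, eGo_cons, eGo_cons, eGo_cons, eGo_nil]
  rfl

/-- The combination `∑ l_n j_n`. -/
def pair1 {M : Type} [AddCommGroup M] [Module ℂ M] : List M → (ℕ → ℂ) → M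
  | [], _ => 0
  | c :: l, j => j 0 • c + pair1 l fun n => j (n + 1)

/-- The combination `∑ C_{a,b} j_{a,b}`. -/
def pair2 {M : Type} [AddCommGroup M] [Module ℂ M] : List (List M) → (ℕ → ℕ → ℂ) → M
  | [], _ => 0
  | r :: C, j => pair1 r (j 0) + pair2 C fun n => j (n + 1)

section
variable {k : ℕ}

theorem pair1_addL (l m : List (Tower ℂ k)) (j : ℕ → ℂ) :
    pair1 (addL (ringOps ℂ) k l m) j = pair1 l j + pair1 m j := by
  induction l generalizing m j with
  | nil => simp [addL, pair1]
  | cons a l ih =>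
    cases m with
    | nil => simp [addL, pair1]
    | cons b m => rw [addL, pair1, pair1, pair1, ih, Tower.add_eq, smul_add]; abel

theorem pair2_addL2 (l m : List (List (Tower ℂ k))) (j : ℕ → ℕ → ℂ) :
    pair2 (addL2 (ringOps ℂ) k l m) j = pair2 l j + pair2 m j := by
  induction l generalizing m j with
  | nil => simp [addL2, pair2]
  | cons a l ih =>
    cases m with
    | nil => simp [addL2, pair2]
    | cons b m => rw [addL2, pair2, pair2, pair2, ih, pair1_addL]; abel

theorem pair1_map_left (m : List (Tower ℂ k)) (j : ℕ → ℂ) :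
    pair1 (m.map fun b => Tower.mk (0 : Tower ℂ k) b) j = Tower.mk (0 : Tower ℂ k) (pair1 m j) := by
  induction m generalizing j with
  | nil => rfl
  | cons b m ih =>
    rw [List.map_cons, pair1, ih]
    refine Prod.ext ?_ rfl
    change j 0 • (0 : Tower ℂ k) + 0 = 0
    rw [smul_zero, add_zero]

theorem pair1_map_right (m : List (Tower ℂ k)) (j : ℕ → ℂ) :
    pair1 (m.map fun b => Tower.mk b (0 : Tower ℂ k)) j = Tower.mk (pair1 m j) (0 : Tower ℂ k) := by
  induction m generalizing j with
  | nil => rfl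
  | cons b m ih =>
    rw [List.map_cons, pair1, ih]
    refine Prod.ext rfl ?_
    change j 0 • (0 : Tower ℂ k) + 0 = 0
    rw [smul_zero, add_zero]

theorem pair1_zipPad (l m : List (Tower ℂ k)) (j : ℕ → ℂ) :
    pair1 (zipPad k 0 l m) j = Tower.mk (pair1 l j) (pair1 m j) := by
  induction l generalizing m j with
  | nil => exact pair1_map_left m j
  | cons a l ih =>
    cases m with
    | nil => exact pair1_map_right (a :: l) j
    | cons b m => rw [zipPad, pair1, ih]; rfl

theorem pair2_zipPad2 (l m : List (List (Tower ℂ k))) (j : ℕ → ℕ → ℂ) :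
    pair2 (zipPad2 k 0 l m) j = Tower.mk (pair2 l j) (pair2 m j) := by
  have h0 (m : List (List (Tower ℂ k))) (j : ℕ → ℕ → ℂ) :
      pair2 (m.map fun b => zipPad k 0 [] b) j = Tower.mk (0 : Tower ℂ k) (pair2 m j) := by
    induction m generalizing j with
    | nil => rfl
    | cons b m ih =>
      rw [List.map_cons, pair2, ih, pair1_zipPad]
      exact Prod.ext (add_zero (0 : Tower ℂ k)) rfl
  have h1 (m : List (List (Tower ℂ k))) (j : ℕ → ℕ → ℂ) :
      pair2 (m.map fun b => zipPad k 0 b []) j = Tower.mk (pair2 m j) (0 : Tower ℂ k) := by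
    induction m generalizing j with
    | nil => rfl
    | cons b m ih =>
      rw [List.map_cons, pair2, ih, pair1_zipPad]
      exact Prod.ext rfl (add_zero (0 : Tower ℂ k))
  induction l generalizing m j with
  | nil => exact h0 m j
  | cons a l ih =>
    cases m with
    | nil => exact h1 (a :: l) j
    | cons b m => rw [zipPad2, pair2, ih, pair1_zipPad]; rfl

theorem pair1_map_mul (l : List (Tower ℂ k)) (e : Tower ℂ k) (j : ℕ → ℂ) :
    pair1 (l.map fun c => Tower.mul (ringOps ℂ) k c e) j = Tower.mul (ringOps ℂ) k (pair1 l j) e := by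
  induction l generalizing j with
  | nil => exact (Tower.zero_mul k e).symm
  | cons a l ih => rw [List.map_cons, pair1, pair1, ih, Tower.add_mul, Tower.smul_mul]

theorem pair2_map_mul (C : List (List (Tower ℂ k))) (e : Tower ℂ k) (j : ℕ → ℕ → ℂ) :
    pair2 (C.map fun r => r.map fun c => Tower.mul (ringOps ℂ) k c e) j
      = Tower.mul (ringOps ℂ) k (pair2 C j) e := by
  induction C generalizing j with
  | nil => exact (Tower.zero_mul k e).symm
  | cons a l ih => rw [List.map_cons, pair2, pair2, ih, Tower.add_mul, pair1_map_mul]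

theorem pair2_map_shift (C : List (List (Tower ℂ k))) (e : Tower ℂ k) (j : ℕ → ℕ → ℂ) :
    pair2 (C.map fun r => 0 :: r.map fun c => Tower.mul (ringOps ℂ) k c e) j
      = Tower.mul (ringOps ℂ) k (pair2 C fun a b => j a (b + 1)) e := by
  rw [← pair2_map_mul]
  induction C generalizing j with
  | nil => rfl
  | cons a l ih => rw [List.map_cons, List.map_cons, pair2, pair2, ih, pair1, smul_zero, zero_add]

theorem pair1_top (l : List (Tower ℂ k)) (j : ℕ → ℂ) :
    Tower.top k (pair1 l j) = pair1 (l.map (Tower.top k)) j := by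
  induction l generalizing j with
  | nil => exact Tower.top_zero k
  | cons a l ih => rw [List.map_cons, pair1, pair1, Tower.top_add, Tower.top_smul, ih]; rfl

theorem pair2_top (C : List (List (Tower ℂ k))) (j : ℕ → ℕ → ℂ) :
    Tower.top k (pair2 C j) = pair2 (C.map fun r => r.map (Tower.top k)) j := by
  induction C generalizing j with
  | nil => exact Tower.top_zero k
  | cons a l ih => rw [List.map_cons, pair2, pair2, Tower.top_add, pair1_top, ih]

end

/-- The functions `j a b` behave on `D` as the derivatives `θ_0^a θ_1^b h` of a basic function of
the foliation `f`. -/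
def IsJet (f : Fol) (D : Set Y5) (j : ℕ → ℕ → Y5 → ℂ) : Prop :=
  (∀ a b, AnalyticOnNhd ℂ (j a b) D) ∧ ∀ a b, ∀ x ∈ D, ∀ v,
    fderiv ℂ (j a b) x v = j (a + 1) b x * dlogU f 0 x v + j a (b + 1) x * dlogU f 1 x v

theorem isJet_jet {f : Fol} {D : Set Y5} (hD : IsOpen D) (hDY : D ⊆ Ystar) {h : Y5 → ℂ}
    (hh : IsBas f D h) : IsJet f D (jet f h) :=
  ⟨fun a b => (isBas_jet hD hDY hh a b).1, fun a b _ hx v => fderiv_jet hD hDY hh a b hx v⟩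

theorem analyticOnNhd_dlogU_logVec (f : Fol) (s : Fin 3) {D : Set Y5} (hDY : D ⊆ Ystar) (w : Dir) :
    AnalyticOnNhd ℂ (fun y => dlogU f s y (logVec w.vec y)) D :=
  fun x hx => analyticAt_apply_logVec (analyticOnNhd_dlogU f s x (hDY hx)) w.vec

theorem cT_spec {f : Fol} {D : Set Y5} (hD : IsOpen D) (hDY : D ⊆ Ystar) {x : Y5} (hx : x ∈ D)
    (ws : List Dir) {j : ℕ → ℕ → Y5 → ℂ} (hj : IsJet f D j) :
    tow ws (j 0 0) x = pair2 (cT (ringOps ℂ) (abVal x) (expoList f 0, expoList f 1) ws)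
      fun a b => j a b x := by
  induction ws generalizing j with
  | nil =>
    change j 0 0 x = (j 0 0 x * ((1 : ℤ) : ℂ) + (0 : ℂ)) + (0 : ℂ)
    simp
  | cons w ws ih =>
    have hA (s : Fin 3) := analyticOnNhd_dlogU_logVec f s hDY w
    rw [cT]
    dsimp only
    rw [Tower.const_zero, eT_eq hD hDY hx, eT_eq hD hDY hx, pair2_zipPad2, pair2_addL2,
      ← ih hj, pair2_map_shift, pair2, pair1, zero_add, pair2_map_mul]
    have i0 : IsJet f D fun a b => j (a + 1) b := ⟨fun a b => hj.1 _ _, fun a b => hj.2 _ _⟩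
    have i1 : IsJet f D fun a b => j a (b + 1) := ⟨fun a b => hj.1 _ _, fun a b => hj.2 _ _⟩
    rw [← ih i0, ← ih i1, ← tow_mul hD hx ws (hj.1 _ _) (hA 0), ← tow_mul hD hx ws (hj.1 _ _) (hA 1),
      ← tow_add hD hx ws ((hj.1 _ _).mul (hA 0)) ((hj.1 _ _).mul (hA 1))]
    exact Prod.ext rfl (tow_congr hD hx ws fun y hy => hj.2 0 0 y hy _)

theorem rowF_spec {f : Fol} {D : Set Y5} (hD : IsOpen D) (hDY : D ⊆ Ystar) {x : Y5} (hx : x ∈ D)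
    (ws : List Dir) (w : Dir) {j0 j1 : ℕ → ℕ → Y5 → ℂ} (h0 : IsJet f D j0) (h1 : IsJet f D j1) :
    Tower.top _ (tow ws (fun y => j0 0 0 y * dlogU f 0 y (logVec w.vec y)
      + j1 0 0 y * dlogU f 1 y (logVec w.vec y)) x)
      = pair2 (rowF (ringOps ℂ) (abVal x) (expoList f 0, expoList f 1) ws w).1
          (fun a b => j0 a b x)
        + pair2 (rowF (ringOps ℂ) (abVal x) (expoList f 0, expoList f 1) ws w).2
          (fun a b => j1 a b x) := by
  have hA (s : Fin 3) := analyticOnNhd_dlogU_logVec f s hDY w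
  have key (e : Tower ℂ ws.length) (C : List (List (Tower ℂ ws.length))) (j) :
      pair2 (C.map fun r => r.map fun c =>
        Tower.top ws.length (Tower.mul (ringOps ℂ) ws.length c e)) j
      = Tower.top ws.length (Tower.mul (ringOps ℂ) ws.length (pair2 C j) e) := by
    rw [← pair2_map_mul, pair2_top, List.map_map]
    simp only [Function.comp_def, List.map_map]
  rw [rowF]
  dsimp only
  rw [key, key, eT_eq hD hDY hx, eT_eq hD hDY hx, ← cT_spec hD hDY hx ws h0,
    ← cT_spec hD hDY hx ws h1, ← tow_mul hD hx ws (h0.1 _ _) (hA 0),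
    ← tow_mul hD hx ws (h1.1 _ _) (hA 1), ← Tower.top_add,
    ← tow_add hD hx ws ((h0.1 _ _).mul (hA 0)) ((h1.1 _ _).mul (hA 1))]

/-! ### Coefficients as finite sums -/

theorem pair1_eq_sum (l : List ℂ) (j : ℕ → ℂ) (n : ℕ) (h : l.length ≤ n) :
    pair1 l j = ∑ b ∈ Finset.range n, l.getD b 0 * j b := by
  induction l generalizing j n with
  | nil => simp [pair1]
  | cons a l ih =>
    obtain ⟨n, rfl⟩ : ∃ m, n = m + 1 := ⟨n - 1, by simp at h; omega⟩
    rw [Finset.sum_range_succ', add_comm]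
    refine congrArg₂ (· + ·) (mul_comm (G := ℂ) _ _) ?_
    rw [ih _ n (by simpa using h)]
    rfl

theorem pair2_eq_sum (C : List (List ℂ)) (j : ℕ → ℕ → ℂ) (n : ℕ) (h : C.length ≤ n)
    (h' : ∀ a, (C.getD a []).length ≤ n - a) :
    pair2 C j
      = ∑ a ∈ Finset.range n, ∑ b ∈ Finset.range (n - a), (C.getD a []).getD b 0 * j a b := by
  induction C generalizing j n with
  | nil => simp [pair2]
  | cons r C ih =>
    obtain ⟨n, rfl⟩ : ∃ m, n = m + 1 := ⟨n - 1, by simp at h; omega⟩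
    rw [Finset.sum_range_succ', add_comm]
    refine congrArg₂ (· + ·) (pair1_eq_sum r _ _ (h' 0)) ?_
    rw [ih _ n (by simpa using h) fun a => by simpa using h' (a + 1)]
    simp

/-- The list of lists `C` has `n` entries at most, the `a`-th one of length at most `n - a`. -/
def IsTri {α : Type} (C : List (List α)) (n : ℕ) : Prop :=
  C.length ≤ n ∧ ∀ a, (C.getD a []).length ≤ n - a

section
variable {F : Type} (o : Ops F) {k : ℕ}

theorem isTri_cons {α : Type} {r : List α} {C : List (List α)} {n : ℕ} :
    IsTri (r :: C) (n + 1) ↔ r.length ≤ n + 1 ∧ IsTri C n := by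
  simp only [IsTri, List.length_cons, add_le_add_iff_right]
  constructor
  · rintro ⟨h1, h2⟩
    exact ⟨h2 0, h1, fun a => by simpa using h2 (a + 1)⟩
  · rintro ⟨h0, h1, h2⟩
    refine ⟨h1, fun a => ?_⟩
    cases a with
    | zero => simpa using h0
    | succ a => simpa using h2 a

theorem isTri_nil {α : Type} (n : ℕ) : IsTri ([] : List (List α)) n := by simp [IsTri]

theorem length_zipPad (z : Tower F k) (l m : List (Tower F k)) (n : ℕ) (hl : l.length ≤ n)
    (hm : m.length ≤ n) : (zipPad k z l m).length ≤ n := by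
  induction l generalizing m n with
  | nil => simpa [zipPad] using hm
  | cons a l ih =>
    cases m with
    | nil => simpa [zipPad] using hl
    | cons b m =>
      obtain ⟨n, rfl⟩ : ∃ m, n = m + 1 := ⟨n - 1, by simp at hl; omega⟩
      simpa [zipPad] using ih m n (by simpa using hl) (by simpa using hm)

theorem length_addL (l m : List (Tower F k)) (n : ℕ) (hl : l.length ≤ n)
    (hm : m.length ≤ n) : (addL o k l m).length ≤ n := by
  induction l generalizing m n with
  | nil => simpa [addL] using hm
  | cons a l ih =>
    cases m with
    | nil => simpa [addL] using hl
    | cons b m =>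
      obtain ⟨n, rfl⟩ : ∃ m, n = m + 1 := ⟨n - 1, by simp at hl; omega⟩
      simpa [addL] using ih m n (by simpa using hl) (by simpa using hm)

theorem IsTri.map {α β : Type} {C : List (List α)} {n : ℕ} (h : IsTri C n)
    (g : List α → List β) (d : ℕ) (hg : ∀ r, (g r).length ≤ r.length + d) (hd : n + d ≤ n + 1) :
    IsTri (C.map g) (n + d) := by
  induction C generalizing n with
  | nil => exact isTri_nil _
  | cons r C ih =>
    obtain ⟨n, rfl⟩ : ∃ m, n = m + 1 := ⟨n - 1, by have := h.1; simp at this; omega⟩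
    rw [isTri_cons] at h
    have : n + 1 + d = (n + d) + 1 := by ring
    rw [List.map_cons, this, isTri_cons]
    exact ⟨(hg r).trans (by omega), ih h.2 (by omega)⟩

theorem isTri_zipPad2 (z : Tower F k) (l m : List (List (Tower F k))) (n : ℕ) (hl : IsTri l n)
    (hm : IsTri m n) : IsTri (zipPad2 k z l m) n := by
  induction l generalizing m n with
  | nil => exact hm.map (fun b => zipPad k z [] b) 0 (fun r => by simp [zipPad]) (by omega)
  | cons a l ih =>
    cases m with
    | nil =>
      refine hl.map (fun b => zipPad k z b []) 0 (fun r => ?_) (by omega)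
      cases r <;> simp [zipPad]
    | cons b m =>
      obtain ⟨n, rfl⟩ : ∃ m, n = m + 1 := ⟨n - 1, by have := hl.1; simp at this; omega⟩
      rw [isTri_cons] at hl hm
      exact isTri_cons.2 ⟨length_zipPad z a b _ hl.1 hm.1, ih m n hl.2 hm.2⟩

theorem isTri_addL2 (l m : List (List (Tower F k))) (n : ℕ) (hl : IsTri l n)
    (hm : IsTri m n) : IsTri (addL2 o k l m) n := by
  induction l generalizing m n with
  | nil => exact hm
  | cons a l ih =>
    cases m with
    | nil => exact hl
    | cons b m =>
      obtain ⟨n, rfl⟩ : ∃ m, n = m + 1 := ⟨n - 1, by have := hl.1; simp at this; omega⟩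
      rw [isTri_cons] at hl hm
      exact isTri_cons.2 ⟨length_addL o a b _ hl.1 hm.1, ih m n hl.2 hm.2⟩

theorem IsTri.mono {α : Type} {C : List (List α)} {n m : ℕ} (h : IsTri C n) (hm : n ≤ m) :
    IsTri C m := ⟨h.1.trans hm, fun a => (h.2 a).trans (by omega)⟩

theorem isTri_cT (ab : List (F × F)) (n : List ℤ × List ℤ) (ws : List Dir) :
    IsTri (cT o ab n ws) (ws.length + 1) := by
  induction ws with
  | nil => exact isTri_cons.2 ⟨le_rfl, isTri_nil 0⟩
  | cons w ws ih =>
    rw [cT]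
    refine isTri_zipPad2 _ _ _ _ (ih.mono (by simp)) (isTri_addL2 o _ _ _ ?_ ?_)
    · exact isTri_cons.2 ⟨by simp, ih.map _ 0 (fun r => by simp) (by omega)⟩
    · exact ih.map _ 1 (fun r => by simp) (by omega)

theorem isTri_rowF (ab : List (F × F)) (n : List ℤ × List ℤ) (ws : List Dir) (w : Dir) :
    IsTri (rowF o ab n ws w).1 (ws.length + 1) ∧ IsTri (rowF o ab n ws w).2 (ws.length + 1) :=
  ⟨(isTri_cT o ab n ws).map _ 0 (fun r => by simp) (by omega),
   (isTri_cT o ab n ws).map _ 0 (fun r => by simp) (by omega)⟩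

end

end

section

/-! ### Linear equations between the derivatives of the components -/

/-- A column `(i, s, a, b)` stands for `θ_0^a θ_1^b g_s`, where `g_0, g_1` are the coefficients of
the component on the `i`-th foliation of a list. -/
abbrev Col : Type := ℕ × ℕ × ℕ × ℕ

/-- The entry of a table of coefficients in a given column. -/
def look {F : Type} (z : F) (R : List (List (List F) × List (List F))) (c : Col) : F :=
  let x := R.getD c.1 ([], [])
  ((if c.2.1 = 0 then x.1 else x.2).getD c.2.2.1 []).getD c.2.2.2 z

/-- The columns of order at most `K`, for `n` foliations. -/
def allCols (n K : ℕ) : List Col :=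
  (List.range n).flatMap fun i => (List.range 2).flatMap fun s =>
    (List.range (K + 1)).flatMap fun a => (List.range (K + 1 - a)).map fun b => (i, s, a, b)

/-- The exponents of the first integrals of a list of foliations. -/
def expoLists (J : List Fol) : List (List ℤ × List ℤ) :=
  J.map fun f => (expoList f 0, expoList f 1)

/-- The coefficient at `x`, in the column `c`, of the equation attached to a word `p`. -/
def entry (J : List Fol) (p : List Dir × Dir) (c : Col) (x : Y5) : ℂ :=
  look 0 ((expoLists J).map fun n => rowF (ringOps ℂ) (abVal x) n p.1 p.2) c

/-- The function attached to a column by a tuple of forms. -/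
def colFun (J : List Fol) (η : Tuple 1) (c : Col) : Y5 → ℂ :=
  jet (J.getD c.1 (0, 1)) (coef η (J.getD c.1 (0, 1)) (if c.2.1 = 0 then 0 else 1)) c.2.2.1 c.2.2.2

/-- The vector field `w` is tangent to the foliation `f`, whose first integral is formed of two
monomials in the coordinates. -/
def killsDir (f : Fol) (w : Dir) : Prop :=
  f.2 = 1 ∧ dotZ (expoList f 0) w.list = 0 ∧ dotZ (expoList f 1) w.list = 0

instance (f : Fol) (w : Dir) : Decidable (killsDir f w) := by unfold killsDir; infer_instance

theorem dotZ_eq (f : Fol) (s : Fin 3) (w : Dir) : dotZ (expoList f s) w.list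
    = ∑ k : Fin 5, expo f s (Fin.castAdd 5 k) * w.vec k := by
  simp only [Fin.sum_univ_five, expo_eq]
  simp [expoList, List.ofFn_succ, Dir.list, Dir.vec, dotZ, ← add_assoc]

theorem expo_natAdd_eq_zero : ∀ (f : Fol) (s : Fin 3) (k : Fin 5), f.2 = 1 → s ≠ 2 →
    expo f s (Fin.natAdd 5 k) = 0 := by decide +kernel

theorem dlogU_logVec_const {f : Fol} (hf : f.2 = 1) {s : Fin 3} (hs : s ≠ 2) {x : Y5}
    (hx : x ∈ Ystar) (w : Dir) : dlogU f s x (logVec w.vec x) = (dotZ (expoList f s) w.list : ℤ) := by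
  rw [dlogU_logVec hx, dotZ_eq]
  simp only [expo_natAdd_eq_zero f s _ hf hs]
  simp

section
variable {D : Set Y5} (hD : IsOpen D) (hDY : D ⊆ Ystar)
include hD

theorem tow_zero {x : Y5} (hx : x ∈ D) (ws : List Dir) {c : Y5 → ℂ} (hc : Set.EqOn c 0 D) :
    Tower.top _ (tow ws c x) = 0 := by
  rw [tow_congr hD hx ws (d := fun y => 0 * (fun _ : Y5 => (0 : ℂ)) y) fun y hy => by simp [hc hy],
    tow_smul hD hx ws 0 (c := fun _ : Y5 => (0 : ℂ)) analyticOnNhd_const, zero_smul, Tower.top_zero]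

theorem top_tow_sum {x : Y5} (hx : x ∈ D) (ws : List Dir) {ι : Type} (s : Finset ι)
    (c : ι → Y5 → ℂ) (hc : ∀ i ∈ s, AnalyticOnNhd ℂ (c i) D) :
    Tower.top _ (tow ws (fun y => ∑ i ∈ s, c i y) x) = ∑ i ∈ s, Tower.top _ (tow ws (c i) x) := by
  classical
  induction s using Finset.induction_on with
  | empty => exact tow_zero hD hx ws fun y _ => by simp
  | insert i s hi ih =>
    have h := tow_add hD hx ws (hc i (Finset.mem_insert_self i s))
      (Finset.analyticOnNhd_fun_sum s fun j hj => hc j (Finset.mem_insert_of_mem hj))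
    simp only [Finset.sum_insert hi]
    rw [h, Tower.top_add, ih fun j hj => hc j (Finset.mem_insert_of_mem hj)]

include hDY

/-- A basic function of `f` is killed by the vector fields tangent to `f`, even when other
derivations of the same kind are applied before. -/
theorem top_tow_eq_zero {f : Fol} {x : Y5} (hx : x ∈ D) (ws : List Dir)
    (hw : ∃ w ∈ ws, killsDir f w) {h : Y5 → ℂ} (hh : IsBas f D h) :
    Tower.top _ (tow ws h x) = 0 := by
  induction ws generalizing h with
  | nil => simp at hw
  | cons w ws ih =>
    change Tower.top _ (tow ws (Dv w h) x) = 0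
    have hf : f.2 = 1 := by obtain ⟨_, _, h, _⟩ := hw; exact h
    have e : Set.EqOn (Dv w h) (fun y => ((dotZ (expoList f 0) w.list : ℤ) : ℂ) * theta f 0 h y
        + ((dotZ (expoList f 1) w.list : ℤ) : ℂ) * theta f 1 h y) D := fun y hy => by
      rw [Dv, hh.fderiv_apply hDY hy, dlogU_logVec_const hf (by decide) (hDY hy),
        dlogU_logVec_const hf (by decide) (hDY hy)]
      ring
    have t (m) := hh.theta hD hDY m
    by_cases hk : killsDir f w
    · refine tow_zero hD hx ws fun y hy => ?_
      rw [e hy, hk.2.1, hk.2.2]; simp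
    · have hw' : ∃ w ∈ ws, killsDir f w := by
        obtain ⟨u, hu, hu'⟩ := hw
        rcases List.mem_cons.1 hu with rfl | hu
        · exact absurd hu' hk
        · exact ⟨u, hu, hu'⟩
      have hc (z : ℂ) : AnalyticOnNhd ℂ (fun _ : Y5 => z) D := analyticOnNhd_const
      rw [tow_congr hD hx ws e, tow_add hD hx ws ((hc _).mul (t 0).1) ((hc _).mul (t 1).1),
        tow_smul hD hx ws _ (t 0).1, tow_smul hD hx ws _ (t 1).1, Tower.top_add, Tower.top_smul,
        Tower.top_smul, ih hw' (t 0), ih hw' (t 1)]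
      simp

end

theorem list_sum_eq' {α : Type} (J : List α) (d : α) (g : α → ℂ) :
    ∑ i ∈ Finset.range J.length, g (J.getD i d) = (J.map g).sum := by
  induction J with
  | nil => simp
  | cons a l ih =>
    rw [List.length_cons, Finset.sum_range_succ', List.map_cons, List.sum_cons, ← ih, add_comm]
    simp

theorem sum_flatMap {α β : Type} (l : List α) (g : α → List β) (h : β → ℂ) :
    ((l.flatMap g).map h).sum = (l.map fun a => ((g a).map h).sum).sum := by
  induction l with
  | nil => simp
  | cons a l ih => simp [ih]

theorem sum_allCols (n K : ℕ) (g : Col → ℂ) : ((allCols n K).map g).sum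
    = ∑ i ∈ Finset.range n, ∑ s ∈ Finset.range 2, ∑ a ∈ Finset.range (K + 1),
      ∑ b ∈ Finset.range (K + 1 - a), g (i, s, a, b) := by
  simp only [allCols, sum_flatMap, List.map_map]
  rfl

/-- The equations satisfied by the derivatives of the components of an abelian relation: the
derivative along the word `p.1` of the relation evaluated on `p.2`, a word which kills the
components outside `J`. -/
theorem row_identity {D : Set Y5} (hD : IsOpen D) (hDY : D ⊆ Ystar) {I : Finset Fol} {J : List Fol}
    (hJ : J.Nodup) {η : Tuple 1} (hη : η ∈ AR 1 D I) {p : List Dir × Dir} {K : ℕ}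
    (hK : p.1.length ≤ K) (hp : ∀ f ∈ I, f ∈ J ∨ ∃ w ∈ p.2 :: p.1, killsDir f w) {x : Y5}
    (hx : x ∈ D) : ((allCols J.length K).map fun c => entry J p c x * colFun J η c x).sum = 0 := by
  obtain ⟨ws, w⟩ := p
  have hb (f s) := isBas_coef hD hDY hη f s
  have hj (f s) := isJet_jet hD hDY (hb f s)
  have hA (f : Fol) (s : Fin 3) := analyticOnNhd_dlogU_logVec f s hDY w
  let G (f : Fol) (y : Y5) : ℂ := coef η f 0 y * dlogU f 0 y (logVec w.vec y)
      + coef η f 1 y * dlogU f 1 y (logVec w.vec y)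
  have hG (f : Fol) : AnalyticOnNhd ℂ (G f) D :=
    ((hb f 0).1.mul (hA f 0)).add ((hb f 1).1.mul (hA f 1))
  have hsum : ∑ f, Tower.top _ (tow ws (G f) x) = 0 := by
    rw [← top_tow_sum hD hx ws _ G fun f _ => hG f]
    refine tow_zero hD hx ws fun y hy => ?_
    have := DFunLike.congr_fun (hη.2.2.2.2.2 y) ![logVec w.vec y]
    rw [ContinuousAlternatingMap.sum_apply] at this
    rw [Pi.zero_apply, ← show _ = (0 : ℂ) from this]
    exact Finset.sum_congr rfl fun f _ => (apply_eq_coef hDY hη f hy _).symm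
  have hz (f : Fol) (hf : f ∉ J) : Tower.top _ (tow ws (G f) x) = 0 := by
    by_cases hI : f ∈ I
    · obtain ⟨u, hu, hk⟩ := (hp f hI).resolve_left hf
      have e (s : Fin 3) (hs : s ≠ 2) (y : Y5) (hy : y ∈ D) :=
        dlogU_logVec_const hk.1 hs (hDY hy) w
      rcases List.mem_cons.1 hu with rfl | hu
      · refine tow_zero hD hx ws fun y hy => ?_
        simp [G, e 0 (by decide) y hy, e 1 (by decide) y hy, hk.2.1, hk.2.2]
      · have e' : Set.EqOn (G f) (fun y => ((dotZ (expoList f 0) w.list : ℤ) : ℂ) * coef η f 0 y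
            + ((dotZ (expoList f 1) w.list : ℤ) : ℂ) * coef η f 1 y) D := fun y hy => by
          simp only [G, e 0 (by decide) y hy, e 1 (by decide) y hy]; ring
        have hc (z : ℂ) : AnalyticOnNhd ℂ (fun _ : Y5 => z) D := analyticOnNhd_const
        rw [tow_congr hD hx ws e', tow_add hD hx ws ((hc _).mul (hb f 0).1) ((hc _).mul (hb f 1).1),
          tow_smul hD hx ws _ (hb f 0).1, tow_smul hD hx ws _ (hb f 1).1, Tower.top_add,
          Tower.top_smul, Tower.top_smul, top_tow_eq_zero hD hDY hx ws ⟨u, hu, hk⟩ (hb f 0),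
          top_tow_eq_zero hD hDY hx ws ⟨u, hu, hk⟩ (hb f 1)]
        simp
    · refine tow_zero hD hx ws fun y hy => ?_
      simp only [G]
      rw [← apply_eq_coef hDY hη f hy, hη.2.2.1 f hI]
      rfl
  have hJsum : (J.map fun f => Tower.top _ (tow ws (G f) x)).sum = 0 := by
    rw [← List.sum_toFinset _ hJ, ← hsum]
    exact Finset.sum_subset (Finset.subset_univ _) fun f _ hf => hz f (by simpa using hf)
  rw [sum_allCols, ← hJsum, ← list_sum_eq' J (0, 1)]
  refine Finset.sum_congr rfl fun i hi => ?_
  have hi' : i < J.length := Finset.mem_range.1 hi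
  set f := J.getD i (0, 1) with hf
  have hR : ((expoLists J).map fun n => rowF (ringOps ℂ) (abVal x) n ws w).getD i ([], [])
      = rowF (ringOps ℂ) (abVal x) (expoList f 0, expoList f 1) ws w := by
    rw [expoLists, List.map_map, List.getD_eq_getElem _ _ (by simpa using hi'), List.getElem_map,
      hf, List.getD_eq_getElem _ _ hi']
    rfl
  have hT := isTri_rowF (ringOps ℂ) (abVal x) (expoList f 0, expoList f 1) ws w
  have hT1 := hT.1.mono (Nat.add_le_add_right hK 1)
  have hT2 := hT.2.mono (Nat.add_le_add_right hK 1)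
  refine Eq.trans ?_ (rowF_spec hD hDY hx ws w (hj f 0) (hj f 1)).symm
  rw [pair2_eq_sum _ _ _ hT1.1 hT1.2, pair2_eq_sum _ _ _ hT2.1 hT2.2, Finset.sum_range_succ,
    Finset.sum_range_one]
  simp only [entry, look, hR, colFun, ← hf, if_pos, one_ne_zero, if_false]

end

section

/-! ### Naturality of the coefficients -/

/-- A map compatible with the operations. -/
structure OpsHom {F G : Type} (o : Ops F) (o' : Ops G) (φ : F → G) : Prop where
  add : ∀ a b, φ (o.add a b) = o'.add (φ a) (φ b)
  mul : ∀ a b, φ (o.mul a b) = o'.mul (φ a) (φ b)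
  sc : ∀ n, φ (o.sc n) = o'.sc n

/-- The map induced on towers. -/
def Tower.map {F G : Type} (φ : F → G) : (k : ℕ) → Tower F k → Tower G k
  | 0, a => φ a
  | k + 1, a => (Tower.map φ k a.1, Tower.map φ k a.2)

section
variable {F G : Type} {o : Ops F} {o' : Ops G} {φ : F → G} (h : OpsHom o o' φ)
include h

theorem Tower.map_add (k : ℕ) (a b : Tower F k) :
    Tower.map φ k (Tower.add o k a b) = Tower.add o' k (Tower.map φ k a) (Tower.map φ k b) := by
  induction k with
  | zero => exact h.add a b
  | succ k ih => exact Prod.ext (ih _ _) (ih _ _)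

theorem Tower.map_mul (k : ℕ) (a b : Tower F k) :
    Tower.map φ k (Tower.mul o k a b) = Tower.mul o' k (Tower.map φ k a) (Tower.map φ k b) := by
  induction k with
  | zero => exact h.mul a b
  | succ k ih =>
    refine Prod.ext (ih _ _) ?_
    change Tower.map φ k (Tower.add o k (Tower.mul o k a.1 b.2) (Tower.mul o k a.2 b.1)) = _
    rw [Tower.map_add h, ih, ih]
    rfl

theorem Tower.map_smul (k : ℕ) (c : ℤ) (a : Tower F k) :
    Tower.map φ k (Tower.smul o (o.sc c) k a) = Tower.smul o' (o'.sc c) k (Tower.map φ k a) := by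
  induction k with
  | zero => exact (h.mul _ a).trans (by rw [h.sc]; rfl)
  | succ k ih => exact Prod.ext (ih _) (ih _)

theorem Tower.map_const (k : ℕ) (c : ℤ) :
    Tower.map φ k (Tower.const o k (o.sc c)) = Tower.const o' k (o'.sc c) := by
  induction k generalizing c with
  | zero => exact h.sc c
  | succ k ih => exact Prod.ext (ih _) (ih _)

omit h in
theorem Tower.map_top (k : ℕ) (a : Tower F k) :
    Tower.top k (Tower.map φ k a) = φ (Tower.top k a) := by
  induction k with
  | zero => rfl
  | succ k ih => exact ih a.2

theorem map_stepAB (k : ℕ) (sA sB : List ℤ) (l : List (Tower F k × Tower F k)) :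
    (stepAB o k sA sB l).map (Prod.map (Tower.map φ (k + 1)) (Tower.map φ (k + 1)))
      = stepAB o' k sA sB (l.map (Prod.map (Tower.map φ k) (Tower.map φ k))) := by
  induction l generalizing sA sB with
  | nil => cases sA <;> cases sB <;> rfl
  | cons ab l ih =>
    cases sA with
    | nil => rfl
    | cons a sA =>
      cases sB with
      | nil => rfl
      | cons b sB =>
        refine congrArg₂ List.cons (Prod.ext (Prod.ext rfl ?_) (Prod.ext rfl ?_)) (ih sA sB)
        · exact (Tower.map_mul h k _ _).trans (by
            rw [Tower.map_add h, Tower.map_add h, Tower.map_smul h, Tower.map_smul h,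
              Tower.map_const h]; rfl)
        · exact (Tower.map_mul h k _ _).trans (by
            rw [Tower.map_add h, Tower.map_add h, Tower.map_smul h, Tower.map_smul h,
              Tower.map_const h]; rfl)

theorem map_abT (ab : List (F × F)) (ws : List Dir) :
    (abT o ab ws).map (Prod.map (Tower.map φ ws.length) (Tower.map φ ws.length))
      = abT o' (ab.map (Prod.map φ φ)) ws := by
  induction ws with
  | nil => rfl
  | cons w ws ih => exact (map_stepAB h _ _ _ _).trans (by rw [ih]; rfl)

theorem map_eGo (k : ℕ) (ns sA sB : List ℤ) (l : List (Tower F k × Tower F k)) (acc : Tower F k) :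
    Tower.map φ k (eGo o k ns sA sB l acc)
      = eGo o' k ns sA sB (l.map (Prod.map (Tower.map φ k) (Tower.map φ k))) (Tower.map φ k acc) := by
  induction l generalizing ns sA sB acc with
  | nil => cases ns <;> cases sA <;> cases sB <;> rfl
  | cons ab l ih =>
    cases ns with
    | nil => rfl
    | cons n ns =>
      cases sA with
      | nil => rfl
      | cons a sA =>
        cases sB with
        | nil => rfl
        | cons b sB =>
          rw [List.map_cons, eGo, eGo]
          split_ifs
          · exact ih ..
          · rw [ih, Tower.map_add h, Tower.map_add h, Tower.map_smul h, Tower.map_smul h]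
            rfl

theorem map_eT (k : ℕ) (l : List (Tower F k × Tower F k)) (n : List ℤ) (w : Dir) :
    Tower.map φ k (eT o k l n w)
      = eT o' k (l.map (Prod.map (Tower.map φ k) (Tower.map φ k))) n w := by
  rw [eT, map_eGo h, Tower.map_const h]
  rfl

omit h in
theorem map_zipPad (k : ℕ) (z : Tower F k) (l m : List (Tower F k)) :
    (zipPad k z l m).map (Tower.map φ (k + 1))
      = zipPad k (Tower.map φ k z) (l.map (Tower.map φ k)) (m.map (Tower.map φ k)) := by
  induction l generalizing m with
  | nil => simp only [zipPad, List.map_nil, List.map_map]; rfl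
  | cons a l ih =>
    cases m with
    | nil => simp only [zipPad, List.map_nil, List.map_map, List.map_cons]; rfl
    | cons b m => exact congrArg _ (ih m)

omit h in
theorem map_zipPad2 (k : ℕ) (z : Tower F k) (l m : List (List (Tower F k))) :
    (zipPad2 k z l m).map (List.map (Tower.map φ (k + 1)))
      = zipPad2 k (Tower.map φ k z) (l.map (List.map (Tower.map φ k)))
        (m.map (List.map (Tower.map φ k))) := by
  induction l generalizing m with
  | nil =>
    simp only [zipPad2, List.map_nil, List.map_map]
    exact List.map_congr_left fun r _ => map_zipPad k z [] r
  | cons a l ih =>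
    cases m with
    | nil =>
      change List.map _ (List.map (fun r => zipPad k z r []) (a :: l))
        = List.map (fun r => zipPad k _ r []) (List.map (List.map (Tower.map φ k)) (a :: l))
      rw [List.map_map, List.map_map]
      exact List.map_congr_left fun r _ => map_zipPad k z r []
    | cons b m => exact congrArg₂ List.cons (map_zipPad k z a b) (ih m)

theorem map_addL (k : ℕ) (l m : List (Tower F k)) :
    (addL o k l m).map (Tower.map φ k)
      = addL o' k (l.map (Tower.map φ k)) (m.map (Tower.map φ k)) := by
  induction l generalizing m with
  | nil => rfl
  | cons a l ih =>
    cases m with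
    | nil => rfl
    | cons b m => exact congrArg₂ List.cons (Tower.map_add h k a b) (ih m)

theorem map_addL2 (k : ℕ) (l m : List (List (Tower F k))) :
    (addL2 o k l m).map (List.map (Tower.map φ k))
      = addL2 o' k (l.map (List.map (Tower.map φ k))) (m.map (List.map (Tower.map φ k))) := by
  induction l generalizing m with
  | nil => rfl
  | cons a l ih =>
    cases m with
    | nil => rfl
    | cons b m => exact congrArg₂ List.cons (map_addL h k a b) (ih m)

theorem map_cT (ab : List (F × F)) (n : List ℤ × List ℤ) (ws : List Dir) :
    (cT o ab n ws).map (List.map (Tower.map φ ws.length))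
      = cT o' (ab.map (Prod.map φ φ)) n ws := by
  induction ws with
  | nil => exact congrArg (fun a => [[a]]) (h.sc 1)
  | cons w ws ih =>
    rw [cT, cT]
    refine (map_zipPad2 _ _ _ _).trans ?_
    rw [map_addL2 h, ih, Tower.map_const h, ← map_abT h, ← map_eT h, ← map_eT h, ← ih]
    simp only [List.map_cons, List.map_map, List.map_nil, Function.comp_def, Tower.map_mul h,
      Tower.map_const h]

theorem map_rowF (ab : List (F × F)) (n : List ℤ × List ℤ) (ws : List Dir) (w : Dir) :
    Prod.map (List.map (List.map φ)) (List.map (List.map φ)) (rowF o ab n ws w)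
      = rowF o' (ab.map (Prod.map φ φ)) n ws w := by
  rw [rowF, rowF]
  rw [← map_abT h, ← map_cT h, ← map_eT h, ← map_eT h]
  simp only [Prod.map, List.map_map, Function.comp_def, ← Tower.map_mul h, Tower.map_top]

omit h in
theorem map_look (z : F) (R : List (List (List F) × List (List F))) (c : Col) :
    φ (look z R c) = look (φ z)
      (R.map (Prod.map (List.map (List.map φ)) (List.map (List.map φ)))) c := by
  have h1 (i : ℕ) : (R.map (Prod.map (List.map (List.map φ)) (List.map (List.map φ)))).getD i ([], [])
      = Prod.map (List.map (List.map φ)) (List.map (List.map φ)) (R.getD i ([], [])) := by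
    exact List.getD_map R ([], []) (Prod.map (List.map (List.map φ)) (List.map (List.map φ)))
  have h2 (l : List (List F)) (i : ℕ) : (l.map (List.map φ)).getD i [] = (l.getD i []).map φ := by
    exact List.getD_map l [] (List.map φ)
  simp only [look, h1]
  split_ifs <;> simp only [Prod.map, h2, List.getD_map]

theorem map_entry (z : F) (J : List Fol) (ab : List (F × F)) (p : List Dir × Dir) (c : Col) :
    φ (look z ((expoLists J).map fun n => rowF o ab n p.1 p.2) c)
      = look (φ z) ((expoLists J).map fun n => rowF o' (ab.map (Prod.map φ φ)) n p.1 p.2) c := by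
  rw [map_look (φ := φ), List.map_map]
  simp only [Function.comp_def, map_rowF h]

end

theorem opsHom_ringHom {R S : Type} [Ring R] [Ring S] (φ : R →+* S) :
    OpsHom (ringOps R) (ringOps S) φ :=
  ⟨map_add φ, map_mul φ, map_intCast φ⟩

/-- The ring of analytic functions on `Y₅*`. -/
def anaRing : Subring (Y5 → ℂ) where
  carrier := {c | AnalyticOnNhd ℂ c Ystar}
  zero_mem' := analyticOnNhd_const
  one_mem' := analyticOnNhd_const
  add_mem' h h' := AnalyticOnNhd.add h h'
  mul_mem' h h' := AnalyticOnNhd.mul h h'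
  neg_mem' h := AnalyticOnNhd.neg h

theorem analyticOnNhd_entry (J : List Fol) (p : List Dir × Dir) (c : Col) :
    AnalyticOnNhd ℂ (entry J p c) Ystar := by
  let ab : List (anaRing × anaRing) := (List.finRange 5).map fun k =>
    (⟨al k, analyticOnNhd_al k subset_rfl⟩, ⟨be k, analyticOnNhd_be k subset_rfl⟩)
  let e := look 0 ((expoLists J).map fun n => rowF (ringOps anaRing) ab n p.1 p.2) c
  have he : entry J p c = e.1 := by
    funext x
    let φ : anaRing →+* ℂ := (Pi.evalRingHom (fun _ => ℂ) x).comp anaRing.subtype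
    have := map_entry (opsHom_ringHom φ) 0 J ab p c
    rw [map_zero] at this
    refine Eq.trans ?_ this.symm
    rw [List.map_map]
    rfl
  rw [he]
  exact e.2

end

section

/-! ### Closure of the differential system and bound of the rank -/

/-- A vector of functions whose derivatives are bounded by its values vanishes if it vanishes at one
point. -/
theorem eq_zero_of_fderiv_bound {n : ℕ} {V : Y5 → Fin n → ℂ} {x₀ : Y5} {r C : ℝ}
    (hV : ∀ x ∈ Metric.ball x₀ r, DifferentiableAt ℂ V x)
    (hC : ∀ x ∈ Metric.ball x₀ r, ∀ u, ‖fderiv ℂ V x u‖ ≤ C * ‖u‖ * ‖V x‖) (h0 : V x₀ = 0) :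
    ∀ x ∈ Metric.ball x₀ r, V x = 0 := by
  intro x hx
  let γ : ℝ → Y5 := fun t => x₀ + t • (x - x₀)
  have hγ (t : ℝ) : HasDerivAt γ (x - x₀) t := by
    have := ((hasDerivAt_id t).smul_const (x - x₀)).const_add x₀
    rwa [one_smul] at this
  have hmem (t : ℝ) (ht : t ∈ Set.Icc (0 : ℝ) 1) : γ t ∈ Metric.ball x₀ r := by
    rw [Metric.mem_ball, dist_eq_norm] at hx ⊢
    rw [show γ t - x₀ = t • (x - x₀) by simp [γ], norm_smul, Real.norm_eq_abs, abs_of_nonneg ht.1]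
    nlinarith [norm_nonneg (x - x₀), ht.2]
  have hd (t : ℝ) (ht : t ∈ Set.Icc (0 : ℝ) 1) :
      HasDerivAt (fun t => V (γ t)) (fderiv ℂ V (γ t) (x - x₀)) t :=
    ((hV _ (hmem t ht)).hasFDerivAt.restrictScalars ℝ).comp_hasDerivAt t (hγ t)
  have := norm_le_gronwallBound_of_norm_deriv_right_le (f := fun t => V (γ t)) (δ := 0)
    (K := C * ‖x - x₀‖) (ε := 0) (a := 0) (b := 1)
    (fun t ht => (hd t ht).continuousAt.continuousWithinAt)
    (fun t ht => (hd t ⟨ht.1, ht.2.le⟩).hasDerivWithinAt)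
    (by simp [γ, h0])
    (fun t ht => by simpa using hC _ (hmem t ⟨ht.1, ht.2.le⟩) (x - x₀)) 1 (by simp)
  simpa [gronwallBound_ε0, γ] using this

theorem continuousAt_matrix_inv {m : ℕ} {M : Y5 → Matrix (Fin m) (Fin m) ℂ} {x : Y5}
    (hM : ContinuousAt M x) (h : (M x).det ≠ 0) : ContinuousAt (fun y => (M y)⁻¹) x := by
  have h1 : ContinuousAt (fun y => (M y).det) x :=
    (Continuous.matrix_det continuous_id).continuousAt.comp hM
  have h2 : ContinuousAt (fun y => (M y).adjugate) x :=
    (Continuous.matrix_adjugate continuous_id).continuousAt.comp hM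
  have h3 : (fun y => (M y)⁻¹) = fun y => ((M y).det)⁻¹ • (M y).adjugate := by
    ext y : 1
    rw [Matrix.inv_def, Ring.inverse_eq_inv']
  rw [h3]
  exact (h1.inv₀ h).smul h2

theorem mem_allCols {n K : ℕ} {i s a b : ℕ} :
    (i, s, a, b) ∈ allCols n K ↔ i < n ∧ s < 2 ∧ a + b ≤ K := by
  simp only [allCols, List.mem_flatMap, List.mem_range, List.mem_map, Prod.mk.injEq]
  constructor
  · rintro ⟨_, h1, _, h2, _, h3, _, h4, rfl, rfl, rfl, rfl⟩
    exact ⟨h1, h2, by omega⟩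
  · rintro ⟨h1, h2, h3⟩
    exact ⟨i, h1, s, h2, a, by omega, b, by omega, rfl, rfl, rfl, rfl⟩

/-- The data of a solution of the linear equations between derivatives of order at most `K`: as many
words as pivot columns, the other columns being of order less than `K`. -/
structure WordData (I : Finset Fol) (J : List Fol) (K m n : ℕ) where
  /-- The words. -/
  word : Fin m → List Dir × Dir
  /-- The pivot columns. -/
  piv : Fin m → Col
  /-- The other columns. -/
  free : Fin n → Col
  nodup : J.Nodup
  length_le : ∀ i, (word i).1.length ≤ K
  kills : ∀ i, ∀ f ∈ I, f ∈ J ∨ ∃ w ∈ (word i).2 :: (word i).1, killsDir f w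
  perm : (List.ofFn piv ++ List.ofFn free).Perm (allCols J.length K)
  order_free : ∀ i, (free i).2.2.1 + (free i).2.2.2 < K

namespace WordData
variable {I : Finset Fol} {J : List Fol} {K m n : ℕ} (W : WordData I J K m n)

/-- The square matrix of the coefficients of the equations in the pivot columns. -/
def mat (x : Y5) : Matrix (Fin m) (Fin m) ℂ := Matrix.of fun i j => entry J (W.word i) (W.piv j) x

/-- The matrix of the coefficients of the equations in the other columns. -/
def matFree (x : Y5) : Matrix (Fin m) (Fin n) ℂ :=
  Matrix.of fun i j => entry J (W.word i) (W.free j) x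

theorem continuousAt_mat {x : Y5} (hx : x ∈ Ystar) : ContinuousAt W.mat x :=
  continuousAt_pi.2 fun _ => continuousAt_pi.2 fun _ => (analyticOnNhd_entry _ _ _ x hx).continuousAt

theorem continuousAt_matFree {x : Y5} (hx : x ∈ Ystar) : ContinuousAt W.matFree x :=
  continuousAt_pi.2 fun _ => continuousAt_pi.2 fun _ => (analyticOnNhd_entry _ _ _ x hx).continuousAt

variable {D : Set Y5} (hD : IsOpen D) (hDY : D ⊆ Ystar) {η : Tuple 1} (hη : η ∈ AR 1 D I)
include hD hDY hη

theorem equations {x : Y5} (hx : x ∈ D) : (W.mat x).mulVec (fun j => colFun J η (W.piv j) x)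
    + (W.matFree x).mulVec (fun j => colFun J η (W.free j) x) = 0 := by
  ext i
  have := row_identity hD hDY W.nodup hη (W.length_le i) (W.kills i) hx
  rw [← (W.perm.map _).sum_eq, List.map_append, List.sum_append, List.map_ofFn, List.map_ofFn,
    List.sum_ofFn, List.sum_ofFn] at this
  exact this

theorem piv_eq {x : Y5} (hx : x ∈ D) (hdet : (W.mat x).det ≠ 0) (i : Fin m) :
    colFun J η (W.piv i) x
      = (-((W.mat x)⁻¹ * W.matFree x)).mulVec (fun j => colFun J η (W.free j) x) i := by
  have h := congrArg (W.mat x)⁻¹.mulVec (W.equations hD hDY hη hx)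
  rw [Matrix.mulVec_add, Matrix.mulVec_mulVec, Matrix.nonsing_inv_mul _ (isUnit_iff_ne_zero.2 hdet),
    Matrix.one_mulVec, Matrix.mulVec_zero, Matrix.mulVec_mulVec] at h
  have := congrFun (eq_neg_of_add_eq_zero_left h) i
  rw [this, Matrix.neg_mulVec]

/-- Near a point where the matrix is invertible, an abelian relation whose derivatives in the free
columns vanish at this point has trivial components on the foliations in `J`. -/
theorem eventually_eq_zero {x₀ : Y5} (hx₀ : x₀ ∈ D) (hdet : (W.mat x₀).det ≠ 0)
    (h0 : ∀ i, colFun J η (W.free i) x₀ = 0) :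
    ∀ᶠ x in nhds x₀, ∀ c ∈ allCols J.length K, colFun J η c x = 0 := by
  have hc0 : ContinuousAt (fun x => (W.mat x).det) x₀ :=
    (Continuous.matrix_det continuous_id).continuousAt.comp (W.continuousAt_mat (hDY hx₀))
  obtain ⟨r, hr, hball⟩ : ∃ r > 0, Metric.closedBall x₀ r ⊆ D ∩ {x | (W.mat x).det ≠ 0} :=
    Metric.nhds_basis_closedBall.mem_iff.1
      (Filter.inter_mem (hD.mem_nhds hx₀) (hc0.eventually_ne hdet))
  have hB := isCompact_closedBall x₀ r
  -- the matrix expressing the pivot derivatives by the free ones is bounded near `x₀`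
  have hN : ContinuousOn (fun x => (W.mat x)⁻¹ * W.matFree x) (Metric.closedBall x₀ r) := by
    intro x hx
    have hx' := hball hx
    refine ContinuousAt.continuousWithinAt ?_
    have h1 := continuousAt_matrix_inv (W.continuousAt_mat (hDY hx'.1)) hx'.2
    have h2 := W.continuousAt_matFree (hDY hx'.1)
    have h3 : Continuous fun p : Matrix (Fin m) (Fin m) ℂ × Matrix (Fin m) (Fin n) ℂ => p.1 * p.2 :=
      Continuous.matrix_mul continuous_fst continuous_snd
    exact ContinuousAt.comp (g := fun p : Matrix (Fin m) (Fin m) ℂ × Matrix (Fin m) (Fin n) ℂ =>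
      p.1 * p.2) (f := fun y => ((W.mat y)⁻¹, W.matFree y)) h3.continuousAt (h1.prodMk h2)
  have hN' (i : Fin m) (j : Fin n) : ∃ C, ∀ x ∈ Metric.closedBall x₀ r,
      ‖((W.mat x)⁻¹ * W.matFree x) i j‖ ≤ C :=
    hB.exists_bound_of_continuousOn (continuousOn_pi.1 (continuousOn_pi.1 hN i) j)
  choose C hC using hN'
  have hCp (i : Fin m) : ∀ x ∈ Metric.closedBall x₀ r, ‖colFun J η (W.piv i) x‖
      ≤ (∑ j, C i j) * ‖fun j => colFun J η (W.free j) x‖ := by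
    intro x hx
    rw [W.piv_eq hD hDY hη (hball hx).1 (hball hx).2, Matrix.neg_mulVec, Pi.neg_apply, norm_neg,
      Matrix.mulVec, dotProduct, Finset.sum_mul]
    refine (norm_sum_le _ _).trans (Finset.sum_le_sum fun j _ => ?_)
    rw [norm_mul]
    exact mul_le_mul (hC i j x hx) (norm_le_pi_norm (fun j => colFun J η (W.free j) x) j)
      (norm_nonneg _) ((norm_nonneg _).trans (hC i j x hx))
  have hall (c : Col) (hc : c ∈ allCols J.length K) : ∃ A, 0 ≤ A ∧ ∀ x ∈ Metric.closedBall x₀ r,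
      ‖colFun J η c x‖ ≤ A * ‖fun j => colFun J η (W.free j) x‖ := by
    rw [← W.perm.mem_iff, List.mem_append, List.mem_ofFn', List.mem_ofFn'] at hc
    rcases hc with ⟨i, rfl⟩ | ⟨i, rfl⟩
    · refine ⟨|∑ j, C i j|, abs_nonneg _, fun x hx => (hCp i x hx).trans ?_⟩
      exact mul_le_mul_of_nonneg_right (le_abs_self _) (norm_nonneg _)
    · exact ⟨1, zero_le_one, fun x _ => by
        rw [one_mul]; exact norm_le_pi_norm (fun j => colFun J η (W.free j) x) i⟩
  choose! A hA0 hA using hall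
  have hE (f : Fol) (s : Fin 3) : ∃ E, ∀ x ∈ Metric.closedBall x₀ r, ‖dlogU f s x‖ ≤ E :=
    hB.exists_bound_of_continuousOn fun x hx =>
      (analyticOnNhd_dlogU f s x (hDY (hball hx).1)).continuousAt.continuousWithinAt
  choose E hE using hE
  have hE0 (f s) : 0 ≤ E f s :=
    (norm_nonneg _).trans (hE f s x₀ (Metric.mem_closedBall_self hr.le))
  let V : Y5 → Fin n → ℂ := fun x j => colFun J η (W.free j) x
  have hbas (f : Fol) (s : Fin 2) := isBas_coef hD hDY hη f s
  have hderiv (i : Fin n) (x : Y5) (hx : x ∈ D) (u : Y5) :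
      fderiv ℂ (colFun J η (W.free i)) x u =
      colFun J η ((W.free i).1, (W.free i).2.1, (W.free i).2.2.1 + 1, (W.free i).2.2.2) x
        * dlogU (J.getD (W.free i).1 (0, 1)) 0 x u
      + colFun J η ((W.free i).1, (W.free i).2.1, (W.free i).2.2.1, (W.free i).2.2.2 + 1) x
        * dlogU (J.getD (W.free i).1 (0, 1)) 1 x u :=
    fderiv_jet hD hDY (hbas _ _) _ _ hx u
  have hdiff (i : Fin n) (x : Y5) (hx : x ∈ D) :
      DifferentiableAt ℂ (colFun J η (W.free i)) x :=
    ((isBas_jet hD hDY (hbas _ _) _ _).1 x hx).differentiableAt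
  have hfree (i : Fin n) : W.free i ∈ allCols J.length K := by
    rw [← W.perm.mem_iff, List.mem_append, List.mem_ofFn', List.mem_ofFn']
    exact Or.inr ⟨i, rfl⟩
  have hmem (i : Fin n) (a b : ℕ) (hab : a + b ≤ K) :
      ((W.free i).1, (W.free i).2.1, a, b) ∈ allCols J.length K := by
    have := mem_allCols.1 (hfree i)
    exact mem_allCols.2 ⟨this.1, this.2.1, hab⟩
  have hV := eq_zero_of_fderiv_bound (V := V) (x₀ := x₀) (r := r)
    (C := ∑ i : Fin n, (A ((W.free i).1, (W.free i).2.1, (W.free i).2.2.1 + 1, (W.free i).2.2.2)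
        * E (J.getD (W.free i).1 (0, 1)) 0
      + A ((W.free i).1, (W.free i).2.1, (W.free i).2.2.1, (W.free i).2.2.2 + 1)
        * E (J.getD (W.free i).1 (0, 1)) 1))
    (fun x hx => differentiableAt_pi.2 fun i => hdiff i x (hball (Metric.ball_subset_closedBall hx)).1)
    (fun x hx u => by
      have hx' := Metric.ball_subset_closedBall hx
      have hxD := (hball hx').1
      have hfd : fderiv ℂ V x u = fun i => fderiv ℂ (colFun J η (W.free i)) x u := by
        rw [fderiv_pi fun i => hdiff i x hxD]; rfl
      have hnn (i : Fin n) : 0 ≤ A ((W.free i).1, (W.free i).2.1, (W.free i).2.2.1 + 1,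
          (W.free i).2.2.2) * E (J.getD (W.free i).1 (0, 1)) 0
          + A ((W.free i).1, (W.free i).2.1, (W.free i).2.2.1, (W.free i).2.2.2 + 1)
          * E (J.getD (W.free i).1 (0, 1)) 1 := by
        have o := W.order_free i
        exact add_nonneg (mul_nonneg (hA0 _ (hmem i _ _ (by omega))) (hE0 _ _))
          (mul_nonneg (hA0 _ (hmem i _ _ (by omega))) (hE0 _ _))
      rw [hfd, pi_norm_le_iff_of_nonneg (mul_nonneg (mul_nonneg
        (Finset.sum_nonneg fun i _ => hnn i) (norm_nonneg _)) (norm_nonneg _))]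
      intro i
      have o := W.order_free i
      rw [hderiv i x hxD]
      have b (c : Col) (hc : c ∈ allCols J.length K) (f : Fol) (s : Fin 3) :
          ‖colFun J η c x * dlogU f s x u‖ ≤ A c * E f s * ‖u‖ * ‖V x‖ := by
        rw [norm_mul]
        calc _ ≤ (A c * ‖V x‖) * (E f s * ‖u‖) :=
              mul_le_mul (hA c hc x hx') (((dlogU f s x).le_opNorm u).trans
                (mul_le_mul_of_nonneg_right (hE f s x hx') (norm_nonneg _))) (norm_nonneg _)
                (mul_nonneg (hA0 c hc) (norm_nonneg _))
          _ = _ := by ring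
      refine (norm_add_le _ _).trans ((add_le_add (b _ (hmem i _ _ (by omega)) _ 0)
        (b _ (hmem i _ _ (by omega)) _ 1)).trans ?_)
      rw [← add_mul, ← add_mul]
      exact mul_le_mul_of_nonneg_right (mul_le_mul_of_nonneg_right
        (Finset.single_le_sum (fun i _ => hnn i) (Finset.mem_univ i)) (norm_nonneg _))
        (norm_nonneg _))
    (funext h0)
  filter_upwards [Metric.ball_mem_nhds x₀ hr] with x hx c hc
  have := hA c hc x (Metric.ball_subset_closedBall hx)
  rw [show (fun j => colFun J η (W.free j) x) = 0 from hV x hx, norm_zero, mul_zero] at this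
  exact norm_le_zero_iff.1 this

end WordData

theorem coef_add {η η' : Tuple 1} (f : Fol) (s : Fin 2) :
    coef (η + η') f s = coef η f s + coef η' f s := by
  ext x
  fin_cases s <;>
  · simp only [coef, co, cov_apply, Pi.add_apply, ContinuousAlternatingMap.add_apply]
    simp
    ring

theorem coef_smul (z : ℂ) (η : Tuple 1) (f : Fol) (s : Fin 2) :
    coef (z • η) f s = z • coef η f s := by
  ext x
  fin_cases s <;>
  · simp only [coef, co, cov_apply, Pi.smul_apply, ContinuousAlternatingMap.smul_apply]
    simp
    ring

theorem theta_add {f : Fol} {D : Set Y5} {h h' : Y5 → ℂ} (hh : AnalyticOnNhd ℂ h D)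
    (hh' : AnalyticOnNhd ℂ h' D) (m : Fin 2) :
    Set.EqOn (theta f m (h + h')) (theta f m h + theta f m h') D := fun x hx => by
  have : fderiv ℂ (h + h') x = fderiv ℂ h x + fderiv ℂ h' x :=
    fderiv_add (hh x hx).differentiableAt (hh' x hx).differentiableAt
  fin_cases m <;>
  · simp only [theta, co, this, Pi.add_apply]
    simp
    ring

theorem theta_smul {f : Fol} {D : Set Y5} (z : ℂ) {h : Y5 → ℂ} (hh : AnalyticOnNhd ℂ h D)
    (m : Fin 2) : Set.EqOn (theta f m (z • h)) (z • theta f m h) D := fun x hx => by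
  have : fderiv ℂ (z • h) x = z • fderiv ℂ h x := fderiv_const_smul (hh x hx).differentiableAt z
  fin_cases m <;>
  · simp only [theta, co, this, Pi.smul_apply]
    simp
    ring

section
variable {f : Fol} {D : Set Y5} (hD : IsOpen D) (hDY : D ⊆ Ystar)
include hD hDY

theorem jet_add {h h' : Y5 → ℂ} (hh : IsBas f D h) (hh' : IsBas f D h') (a b : ℕ) :
    Set.EqOn (jet f (h + h') a b) (jet f h a b + jet f h' a b) D := by
  have h1 (b : ℕ) : Set.EqOn (jet f (h + h') 0 b) (jet f h 0 b + jet f h' 0 b) D := by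
    induction b with
    | zero => exact fun x _ => rfl
    | succ b ih =>
      simp only [jet, Function.iterate_succ_apply'] at ih ⊢
      exact (theta_congr hD 1 ih).trans
        (theta_add (isBas_jet hD hDY hh 0 b).1 (isBas_jet hD hDY hh' 0 b).1 1)
  induction a with
  | zero => exact h1 b
  | succ a ih =>
    simp only [jet, Function.iterate_succ_apply'] at ih ⊢
    exact (theta_congr hD 0 ih).trans
      (theta_add (isBas_jet hD hDY hh a b).1 (isBas_jet hD hDY hh' a b).1 0)

theorem jet_smul (z : ℂ) {h : Y5 → ℂ} (hh : IsBas f D h) (a b : ℕ) :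
    Set.EqOn (jet f (z • h) a b) (z • jet f h a b) D := by
  have h1 (b : ℕ) : Set.EqOn (jet f (z • h) 0 b) (z • jet f h 0 b) D := by
    induction b with
    | zero => exact fun x _ => rfl
    | succ b ih =>
      simp only [jet, Function.iterate_succ_apply'] at ih ⊢
      exact (theta_congr hD 1 ih).trans (theta_smul z (isBas_jet hD hDY hh 0 b).1 1)
  induction a with
  | zero => exact h1 b
  | succ a ih =>
    simp only [jet, Function.iterate_succ_apply'] at ih ⊢
    exact (theta_congr hD 0 ih).trans (theta_smul z (isBas_jet hD hDY hh a b).1 0)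

end

/-- Bound of the rank: if the matrix of the pivot columns is invertible at some point, the abelian
relations are determined, up to those of the complementary subweb, by their derivatives in the free
columns at that point. -/
theorem WordData.rank_le {I : Finset Fol} {J : List Fol} {K m n : ℕ} (W : WordData I J K m n)
    {D : Set Y5} (hD : IsOpen D) (hc : IsPreconnected D) (hDY : D ⊆ Ystar)
    (hx : ∃ x ∈ D, (W.mat x).det ≠ 0) :
    Module.rank ℂ (AR 1 D I) ≤ n + Module.rank ℂ (AR 1 D (I \ J.toFinset)) := by
  obtain ⟨x₀, hx₀, hdet⟩ := hx
  let Φ : AR 1 D I →ₗ[ℂ] (Fin n → ℂ) :=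
    { toFun := fun η i => colFun J η.1 (W.free i) x₀
      map_add' := fun η η' => by
        ext i
        simp only [colFun, Submodule.coe_add]
        rw [coef_add]
        exact jet_add hD hDY (isBas_coef hD hDY η.2 _ _) (isBas_coef hD hDY η'.2 _ _) _ _ hx₀
      map_smul' := fun z η => by
        ext i
        simp only [colFun, Submodule.coe_smul]
        rw [coef_smul]
        exact jet_smul hD hDY z (isBas_coef hD hDY η.2 _ _) _ _ hx₀ }
  have hker (η : AR 1 D I) (h : Φ η = 0) : η.1 ∈ AR 1 D (I \ J.toFinset) := by
    obtain ⟨η, hη⟩ := η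
    refine ⟨hη.1, hη.2.1, fun f hf => ?_, hη.2.2.2⟩
    by_cases hI : f ∈ I
    swap
    · exact hη.2.2.1 f hI
    have hfJ : f ∈ J := by simpa [hI] using hf
    obtain ⟨i, hi, rfl⟩ := List.mem_iff_getElem.1 hfJ
    have hz := W.eventually_eq_zero hD hDY hη hx₀ hdet (congrFun h)
    have hz' : ∀ᶠ x in nhds x₀, η J[i] x = 0 := by
      have hK (s : ℕ) (hs : s < 2) : (i, s, 0, 0) ∈ allCols J.length K :=
        mem_allCols.2 ⟨hi, hs, Nat.zero_le _⟩
      have hJ : J.getD i (0, 1) = J[i] := List.getD_eq_getElem _ _ hi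
      filter_upwards [hz, hD.mem_nhds hx₀] with x hx hxD
      have e0 : coef η J[i] 0 x = 0 := by
        have := hx _ (hK 0 (by norm_num)); rwa [colFun, hJ] at this
      have e1 : coef η J[i] 1 x = 0 := by
        have := hx _ (hK 1 (by norm_num)); rwa [colFun, hJ] at this
      ext v
      have := apply_eq_coef hDY hη J[i] hxD (v 0)
      rw [e0, e1] at this
      have hv : v = ![v 0] := by ext j; fin_cases j; rfl
      rw [hv, this]
      simp
    have hall := (hη.1 J[i]).eqOn_zero_of_preconnected_of_eventuallyEq_zero hc hx₀ hz'
    ext x : 1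
    by_cases hxD : x ∈ D
    · exact hall hxD
    · exact hη.2.1 _ x hxD
  have h1 := LinearMap.rank_range_add_rank_ker (R := ℂ) (M := AR 1 D I) (M₁ := Fin n → ℂ) Φ
  rw [← h1]
  refine add_le_add ?_ ?_
  · refine (Submodule.rank_le _).trans ?_
    simp
  · let ι : LinearMap.ker Φ →ₗ[ℂ] AR 1 D (I \ J.toFinset) :=
      { toFun := fun η => ⟨η.1.1, hker η.1 η.2⟩
        map_add' := fun _ _ => rfl
        map_smul' := fun _ _ => rfl }
    refine LinearMap.rank_le_of_injective ι fun a b hab => ?_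
    exact Subtype.ext (Subtype.ext (congrArg (fun z : AR 1 D (I \ J.toFinset) => z.1) hab))

end

/-! ### Connectedness of `Y₅*` -/

/-- The complex line through two points of `Y₅*` meets `Y₅*` in the complement of a finite set. -/
theorem isPreconnected_Ystar : IsPreconnected Ystar := by
  refine isPreconnected_of_forall_pair fun a ha b hb => ?_
  let y : Fin 5 → Polynomial ℂ := fun i =>
    Polynomial.C (a i) + Polynomial.X * Polynomial.C (b i - a i)
  let γ : ℂ → Y5 := fun t => a + t • (b - a)
  have hy (t : ℂ) (i : Fin 5) : (y i).eval t = γ t i := by simp [y, γ]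
  have hP (t : ℂ) (k : Fin 5) : (polP y k).eval t = polP (γ t) k := by
    simp only [polP, Polynomial.eval_sub, Polynomial.eval_add, Polynomial.eval_mul,
      Polynomial.eval_one, hy]
  have hγ0 : γ 0 = a := by simp [γ]
  have hγ1 : γ 1 = b := by simp [γ]
  let S : Set ℂ := (⋃ i, {t | (y i).IsRoot t}) ∪ ⋃ k, {t | (polP y k).IsRoot t}
  have hS : S.Countable := by
    refine (Set.Finite.union (Set.finite_iUnion fun i => ?_) (Set.finite_iUnion fun k => ?_)).countable
    · refine Polynomial.finite_setOfPred_isRoot fun h => coord_ne_zero ha i ?_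
      rw [← hγ0, ← hy, h, Polynomial.eval_zero]
    · refine Polynomial.finite_setOfPred_isRoot fun h => polP_ne_zero ha k ?_
      rw [← hγ0, ← hP, h, Polynomial.eval_zero]
  have hmem (t : ℂ) : t ∈ Sᶜ ↔ γ t ∈ Ystar := by
    simp only [S, Set.mem_compl_iff, Set.mem_union, Set.mem_iUnion, Set.mem_ofPred_eq,
      Polynomial.IsRoot, hy, hP, not_or, not_exists]
    constructor
    · rintro ⟨h1, h2⟩ k
      refine Fin.addCases (m := 5) (n := 5) (motive := fun k => zeta k (γ t) ≠ 0) (fun i => ?_)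
        (fun i => ?_) k
      · rw [zeta_castAdd]; exact h1 i
      · rw [zeta_natAdd]; exact h2 i
    · exact fun h => ⟨coord_ne_zero h, polP_ne_zero h⟩
  refine ⟨γ '' Sᶜ, ?_, ⟨0, (hmem 0).2 (by rwa [hγ0]), hγ0⟩, ⟨1, (hmem 1).2 (by rwa [hγ1]), hγ1⟩, ?_⟩
  · rintro _ ⟨t, ht, rfl⟩
    exact (hmem t).1 ht
  · refine IsPreconnected.image ?_ γ (by fun_prop)
    exact (hS.isConnected_compl_of_one_lt_rank (by simp)).isPreconnected

/-- A function analytic on `Y₅*` and not zero at some point is not zero on any nonempty open set. -/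
theorem exists_ne_zero {F : Y5 → ℂ} (hF : AnalyticOnNhd ℂ F Ystar) {y : Y5} (hy : y ∈ Ystar)
    (h : F y ≠ 0) {D : Set Y5} (hD : IsOpen D) (hne : D.Nonempty) (hDY : D ⊆ Ystar) :
    ∃ x ∈ D, F x ≠ 0 := by
  by_contra! hx
  obtain ⟨x, hxD⟩ := hne
  exact h (hF.eqOn_zero_of_preconnected_of_eventuallyEq_zero isPreconnected_Ystar (hDY hxD)
    (Filter.eventuallyEq_of_mem (hD.mem_nhds hxD) hx) hy)

/-! ### Invertibility modulo a prime -/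

/-- A list of natural numbers packed into a single one, in base `B`. -/
def pack (B : ℕ) : List ℕ → ℕ
  | [] => 0
  | a :: l => a + B * pack B l

/-- Looks for a packed row whose first entry is not zero modulo `q`. -/
def findPivot (q B : ℕ) : List ℕ → Option (ℕ × List ℕ)
  | [] => none
  | r :: M => match Nat.beq (Nat.mod (Nat.mod r B) q) 0 with
    | false => some (r, M)
    | true => match findPivot q B M with
      | none => none
      | some (p, M') => some (p, r :: M')

/-- Gaussian elimination modulo `q` on packed rows; the entries are not reduced, `B` being large
enough for avoiding carries. -/
def elim (q B : ℕ) : ℕ → List ℕ → Bool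
  | 0, _ => true
  | n + 1, M => match findPivot q B M with
    | none => false
    | some (p, M') =>
      let h := Nat.mod (Nat.mod p B) q
      let p' := Nat.div p B
      elim q B n (M'.map fun r => Nat.add (Nat.mul (Nat.div r B) h)
        (Nat.mul (Nat.sub q (Nat.mod (Nat.mod r B) q)) p'))

/-- Dot product of a row with a vector modulo `q`. -/
def dotMod (q : ℕ) : List ℕ → List (ZMod q) → ZMod q
  | a :: l, b :: m => a * b + dotMod q l m
  | _, _ => 0

theorem findPivot_spec {q B : ℕ} {M M' : List ℕ} {p : ℕ} (h : findPivot q B M = some (p, M')) :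
    p % B % q ≠ 0 ∧ ∀ r, r ∈ M ↔ r = p ∨ r ∈ M' := by
  induction M generalizing p M' with
  | nil => simp [findPivot] at h
  | cons r M ih =>
    rw [findPivot] at h
    split at h
    · rename_i hb
      simp only [Option.some.injEq, Prod.mk.injEq] at h
      obtain ⟨rfl, rfl⟩ := h
      exact ⟨Nat.ne_of_beq_eq_false hb, fun r => List.mem_cons⟩
    · split at h
      · simp at h
      · rename_i heq
        simp only [Option.some.injEq, Prod.mk.injEq] at h
        obtain ⟨rfl, rfl⟩ := h
        obtain ⟨h1, h2⟩ := ih heq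
        refine ⟨h1, fun x => ?_⟩
        rw [List.mem_cons, List.mem_cons, h2]
        tauto

theorem pack_comb (B a c : ℕ) (l m : List ℕ) (h : l.length = m.length) :
    pack B l * a + c * pack B m = pack B (List.zipWith (fun x y => x * a + c * y) l m) := by
  induction l generalizing m with
  | nil =>
    cases m with
    | nil => simp [pack]
    | cons => simp at h
  | cons x l ih =>
    cases m with
    | nil => simp at h
    | cons y m =>
      rw [List.zipWith_cons_cons, pack, pack, pack, ← ih m (by simpa using h)]
      ring

theorem dotMod_comb {q : ℕ} (a c : ℕ) (l m : List ℕ) (h : l.length = m.length)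
    (v : List (ZMod q)) : dotMod q (List.zipWith (fun x y => x * a + c * y) l m) v
      = a * dotMod q l v + c * dotMod q m v := by
  induction l generalizing m v with
  | nil =>
    cases m with
    | nil => simp [dotMod]
    | cons => simp at h
  | cons x l ih =>
    cases m with
    | nil => simp at h
    | cons y m =>
      cases v with
      | nil => simp [dotMod]
      | cons b v =>
        rw [List.zipWith_cons_cons, dotMod, dotMod, dotMod, ih m (by simpa using h)]
        push_cast
        ring

theorem dotMod_eq_zero {q : ℕ} (l : List ℕ) (v : List (ZMod q)) (h : ∀ c ∈ v, c = 0) :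
    dotMod q l v = 0 := by
  induction l generalizing v with
  | nil => simp [dotMod]
  | cons y l ih =>
    cases v with
    | nil => simp [dotMod]
    | cons z v => rw [dotMod, h z (by simp), ih v fun c hc => h c (by simp [hc])]; simp

/-- A packed row is orthogonal to the vector `v`. -/
def OrthRow (q B b : ℕ) (v : List (ZMod q)) (r : ℕ) : Prop :=
  ∃ l : List ℕ, l.length = v.length ∧ (∀ a ∈ l, a < b) ∧ r = pack B l ∧ dotMod q l v = 0

/-- If the elimination succeeds, the rows span the dual space: a vector orthogonal to them is zero.
The entries are multiplied by at most `2 q` at each step, whence the condition on `B`. -/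
theorem elim_spec {q B : ℕ} [hq : Fact q.Prime] (n b : ℕ) (hb : b * (2 * q) ^ n ≤ B) (hb0 : b ≠ 0)
    (M : List ℕ) (hM : elim q B n M = true) (v : List (ZMod q)) (hv : v.length = n)
    (h : ∀ r ∈ M, OrthRow q B b v r) : ∀ a ∈ v, a = 0 := by
  have hq0 : 0 < q := hq.out.pos
  induction n generalizing b M v with
  | zero => rw [List.length_eq_zero_iff.1 hv]; simp
  | succ n ih =>
    obtain ⟨x, v, rfl⟩ : ∃ x w, v = x :: w := List.exists_cons_of_length_eq_add_one hv
    rw [elim] at hM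
    split at hM
    · simp at hM
    rename_i p M' hp
    obtain ⟨hp0, hmem⟩ := findPivot_spec hp
    have hbB : b ≤ B := le_trans (Nat.le_mul_of_pos_right b (by positivity)) hb
    have hB : 0 < B := lt_of_lt_of_le (Nat.pos_of_ne_zero hb0) hbB
    have hsplit (r : ℕ) (hr : r ∈ M) : ∃ (a : ℕ) (l : List ℕ), l.length = v.length ∧
        (∀ c ∈ l, c < b) ∧ r % B = a ∧ r / B = pack B l ∧ (a : ZMod q) * x + dotMod q l v = 0 := by
      obtain ⟨l, h1, h2, h3, h4⟩ := h r hr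
      obtain ⟨a, l, rfl⟩ : ∃ a m, l = a :: m := List.exists_cons_of_length_eq_add_one h1
      have ha : a < B := lt_of_lt_of_le (h2 a (by simp)) hbB
      refine ⟨a, l, by simpa using h1, fun c hc => h2 c (by simp [hc]), ?_, ?_, h4⟩
      · rw [h3, pack, Nat.add_mul_mod_self_left, Nat.mod_eq_of_lt ha]
      · rw [h3, pack, Nat.add_mul_div_left _ _ hB, Nat.div_eq_of_lt ha, zero_add]
    obtain ⟨a, l, hl, hlb, hpa, hpl, hpx⟩ := hsplit p ((hmem p).2 (Or.inl rfl))
    have hcast (c : ℕ) : ((c % q : ℕ) : ZMod q) = c := ZMod.natCast_mod c q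
    have hrest : ∀ c ∈ v, c = 0 := by
      refine ih (b * (2 * q)) (by rw [pow_succ] at hb; linarith [hb]) (by positivity) _ hM v
        (by simpa using hv) fun r' hr' => ?_
      obtain ⟨r, hr, rfl⟩ := List.mem_map.1 hr'
      obtain ⟨c, m, hm, hmb, hrc, hrm, hrx⟩ := hsplit r ((hmem r).2 (Or.inr hr))
      refine ⟨List.zipWith (fun x y => x * (a % q) + (q - c % q) * y) m l, ?_, ?_, ?_, ?_⟩
      · simp [hm, hl]
      · intro z hz
        obtain ⟨i, hi, rfl⟩ := List.mem_iff_getElem.1 hz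
        rw [List.getElem_zipWith]
        have i1 := hmb _ (List.getElem_mem (l := m) (n := i) (by simp at hi; omega))
        have i2 := hlb _ (List.getElem_mem (l := l) (n := i) (by simp at hi; omega))
        have i3 := Nat.mod_lt a hq0
        have i4 : q - c % q ≤ q := Nat.sub_le _ _
        calc _ < b * q + q * b :=
              add_lt_add_of_lt_of_le (Nat.mul_lt_mul'' i1 i3) (Nat.mul_le_mul i4 i2.le)
          _ = b * (2 * q) := by ring
      · rw [← pack_comb _ _ _ _ _ (hm.trans hl.symm), ← hpl, ← hrm, ← hpa, ← hrc]
        rfl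
      · rw [dotMod_comb _ _ _ _ (hm.trans hl.symm), hcast, Nat.cast_sub (Nat.mod_lt c hq0).le,
          hcast, ZMod.natCast_self]
        linear_combination (a : ZMod q) * hrx - (c : ZMod q) * hpx
    have hv0 : dotMod q l v = 0 := dotMod_eq_zero l v hrest
    have hax : (a : ZMod q) ≠ 0 := by
      rw [← hcast, ← hpa]
      rw [Ne, ZMod.natCast_eq_zero_iff]
      intro hd
      exact hp0 (Nat.eq_zero_of_dvd_of_lt hd (Nat.mod_lt _ hq0))
    intro c hc
    rcases List.mem_cons.1 hc with rfl | hc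
    · rw [hv0, add_zero] at hpx
      exact (mul_eq_zero.1 hpx).resolve_left hax
    · exact hrest c hc

/-- The operations on natural numbers seen as representatives modulo `q`. -/
def natOps (q : ℕ) : Ops ℕ := ⟨Nat.add, Nat.mul, fun z => (z % (q : ℤ)).toNat⟩

theorem opsHom_natCast (q : ℕ) [hq : Fact q.Prime] :
    OpsHom (natOps q) (ringOps (ZMod q)) (Nat.cast : ℕ → ZMod q) where
  add := Nat.cast_add
  mul := Nat.cast_mul
  sc n := by
    have h : ((n % (q : ℤ)).toNat : ℤ) = n % (q : ℤ) :=
      Int.toNat_of_nonneg (Int.emod_nonneg _ (by exact_mod_cast hq.out.ne_zero))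
    have h2 : (((n % (q : ℤ)).toNat : ℤ) : ZMod q) = n := by rw [h, ZMod.intCast_mod]
    rw [Int.cast_natCast] at h2
    exact h2

/-- The base point `(2, 3, 5, 7, 11)`. -/
def basePt : Y5 := ![2, 3, 5, 7, 11]

/-- The values at the base point of the `α_k` and `β_k`, multiplied by `1410`. -/
def abInt : List (ℤ × ℤ) :=
  [(-210, -1650), (-94, -1551), (-470, -1974), (-7755, -9870), (-705, -2350)]

/-- The values at the base point of the `α_k` and `β_k`, modulo `10007`. -/
def abMod : List (ℕ × ℕ) :=
  [(2129, 9580), (5337, 3001), (6671, 2000), (4998, 10000), (5003, 3334)]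

theorem basePt_mem : basePt ∈ Ystar := by
  intro k
  fin_cases k <;> simp [zeta, basePt] <;> norm_num

theorem abVal_basePt : abVal basePt = abInt.map fun p => ((p.1 : ℂ) / 1410, (p.2 : ℂ) / 1410) := by
  simp [abVal, abInt, List.finRange_succ, al, be, polP, aI, bI, bJ, basePt]
  norm_num

instance : Fact (Nat.Prime 10007) := ⟨by norm_num⟩

theorem abMod_spec : abMod.map (Prod.map (Nat.cast : ℕ → ZMod 10007) Nat.cast)
    = abInt.map fun p => ((p.1 : ZMod 10007) * 1753, (p.2 : ZMod 10007) * 1753) := by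
  decide +kernel

/-- The packed rows, modulo `10007`, of the matrix of the equations at the base point. -/
def packedRows (B : ℕ) (tab : List (List ℤ × List ℤ)) (ws : List (List Dir × Dir))
    (ps : List Col) : List ℕ :=
  ws.map fun p =>
    let R := tab.map fun n => rowF (natOps 10007) abMod n p.1 p.2
    pack B (ps.map fun c => Nat.mod (look 0 R c) 10007)

theorem WordData.det_ne_zero {I : Finset Fol} {J : List Fol} {K m n : ℕ} (W : WordData I J K m n)
    {ws : List (List Dir × Dir)} {ps : List Col} {tab : List (List ℤ × List ℤ)} {B : ℕ}
    (hps : List.ofFn W.piv = ps) (htab : expoLists J = tab)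
    (hB : 10007 * (2 * 10007) ^ m ≤ B) (h : elim 10007 B m (packedRows B tab ws ps) = true)
    (hsub : ∀ p ∈ ws, ∃ i, W.word i = p) : (W.mat basePt).det ≠ 0 := by
  let Mq : Matrix (Fin m) (Fin m) (ZMod 10007) := Matrix.of fun i j =>
    ((look 0 ((expoLists J).map fun n => rowF (natOps 10007) abMod n (W.word i).1 (W.word i).2)
      (W.piv j) : ℕ) : ZMod 10007)
  have hMq : Mq.det ≠ 0 := by
    intro hdet
    obtain ⟨v, hv0, hv⟩ := Matrix.exists_mulVec_eq_zero_iff.2 hdet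
    apply hv0
    have key := elim_spec (q := 10007) m 10007 hB (by norm_num) _ h (List.ofFn v) (by simp) ?_
    · ext i; exact key (v i) (by simp)
    intro r hr
    obtain ⟨p, hp, rfl⟩ := List.mem_map.1 hr
    obtain ⟨i, rfl⟩ := hsub p hp
    refine ⟨_, ?_, ?_, rfl, ?_⟩
    · rw [← hps]; simp
    · intro a ha
      obtain ⟨c, -, rfl⟩ := List.mem_map.1 ha
      exact Nat.mod_lt _ (by norm_num)
    · have hdot : ∀ (k : ℕ) (f : Fin k → ℕ) (w : Fin k → ZMod 10007),
          dotMod 10007 (List.ofFn f) (List.ofFn w) = ∑ j, (f j : ZMod 10007) * w j := by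
        intro k
        induction k with
        | zero => intro f w; simp [dotMod]
        | succ k ih => intro f w; rw [List.ofFn_succ, List.ofFn_succ, dotMod, ih, Fin.sum_univ_succ]
      have hvi : ∑ j, Mq i j * v j = 0 := congrFun hv i
      rw [← hps, List.map_ofFn, hdot, ← hvi]
      refine Finset.sum_congr rfl fun j _ => ?_
      congr 1
      change ((_ % 10007 : ℕ) : ZMod 10007) = _
      rw [ZMod.natCast_mod, ← htab]
      rfl
  -- the ring of the integers with `1410` inverted maps to `ℂ` and to `ZMod 10007`
  let R := Localization.Away (1410 : ℤ)
  have hC : IsUnit (Int.castRingHom ℂ 1410) := by simp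
  have hZ : IsUnit (Int.castRingHom (ZMod 10007) 1410) :=
    IsUnit.of_mul_eq_one 1753 (by decide +kernel)
  let φ : R →+* ℂ := IsLocalization.Away.lift (1410 : ℤ) hC
  let ψ : R →+* ZMod 10007 := IsLocalization.Away.lift (1410 : ℤ) hZ
  let u : R := IsLocalization.Away.invSelf (1410 : ℤ)
  have hu : (1410 : R) * u = 1 := by
    have := IsLocalization.Away.mul_invSelf (S := R) (1410 : ℤ)
    simpa using this
  have hφu : φ u = 1 / 1410 := by
    have := congrArg φ hu
    rw [map_mul, map_one, map_ofNat] at this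
    field_simp
    linear_combination this
  have hψu : ψ u = 1753 := by
    have := congrArg ψ hu
    rw [map_mul, map_one, map_ofNat] at this
    calc ψ u = (1753 * 1410) * ψ u := by
          rw [show (1753 * 1410 : ZMod 10007) = 1 by decide +kernel, one_mul]
      _ = 1753 := by rw [mul_assoc, this, mul_one]
  let ab : List (R × R) := abInt.map fun p => ((p.1 : R) * u, (p.2 : R) * u)
  have habφ : ab.map (Prod.map φ φ) = abVal basePt := by
    rw [abVal_basePt, List.map_map]
    refine List.map_congr_left fun p _ => ?_
    have hp (z : ℤ) : φ ((z : R) * u) = (z : ℂ) / 1410 := by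
      rw [map_mul, map_intCast, hφu, mul_one_div]
    exact Prod.ext (hp p.1) (hp p.2)
  have habψ : ab.map (Prod.map ψ ψ) = abMod.map (Prod.map (Nat.cast : ℕ → ZMod 10007) Nat.cast) := by
    rw [abMod_spec, List.map_map]
    refine List.map_congr_left fun p _ => ?_
    have hp (z : ℤ) : ψ ((z : R) * u) = (z : ZMod 10007) * 1753 := by
      rw [map_mul, map_intCast, hψu]
    exact Prod.ext (hp p.1) (hp p.2)
  let MR : Matrix (Fin m) (Fin m) R := Matrix.of fun i j =>
    look 0 ((expoLists J).map fun n => rowF (ringOps R) ab n (W.word i).1 (W.word i).2) (W.piv j)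
  have h1 : φ MR.det = (W.mat basePt).det := by
    rw [RingHom.map_det]
    congr 1
    ext i j
    have := map_entry (opsHom_ringHom φ) 0 J ab (W.word i) (W.piv j)
    rw [map_zero, habφ] at this
    exact this
  have h2 : ψ MR.det = Mq.det := by
    rw [RingHom.map_det]
    congr 1
    ext i j
    have t1 := map_entry (opsHom_ringHom ψ) 0 J ab (W.word i) (W.piv j)
    have t2 := map_entry (opsHom_natCast 10007) 0 J abMod (W.word i) (W.piv j)
    rw [map_zero, habψ] at t1
    rw [Nat.cast_zero] at t2
    exact t1.trans t2.symm
  rw [← h1]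
  intro h0
  apply hMq
  rw [← h2]
  obtain ⟨k, a, ha⟩ := IsLocalization.Away.surj (1410 : ℤ) MR.det
  have e1 := congrArg φ ha
  rw [map_mul, h0, zero_mul] at e1
  have e2 : a = 0 := by
    have : φ (algebraMap ℤ R a) = (a : ℂ) := by simp
    rw [this] at e1
    exact_mod_cast e1.symm
  rw [e2, map_zero] at ha
  have e3 : IsUnit (algebraMap ℤ R 1410 ^ k) :=
    (IsLocalization.Away.algebraMap_isUnit (S := R) (1410 : ℤ)).pow k
  rw [(e3.mul_left_eq_zero).1 ha, map_zero]

/-- The bound of the rank, for a matrix which is invertible modulo `10007` at the base point. -/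
theorem WordData.rank_le_of_elim {I : Finset Fol} {J : List Fol} {K m n : ℕ}
    (W : WordData I J K m n) {ws : List (List Dir × Dir)} {ps : List Col}
    {tab : List (List ℤ × List ℤ)} {B : ℕ} (hps : List.ofFn W.piv = ps) (htab : expoLists J = tab)
    (hB : 10007 * (2 * 10007) ^ m ≤ B) (h : elim 10007 B m (packedRows B tab ws ps) = true)
    (hsub : ∀ p ∈ ws, ∃ i, W.word i = p) {D : Set Y5} (hD : IsOpen D) (hc : IsConnected D)
    (hDY : D ⊆ Ystar) :
    Module.rank ℂ (AR 1 D I) ≤ n + Module.rank ℂ (AR 1 D (I \ J.toFinset)) := by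
  refine W.rank_le hD hc.isPreconnected hDY ?_
  refine exists_ne_zero (F := fun x => (W.mat x).det) ?_ basePt_mem
    (W.det_ne_zero hps htab hB h hsub) hD hc.nonempty hDY
  simp only [Matrix.det_apply]
  refine Finset.analyticOnNhd_fun_sum _ fun σ _ => ?_
  have := Finset.analyticOnNhd_fun_prod Finset.univ fun i (_ : i ∈ Finset.univ) =>
    analyticOnNhd_entry J (W.word (σ i)) (W.piv i)
  exact (analyticOnNhd_const (v := ((Equiv.Perm.sign σ : ℤ) : ℂ))).mul this |>.congr isOpen_Ystar
    fun x _ => by simp [WordData.mat, Units.smul_def]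

/-! ### The bounds `r¹(W) ≤ 35` and `r¹(W⁺) ≤ 6` -/

/-- The directions of the coordinate vector fields. -/
def units : List Dir :=
  [⟨1, 0, 0, 0, 0⟩, ⟨0, 1, 0, 0, 0⟩, ⟨0, 0, 1, 0, 0⟩, ⟨0, 0, 0, 1, 0⟩, ⟨0, 0, 0, 0, 1⟩]

/-- Words for the subweb of the five foliations `(i, 1)`; the relation contracted with a member of
the second list is differentiated along the first one. With them, the minor of the columns
`pivCols 2 plusFree` is invertible at `basePt`. -/
def plusProg : List (List Dir × List Dir) := [
  ([⟨1, 0, 0, 0, 0⟩, ⟨1, 0, 0, 0, 0⟩], units),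
  ([⟨1, 0, 0, 0, 0⟩, ⟨0, 1, 0, 0, 0⟩], [⟨1, 0, 0, 0, 0⟩, ⟨0, 1, 0, 0, 0⟩, ⟨0, 0, 1, 0, 0⟩, ⟨0, 0, 0, 0, 1⟩]),
  ([⟨1, 0, 0, 0, 0⟩, ⟨0, 0, 1, 0, 0⟩], [⟨0, 1, 0, 0, 0⟩]),
  ([⟨1, 0, 0, 0, 0⟩, ⟨0, 0, 0, 0, 1⟩], [⟨1, 0, 0, 0, 0⟩, ⟨0, 0, 0, 0, 1⟩]),
  ([⟨0, 1, 0, 0, 0⟩, ⟨0, 1, 0, 0, 0⟩], units),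
  ([⟨0, 1, 0, 0, 0⟩, ⟨0, 0, 1, 0, 0⟩], [⟨0, 1, 0, 0, 0⟩, ⟨0, 0, 1, 0, 0⟩]),
  ([⟨0, 1, 0, 0, 0⟩, ⟨0, 0, 0, 1, 0⟩], [⟨0, 0, 1, 0, 0⟩]),
  ([⟨0, 0, 1, 0, 0⟩, ⟨0, 0, 1, 0, 0⟩], [⟨0, 1, 0, 0, 0⟩, ⟨0, 0, 1, 0, 0⟩, ⟨0, 0, 0, 1, 0⟩, ⟨0, 0, 0, 0, 1⟩]),
  ([⟨0, 0, 1, 0, 0⟩, ⟨0, 0, 0, 1, 0⟩], [⟨0, 0, 1, 0, 0⟩, ⟨0, 0, 0, 1, 0⟩]),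
  ([⟨0, 0, 0, 1, 0⟩, ⟨0, 0, 0, 1, 0⟩], [⟨0, 0, 1, 0, 0⟩, ⟨0, 0, 0, 1, 0⟩]),
  ([⟨0, 0, 0, 0, 1⟩, ⟨0, 0, 0, 0, 1⟩], [⟨1, 0, 0, 0, 0⟩, ⟨0, 0, 0, 0, 1⟩]),
  ([⟨1, 0, 0, 0, 0⟩], units),
  ([⟨0, 1, 0, 0, 0⟩], units),
  ([⟨0, 0, 1, 0, 0⟩], [⟨0, 1, 0, 0, 0⟩, ⟨0, 0, 1, 0, 0⟩, ⟨0, 0, 0, 1, 0⟩, ⟨0, 0, 0, 0, 1⟩]),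
  ([⟨0, 0, 0, 1, 0⟩], [⟨0, 0, 1, 0, 0⟩, ⟨0, 0, 0, 1, 0⟩, ⟨0, 0, 0, 0, 1⟩]),
  ([⟨0, 0, 0, 0, 1⟩], [⟨1, 0, 0, 0, 0⟩, ⟨0, 0, 0, 0, 1⟩]),
  ([], units)]

/-- Words killing the five components `(i, 1)`: each of these foliations is tangent to one of the
vector fields of the word. The minor of the columns `pivCols 4 starFree` is invertible at `basePt`. -/
def starProg : List (List Dir × List Dir) := [
  ([⟨1, 0, -1, 0, 1⟩, ⟨0, 0, 1, 0, 0⟩, ⟨1, 0, 0, 0, 0⟩, ⟨0, 1, 0, 0, 0⟩], units),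
  ([⟨0, 1, 0, 0, 0⟩, ⟨0, 0, 0, 1, 0⟩, ⟨1, 0, 0, 0, 0⟩, ⟨0, 1, 0, 0, 0⟩], units),
  ([⟨0, 1, 1, 0, -1⟩, ⟨0, 0, 0, 0, 1⟩, ⟨0, 0, 1, 0, 0⟩, ⟨1, 0, 0, 0, 0⟩], units),
  ([⟨0, 0, 1, 0, 0⟩, ⟨0, 0, 0, 0, 1⟩, ⟨0, 0, 1, 0, -1⟩, ⟨0, 0, 0, 1, 0⟩], units),
  ([⟨1, 0, -1, 0, 1⟩, ⟨0, 0, 1, 0, 0⟩, ⟨0, 1, 0, -1, 0⟩, ⟨0, 0, 0, 0, 1⟩], units),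
  ([⟨1, 0, -1, 0, 1⟩, ⟨0, 1, 0, -1, -1⟩, ⟨0, 1, 0, 0, 0⟩, ⟨0, 0, 0, 0, 1⟩], units),
  ([⟨1, 0, 0, 0, 0⟩, ⟨0, 0, 1, 0, 0⟩, ⟨0, 0, 0, 1, 0⟩, ⟨0, 0, 0, 1, 0⟩], units),
  ([⟨0, 1, 0, 0, 0⟩, ⟨0, 0, 0, 0, 1⟩, ⟨0, 0, 1, 0, 0⟩, ⟨1, 0, 0, 0, 0⟩], units),
  ([⟨0, 1, 1, 0, -1⟩, ⟨1, 0, -1, -1, 0⟩, ⟨0, 0, 0, 0, 1⟩, ⟨0, 1, 0, 0, 0⟩], units),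
  ([⟨0, 1, 1, 0, -1⟩, ⟨1, 0, -1, -1, 0⟩, ⟨1, 0, 0, 0, 0⟩, ⟨0, 1, 0, 0, 0⟩], units),
  ([⟨0, 0, 1, 0, 0⟩, ⟨0, 0, 0, 0, 1⟩, ⟨1, 0, 0, 0, 0⟩, ⟨1, 0, 0, 0, 0⟩], [⟨1, 0, 0, 0, 0⟩, ⟨0, 1, 0, 0, 0⟩]),
  ([⟨0, 1, 0, 0, 0⟩, ⟨0, 0, 0, 1, 0⟩, ⟨0, 1, 0, -1, 0⟩], units),
  ([⟨1, 0, 0, 0, 0⟩, ⟨1, 0, -1, -1, 0⟩, ⟨0, 1, 0, 0, -1⟩], units),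
  ([⟨0, 1, 0, 0, 0⟩, ⟨0, 1, 0, -1, -1⟩, ⟨0, 0, 0, 1, 0⟩], units),
  ([⟨0, 1, 1, 0, -1⟩, ⟨1, 1, 0, -1, 0⟩, ⟨0, 0, 0, 1, 0⟩], units),
  ([⟨1, 0, 0, 0, 0⟩, ⟨0, 0, 1, 0, 0⟩, ⟨1, 0, -1, 0, 0⟩], units),
  ([⟨1, 0, -1, 0, 1⟩, ⟨0, 0, 1, 0, 0⟩, ⟨1, 0, 0, 0, 0⟩], units),
  ([⟨0, 0, 1, 0, 0⟩, ⟨0, 0, 0, 0, 1⟩, ⟨0, 0, 1, 0, -1⟩], units),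
  ([⟨1, 0, -1, 0, 1⟩, ⟨1, 1, 0, -1, 0⟩, ⟨0, 0, 1, 0, 0⟩], units),
  ([⟨0, 1, 0, 0, 0⟩, ⟨0, 0, 0, 0, 1⟩, ⟨0, 0, 1, 0, 0⟩], units),
  ([⟨0, 1, 1, 0, -1⟩, ⟨0, 0, 0, 0, 1⟩, ⟨1, 0, 0, -1, 0⟩], [⟨1, 0, 0, 0, 0⟩, ⟨0, 1, 0, 0, 0⟩, ⟨0, 0, 1, 0, 0⟩]),
  ([⟨0, 1, 0, 0, 0⟩, ⟨0, 1, 0, -1, -1⟩], [⟨1, 0, -1, 0, 0⟩]),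
  ([⟨0, 1, 0, 0, 0⟩, ⟨1, 0, -1, 0, 0⟩], [⟨0, 1, 0, -1, -1⟩]),
  ([⟨0, 1, 0, -1, -1⟩, ⟨1, 0, -1, 0, 0⟩], [⟨0, 1, 0, 0, 0⟩]),
  ([⟨0, 1, 0, 0, 0⟩, ⟨0, 1, 0, -1, -1⟩], [⟨0, 0, 0, 1, 0⟩]),
  ([⟨0, 1, 0, 0, 0⟩, ⟨0, 0, 0, 1, 0⟩], [⟨0, 1, 0, -1, -1⟩]),
  ([⟨0, 1, 0, -1, -1⟩, ⟨0, 0, 0, 1, 0⟩], [⟨0, 1, 0, 0, 0⟩]),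
  ([⟨0, 1, 0, 0, 0⟩, ⟨0, 1, 0, -1, -1⟩], [⟨0, 0, 0, 0, 1⟩]),
  ([⟨0, 1, 0, 0, 0⟩, ⟨0, 0, 0, 0, 1⟩], [⟨0, 1, 0, -1, -1⟩]),
  ([⟨1, 0, 0, 0, 0⟩, ⟨0, 0, 1, 0, 0⟩], [⟨1, 0, -1, 0, 0⟩]),
  ([⟨1, 0, 0, 0, 0⟩, ⟨1, 0, -1, 0, 0⟩], [⟨0, 0, 1, 0, 0⟩]),
  ([⟨1, 0, 0, 0, 0⟩, ⟨0, 0, 1, 0, 0⟩], [⟨0, 0, 0, 1, 0⟩]),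
  ([⟨1, 0, 0, 0, 0⟩, ⟨0, 0, 1, 0, 0⟩], [⟨0, 0, 0, 0, 1⟩]),
  ([⟨0, 1, 1, 0, -1⟩, ⟨1, 1, 0, -1, 0⟩], [⟨1, 0, -1, 0, 0⟩]),
  ([⟨0, 1, 1, 0, -1⟩, ⟨1, 1, 0, -1, 0⟩], [⟨0, 0, 0, 1, 0⟩]),
  ([⟨0, 1, 1, 0, -1⟩, ⟨1, 1, 0, -1, 0⟩], [⟨0, 0, 0, 0, 1⟩]),
  ([⟨1, 0, -1, 0, 1⟩, ⟨0, 1, 0, -1, -1⟩], [⟨1, 0, 0, -1, 0⟩]),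
  ([⟨1, 0, -1, 0, 1⟩, ⟨0, 1, 0, -1, -1⟩], [⟨0, 0, 1, 0, 0⟩]),
  ([⟨1, 0, 0, 0, 0⟩, ⟨0, 0, 0, 1, 0⟩], [⟨1, 0, 0, -1, 0⟩]),
  ([⟨1, 0, 0, 0, 0⟩, ⟨0, 0, 0, 1, 0⟩], [⟨0, 1, 0, 0, 0⟩]),
  ([⟨0, 1, 1, 0, -1⟩, ⟨0, 0, 0, 0, 1⟩], [⟨1, 0, 0, -1, 0⟩]),
  ([⟨1, 0, -1, 0, 1⟩, ⟨0, 0, 1, 0, 0⟩], [⟨0, 1, 0, -1, 0⟩])]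

/-- The words obtained by splitting the entries of a table with a common prefix. -/
def flatProg (P : List (List Dir × List Dir)) : List (List Dir × Dir) :=
  P.flatMap fun p => p.2.map fun w => (p.1, w)

/-- The columns which are not eliminated by `plusProg`. -/
def plusFree : List Col := [(0, 0, 0, 1), (0, 0, 0, 0), (0, 1, 0, 0), (1, 0, 0, 0), (1, 1, 0, 0), (2, 0, 0, 0)]

/-- The columns which are not eliminated by `starProg`. -/
def starFree : List Col :=
  [(0, 0, 1, 1), (0, 0, 0, 2), (1, 0, 1, 1), (1, 0, 0, 2), (2, 0, 0, 2), (0, 0, 1, 0), (0, 0, 0, 1),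
    (0, 1, 1, 0), (0, 1, 0, 1), (1, 0, 1, 0), (1, 0, 0, 1), (1, 1, 1, 0), (1, 1, 0, 1), (2, 0, 1, 0),
    (2, 0, 0, 1), (2, 1, 0, 1), (3, 0, 1, 0), (3, 0, 0, 1), (4, 0, 0, 1), (0, 0, 0, 0), (0, 1, 0, 0),
    (1, 0, 0, 0), (1, 1, 0, 0), (2, 0, 0, 0), (2, 1, 0, 0), (3, 0, 0, 0), (3, 1, 0, 0), (4, 0, 0, 0),
    (4, 1, 0, 0)]

/-- The columns of order at most `K`, by decreasing orders. -/
def sortedCols (K : ℕ) : List Col :=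
  (List.range (K + 1)).reverse.flatMap fun d => (List.range 5).flatMap fun f => [0, 1].flatMap fun s =>
    (List.range (d + 1)).map fun b => (f, s, d - b, b)

/-- The columns of order at most `K` which are not in a given list. -/
def pivCols (K : ℕ) (free : List Col) : List Col :=
  (sortedCols K).filter fun c => !free.contains c

/-- The five foliations with a given sign. -/
def folList (e : ℤˣ) : List Fol := [(0, e), (1, e), (2, e), (3, e), (4, e)]

/-- The exponents of the first integrals of the foliations `(i, 1)`. -/
def plusTab : List (List ℤ × List ℤ) := [
  ([0, 0, 0, 1, 0, 0, 0, 0, 0, 0], [0, 0, 1, 0, 1, 0, 0, 0, 0, 0]),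
  ([-1, 0, 0, 0, 0, 0, 0, 0, 0, 0], [-1, 1, 0, 0, 1, 0, 0, 0, 0, 0]),
  ([0, 0, 1, 0, 0, 0, 0, 0, 0, 0], [0, 1, 0, 1, 0, 0, 0, 0, 0, 0]),
  ([0, 0, 0, 0, -1, 0, 0, 0, 0, 0], [1, 0, 0, 1, -1, 0, 0, 0, 0, 0]),
  ([0, 1, 0, 0, 0, 0, 0, 0, 0, 0], [1, 0, 1, 0, 0, 0, 0, 0, 0, 0])]

/-- The exponents of the first integrals of the foliations `(i, -1)`. -/
def starTab : List (List ℤ × List ℤ) := [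
  ([0, -1, 0, 0, 0, 0, 1, 0, -1, 0], [1, -1, 0, 0, 0, 0, 0, 1, -1, 0]),
  ([0, 0, -1, 0, 0, 1, 0, 0, -1, 0], [0, 0, -1, 0, 0, 0, 0, 1, -1, 0]),
  ([1, 0, 0, 0, 0, 1, 0, 0, -1, 0], [0, 0, 0, 0, 0, 0, 1, 0, -1, 0]),
  ([0, 1, 0, 0, 0, 1, 0, -1, 0, 0], [0, 0, 1, 0, 0, 0, 1, -1, 0, 0]),
  ([0, 0, 0, 0, -1, 1, 0, -1, 0, 0], [0, 0, 0, 1, -1, 0, 1, -1, 0, 0])]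

theorem expoLists_plus : expoLists (folList 1) = plusTab := by decide +kernel

theorem expoLists_star : expoLists (folList (-1)) = starTab := by decide +kernel

theorem ofFn_getD {α : Type} (l : List α) (d : α) {n : ℕ} (h : l.length = n) :
    List.ofFn (fun i : Fin n => l.getD i d) = l := by
  subst h
  have : (fun i : Fin l.length => l.getD i d) = fun i => l.get i := by
    ext i; exact List.getD_eq_getElem _ _ i.2
  rw [this, List.ofFn_get]

/-- The system of equations given by a table of words. -/
def WordData.ofProg {I : Finset Fol} {J : List Fol} {K m n : ℕ} (ws : List (List Dir × Dir))
    (ps fs : List Col) (hm : ws.length = m) (hp : ps.length = m) (hn : fs.length = n)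
    (hJ : J.Nodup) (hK : ∀ p ∈ ws, p.1.length ≤ K)
    (hk : ∀ p ∈ ws, ∀ f ∈ I, f ∈ J ∨ ∃ w ∈ p.2 :: p.1, killsDir f w)
    (hperm : (ps ++ fs).Perm (allCols J.length K)) (ho : ∀ c ∈ fs, c.2.2.1 + c.2.2.2 < K) :
    WordData I J K m n where
  word i := ws.getD i ([], ⟨0, 0, 0, 0, 0⟩)
  piv i := ps.getD i (0, 0, 0, 0)
  free i := fs.getD i (0, 0, 0, 0)
  nodup := hJ
  length_le i := by
    have hi : (i : ℕ) < ws.length := by rw [hm]; exact i.2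
    rw [List.getD_eq_getElem _ _ hi]
    exact hK _ (List.getElem_mem hi)
  kills i := by
    have hi : (i : ℕ) < ws.length := by rw [hm]; exact i.2
    rw [List.getD_eq_getElem _ _ hi]
    exact hk _ (List.getElem_mem hi)
  perm := by rw [ofFn_getD ps _ hp, ofFn_getD fs _ hn]; exact hperm
  order_free i := by
    have hi : (i : ℕ) < fs.length := by rw [hn]; exact i.2
    rw [List.getD_eq_getElem _ _ hi]
    exact ho _ (List.getElem_mem hi)

theorem rank_le_ofProg {I : Finset Fol} {J : List Fol} {K m n : ℕ} (ws : List (List Dir × Dir))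
    (ps fs : List Col) (tab : List (List ℤ × List ℤ)) (hm : ws.length = m) (hp : ps.length = m)
    (hn : fs.length = n) (hJ : J.Nodup) (hK : ∀ p ∈ ws, p.1.length ≤ K)
    (hk : ∀ p ∈ ws, ∀ f ∈ I, f ∈ J ∨ ∃ w ∈ p.2 :: p.1, killsDir f w)
    (hperm : (ps ++ fs).Perm (allCols J.length K)) (ho : ∀ c ∈ fs, c.2.2.1 + c.2.2.2 < K)
    (htab : expoLists J = tab) {B : ℕ} (hB : 10007 * (2 * 10007) ^ m ≤ B)
    (h : elim 10007 B m (packedRows B tab ws ps) = true) {D : Set Y5} (hD : IsOpen D)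
    (hc : IsConnected D) (hDY : D ⊆ Ystar) :
    Module.rank ℂ (AR 1 D I) ≤ n + Module.rank ℂ (AR 1 D (I \ J.toFinset)) := by
  let W : WordData I J K m n := WordData.ofProg ws ps fs hm hp hn hJ hK hk hperm ho
  refine W.rank_le_of_elim (ofFn_getD ps _ hp) htab hB h (fun p hpw => ?_) hD hc hDY
  obtain ⟨i, hi, rfl⟩ := List.mem_iff_getElem.1 hpw
  exact ⟨⟨i, hm ▸ hi⟩, List.getD_eq_getElem _ _ hi⟩

theorem rank_AR_plus_le {D : Set Y5} (hD : IsOpen D) (hc : IsConnected D) (hDY : D ⊆ Ystar) :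
    Module.rank ℂ (AR 1 D (folList 1).toFinset) ≤ 6 := by
  have h := rank_le_ofProg (I := (folList 1).toFinset) (J := folList 1) (K := 2) (m := 54) (n := 6)
    (flatProg plusProg) (pivCols 2 plusFree) plusFree plusTab (by decide +kernel)
    (by decide +kernel) rfl (by decide +kernel) (by decide +kernel)
    (fun p _ f hf => Or.inl (List.mem_toFinset.1 hf)) (by decide +kernel) (by decide +kernel)
    expoLists_plus (B := 2 ^ 2048) (by decide +kernel) (by decide +kernel) hD hc hDY
  rw [Finset.sdiff_self] at h
  have h0 : AR 1 D ∅ = ⊥ := by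
    refine (Submodule.eq_bot_iff _).2 fun η hη => ?_
    ext f : 1
    exact hη.2.2.1 f (by simp)
  rw [h0, rank_bot] at h
  simpa using h

theorem rank_AR_univ_le {D : Set Y5} (hD : IsOpen D) (hc : IsConnected D) (hDY : D ⊆ Ystar) :
    Module.rank ℂ (AR 1 D Finset.univ) ≤ 35 := by
  have h := rank_le_ofProg (I := Finset.univ) (J := folList (-1)) (K := 4) (m := 121) (n := 29)
    (flatProg starProg) (pivCols 4 starFree) starFree starTab (by decide +kernel)
    (by decide +kernel) rfl (by decide +kernel) (by decide +kernel)
    (by decide +kernel) (by decide +kernel) (by decide +kernel)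
    expoLists_star (B := 2 ^ 2048) (by decide +kernel) (by decide +kernel) hD hc hDY
  rw [show Finset.univ \ (folList (-1)).toFinset = (folList 1).toFinset by decide +kernel] at h
  refine h.trans ((add_le_add le_rfl (rank_AR_plus_le hD hc hDY)).trans ?_)
  norm_num

section

/-! ### Independence of logarithms in one variable -/

section OneVariable

open Polynomial

variable {ι : Type*} (J : Finset ι) (r : ι → ℂ)

/-- The polynomial `∏_{j ∈ J} (X - r_j)`. -/
def rootPoly : ℂ[X] := ∏ j ∈ J, (X - C (r j))

variable {J r}

theorem rootPoly_dvd (hr : Set.InjOn r J) {q : ℂ[X]} (h : ∀ i ∈ J, q.eval (r i) = 0) :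
    rootPoly J r ∣ q := by
  refine Finset.prod_dvd_of_coprime (fun i hi j hj hij => ?_) fun i hi =>
    dvd_iff_isRoot.2 (h i hi)
  exact isCoprime_X_sub_C_of_isUnit_sub (sub_ne_zero.2 fun he => hij (hr hi hj he)).isUnit

variable [DecidableEq ι]

theorem rootPoly_eq_mul {j : ι} (hj : j ∈ J) :
    rootPoly J r = (X - C (r j)) * rootPoly (J.erase j) r :=
  (Finset.mul_prod_erase J _ hj).symm

theorem derivative_rootPoly :
    derivative (rootPoly J r) = ∑ j ∈ J, rootPoly (J.erase j) r := by
  rw [rootPoly, derivative_prod_finset]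
  refine Finset.sum_congr rfl fun j _ => ?_
  rw [derivative_X_sub_C, mul_one, rootPoly]

theorem eval_rootPoly_erase (i j : ι) (hi : i ∈ J) (h : i ≠ j) :
    (rootPoly (J.erase j) r).eval (r i) = 0 := by
  rw [rootPoly, eval_prod]
  exact Finset.prod_eq_zero (Finset.mem_erase.2 ⟨h, hi⟩) (by simp)

theorem eval_rootPoly_erase_ne_zero (hr : Set.InjOn r J) {i : ι} (hi : i ∈ J) :
    (rootPoly (J.erase i) r).eval (r i) ≠ 0 := by
  rw [rootPoly, eval_prod]
  refine Finset.prod_ne_zero_iff.2 fun j hj => ?_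
  obtain ⟨hji, hj⟩ := Finset.mem_erase.1 hj
  simpa [sub_eq_zero] using fun h => hji (hr hj hi h.symm)

theorem eval_derivative_rootPoly_ne_zero (hr : Set.InjOn r J) {i : ι} (hi : i ∈ J) :
    (derivative (rootPoly J r)).eval (r i) ≠ 0 := by
  rw [derivative_rootPoly, eval_finsetSum, Finset.sum_eq_single_of_mem i hi]
  · exact eval_rootPoly_erase_ne_zero hr hi
  · exact fun j _ h => eval_rootPoly_erase i j hi h.symm

theorem poly_ext_of_isOpen {S : Set ℝ} (hS : IsOpen S) (hne : S.Nonempty) {p q : ℂ[X]}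
    (h : ∀ t ∈ S, p.eval (t : ℂ) = q.eval (t : ℂ)) : p = q := by
  refine eq_of_infinite_eval_eq p q (Set.Infinite.mono (s := (fun t : ℝ => (t : ℂ)) '' S) ?_ ?_)
  · rintro _ ⟨t, ht, rfl⟩
    exact h t ht
  · obtain ⟨t, ht⟩ := hne
    exact (infinite_of_mem_nhds t (hS.mem_nhds ht)).image Complex.ofReal_injective.injOn

variable {S : Set ℝ} (hS : IsOpen S) (hne : S.Nonempty) {h : ι → ℝ → ℂ}
  (hnz : ∀ j ∈ J, ∀ t ∈ S, (t : ℂ) - r j ≠ 0)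
  (hd : ∀ j ∈ J, ∀ t ∈ S, HasDerivAt (h j) (1 / ((t : ℂ) - r j)) t)
include hS hnz hd

/-- Differentiation of a relation `Q^e ∑ p_j h_j = q` between functions `h_j` with
`h_j' = 1 / (t - r_j)`, where `Q = ∏ (t - r_j)`. -/
theorem log_relation_deriv {e : ℕ} {p : ι → ℂ[X]} {q : ℂ[X]}
    (H : ∀ t ∈ S, (rootPoly J r ^ e).eval (t : ℂ) * ∑ j ∈ J, (p j).eval (t : ℂ) * h j t
      = q.eval (t : ℂ)) :
    ∀ t ∈ S, (rootPoly J r ^ (e + 1)).eval (t : ℂ) *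
        ∑ j ∈ J, (derivative (p j)).eval (t : ℂ) * h j t =
      (rootPoly J r * derivative q - (e : ℂ[X]) * derivative (rootPoly J r) * q -
        rootPoly J r ^ e * ∑ j ∈ J, p j * rootPoly (J.erase j) r).eval (t : ℂ) := by
  intro t ht
  have ev (P : ℂ[X]) : HasDerivAt (fun t : ℝ => P.eval (t : ℂ)) ((derivative P).eval (t : ℂ)) t :=
    (P.hasDerivAt (t : ℂ)).comp_ofReal
  have h1 := (ev (rootPoly J r ^ e)).mul
    (HasDerivAt.fun_sum fun j hj => (ev (p j)).mul (hd j hj t ht))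
  have h2 : HasDerivAt (fun t : ℝ => q.eval (t : ℂ)) _ t :=
    h1.congr_of_eventuallyEq (by
      filter_upwards [hS.mem_nhds ht] with u hu
      exact (H u hu).symm)
  have h3 := (ev q).unique h2
  have h4 : (rootPoly J r).eval (t : ℂ) * ∑ j ∈ J, (p j).eval (t : ℂ) * (1 / ((t : ℂ) - r j))
      = ∑ j ∈ J, (p j).eval (t : ℂ) * (rootPoly (J.erase j) r).eval (t : ℂ) := by
    rw [Finset.mul_sum]
    refine Finset.sum_congr rfl fun j hj => ?_
    have := hnz j hj t ht
    rw [rootPoly_eq_mul hj, eval_mul]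
    simp only [eval_sub, eval_X, eval_C]
    field_simp
  have h5 : (rootPoly J r).eval (t : ℂ) * (derivative (rootPoly J r ^ e)).eval (t : ℂ) =
      e * (derivative (rootPoly J r)).eval (t : ℂ) * (rootPoly J r ^ e).eval (t : ℂ) := by
    cases e with
    | zero => simp
    | succ e => simp [derivative_pow]; ring
  simp only [eval_sub, eval_mul, eval_finsetSum, eval_natCast, ← h4]
  rw [h3, ← H t ht]
  simp only [Finset.sum_add_distrib, pow_succ, eval_mul]
  linear_combination (-(∑ j ∈ J, (p j).eval (t : ℂ) * h j t)) * h5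

include hne

/-- Independence with constant coefficients: if `Q^e ∑ c_j h_j = q`, then `q` is divisible by `Q`, so
that the exponent `e` may be lowered to `0`; then the residues `c_j` of the derivative vanish. -/
theorem log_indep_const (hr : Set.InjOn r J) (c : ι → ℂ) (e : ℕ) (q : ℂ[X])
    (H : ∀ t ∈ S, (rootPoly J r ^ e).eval (t : ℂ) * ∑ j ∈ J, (C (c j)).eval (t : ℂ) * h j t
      = q.eval (t : ℂ)) : ∀ j ∈ J, c j = 0 := by
  induction e generalizing q with
  | zero =>
    intro i hi
    have h1 := poly_ext_of_isOpen (p := 0) hS hne fun t ht => by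
      rw [← log_relation_deriv hS hnz hd H t ht]; simp
    have h2 := congrArg (eval (r i)) h1
    rw [eval_zero, eval_sub, eval_sub, eval_mul, eval_mul, rootPoly_eq_mul hi] at h2
    simp only [eval_mul, eval_sub, eval_X, eval_C, sub_self, zero_mul, CharP.cast_eq_zero,
      eval_zero, pow_zero, one_mul, zero_sub, eval_finsetSum, zero_eq_neg] at h2
    rw [Finset.sum_eq_single_of_mem i hi
      fun j _ h => by rw [eval_rootPoly_erase i j hi h.symm, mul_zero]] at h2
    exact (mul_eq_zero.1 h2).resolve_right (eval_rootPoly_erase_ne_zero hr hi)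
  | succ e ih =>
    have h1 := poly_ext_of_isOpen (p := 0) hS hne fun t ht => by
      rw [← log_relation_deriv hS hnz hd H t ht]; simp
    have h2 : rootPoly J r ∣ q := by
      refine rootPoly_dvd hr fun i hi => ?_
      have h3 := congrArg (eval (r i)) h1
      have h0 : (rootPoly J r).eval (r i) = 0 := by rw [rootPoly_eq_mul hi]; simp
      simp only [eval_zero, eval_sub, eval_mul, h0, zero_mul, zero_sub, eval_natCast, pow_succ,
        mul_zero, sub_zero, zero_eq_neg] at h3
      refine (mul_eq_zero.1 h3).resolve_left (mul_ne_zero ?_ ?_)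
      · exact_mod_cast e.succ_ne_zero
      · exact eval_derivative_rootPoly_ne_zero hr hi
    obtain ⟨q', rfl⟩ := h2
    refine ih q' fun t ht => ?_
    have h0 : (rootPoly J r).eval (t : ℂ) ≠ 0 := by
      rw [rootPoly, eval_prod]
      exact Finset.prod_ne_zero_iff.2 fun j hj => by simpa using hnz j hj t ht
    have := H t ht
    rw [pow_succ, eval_mul, eval_mul] at this
    exact mul_left_cancel₀ h0 (by linear_combination this)

/-- Functions `h_j` with `h_j' = 1 / (t - r_j)`, for pairwise distinct `r_j`, are linearly
independent over the polynomials, modulo the polynomials. -/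
theorem log_indep (hr : Set.InjOn r J) (p : ι → ℂ[X]) (q : ℂ[X])
    (H : ∀ t ∈ S, ∑ j ∈ J, (p j).eval (t : ℂ) * h j t = q.eval (t : ℂ)) :
    ∀ j ∈ J, p j = 0 := by
  -- the induction is on a bound of the degrees, and needs the relation up to a power of `Q`
  have key : ∀ (d e : ℕ) (p : ι → ℂ[X]) (q : ℂ[X]), (∀ j ∈ J, (p j).degree < d) →
      (∀ t ∈ S, (rootPoly J r ^ e).eval (t : ℂ) * ∑ j ∈ J, (p j).eval (t : ℂ) * h j t
        = q.eval (t : ℂ)) → ∀ j ∈ J, p j = 0 := by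
    intro d
    induction d with
    | zero =>
      intro e p q hp _ j hj
      simpa [Polynomial.degree_eq_bot, Nat.WithBot.lt_zero_iff] using hp j hj
    | succ d ih =>
      intro e p q hp H
      have h1 : ∀ j ∈ J, derivative (p j) = 0 := by
        refine ih (e + 1) (fun j => derivative (p j)) _ (fun j hj => ?_)
          (log_relation_deriv hS hnz hd H)
        by_cases h0 : p j = 0
        · rw [h0, derivative_zero, degree_zero]
          exact WithBot.bot_lt_coe d
        · have h2 := hp j hj
          rw [degree_eq_natDegree h0] at h2
          have h3 := degree_derivative_lt h0
          rw [degree_eq_natDegree h0] at h3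
          refine h3.trans_le ?_
          have h4 : (p j).natDegree < d + 1 := by exact_mod_cast h2
          exact_mod_cast Nat.lt_succ_iff.1 h4
      have h2 : ∀ j ∈ J, p j = C ((p j).coeff 0) := fun j hj =>
        eq_C_of_natDegree_eq_zero (derivative_eq_zero.1 (h1 j hj))
      intro j hj
      rw [h2 j hj, log_indep_const hS hne hnz hd hr (fun j => (p j).coeff 0) e q ?_ j hj, C_0]
      intro t ht
      rw [← H t ht]
      congr 1
      exact Finset.sum_congr rfl fun j hj => by rw [← h2 j hj]
  refine key ((J.sup fun j => (p j).natDegree) + 1) 0 p q (fun j hj => ?_) (by simpa using H)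
  refine (degree_le_natDegree).trans_lt ?_
  exact_mod_cast Nat.lt_succ_iff.2 (Finset.le_sup (f := fun j => (p j).natDegree) hj)

end OneVariable

end

section

/-! ### Independence of the logarithms of the `ζ_k` over the polynomials -/

/-- The polynomials `ζ_k` over an arbitrary commutative ring. -/
def zetaR {R : Type*} [CommRing R] (y : Fin 5 → R) (k : Fin 10) : R :=
  Fin.addCases (m := 5) (n := 5) y (polP y) k

theorem zetaR_castAdd {R : Type*} [CommRing R] (y : Fin 5 → R) (k : Fin 5) :
    zetaR y (Fin.castAdd 5 k) = y k := by rw [zetaR, Fin.addCases_left]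

theorem zetaR_natAdd {R : Type*} [CommRing R] (y : Fin 5 → R) (k : Fin 5) :
    zetaR y (Fin.natAdd 5 k) = polP y k := by rw [zetaR, Fin.addCases_right]

theorem zetaR_eq (x : Y5) (k : Fin 10) : zetaR x k = zeta k x := by
  refine Fin.addCases (m := 5) (n := 5) (fun i => ?_) (fun i => ?_) k
  · rw [zetaR_castAdd, zeta_castAdd]
  · rw [zetaR_natAdd, zeta_natAdd]

theorem map_zetaR {R S : Type*} [CommRing R] [CommRing S] (φ : R →+* S) (y : Fin 5 → R)
    (k : Fin 10) : φ (zetaR y k) = zetaR (fun i => φ (y i)) k := by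
  refine Fin.addCases (m := 5) (n := 5) (fun i => ?_) (fun i => ?_) k
  · rw [zetaR_castAdd, zetaR_castAdd]
  · rw [zetaR_natAdd, zetaR_natAdd]
    simp [polP]

/-- The partial derivative of `ζ_k` in the direction `i` (`ζ_k` is of degree one in each
variable). -/
def partR {R : Type*} [CommRing R] (y : Fin 5 → R) (k : Fin 10) (i : Fin 5) : R :=
  zetaR (fun j => y j + if j = i then 1 else 0) k - zetaR y k

theorem map_partR {R S : Type*} [CommRing R] [CommRing S] (φ : R →+* S) (y : Fin 5 → R)
    (k : Fin 10) (i : Fin 5) : φ (partR y k i) = partR (fun j => φ (y j)) k i := by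
  rw [partR, map_sub, map_zetaR, map_zetaR, partR]
  congr 3
  ext j
  split_ifs <;> simp

/-- The line through `x` in the direction `i`. -/
def coordLine (x : Y5) (i : Fin 5) (t : ℂ) : Y5 := fun j => x j + if j = i then t else 0

theorem zetaR_coordLine (x : Y5) (k : Fin 10) (i : Fin 5) (t : ℂ) :
    zetaR (coordLine x i t) k = zetaR x k + t * partR x k i := by
  have h := Fin.addCases (m := 5) (n := 5) (motive := fun k => ∀ i : Fin 5,
    zetaR (coordLine x i t) k = zetaR x k + t * partR x k i) (fun k i => ?_) (fun k i => ?_) k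
  · exact h i
  · simp only [partR, zetaR_castAdd]
    simp [coordLine]
  · simp only [partR, zetaR_natAdd, coordLine, polP]
    fin_cases k <;> fin_cases i <;> simp [aI, bI, bJ] <;> ring

theorem coordLine_coordLine (x : Y5) (i : Fin 5) (s t : ℂ) :
    coordLine (coordLine x i s) i t = coordLine x i (s + t) := by
  ext j
  simp only [coordLine]
  split_ifs <;> ring

theorem partR_coordLine (x : Y5) (k : Fin 10) (i : Fin 5) (t : ℂ) :
    partR (coordLine x i t) k i = partR x k i := by
  have h1 := zetaR_coordLine (coordLine x i t) k i 1
  rw [coordLine_coordLine, zetaR_coordLine, zetaR_coordLine] at h1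
  linear_combination -h1

theorem hasDerivAt_coordLine (x : Y5) (i : Fin 5) (t : ℂ) :
    HasDerivAt (coordLine x i) (Pi.single i 1) t := by
  refine hasDerivAt_pi.2 fun j => ?_
  by_cases h : j = i
  · subst h
    simpa [coordLine] using (hasDerivAt_id t).const_add (x j)
  · simpa [coordLine, h] using hasDerivAt_const t (x j)

theorem fderiv_zeta_single (x : Y5) (k : Fin 10) (i : Fin 5) :
    fderiv ℂ (zeta k) x (Pi.single i 1) = partR x k i := by
  have h0 : coordLine x i 0 = x := by ext j; simp [coordLine]
  have h1 : HasDerivAt (fun t => zeta k (coordLine x i t)) (fderiv ℂ (zeta k) x (Pi.single i 1))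
      0 := by
    have := (differentiableAt_zeta k (coordLine x i 0)).hasFDerivAt.comp_hasDerivAt (0 : ℂ)
      (hasDerivAt_coordLine x i 0)
    rwa [h0] at this
  have h2 : HasDerivAt (fun t => zeta k (coordLine x i t)) (partR x k i) 0 := by
    simp only [← zetaR_eq, zetaR_coordLine]
    simpa using ((hasDerivAt_id (0 : ℂ)).mul_const (partR x k i)).const_add (zetaR x k)
  exact h1.unique h2

theorem dz_single (x : Y5) (k : Fin 10) (i : Fin 5) :
    dz k x (Pi.single i 1) = partR x k i / zetaR x k := by
  rw [dz, smul_apply, fderiv_zeta_single, smul_eq_mul, zetaR_eq]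
  ring

/-- The indices `k` such that `ζ_k` depends on `y_i`. -/
def depOn (i : Fin 5) : Finset (Fin 10) := Finset.univ.filter fun k =>
  Fin.addCases (m := 5) (n := 5) (motive := fun _ => Bool) (fun j => j = i)
    (fun j => aI j = i ∨ bI j = i ∨ bJ j = i) k = true

theorem partR_eq_zero {R : Type*} [CommRing R] (y : Fin 5 → R) {k : Fin 10} {i : Fin 5}
    (h : k ∉ depOn i) : partR y k i = 0 := by
  have := Fin.addCases (m := 5) (n := 5) (motive := fun k => k ∉ depOn i → partR y k i = 0)
    (fun k hk => ?_) (fun k hk => ?_) k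
  · exact this h
  · simp only [depOn, Finset.mem_filter, Finset.mem_univ, true_and, Fin.addCases_left,
      decide_eq_true_eq] at hk
    simp only [partR, zetaR_castAdd, hk, if_false, add_zero, sub_self]
  · simp only [depOn, Finset.mem_filter, Finset.mem_univ, true_and, Fin.addCases_right,
      decide_eq_true_eq, not_or] at hk
    simp only [partR, zetaR_natAdd, polP, hk, if_false, add_zero, sub_self]

/-- A polynomial which does not vanish at `y` only if the restrictions to the line through `y` in
the direction `i` of the `ζ_k` which depend on `y_i` have distinct roots. -/
def goodR {R : Type*} [CommRing R] (y : Fin 5 → R) (i : Fin 5) : R :=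
  (∏ k ∈ depOn i, partR y k i) *
    ∏ k ∈ depOn i, ∏ l ∈ (depOn i).erase k,
      (zetaR y k * partR y l i - zetaR y l * partR y k i)

theorem map_goodR {R S : Type*} [CommRing R] [CommRing S] (φ : R →+* S) (y : Fin 5 → R)
    (i : Fin 5) : φ (goodR y i) = goodR (fun j => φ (y j)) i := by
  simp only [goodR, map_mul, map_prod, map_sub, map_zetaR, map_partR]

theorem goodR_ne_zero (i : Fin 5) :
    goodR (fun j => (MvPolynomial.X j : MvPolynomial (Fin 5) ℂ)) i ≠ 0 := by
  intro h
  have h1 := congrArg (MvPolynomial.eval (fun j => ((![2, 3, 5, 7, 11] j : ℤ) : ℂ))) h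
  rw [map_goodR, map_zero] at h1
  simp only [MvPolynomial.eval_X] at h1
  have h3 := map_goodR (Int.castRingHom ℂ) ![2, 3, 5, 7, 11] i
  simp only [eq_intCast] at h3
  rw [← h3] at h1
  have h2 : ∀ i, goodR (![2, 3, 5, 7, 11] : Fin 5 → ℤ) i ≠ 0 := by decide +kernel
  exact h2 i (by exact_mod_cast h1)

/-- On the set `X ⊆ Y₅*`, which contains a real interval of each coordinate line through each of
its points and is dense for the Zariski topology, the functions `L_k` are primitives of the
`dζ_k / ζ_k` along these intervals. -/
structure LogSys (X : Set Y5) (L : Fin 10 → Y5 → ℂ) : Prop where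
  sub : X ⊆ Ystar
  line : ∀ x ∈ X, ∀ i, ∃ δ > (0 : ℝ), ∀ t : ℝ, |t| < δ → coordLine x i t ∈ X
  dense : ∀ p : MvPolynomial (Fin 5) ℂ, (∀ x ∈ X, MvPolynomial.eval x p = 0) → p = 0
  deriv : ∀ x ∈ X, ∀ i k,
    HasDerivAt (fun t : ℝ => L k (coordLine x i t)) (partR x k i / zetaR x k) 0

/-- The restriction of a polynomial to a coordinate line. -/
def onLine (x : Y5) (i : Fin 5) : MvPolynomial (Fin 5) ℂ →+* Polynomial ℂ :=
  MvPolynomial.eval₂Hom Polynomial.C fun j =>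
    Polynomial.C (x j) + if j = i then Polynomial.X else 0

theorem eval_onLine (x : Y5) (i : Fin 5) (p : MvPolynomial (Fin 5) ℂ) (t : ℂ) :
    (onLine x i p).eval t = MvPolynomial.eval (coordLine x i t) p := by
  induction p using MvPolynomial.induction_on with
  | C a => simp [onLine]
  | add p q hp hq => rw [map_add, map_add, Polynomial.eval_add, hp, hq]
  | mul_X p j hp =>
    rw [map_mul, map_mul, Polynomial.eval_mul, hp]
    congr 1
    simp only [onLine, MvPolynomial.eval₂Hom_X', MvPolynomial.eval_X, coordLine]
    split_ifs <;> simp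

/-- Every `ζ_k` depends on some coordinate. -/
theorem exists_mem_depOn (k : Fin 10) : ∃ i, k ∈ depOn i := by
  revert k; decide +kernel

/-- The logarithms of the `ζ_k` are linearly independent over the polynomials, modulo the
polynomials: on a generic line in a suitable coordinate direction, this is `log_indep`. -/
theorem LogSys.indep {X : Set Y5} {L : Fin 10 → Y5 → ℂ} (h : LogSys X L)
    (r : Fin 10 → MvPolynomial (Fin 5) ℂ) (q : MvPolynomial (Fin 5) ℂ)
    (H : ∀ x ∈ X, ∑ k, MvPolynomial.eval x (r k) * L k x = MvPolynomial.eval x q) (k₀ : Fin 10) :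
    r k₀ = 0 := by
  obtain ⟨i, hi⟩ := exists_mem_depOn k₀
  refine (mul_eq_zero.1 (h.dense (goodR (fun j => MvPolynomial.X j) i * r k₀)
    fun x hx => ?_)).resolve_left (goodR_ne_zero i)
  rw [map_mul, map_goodR]
  simp only [MvPolynomial.eval_X]
  by_cases hG : goodR x i = 0
  · rw [hG, zero_mul]
  rw [goodR, ← ne_eq, mul_ne_zero_iff, Finset.prod_ne_zero_iff, Finset.prod_ne_zero_iff] at hG
  obtain ⟨hG1, hG2⟩ := hG
  obtain ⟨δ, hδ, hX⟩ := h.line x hx i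
  have hS (t : ℝ) (ht : t ∈ Metric.ball (0 : ℝ) δ) : coordLine x i t ∈ X :=
    hX t (by simpa using ht)
  have h0 : coordLine x i ((0 : ℝ) : ℂ) = x := by ext j; simp [coordLine]
  have hd (t : ℝ) (ht : t ∈ Metric.ball (0 : ℝ) δ) (k : Fin 10) :
      HasDerivAt (fun t : ℝ => L k (coordLine x i t))
        (partR x k i / (zetaR x k + t * partR x k i)) t := by
    have h1 := h.deriv _ (hS t ht) i k
    rw [partR_coordLine, zetaR_coordLine] at h1
    simp only [coordLine_coordLine] at h1
    have h2 := HasDerivAt.comp_sub_const (f := fun s : ℝ => L k (coordLine x i (t + s))) t t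
      (by rwa [sub_self])
    simpa using h2
  have hz (t : ℝ) (ht : t ∈ Metric.ball (0 : ℝ) δ) (k : Fin 10) :
      zetaR x k + t * partR x k i ≠ 0 := by
    rw [← zetaR_coordLine, zetaR_eq]
    exact h.sub (hS t ht) k
  have hconst (k : Fin 10) (hk : k ∉ depOn i) (t : ℝ) (ht : t ∈ Metric.ball (0 : ℝ) δ) :
      L k (coordLine x i t) = L k x := by
    have h1 := Metric.isOpen_ball.is_const_of_deriv_eq_zero
      (f := fun t : ℝ => L k (coordLine x i t)) (convex_ball (0 : ℝ) δ).isPreconnected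
      (fun t ht => (hd t ht k).differentiableAt.differentiableWithinAt) (fun t ht => by
        rw [(hd t ht k).deriv, partR_eq_zero x hk, zero_div]; rfl) ht
      (Metric.mem_ball_self hδ)
    simpa only [h0] using h1
  have key := log_indep (J := depOn i) (r := fun k => -(zetaR x k / partR x k i))
    Metric.isOpen_ball ⟨0, Metric.mem_ball_self hδ⟩
    (h := fun k t => L k (coordLine x i t)) (fun k hk t ht => ?_) (fun k hk t ht => ?_)
    (fun k hk l hl hkl => ?_) (fun k => onLine x i (r k))
    (onLine x i q - ∑ k ∈ (depOn i)ᶜ, Polynomial.C (L k x) * onLine x i (r k))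
    (fun t ht => ?_) k₀ hi
  · have h1 := eval_onLine x i (r k₀) ((0 : ℝ) : ℂ)
    rw [h0, key] at h1
    rw [← h1]; simp
  · have := hG1 k hk
    have h1 := hz t ht k
    intro h2
    apply h1
    field_simp at h2
    linear_combination h2
  · have := hG1 k hk
    have h1 := hz t ht k
    have h2 : (1 : ℂ) / ((t : ℂ) - -(zetaR x k / partR x k i))
        = partR x k i / (zetaR x k + t * partR x k i) := by
      rw [show (t : ℂ) - -(zetaR x k / partR x k i)
        = (zetaR x k + t * partR x k i) / partR x k i by field_simp; ring, one_div_div]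
    rw [h2]
    exact hd t ht k
  · by_contra hne
    have h1 := Finset.prod_ne_zero_iff.1 (hG2 k hk) l (Finset.mem_erase.2 ⟨Ne.symm hne, hl⟩)
    have := hG1 k hk
    have := hG1 l hl
    apply h1
    simp only [neg_inj] at hkl
    field_simp at hkl
    linear_combination hkl
  · have h1 := H _ (hS t ht)
    rw [← Finset.sum_add_sum_compl (depOn i)] at h1
    rw [Polynomial.eval_sub, Polynomial.eval_finsetSum, eval_onLine, ← h1]
    simp only [eval_onLine, Polynomial.eval_mul, Polynomial.eval_C]
    rw [add_sub_assoc, left_eq_add, sub_eq_zero]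
    refine Finset.sum_congr rfl fun k hk => ?_
    rw [hconst k (Finset.mem_compl.1 hk) t ht, mul_comm]

end

/-! ### Homogeneous linear systems with integer coefficients -/

/-- The list `p r - q s`, lists being completed by zeros. -/
def combo (p q : ℤ) : List ℤ → List ℤ → List ℤ
  | [], s => s.map fun b => -(q * b)
  | r, [] => r.map fun a => p * a
  | a :: r, b :: s => (p * a - q * b) :: combo p q r s

/-- Division of a list by its content. -/
def primitivePart (r : List ℤ) : List ℤ :=
  let g : ℤ := r.foldl (fun a b => (Int.gcd a b : ℤ)) 0
  if g ≠ 0 ∧ ∀ a ∈ r, g ∣ a then r.map fun a => a / g else r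

/-- An upper bound, found by elimination, for the dimension of the space of solutions in `n`
unknowns of a homogeneous system. -/
def nullity : ℕ → List (List ℤ) → ℕ
  | 0, _ => 0
  | n + 1, rows =>
    match rows.find? fun r => r.headD 0 ≠ 0 with
    | none => nullity n (rows.map List.tail) + 1
    | some p => nullity n
        ((rows.map fun r => if r.headD 0 = 0 then r.tail else
          primitivePart (combo (p.headD 0) (r.headD 0) r.tail p.tail)).filter
            fun r => r.any (· ≠ 0))

theorem getD_combo (p q : ℤ) (r s : List ℤ) (i : ℕ) :
    (combo p q r s).getD i 0 = p * r.getD i 0 - q * s.getD i 0 := by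
  induction r generalizing s i with
  | nil =>
    simp only [combo, List.getD_eq_getElem?_getD, List.getElem?_map]
    cases s[i]? <;> simp
  | cons a r ih =>
    cases s with
    | nil =>
      simp only [combo, List.getD_eq_getElem?_getD, List.getElem?_map]
      cases (a :: r)[i]? <;> simp
    | cons b s =>
      cases i with
      | zero => simp [combo]
      | succ i => simpa [combo] using ih s i

/-- The value at `v` of the linear form with coefficients `r`. -/
def rowVal {n : ℕ} (r : List ℤ) (v : Fin n → ℂ) : ℂ := ∑ i : Fin n, (r.getD i 0 : ℂ) * v i

theorem rowVal_succ {n : ℕ} (r : List ℤ) (v : Fin (n + 1) → ℂ) :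
    rowVal r v = (r.headD 0 : ℂ) * v 0 + rowVal r.tail (Fin.tail v) := by
  rw [rowVal, Fin.sum_univ_succ, rowVal]
  congr 1
  · cases r <;> simp
  · refine Finset.sum_congr rfl fun i _ => ?_
    cases r <;> simp [Fin.tail]

theorem rowVal_combo {n : ℕ} (p q : ℤ) (r s : List ℤ) (v : Fin n → ℂ) :
    rowVal (combo p q r s) v = p * rowVal r v - q * rowVal s v := by
  simp only [rowVal, getD_combo, Finset.mul_sum, ← Finset.sum_sub_distrib]
  refine Finset.sum_congr rfl fun i _ => ?_
  push_cast
  ring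

theorem rowVal_primitivePart {n : ℕ} {r : List ℤ} {v : Fin n → ℂ} (h : rowVal r v = 0) :
    rowVal (primitivePart r) v = 0 := by
  rw [primitivePart]
  set g : ℤ := r.foldl (fun a b => (Int.gcd a b : ℤ)) 0
  split_ifs with hg
  · obtain ⟨hg0, hg⟩ := hg
    have h0 : (g : ℂ) ≠ 0 := by exact_mod_cast hg0
    refine (mul_eq_zero.1 (?_ : (g : ℂ) * _ = 0)).resolve_left h0
    rw [← h, rowVal, rowVal, Finset.mul_sum]
    refine Finset.sum_congr rfl fun i _ => ?_
    rw [← mul_assoc]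
    congr 1
    simp only [List.getD_eq_getElem?_getD, List.getElem?_map]
    rcases hr : r[(i : ℕ)]? with _ | a
    · simp
    · simp only [Option.map_some, Option.getD_some]
      exact_mod_cast Int.mul_ediv_cancel' (hg a (List.mem_of_getElem? hr))
  · exact h

/-- Elimination of the first unknown: with a pivot the projection forgetting it is injective on the
space of solutions, and without a pivot its kernel has dimension one at most. -/
theorem finrank_le_nullity (n : ℕ) (rows : List (List ℤ)) (S : Submodule ℂ (Fin n → ℂ))
    (h : ∀ v ∈ S, ∀ r ∈ rows, rowVal r v = 0) : Module.finrank ℂ S ≤ nullity n rows := by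
  induction n generalizing rows with
  | zero =>
    rw [Module.finrank_zero_of_subsingleton]
    exact Nat.zero_le _
  | succ n ih =>
    let T : (Fin (n + 1) → ℂ) →ₗ[ℂ] (Fin n → ℂ) := LinearMap.funLeft ℂ ℂ Fin.succ
    have hT (v : Fin (n + 1) → ℂ) : T v = Fin.tail v := rfl
    let P : S →ₗ[ℂ] ℂ := (LinearMap.proj 0).comp S.subtype
    have hrank := (T.comp S.subtype).finrank_range_add_finrank_ker
    have hrange : LinearMap.range (T.comp S.subtype) = S.map T := by
      rw [LinearMap.range_comp, Submodule.range_subtype]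
    have hker0 {v : S} (hv : v ∈ LinearMap.ker (T.comp S.subtype)) : Fin.tail v.1 = 0 := hv
    rw [hrange] at hrank
    rw [nullity]
    rcases hp : rows.find? fun r => r.headD 0 ≠ 0 with _ | p
    · have hz : ∀ r ∈ rows, r.headD 0 = 0 := by simpa using hp
      have h1 := ih (rows.map List.tail) (S.map T) <| by
        rintro _ ⟨v, hv, rfl⟩ _ hr'
        obtain ⟨r, hr, rfl⟩ := List.mem_map.1 hr'
        have := h v hv r hr
        rwa [rowVal_succ, hz r hr, Int.cast_zero, zero_mul, zero_add] at this
      have h2 : Module.finrank ℂ (LinearMap.ker (T.comp S.subtype)) ≤ 1 := by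
        have := LinearMap.finrank_le_finrank_of_injective
          (f := P.comp (LinearMap.ker (T.comp S.subtype)).subtype) <| by
            refine (injective_iff_map_eq_zero _).2 fun v hv => ?_
            ext i
            refine Fin.cases hv (fun i => ?_) i
            exact congrFun (hker0 v.2) i
        simpa using this
      simp only [hp]
      omega
    · have hp1 : p.headD 0 ≠ 0 := by simpa using List.find?_some hp
      have hp2 := List.mem_of_find?_eq_some hp
      have hp3 : (p.headD 0 : ℂ) ≠ 0 := by exact_mod_cast hp1
      simp only [hp]
      refine le_trans ?_ (ih _ (S.map T) ?_)
      · have h2 : Module.finrank ℂ (LinearMap.ker (T.comp S.subtype)) = 0 := by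
          rw [(LinearMap.ker_eq_bot (f := T.comp S.subtype)).2, finrank_bot]
          refine (injective_iff_map_eq_zero _).2 fun v hv => ?_
          have h0 := hker0 (v := v) hv
          have h1 := h v.1 v.2 p hp2
          rw [rowVal_succ, h0] at h1
          have h3 : v.1 0 = 0 := by
            simp only [rowVal, Pi.zero_apply, mul_zero, Finset.sum_const_zero, add_zero] at h1
            exact (mul_eq_zero.1 h1).resolve_left hp3
          ext i
          exact Fin.cases h3 (fun i => congrFun h0 i) i
        omega
      · rintro _ ⟨v, hv, rfl⟩ _ hr'
        obtain ⟨r, hr, rfl⟩ := List.mem_map.1 (List.mem_filter.1 hr').1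
        have hr1 := h v hv r hr
        have hr2 := h v hv p hp2
        rw [rowVal_succ] at hr1 hr2
        split_ifs with h0
        · rwa [h0, Int.cast_zero, zero_mul, zero_add] at hr1
        · refine rowVal_primitivePart ?_
          rw [rowVal_combo, hT]
          linear_combination (p.headD 0 : ℂ) * hr1 - (r.headD 0 : ℂ) * hr2

/-- Bound for the dimension of a space `S` on which the coordinates `x_i`, for `i` in the list
`idx`, are injective and satisfy the equations with coefficients `rows`. -/
theorem finrank_le_nullity_of_coord {V ι : Type*} [AddCommGroup V] [Module ℂ V]
    (S : Submodule ℂ V) (x : ι → V →ₗ[ℂ] ℂ) (idx : List ι)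
    (hinj : ∀ v ∈ S, (∀ i ∈ idx, x i v = 0) → v = 0) (rows : List (ι → ℤ))
    (h : ∀ v ∈ S, ∀ g ∈ rows, (idx.map fun i => (g i : ℂ) * x i v).sum = 0) :
    Module.finrank ℂ S ≤ nullity idx.length (rows.map fun g => idx.map g) := by
  let X : V →ₗ[ℂ] (Fin idx.length → ℂ) := LinearMap.pi fun i => x idx[i]
  have hX : Function.Injective (X.comp S.subtype) := by
    refine (injective_iff_map_eq_zero _).2 fun v hv => Subtype.ext (hinj v.1 v.2 fun i hi => ?_)
    obtain ⟨j, hj, rfl⟩ := List.mem_iff_getElem.1 hi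
    exact congrFun hv ⟨j, hj⟩
  rw [← LinearMap.finrank_range_of_inj hX]
  refine finrank_le_nullity _ _ _ ?_
  rintro _ ⟨v, rfl⟩ r hr
  obtain ⟨g, hg, rfl⟩ := List.mem_map.1 hr
  rw [← h v.1 v.2 g hg, rowVal, ← List.sum_ofFn]
  congr 1
  refine List.ext_getElem (by simp) fun j hj _ => ?_
  simp [X]

/-- A family of complex numbers satisfying a system of rank equal to the number of unknowns
vanishes. -/
theorem eq_zero_of_nullity {ι : Type*} [Fintype ι] (idx : List ι) (hn : idx.Nodup)
    (hm : ∀ i, i ∈ idx) (rows : List (ι → ℤ))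
    (h0 : nullity idx.length (rows.map fun g => idx.map g) = 0) (v : ι → ℂ)
    (h : ∀ g ∈ rows, ∑ i, (g i : ℂ) * v i = 0) : v = 0 := by
  classical
  have h1 := finrank_le_nullity_of_coord (Submodule.span ℂ {v}) (fun i => LinearMap.proj i) idx
    (fun w _ hw => funext fun i => hw i (hm i)) rows fun w hw g hg => by
      obtain ⟨c, rfl⟩ := Submodule.mem_span_singleton.1 hw
      have h2 : (Finset.univ : Finset ι) = idx.toFinset := by ext i; simp [hm i]
      have h3 := h g hg
      rw [h2, List.sum_toFinset _ hn] at h3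
      simp only [LinearMap.proj_apply, Pi.smul_apply, smul_eq_mul, mul_left_comm _ c]
      rw [List.sum_map_mul_left, h3, mul_zero]
  rw [h0, Nat.le_zero, Submodule.finrank_eq_zero, Submodule.span_singleton_eq_bot] at h1
  exact h1

section

/-! ### Logarithmic tuples -/

theorem hasDerivAt_coordLine_ofReal (x : Y5) (i : Fin 5) (t : ℝ) :
    HasDerivAt (fun t : ℝ => coordLine x i t) (Pi.single i 1) t := by
  refine hasDerivAt_pi.2 fun j => ?_
  by_cases h : j = i
  · subst h
    simpa [coordLine] using (hasDerivAt_id t).ofReal_comp.const_add (x j)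
  · simpa [coordLine, h] using hasDerivAt_const t (x j)

theorem logSys_of_exp {D : Set Y5} {L : Fin 10 → Y5 → ℂ} (hD : IsOpen D) (hne : D.Nonempty)
    (hL : ∀ k, AnalyticOnNhd ℂ (L k) D) (hexp : ∀ k, ∀ x ∈ D, Complex.exp (L k x) = zeta k x) :
    LogSys D L where
  sub x hx k := by rw [← hexp k x hx]; exact Complex.exp_ne_zero _
  line x hx i := by
    have h0 : coordLine x i 0 = x := by ext j; simp [coordLine]
    have hc : ContinuousAt (fun t : ℝ => coordLine x i t) 0 :=
      (hasDerivAt_coordLine_ofReal x i 0).continuousAt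
    have := hc.preimage_mem_nhds (hD.mem_nhds (by simpa [h0] using hx))
    obtain ⟨δ, hδ, h⟩ := Metric.mem_nhds_iff.1 this
    exact ⟨δ, hδ, fun t ht => h (by simpa using ht)⟩
  dense p hp := by
    obtain ⟨x, hx⟩ := hne
    obtain ⟨ε, hε, h⟩ := Metric.isOpen_iff.1 hD x hx
    refine MvPolynomial.funext_set (fun i => Metric.ball (x i) ε)
      (fun i => infinite_of_mem_nhds (x i) (Metric.ball_mem_nhds _ hε)) fun y hy => ?_
    rw [map_zero]
    refine hp y (h ?_)
    rw [Metric.mem_ball, dist_pi_lt_iff hε]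
    exact fun i => hy i trivial
  deriv x hx i k := by
    have h0 : coordLine x i ((0 : ℝ) : ℂ) = x := by ext j; simp [coordLine]
    have h1 : HasFDerivAt (L k) (dz k x) x := by
      rw [← fderiv_log_eq (hL k x hx).differentiableAt
        (by filter_upwards [hD.mem_nhds hx] with y hy using hexp k y hy)]
      exact (hL k x hx).differentiableAt.hasFDerivAt
    rw [← dz_single]
    have h2 := hasDerivAt_coordLine_ofReal x i 0
    rw [← h0] at h1
    have := h1.restrictScalars ℝ |>.comp_hasDerivAt (0 : ℝ) h2
    rwa [h0] at this

/-- The real points of `Y₅*`. -/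
def realPts : Set Y5 := {x | x ∈ Ystar ∧ ∃ u : Fin 5 → ℝ, x = fun j => (u j : ℂ)}

/-- On real points, `ln |ζ_k|` is a primitive of `dζ_k / ζ_k` along real lines. -/
theorem logSys_lnAbs : LogSys realPts lnAbs where
  sub _ hx := hx.1
  line := by
    rintro x ⟨hx, u, rfl⟩ i
    have h0 : coordLine (fun j => (u j : ℂ)) i 0 = fun j => (u j : ℂ) := by ext j; simp [coordLine]
    have hc : ContinuousAt (fun t : ℝ => coordLine (fun j => (u j : ℂ)) i t) 0 :=
      (hasDerivAt_coordLine_ofReal _ i 0).continuousAt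
    have := hc.preimage_mem_nhds (isOpen_Ystar.mem_nhds (by simpa [h0] using hx))
    obtain ⟨δ, hδ, h⟩ := Metric.mem_nhds_iff.1 this
    refine ⟨δ, hδ, fun t ht => ⟨h (by simpa using ht), fun j => u j + if j = i then t else 0, ?_⟩⟩
    ext j
    simp only [coordLine]
    split_ifs <;> simp
  dense p hp := by
    have h1 : p * ∏ k, zetaR (fun j => MvPolynomial.X j) k = 0 := by
      refine MvPolynomial.funext_set (fun _ => Set.range ((↑) : ℝ → ℂ))
        (fun _ => Set.infinite_range_of_injective Complex.ofReal_injective) fun y hy => ?_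
      choose u hu using fun i => hy i trivial
      rw [map_zero, map_mul, map_prod]
      simp only [map_zetaR, MvPolynomial.eval_X]
      by_cases h : y ∈ Ystar
      · rw [hp y ⟨h, u, funext fun i => (hu i).symm⟩, zero_mul]
      · simp only [Ystar, Set.mem_ofPred_eq, not_forall, not_not] at h
        obtain ⟨k, hk⟩ := h
        rw [Finset.prod_eq_zero (Finset.mem_univ k) (by rwa [zetaR_eq]), mul_zero]
    refine (mul_eq_zero.1 h1).resolve_right fun h => ?_
    have h2 := congrArg (MvPolynomial.eval basePt) h
    rw [map_prod, map_zero] at h2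
    simp only [map_zetaR, MvPolynomial.eval_X] at h2
    obtain ⟨k, -, hk⟩ := Finset.prod_eq_zero_iff.1 h2
    exact basePt_mem k (by rwa [← zetaR_eq])
  deriv := by
    rintro x ⟨hx, u, rfl⟩ i k
    have hz := map_zetaR Complex.ofRealHom u k
    have hp := map_partR Complex.ofRealHom u k i
    simp only [Complex.ofRealHom_eq_coe] at hz hp
    have h0 : zetaR u k ≠ 0 := fun h => by
      refine hx k ?_
      rw [← zetaR_eq, ← hz, h, Complex.ofReal_zero]
    have h1 (t : ℝ) : lnAbs k (coordLine (fun j => (u j : ℂ)) i t)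
        = (Real.log (zetaR u k + t * partR u k i) : ℝ) := by
      rw [lnAbs, ← zetaR_eq, zetaR_coordLine, ← hz, ← hp, ← Complex.ofReal_mul,
        ← Complex.ofReal_add, Complex.norm_real, Real.norm_eq_abs, Real.log_abs]
    simp only [h1, ← hz, ← hp]
    rw [← Complex.ofReal_div]
    refine HasDerivAt.ofReal_comp ?_
    have h2 : HasDerivAt (fun t : ℝ => zetaR u k + t * partR u k i) (partR u k i) 0 := by
      simpa using ((hasDerivAt_id (0 : ℝ)).mul_const (partR u k i)).const_add (zetaR u k)
    simpa using h2.log (by simpa using h0)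

/-- The product of the `ζ_{l'}`, `l' ≠ l`. -/
def cofR {R : Type*} [CommRing R] (y : Fin 5 → R) (l : Fin 10) : R :=
  ∏ k ∈ Finset.univ.erase l, zetaR y k

theorem map_cofR {R S : Type*} [CommRing R] [CommRing S] (φ : R →+* S) (y : Fin 5 → R)
    (l : Fin 10) : φ (cofR y l) = cofR (fun j => φ (y j)) l := by
  simp only [cofR, map_prod, map_zetaR]

/-- The numerator of the coefficient of `dy_i` in `∑ p_l dζ_l / ζ_l`. -/
def numer {R : Type*} [CommRing R] (y : Fin 5 → R) (p : Fin 10 → R) (i : Fin 5) : R :=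
  ∑ l, p l * (partR y l i * cofR y l)

theorem map_numer {R S : Type*} [CommRing R] [CommRing S] (φ : R →+* S) (y : Fin 5 → R)
    (p : Fin 10 → R) (i : Fin 5) :
    φ (numer y p i) = numer (fun j => φ (y j)) (fun l => φ (p l)) i := by
  simp only [numer, map_sum, map_mul, map_cofR, map_partR]

theorem numer_eq {x : Y5} (hx : x ∈ Ystar) (p : Fin 10 → ℂ) (i : Fin 5) :
    numer x p i = (∏ k, zeta k x) * ∑ l, p l * dz l x (Pi.single i 1) := by
  rw [numer, Finset.mul_sum]
  refine Finset.sum_congr rfl fun l _ => ?_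
  have h0 : zetaR x l ≠ 0 := by rw [zetaR_eq]; exact hx l
  rw [dz_single, ← Finset.mul_prod_erase _ _ (Finset.mem_univ l), cofR, ← zetaR_eq]
  simp only [zetaR_eq] at h0 ⊢
  field_simp

/-- For each `l`, an integral point of the hypersurface `ζ_l = 0` outside the other ones. -/
def divPt (l : Fin 10) : Fin 5 → ℤ :=
  ![![0, 3, 5, 7, 11], ![2, 0, 5, 7, 11], ![2, 3, 0, 7, 11], ![2, 3, 5, 0, 11], ![2, 3, 5, 7, 0],
    ![2, 3, 5, 54, 11], ![32, 3, 5, 7, 11], ![2, 3, 20, 7, 11], ![2, 3, 5, 7, 13],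
    ![2, 9, 5, 7, 11]] l

/-- The forms `dζ_l / ζ_l` are linearly independent: they have different poles. -/
theorem eq_zero_of_numer {p : Fin 10 → ℂ}
    (h : ∀ i, numer (fun j => (MvPolynomial.X j : MvPolynomial (Fin 5) ℂ))
      (fun l => MvPolynomial.C (p l)) i = 0) : p = 0 := by
  ext l
  have h0 : ∀ l, zetaR (divPt l) l = 0 := by decide +kernel
  have h1 : ∀ l, ∃ i, partR (divPt l) l i * cofR (divPt l) l ≠ 0 := by decide +kernel
  obtain ⟨i, hi⟩ := h1 l
  have h2 := congrArg (MvPolynomial.eval fun j => (Int.castRingHom ℂ) (divPt l j)) (h i)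
  rw [map_numer, map_zero] at h2
  simp only [MvPolynomial.eval_X, MvPolynomial.eval_C] at h2
  rw [numer, Finset.sum_eq_single l ?_ (by simp)] at h2
  · refine (mul_eq_zero.1 h2).resolve_right ?_
    rw [← map_partR, ← map_cofR, ← map_mul]
    rw [eq_intCast]
    exact_mod_cast hi
  · intro k _ hk
    rw [cofR, Finset.prod_eq_zero (Finset.mem_erase.2 ⟨hk.symm, Finset.mem_univ l⟩), mul_zero,
      mul_zero]
    rw [← map_zetaR, h0 l, map_zero]

/-- The forms `Log ζ_k dζ_l / ζ_l` are linearly independent modulo the rational forms. -/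
theorem LogSys.quad_eq_zero {X : Set Y5} {L : Fin 10 → Y5 → ℂ} (h : LogSys X L) {p : Fin 10 → ℂ}
    {M : Fin 10 → Fin 10 → ℂ}
    (H : ∀ i : Fin 5, ∃ a b : MvPolynomial (Fin 5) ℂ, b ≠ 0 ∧ ∀ x ∈ X, MvPolynomial.eval x b *
      ∑ l, (p l + ∑ k, M k l * L k x) * dz l x (Pi.single i 1) = MvPolynomial.eval x a) :
    M = 0 := by
  ext k : 1
  refine eq_zero_of_numer fun i => ?_
  obtain ⟨a, b, hb, hab⟩ := H i
  have h1 := h.indep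
    (fun k => b * numer (fun j => MvPolynomial.X j) (fun l => MvPolynomial.C (M k l)) i)
    (a * ∏ k, zetaR (fun j => MvPolynomial.X j) k -
      b * numer (fun j => MvPolynomial.X j) (fun l => MvPolynomial.C (p l)) i) (fun x hx => ?_) k
  · exact (mul_eq_zero.1 h1).resolve_left hb
  · simp only [map_mul, map_sub, map_numer, MvPolynomial.eval_X, MvPolynomial.eval_C, map_prod,
      map_zetaR]
    rw [← hab x hx]
    simp only [numer_eq (h.sub hx), zetaR_eq, add_mul, Finset.sum_add_distrib, Finset.sum_mul,
      Finset.mul_sum, mul_add]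
    rw [eq_sub_iff_add_eq, add_comm]
    congr 1
    · exact Finset.sum_congr rfl fun _ _ => by ring
    · rw [Finset.sum_comm]
      exact Finset.sum_congr rfl fun _ _ => Finset.sum_congr rfl fun _ _ => by ring

/-- The forms `dζ_l / ζ_l` and `Log ζ_k dζ_l / ζ_l` are linearly independent. -/
theorem LogSys.form_indep {X : Set Y5} {L : Fin 10 → Y5 → ℂ} (h : LogSys X L) {p : Fin 10 → ℂ}
    {M : Fin 10 → Fin 10 → ℂ}
    (H : ∀ x ∈ X, ∀ v, ∑ l, (p l + ∑ k, M k l * L k x) * dz l x v = 0) : p = 0 ∧ M = 0 := by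
  have hM : M = 0 := h.quad_eq_zero (p := p) fun i =>
    ⟨0, 1, one_ne_zero, fun x hx => by rw [H x hx, mul_zero, map_zero]⟩
  refine ⟨eq_zero_of_numer fun i => h.dense _ fun x hx => ?_, hM⟩
  simp only [map_numer, MvPolynomial.eval_X, MvPolynomial.eval_C]
  rw [numer_eq (h.sub hx)]
  have := H x hx (Pi.single i 1)
  simp only [hM, Pi.zero_apply, zero_mul, Finset.sum_const_zero, add_zero] at this
  rw [this, mul_zero]

/-- Coefficients of `∑ₛ c_{f,s} d Log U_{f,s}` on the forms `dζ_l / ζ_l`. -/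
def linCo (c : Fol → Fin 3 → ℂ) (f : Fol) (l : Fin 10) : ℂ := ∑ s, c f s * expo f s l

/-- Coefficients of `∑ c_{f,a,b} Log U_{f,a} d Log U_{f,b}` on the forms `Log ζ_k dζ_l / ζ_l`. -/
def quadCo (c : Fol → Fin 3 → Fin 3 → ℂ) (f : Fol) (k l : Fin 10) : ℂ :=
  ∑ a, ∑ b, c f a b * expo f a k * expo f b l

theorem nullity_expo : ∀ f : Fol, nullity [0, 1, 2].length
    (((List.finRange 10).map fun l s => expoTab f s l).map fun g => [0, 1, 2].map g) = 0 := by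
  decide +kernel

theorem expo_indep {f : Fol} {c : Fin 3 → ℂ} (h : ∀ l, ∑ s, c s * expo f s l = 0) : c = 0 := by
  refine eq_zero_of_nullity [0, 1, 2] (by decide) (by decide)
    ((List.finRange 10).map fun l s => expoTab f s l) (nullity_expo f) c fun g hg => ?_
  obtain ⟨l, -, rfl⟩ := List.mem_map.1 hg
  rw [← h l]
  exact Finset.sum_congr rfl fun s _ => by rw [expo_eq, mul_comm]

theorem eq_zero_of_linCo {c : Fol → Fin 3 → ℂ} {f : Fol} (h : linCo c f = 0) : c f = 0 :=
  expo_indep fun l => congrFun h l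

theorem eq_zero_of_quadCo {c : Fol → Fin 3 → Fin 3 → ℂ} {f : Fol} (h : quadCo c f = 0) :
    c f = 0 := by
  have h1 (l : Fin 10) : (fun a => ∑ b, c f a b * expo f b l) = 0 := by
    refine expo_indep (f := f) fun k => ?_
    have h0 : quadCo c f k l = 0 := congrFun (congrFun h k) l
    rw [← h0, quadCo]
    refine Finset.sum_congr rfl fun a _ => ?_
    rw [Finset.sum_mul]
    exact Finset.sum_congr rfl fun b _ => by ring
  ext a : 1
  exact expo_indep fun l => congrFun (h1 l) a

theorem oneForm_apply (a : Y5 →L[ℂ] ℂ) (v : Fin 1 → Y5) : oneForm a v = a (v 0) := by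
  simp [oneForm]

theorem tuple0_apply {D : Set Y5} {x : Y5} (hx : x ∈ D) (hY : x ∈ Ystar) (c : Fol → Fin 3 → ℂ)
    (f : Fol) (v : Fin 1 → Y5) : tuple0 D c f x v = ∑ l, linCo c f l * dz l x (v 0) := by
  simp only [tuple0, Set.indicator_of_mem hx, oneForm_apply, sum_apply, smul_apply,
    dlogU_eq_sum hY, linCo, smul_eq_mul, Finset.mul_sum, Finset.sum_mul]
  rw [Finset.sum_comm]
  exact Finset.sum_congr rfl fun _ _ => Finset.sum_congr rfl fun _ _ => by ring

theorem tuple1_apply {D : Set Y5} {x : Y5} (hx : x ∈ D) (hY : x ∈ Ystar) (L : Fin 10 → Y5 → ℂ)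
    (c : Fol → Fin 3 → Fin 3 → ℂ) (f : Fol) (v : Fin 1 → Y5) :
    tuple1 D L c f x v = ∑ l, (∑ k, quadCo c f k l * L k x) * dz l x (v 0) := by
  simp only [tuple1, Set.indicator_of_mem hx, oneForm_apply, sum_apply, smul_apply,
    dlogU_eq_sum hY, quadCo, smul_eq_mul, Finset.mul_sum, Finset.sum_mul, logU_eq_sum,
    zsmul_eq_mul]
  calc _ = ∑ a, ∑ b, ∑ l, ∑ k, c f a b * (expo f a k * L k x) * (expo f b l * dz l x (v 0)) := rfl
    _ = ∑ l, ∑ k, ∑ a, ∑ b, c f a b * (expo f a k * L k x) * (expo f b l * dz l x (v 0)) := by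
      simp only [Finset.sum_comm (γ := Fin 3) (α := Fin 10)]
    _ = _ := Finset.sum_congr rfl fun _ _ => Finset.sum_congr rfl fun _ _ =>
      Finset.sum_congr rfl fun _ _ => Finset.sum_congr rfl fun _ _ => by ring

/-- The coefficients of weight `0` such that the sum of the components is zero. -/
def K0 : Submodule ℂ (Fol → Fin 3 → ℂ) where
  carrier := {c | ∀ l, ∑ f, linCo c f l = 0}
  zero_mem' l := by simp [linCo]
  add_mem' ha hb l := by
    have := congrArg₂ (· + ·) (ha l) (hb l)
    simpa [linCo, add_mul, Finset.sum_add_distrib] using this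
  smul_mem' t a ha l := by
    have := congrArg (t * ·) (ha l)
    simpa [linCo, Finset.mul_sum, mul_assoc] using this

/-- The coefficients of weight `1` such that the sum of the components is zero. -/
def K1 : Submodule ℂ (Fol → Fin 3 → Fin 3 → ℂ) where
  carrier := {c | ∀ k l, ∑ f, quadCo c f k l = 0}
  zero_mem' k l := by simp [quadCo]
  add_mem' ha hb k l := by
    have := congrArg₂ (· + ·) (ha k l) (hb k l)
    simpa [quadCo, add_mul, Finset.sum_add_distrib] using this
  smul_mem' t a ha k l := by
    have := congrArg (t * ·) (ha k l)
    simpa [quadCo, Finset.mul_sum, mul_assoc] using this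

section

variable {X D : Set Y5} {L : Fin 10 → Y5 → ℂ} (h : LogSys X L) (hXD : X ⊆ D) (hDY : D ⊆ Ystar)
include hXD hDY

theorem logTuple_apply {x : Y5} (hx : x ∈ X) (c₀ : Fol → Fin 3 → ℂ)
    (c₁ : Fol → Fin 3 → Fin 3 → ℂ) (f : Fol) (v : Fin 1 → Y5) :
    (tuple0 D c₀ + tuple1 D L c₁) f x v =
      ∑ l, (linCo c₀ f l + ∑ k, quadCo c₁ f k l * L k x) * dz l x (v 0) := by
  have : (tuple0 D c₀ + tuple1 D L c₁) f x v = tuple0 D c₀ f x v + tuple1 D L c₁ f x v := rfl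
  rw [this, tuple0_apply (hXD hx) (hDY (hXD hx)), tuple1_apply (hXD hx) (hDY (hXD hx)),
    ← Finset.sum_add_distrib]
  exact Finset.sum_congr rfl fun _ _ => by ring

include h

/-- A component of a logarithmic tuple determines its coefficients. -/
theorem logTuple_eq_zero {c₀ : Fol → Fin 3 → ℂ} {c₁ : Fol → Fin 3 → Fin 3 → ℂ} {f : Fol}
    (H : (tuple0 D c₀ + tuple1 D L c₁) f = 0) : c₀ f = 0 ∧ c₁ f = 0 := by
  obtain ⟨h1, h2⟩ := h.form_indep (p := linCo c₀ f) (M := quadCo c₁ f) fun x hx v => by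
    have := logTuple_apply (L := L) hXD hDY hx c₀ c₁ f ![v]
    rw [H] at this
    exact this.symm
  exact ⟨eq_zero_of_linCo h1, eq_zero_of_quadCo h2⟩

/-- A logarithmic tuple determines its coefficients. -/
theorem logTuple_injective {c₀ d₀ : Fol → Fin 3 → ℂ} {c₁ d₁ : Fol → Fin 3 → Fin 3 → ℂ}
    (H : tuple0 D c₀ + tuple1 D L c₁ = tuple0 D d₀ + tuple1 D L d₁) : c₀ = d₀ ∧ c₁ = d₁ := by
  have h1 (f : Fol) : linCo c₀ f - linCo d₀ f = 0 ∧ quadCo c₁ f - quadCo d₁ f = 0 := by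
    refine h.form_indep fun x hx v => ?_
    have h2 := logTuple_apply (L := L) hXD hDY hx c₀ c₁ f ![v]
    rw [H, logTuple_apply hXD hDY hx d₀ d₁ f ![v], ← sub_eq_zero, ← Finset.sum_sub_distrib] at h2
    rw [← neg_eq_zero, ← h2, ← Finset.sum_neg_distrib]
    refine Finset.sum_congr rfl fun l _ => ?_
    simp only [Pi.sub_apply, sub_mul, Finset.sum_sub_distrib, Matrix.cons_val_fin_one]
    ring
  have h2 (f : Fol) : (c₀ - d₀) f = 0 := eq_zero_of_linCo <| by
    ext l
    have := congrFun (h1 f).1 l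
    simpa [linCo, sub_mul, Finset.sum_sub_distrib] using this
  have h3 (f : Fol) : (c₁ - d₁) f = 0 := eq_zero_of_quadCo <| by
    ext k l
    have := congrFun (congrFun (h1 f).2 k) l
    simpa [quadCo, sub_mul, Finset.sum_sub_distrib] using this
  exact ⟨sub_eq_zero.1 (funext h2), sub_eq_zero.1 (funext h3)⟩

/-- A rational logarithmic tuple is of weight `0`. -/
theorem eq_zero_of_isRationalOn {c₀ : Fol → Fin 3 → ℂ} {c₁ : Fol → Fin 3 → Fin 3 → ℂ}
    (H : IsRationalOn D (tuple0 D c₀ + tuple1 D L c₁)) : c₁ = 0 := by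
  ext f : 1
  refine eq_zero_of_quadCo (h.quad_eq_zero (p := linCo c₀ f) fun i => ?_)
  obtain ⟨a, b, hb, hab⟩ := H f ![Pi.single i 1]
  refine ⟨a, b, hb, fun x hx => ?_⟩
  rw [← hab x (hXD hx), logTuple_apply hXD hDY hx]
  rfl

/-- The sum of the components vanishes if and only if the coefficients satisfy linear equations. -/
theorem sum_logTuple_eq_zero_iff (c₀ : Fol → Fin 3 → ℂ) (c₁ : Fol → Fin 3 → Fin 3 → ℂ) :
    (∀ x ∈ X, ∑ f, (tuple0 D c₀ + tuple1 D L c₁) f x = 0) ↔ c₀ ∈ K0 ∧ c₁ ∈ K1 := by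
  have key (x : Y5) (hx : x ∈ X) (v : Fin 1 → Y5) :
      (∑ f, (tuple0 D c₀ + tuple1 D L c₁) f x) v =
        ∑ l, (∑ f, linCo c₀ f l + ∑ k, (∑ f, quadCo c₁ f k l) * L k x) * dz l x (v 0) := by
    rw [ContinuousAlternatingMap.sum_apply]
    simp only [logTuple_apply hXD hDY hx]
    rw [Finset.sum_comm]
    refine Finset.sum_congr rfl fun l _ => ?_
    rw [← Finset.sum_mul, Finset.sum_add_distrib, Finset.sum_comm]
    simp only [Finset.sum_mul]
  constructor
  · intro H
    obtain ⟨h1, h2⟩ := h.form_indep (p := fun l => ∑ f, linCo c₀ f l)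
      (M := fun k l => ∑ f, quadCo c₁ f k l) fun x hx v => by
        have := key x hx ![v]
        rw [H x hx] at this
        exact this.symm
    exact ⟨fun l => congrFun h1 l, fun k l => congrFun (congrFun h2 k) l⟩
  · rintro ⟨h0, h1⟩ x hx
    ext v
    rw [key x hx]
    simp only [h0 _, h1 _ _, zero_mul, Finset.sum_const_zero, add_zero]
    rfl

end

end

section

/-! ### Logarithmic abelian relations -/

/-- A domain on which the `ζ_k` have logarithms `L_k`. -/
structure LogDom (D : Set Y5) (L : Fin 10 → Y5 → ℂ) : Prop where
  isOpen : IsOpen D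
  conn : IsConnected D
  analytic : ∀ k, AnalyticOnNhd ℂ (L k) D
  exp : ∀ k, ∀ x ∈ D, Complex.exp (L k x) = zeta k x

theorem dlogU_two_apply {x : Y5} (hx : x ∈ Ystar) (f : Fol) (v : Y5) :
    U f x 2 * dlogU f 2 x v = U f x 0 * dlogU f 0 x v - U f x 1 * dlogU f 1 x v := by
  have hU (s : Fin 3) : DifferentiableAt ℂ (fun y => U f y s) x := (analyticAt_U hx f s).differentiableAt
  have h2 : fderiv ℂ (fun y => U f y 2) x v
      = fderiv ℂ (fun y => U f y 0) x v - fderiv ℂ (fun y => U f y 1) x v := by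
    have : (fun y => U f y 2) = fun y => 1 + U f y 0 - U f y 1 := rfl
    rw [this, fderiv_fun_sub ((hU 0).const_add 1) (hU 1), fderiv_const_add]; rfl
  have h (s : Fin 3) : U f x s * dlogU f s x v = fderiv ℂ (fun y => U f y s) x v := by
    simp [dlogU, U_ne_zero hx f s]
  rw [h, h, h, h2]

theorem dlogU_eq_zero_of_tangent {x : Y5} (hx : x ∈ Ystar) {f : Fol} {v : Y5}
    (h : fderiv ℂ (U f) x v = 0) (s : Fin 3) : dlogU f s x v = 0 := by
  obtain ⟨h0, h1⟩ := (tangent_iff hx f v).1 h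
  have h2 := dlogU_two_apply hx f v
  rw [h0, h1, mul_zero, mul_zero, sub_zero] at h2
  fin_cases s
  · exact h0
  · exact h1
  · exact (mul_eq_zero.1 h2).resolve_left (U_ne_zero hx f 2)

/-- The tuple on `D` with components `∑ c_{f,a,b} d Log U_{f,a} ∧ d Log U_{f,b}`. -/
def tuple2 (D : Set Y5) (c : Fol → Fin 3 → Fin 3 → ℂ) : Tuple 2 :=
  fun f => D.indicator fun x => ∑ a, ∑ b, c f a b • wedge (dlogU f a x) (dlogU f b x)

/-- The identification of the linear forms with the alternating forms of degree one. -/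
def oneFormCLM : (Y5 →L[ℂ] ℂ) →L[ℂ] (Y5 [⋀^Fin 1]→L[ℂ] ℂ) :=
  (ContinuousAlternatingMap.ofSubsingletonLIE (𝕜 := ℂ) (E := Y5) (F := ℂ)
    (0 : Fin 1)).toContinuousLinearEquiv.toContinuousLinearMap

theorem oneFormCLM_apply (a : Y5 →L[ℂ] ℂ) : oneFormCLM a = oneForm a := rfl

/-- The linear form underlying a component of a logarithmic tuple. -/
def logForm (L : Fin 10 → Y5 → ℂ) (c₀ : Fol → Fin 3 → ℂ) (c₁ : Fol → Fin 3 → Fin 3 → ℂ) (f : Fol)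
    (x : Y5) : Y5 →L[ℂ] ℂ :=
  ∑ s, c₀ f s • dlogU f s x + ∑ a, ∑ b, (c₁ f a b * logU (fun k => L k x) f a) • dlogU f b x

theorem logTuple_eq {D : Set Y5} {x : Y5} (hx : x ∈ D) (L : Fin 10 → Y5 → ℂ)
    (c₀ : Fol → Fin 3 → ℂ) (c₁ : Fol → Fin 3 → Fin 3 → ℂ) (f : Fol) :
    (tuple0 D c₀ + tuple1 D L c₁) f x = oneForm (logForm L c₀ c₁ f x) := by
  rw [← oneFormCLM_apply, logForm, map_add]
  change tuple0 D c₀ f x + tuple1 D L c₁ f x = _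
  rw [tuple0, tuple1, Set.indicator_of_mem hx, Set.indicator_of_mem hx]
  rfl

/-- The identification of the numbers with the alternating forms of degree zero. -/
def zeroFormCLM : ℂ →L[ℂ] (Y5 [⋀^Fin 0]→L[ℂ] ℂ) :=
  LinearMap.toContinuousLinearMap
    { toFun := ContinuousAlternatingMap.constOfIsEmpty ℂ Y5 (Fin 0)
      map_add' := fun _ _ => rfl
      map_smul' := fun _ _ => rfl }

namespace LogDom

variable {D : Set Y5} {L : Fin 10 → Y5 → ℂ} (h : LogDom D L)
include h

theorem logSys : LogSys D L := logSys_of_exp h.isOpen h.conn.1 h.analytic h.exp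

theorem sub : D ⊆ Ystar := h.logSys.sub

theorem hasFDerivAt_logU {x : Y5} (hx : x ∈ D) (f : Fol) (s : Fin 3) :
    HasFDerivAt (fun y => logU (fun k => L k y) f s) (dlogU f s x) x := by
  rw [dlogU_eq_sum (h.sub hx)]
  simp only [logU_eq_sum, zsmul_eq_mul]
  refine HasFDerivAt.fun_sum fun k _ => ?_
  rw [← fderiv_log_eq (h.analytic k x hx).differentiableAt
    (by filter_upwards [h.isOpen.mem_nhds hx] with y hy using h.exp k y hy)]
  exact (h.analytic k x hx).differentiableAt.hasFDerivAt.const_mul _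

theorem hasFDerivAt_form {x : Y5} (hx : x ∈ D) (c₀ : Fol → Fin 3 → ℂ)
    (c₁ : Fol → Fin 3 → Fin 3 → ℂ) (f : Fol) :
    HasFDerivAt (logForm L c₀ c₁ f)
      (∑ s, c₀ f s • fderiv ℂ (dlogU f s) x +
        ∑ a, ∑ b, ((c₁ f a b * logU (fun k => L k x) f a) • fderiv ℂ (dlogU f b) x +
          (c₁ f a b • dlogU f a x).smulRight (dlogU f b x))) x := by
  have hd (s : Fin 3) := (analyticOnNhd_dlogU f s x (h.sub hx)).differentiableAt.hasFDerivAt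
  refine (HasFDerivAt.fun_sum fun s _ => (hd s).fun_const_smul _).add
    (HasFDerivAt.fun_sum fun a _ => HasFDerivAt.fun_sum fun b _ => ?_)
  exact ((h.hasFDerivAt_logU hx f a).const_mul (c₁ f a b)).smul (hd b)

theorem analyticOnNhd_logTuple (c₀ : Fol → Fin 3 → ℂ) (c₁ : Fol → Fin 3 → Fin 3 → ℂ) (f : Fol) :
    AnalyticOnNhd ℂ ((tuple0 D c₀ + tuple1 D L c₁) f) D := by
  intro x hx
  refine AnalyticAt.congr (f := fun x => oneFormCLM (logForm L c₀ c₁ f x))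
    ((oneFormCLM.analyticAt _).comp ?_) (by
      filter_upwards [h.isOpen.mem_nhds hx] with y hy using (logTuple_eq hy L c₀ c₁ f).symm)
  have hd (s : Fin 3) := analyticOnNhd_dlogU f s x (h.sub hx)
  refine AnalyticAt.fun_add (Finset.analyticAt_fun_sum _ fun s _ =>
    (analyticAt_const (v := c₀ f s)).fun_smul (hd s))
    (Finset.analyticAt_fun_sum _ fun a _ => Finset.analyticAt_fun_sum _ fun b _ => ?_)
  exact (analyticAt_const.mul (analyticAt_logU (fun k => h.analytic k x hx) f a)).fun_smul (hd b)

theorem extDeriv_logTuple {x : Y5} (hx : x ∈ D) (c₀ : Fol → Fin 3 → ℂ)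
    (c₁ : Fol → Fin 3 → Fin 3 → ℂ) (f : Fol) :
    extDeriv ((tuple0 D c₀ + tuple1 D L c₁) f) x = tuple2 D c₁ f x := by
  rw [tuple2, Set.indicator_of_mem hx]
  ext v
  have hv : v = ![v 0, v 1] := by ext i; fin_cases i <;> rfl
  have hcov : cov ((tuple0 D c₀ + tuple1 D L c₁) f) =ᶠ[nhds x]
      logForm L c₀ c₁ f := by
    filter_upwards [h.isOpen.mem_nhds hx] with y hy
    ext w
    rw [cov_apply, logTuple_eq hy, oneForm_apply]
    rfl
  rw [hv, extDeriv_one_apply (h.analyticOnNhd_logTuple c₀ c₁ f x hx).differentiableAt,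
    hcov.fderiv_eq, (h.hasFDerivAt_form hx c₀ c₁ f).fderiv]
  simp only [add_apply, sum_apply, smul_apply, ContinuousLinearMap.smulRight_apply,
    ContinuousAlternatingMap.sum_apply, ContinuousAlternatingMap.smul_apply, wedge_apply,
    smul_eq_mul, fderiv_dlogU_symm (h.sub hx) f _ (v 0) (v 1)]
  rw [add_sub_add_left_eq_sub, ← Finset.sum_sub_distrib]
  refine Finset.sum_congr rfl fun a _ => ?_
  rw [← Finset.sum_sub_distrib]
  exact Finset.sum_congr rfl fun b _ => by ring

theorem totalD_logTuple (c₀ : Fol → Fin 3 → ℂ) (c₁ : Fol → Fin 3 → Fin 3 → ℂ) :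
    totalD D (tuple0 D c₀ + tuple1 D L c₁) = tuple2 D c₁ := by
  ext f x : 2
  by_cases hx : x ∈ D
  · rw [totalD, Set.indicator_of_mem hx, h.extDeriv_logTuple hx]
  · rw [totalD, tuple2, Set.indicator_of_notMem hx, Set.indicator_of_notMem hx]

/-- Logarithmic tuples whose coefficients satisfy the linear equations are abelian relations. -/
theorem logTuple_mem_AR {c₀ : Fol → Fin 3 → ℂ} {c₁ : Fol → Fin 3 → Fin 3 → ℂ} (h0 : c₀ ∈ K0)
    (h1 : c₁ ∈ K1) {I : Finset Fol} (hI : ∀ f ∉ I, c₀ f = 0 ∧ c₁ f = 0) :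
    tuple0 D c₀ + tuple1 D L c₁ ∈ AR 1 D I := by
  have hout (f : Fol) (x : Y5) (hx : x ∉ D) : (tuple0 D c₀ + tuple1 D L c₁) f x = 0 := by
    change tuple0 D c₀ f x + tuple1 D L c₁ f x = 0
    rw [tuple0, tuple1, Set.indicator_of_notMem hx, Set.indicator_of_notMem hx, add_zero]
  refine ⟨h.analyticOnNhd_logTuple c₀ c₁, hout, fun f hf => ?_, fun f x hx v hv => ?_,
    fun f x hx v hv => ?_, fun x => ?_⟩
  · ext x : 1
    by_cases hx : x ∈ D
    · ext v
      rw [logTuple_eq hx, oneForm_apply, logForm, (hI f hf).1, (hI f hf).2]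
      simp
    · exact hout f x hx
  · obtain ⟨j, hj⟩ := hv
    rw [Fin.fin_one_eq_zero j] at hj
    rw [logTuple_eq hx, oneForm_apply]
    simp [logForm, dlogU_eq_zero_of_tangent (h.sub hx) hj]
  · obtain ⟨j, hj⟩ := hv
    have hv : v = ![v 0, v 1] := by ext i; fin_cases i <;> rfl
    rw [h.extDeriv_logTuple hx, tuple2, Set.indicator_of_mem hx, hv]
    simp only [ContinuousAlternatingMap.sum_apply, ContinuousAlternatingMap.smul_apply, wedge_apply]
    have := dlogU_eq_zero_of_tangent (h.sub hx) hj
    fin_cases j <;> simp at this <;> simp [this]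
  · by_cases hx : x ∈ D
    · exact (sum_logTuple_eq_zero_iff h.logSys subset_rfl h.sub c₀ c₁).2 ⟨h0, h1⟩ x hx
    · exact Finset.sum_eq_zero fun f _ => hout f x hx

/-- Conversely, the coefficients of a logarithmic abelian relation of a subweb belong to `K0`,
`K1` and vanish outside the subweb. -/
theorem mem_of_logTuple_mem_AR {c₀ : Fol → Fin 3 → ℂ} {c₁ : Fol → Fin 3 → Fin 3 → ℂ}
    {I : Finset Fol} (H : tuple0 D c₀ + tuple1 D L c₁ ∈ AR 1 D I) :
    (c₀ ∈ K0 ∧ c₁ ∈ K1) ∧ ∀ f ∉ I, c₀ f = 0 ∧ c₁ f = 0 :=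
  ⟨(sum_logTuple_eq_zero_iff h.logSys subset_rfl h.sub c₀ c₁).1 fun x _ => H.2.2.2.2.2 x,
    fun f hf => logTuple_eq_zero h.logSys subset_rfl h.sub (H.2.2.1 f hf)⟩

/-- Logarithmic abelian relations with symmetric coefficients are exact. -/
theorem exists_primitive {c₀ : Fol → Fin 3 → ℂ} {c₁ : Fol → Fin 3 → Fin 3 → ℂ} (h0 : c₀ ∈ K0)
    (h1 : c₁ ∈ K1) (hs : ∀ f a b, c₁ f a b = c₁ f b a) :
    ∃ θ ∈ AR 0 D Finset.univ, totalD D θ = tuple0 D c₀ + tuple1 D L c₁ := by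
  let g (f : Fol) (x : Y5) : ℂ := ∑ s, c₀ f s * logU (fun k => L k x) f s +
    ∑ a, ∑ b, c₁ f a b / 2 * (logU (fun k => L k x) f a * logU (fun k => L k x) f b)
  have hg (f : Fol) {x : Y5} (hx : x ∈ D) : HasFDerivAt (g f) (logForm L c₀ c₁ f x) x := by
    have hd := h.hasFDerivAt_logU hx f
    have h2 : HasFDerivAt (g f) (∑ s, c₀ f s • dlogU f s x + ∑ a, ∑ b, (c₁ f a b / 2) •
        (logU (fun k => L k x) f a • dlogU f b x + logU (fun k => L k x) f b • dlogU f a x)) x :=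
      (HasFDerivAt.fun_sum fun s _ => (hd s).const_mul _).add
      (HasFDerivAt.fun_sum fun a _ => HasFDerivAt.fun_sum fun b _ =>
        ((hd a).mul (hd b)).const_mul (c₁ f a b / 2))
    convert h2 using 1
    rw [logForm]
    congr 1
    simp only [smul_add, Finset.sum_add_distrib]
    rw [Finset.sum_comm (f := fun a b =>
      (c₁ f a b / 2) • (logU (fun k => L k x) f b • dlogU f a x))]
    simp only [← Finset.sum_add_distrib]
    refine Finset.sum_congr rfl fun a _ => Finset.sum_congr rfl fun b _ => ?_
    rw [hs f b a, ← smul_add, ← two_smul ℂ (logU (fun k => L k x) f a • dlogU f b x), smul_smul,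
      smul_smul]
    congr 1
    ring
  let θ : Tuple 0 := fun f => D.indicator fun x =>
    ContinuousAlternatingMap.constOfIsEmpty ℂ Y5 (Fin 0) (g f x)
  have hθ (f : Fol) {x : Y5} (hx : x ∈ D) : θ f x = zeroFormCLM (g f x) :=
    Set.indicator_of_mem hx _
  have hext (f : Fol) {x : Y5} (hx : x ∈ D) :
      extDeriv (θ f) x = (tuple0 D c₀ + tuple1 D L c₁) f x := by
    have e : θ f =ᶠ[nhds x] fun x => ContinuousAlternatingMap.constOfIsEmpty ℂ Y5 (Fin 0) (g f x) :=
      Filter.eventuallyEq_of_mem (h.isOpen.mem_nhds hx) fun y hy => hθ f hy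
    rw [Filter.EventuallyEq.extDeriv_eq e, extDeriv_constOfIsEmpty, (hg f hx).fderiv,
      logTuple_eq hx]
    rfl
  have hAR := h.logTuple_mem_AR h0 h1 (I := Finset.univ) (by simp)
  refine ⟨θ, ⟨fun f => ?_, fun f x hx => Set.indicator_of_notMem hx _, by simp,
    fun f x hx v ⟨j, _⟩ => j.elim0, fun f x hx v hv => ?_, fun x => ?_⟩, ?_⟩
  · intro x hx
    have hl := analyticAt_logU (fun k => h.analytic k x hx) f
    have h3 : AnalyticAt ℂ (g f) x := AnalyticAt.fun_add
      (Finset.analyticAt_fun_sum _ fun s _ => analyticAt_const.mul (hl s))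
      (Finset.analyticAt_fun_sum _ fun a _ => Finset.analyticAt_fun_sum _ fun b _ =>
        analyticAt_const.mul ((hl a).mul (hl b)))
    exact ((zeroFormCLM.analyticAt _).comp h3).congr
      (Filter.eventuallyEq_of_mem (h.isOpen.mem_nhds hx) fun y hy => (hθ f hy).symm)
  · rw [hext f hx]
    exact hAR.2.2.2.1 f x hx v hv
  · by_cases hx : x ∈ D
    · have e0 : ∑ f, ∑ s, c₀ f s * logU (fun k => L k x) f s = 0 := by
        calc _ = ∑ k, (∑ f, linCo c₀ f k) * L k x := by
              simp only [linCo, Finset.sum_mul, logU_eq_sum, zsmul_eq_mul, Finset.mul_sum]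
              simp only [Finset.sum_comm (γ := Fin 3) (α := Fin 10),
                Finset.sum_comm (γ := Fol) (α := Fin 10), mul_assoc]
          _ = 0 := by simp [h0 _]
      have e1 : ∑ f, ∑ a, ∑ b, c₁ f a b / 2 *
          (logU (fun k => L k x) f a * logU (fun k => L k x) f b) = 0 := by
        calc _ = ∑ k, ∑ l, (∑ f, quadCo c₁ f l k) * (L l x * L k x / 2) := by
              simp only [quadCo, Finset.sum_mul, logU_eq_sum, zsmul_eq_mul, Finset.mul_sum]
              simp only [Finset.sum_comm (γ := Fin 3) (α := Fin 10),
                Finset.sum_comm (γ := Fol) (α := Fin 10)]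
              refine Finset.sum_congr rfl fun k _ => Finset.sum_congr rfl fun l _ =>
                Finset.sum_congr rfl fun f _ => Finset.sum_congr rfl fun a _ =>
                Finset.sum_congr rfl fun b _ => ?_
              ring
          _ = 0 := by simp [h1 _ _]
      simp only [hθ _ hx, ← map_sum]
      rw [show ∑ f, g f x = 0 by simp only [g, Finset.sum_add_distrib, e0, e1, add_zero], map_zero]
    · exact Finset.sum_eq_zero fun f _ => Set.indicator_of_notMem hx _
  · ext f x : 2
    by_cases hx : x ∈ D
    · rw [totalD, Set.indicator_of_mem hx, hext f hx]
    · rw [totalD, Set.indicator_of_notMem hx, hAR.2.1 f x hx]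

end LogDom

end

/-! ### Explicit coefficients -/

/-- The `i`-th digit in base `3` of `n`, shifted so as to be in `{-1, 0, 1}`. -/
def trit (n i : ℕ) : ℤ := ((n / 3 ^ i % 3 : ℕ) : ℤ) - 1

theorem trit_mem (n i : ℕ) : trit n i ∈ ({-1, 0, 1} : Set ℤ) := by
  have : n / 3 ^ i % 3 < 3 := Nat.mod_lt _ (by norm_num)
  rw [trit]
  interval_cases n / 3 ^ i % 3 <;> simp

/-- Numbering of the foliations. -/
def folIdx (f : Fol) : ℕ := f.1 + if f.2 = 1 then 0 else 5

/-- Weight `0` coefficients encoded by the base `3` digits of `n`. -/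
def dec0 (n : ℕ) (f : Fol) (s : Fin 3) : ℤ := trit n (3 * folIdx f + s)

/-- Weight `1` coefficients, for the pairs `a < b`, encoded by the base `3` digits of `n`. -/
def dec1 (n : ℕ) (f : Fol) (a b : Fin 3) : ℤ :=
  if a < b then trit n (3 * folIdx f + (a + b - 1)) else 0

theorem isSmall_dec1 (n : ℕ) : IsSmall (dec1 n) := fun f a b => by
  rw [dec1]; split_ifs
  · exact trit_mem _ _
  · simp

/-- Codes of a basis of the abelian relations of weight `0`: for each triple `a < b < c`, the
images of the Specht polynomials `x_a x_b x_c (x_a² - x_b²)` and `x_a x_b x_c (x_b² - x_c²)`. -/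
def codes0 : List ℕ :=
  [102947431405104, 102995930707384, 102949669834440, 104353452006232, 102942954546068,
    141076262758666, 103060529482196, 105937226854888, 102872501407788, 186900355013854,
    100968630898716, 51543386825476, 103016076571408, 104849350197592, 102834763779748,
    156439808615398, 99840778032100, 22170712984420, 101585720036164, 66229723746004]

/-- Codes of a basis of the antisymmetric abelian relations of weight `1`. -/
def codesA : List ℕ :=
  [58823793162148, 117629578444756, 26669450645032, 100222000199464, 176377164556516,
    87589797298728, 102401484229616, 148695417052520, 104640889291224, 103006089732832]

/-- Codes of a basis of the symmetric abelian relations of weight `1`. -/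
def codesS : List ℕ :=
  [103006089741268, 104640889527524, 102401512851596, 148702138718756, 87778024148108]

/-- A basis of the space of weight `0` coefficients. -/
def base0 (j : Fin 20) : Fol → Fin 3 → ℤ := dec0 (codes0.getD j 0)

/-- A basis of the space of symmetric weight `1` coefficients. -/
def baseS (j : Fin 5) : Fol → Fin 3 → Fin 3 → ℤ := dec1 (codesS.getD j 0)

/-- A basis of the space of antisymmetric weight `1` coefficients. -/
def baseA (j : Fin 10) : Fol → Fin 3 → Fin 3 → ℤ := dec1 (codesA.getD j 0)

/-- The number with binary digits `ε_i = -1`. -/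
def mask (ε : Fin 5 → ℤˣ) : ℕ := ∑ i, if ε i = 1 then 0 else 2 ^ (i : ℕ)

/-- Codes of the residues, in the order given by `mask`. -/
def codesRes : List ℕ :=
  [102945566559785, 102945566047324, 102945566047324, 102942204815677, 102945566047324,
    103039664644345, 102915351854997, 102945566047324, 102945566047324, 100403604557509,
    103795565012425, 102945566047324, 104849346609949, 102945566047324, 102945566047324,
    102673224323905, 102945566047324, 171575957590285, 80068386228745, 102945566047324,
    49576844143477, 102945566047324, 102945566047324, 110500552541281, 110288733990909,
    102945566047324, 102945566047324, 51544509623257, 102945566047324, 80884810282333,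
    169124733978305, 102945566047324]

/-- The coefficients of the antisymmetric abelian relation with derivative `Res_ε`. -/
def coefA (ε : Fin 5 → ℤˣ) : Fol → Fin 3 → Fin 3 → ℤ := dec1 (codesRes.getD (mask ε) 0)

/-- Codes of the symmetric abelian relations of the subwebs `pairSubweb T`, `|T| = 3`. -/
def codesSym : List (ℕ × ℕ) :=
  [(7, 103006089741268), (11, 104640889527524), (13, 103489619243052), (14, 105124419029308), (19,
    148702138718756), (21, 118113107946540), (22, 163930204311916), (25, 161690827635988), (26,
    117629578444756), (28, 147067338932500)]

/-- The coefficients of the symmetric abelian relation of `pairSubweb T`. -/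
def coefS (T : Finset (Fin 5)) : Fol → Fin 3 → Fin 3 → ℤ :=
  dec1 ((codesSym.lookup (∑ i ∈ T, 2 ^ (i : ℕ))).getD 0)

/-! ### Integral vectors -/

/-- The ten foliations. -/
def allFol : List Fol := [(0, 1), (0, -1), (1, 1), (1, -1), (2, 1), (2, -1), (3, 1), (3, -1),
  (4, 1), (4, -1)]

/-- Indices of the weight `0` coefficients. -/
def pts0 : List (Fol × Fin 3) := allFol.flatMap fun f => [(f, 0), (f, 1), (f, 2)]

/-- Indices of the symmetric or antisymmetric weight `1` coefficients. -/
def pts1 : List (Fol × Fin 3 × Fin 3) := allFol.flatMap fun f => [(f, 0, 1), (f, 0, 2), (f, 1, 2)]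

theorem mem_allFol : ∀ f : Fol, f ∈ allFol := by decide +kernel

/-- A family of vectors is free if some of its integral coordinates form a matrix of maximal
rank. -/
theorem linearIndependent_of_nullity {V P : Type*} [AddCommGroup V] [Module ℂ V] {n : ℕ}
    (v : Fin n → V) (φ : P → V →ₗ[ℂ] ℂ) (c : Fin n → P → ℤ) (pts : List P)
    (hc : ∀ j, ∀ p ∈ pts, φ p (v j) = c j p)
    (h : nullity n (pts.map fun p => (List.finRange n).map fun j => c j p) = 0) :
    LinearIndependent ℂ v := by
  refine Fintype.linearIndependent_iff.2 fun g hg => ?_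
  refine congrFun (eq_zero_of_nullity (List.finRange n) (List.nodup_finRange n) List.mem_finRange
    (pts.map fun p j => c j p) (by rw [List.length_finRange, List.map_map]; exact h) g ?_)
  intro r hr
  obtain ⟨p, hp, rfl⟩ := List.mem_map.1 hr
  have := congrArg (φ p) hg
  rw [map_sum, map_zero] at this
  rw [← this]
  exact Finset.sum_congr rfl fun j _ => by rw [map_smul, smul_eq_mul, hc j p hp, mul_comm]

/-- The complex coefficients associated with integral ones. -/
def cast0 (c : Fol → Fin 3 → ℤ) : Fol → Fin 3 → ℂ := fun f s => c f s

/-- The symmetric coefficients. -/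
def KS : Submodule ℂ (Fol → Fin 3 → Fin 3 → ℂ) where
  carrier := {c | c ∈ K1 ∧ ∀ f a b, c f a b = c f b a}
  zero_mem' := ⟨K1.zero_mem, fun _ _ _ => rfl⟩
  add_mem' ha hb := ⟨K1.add_mem ha.1 hb.1, fun f a b => by simp [ha.2 f a b, hb.2 f a b]⟩
  smul_mem' t a ha := ⟨K1.smul_mem t ha.1, fun f a b => by simp [ha.2 f a b]⟩

/-- The antisymmetric coefficients. -/
def KA : Submodule ℂ (Fol → Fin 3 → Fin 3 → ℂ) where
  carrier := {c | c ∈ K1 ∧ ∀ f a b, c f a b = -c f b a}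
  zero_mem' := ⟨K1.zero_mem, fun _ _ _ => by simp⟩
  add_mem' ha hb := ⟨K1.add_mem ha.1 hb.1, fun f a b => by
    simp only [Pi.add_apply, ha.2 f a b, hb.2 f a b, neg_add]⟩
  smul_mem' t a ha := ⟨K1.smul_mem t ha.1, fun f a b => by
    simp only [Pi.smul_apply, smul_eq_mul, ha.2 f a b, mul_neg]⟩

theorem cast0_mem_K0 {c : Fol → Fin 3 → ℤ}
    (h : ∀ l, ∑ f, ∑ s, c f s * expoTab f s l = 0) : cast0 c ∈ K0 := fun l => by
  simp only [linCo, cast0, expo_eq]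
  exact_mod_cast h l

theorem symCoef_mem_KS {c : Fol → Fin 3 → Fin 3 → ℤ}
    (h : ∀ k l, ∑ f, (c f 0 1 * (expoTab f 0 k * expoTab f 1 l + expoTab f 1 k * expoTab f 0 l) +
      c f 0 2 * (expoTab f 0 k * expoTab f 2 l + expoTab f 2 k * expoTab f 0 l) +
      c f 1 2 * (expoTab f 1 k * expoTab f 2 l + expoTab f 2 k * expoTab f 1 l)) = 0) :
    symCoef c ∈ KS := by
  refine ⟨fun k l => ?_, fun f a b => ?_⟩
  · have h1 := congrArg (Int.cast : ℤ → ℂ) (h k l)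
    push_cast at h1
    rw [← h1]
    refine Finset.sum_congr rfl fun f _ => ?_
    simp [quadCo, symCoef, Fin.sum_univ_three, expo_eq]
    ring
  · rcases lt_trichotomy a b with h | rfl | h
    · simp [symCoef, h, h.not_gt]
    · rfl
    · simp [symCoef, h, h.not_gt]

theorem antiCoef_mem_KA {c : Fol → Fin 3 → Fin 3 → ℤ}
    (h : ∀ k l, ∑ f, (c f 0 1 * (expoTab f 0 k * expoTab f 1 l - expoTab f 1 k * expoTab f 0 l) +
      c f 0 2 * (expoTab f 0 k * expoTab f 2 l - expoTab f 2 k * expoTab f 0 l) +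
      c f 1 2 * (expoTab f 1 k * expoTab f 2 l - expoTab f 2 k * expoTab f 1 l)) = 0) :
    antiCoef c ∈ KA := by
  refine ⟨fun k l => ?_, fun f a b => ?_⟩
  · have h1 := congrArg (Int.cast : ℤ → ℂ) (h k l)
    push_cast at h1
    rw [← mul_zero (1 / 2 : ℂ), ← h1, Finset.mul_sum]
    refine Finset.sum_congr rfl fun f _ => ?_
    simp [quadCo, antiCoef, Fin.sum_univ_three, expo_eq]
    ring
  · rcases lt_trichotomy a b with h | rfl | h
    · simp [antiCoef, h, h.not_gt]
      ring
    · simp [antiCoef]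
    · simp [antiCoef, h, h.not_gt]
      ring

theorem base0_mem (j : Fin 20) : cast0 (base0 j) ∈ K0 := cast0_mem_K0 <| by
  revert j; decide +kernel

theorem baseS_mem (j : Fin 5) : symCoef (baseS j) ∈ KS := symCoef_mem_KS <| by
  revert j; decide +kernel

theorem baseA_mem (j : Fin 10) : antiCoef (baseA j) ∈ KA := antiCoef_mem_KA <| by
  revert j; decide +kernel

/-- The coordinates of the weight `0` coefficients. -/
def coord0 (p : Fol × Fin 3) : (Fol → Fin 3 → ℂ) →ₗ[ℂ] ℂ where
  toFun c := c p.1 p.2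
  map_add' _ _ := rfl
  map_smul' _ _ := rfl

theorem base0_indep : LinearIndependent ℂ fun j => cast0 (base0 j) :=
  linearIndependent_of_nullity _ coord0 (fun j p => base0 j p.1 p.2) pts0
    (fun _ _ _ => rfl) (by decide +kernel)

theorem lt_of_mem_pts1 : ∀ p ∈ pts1, p.2.1 < p.2.2 := by decide +kernel

/-- The coordinates with index in `pts1`, multiplied by `t`. -/
def coord1 (t : ℂ) (p : Fol × Fin 3 × Fin 3) : (Fol → Fin 3 → Fin 3 → ℂ) →ₗ[ℂ] ℂ where
  toFun c := t * c p.1 p.2.1 p.2.2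
  map_add' _ _ := by simp [mul_add]
  map_smul' _ _ := by simp [mul_left_comm]

theorem coord1_symCoef (c : Fol → Fin 3 → Fin 3 → ℤ) {p : Fol × Fin 3 × Fin 3} (hp : p ∈ pts1) :
    coord1 1 p (symCoef c) = c p.1 p.2.1 p.2.2 := by
  simp [coord1, symCoef, lt_of_mem_pts1 p hp]

theorem coord1_antiCoef (c : Fol → Fin 3 → Fin 3 → ℤ) {p : Fol × Fin 3 × Fin 3} (hp : p ∈ pts1) :
    coord1 2 p (antiCoef c) = c p.1 p.2.1 p.2.2 := by
  simp [coord1, antiCoef, lt_of_mem_pts1 p hp]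
  ring

theorem baseS_indep : LinearIndependent ℂ fun j => symCoef (baseS j) :=
  linearIndependent_of_nullity _ (coord1 1) (fun j p => baseS j p.1 p.2.1 p.2.2) pts1
    (fun _ _ hp => coord1_symCoef _ hp) (by decide +kernel)

theorem baseA_indep : LinearIndependent ℂ fun j => antiCoef (baseA j) :=
  linearIndependent_of_nullity _ (coord1 2) (fun j p => baseA j p.1 p.2.1 p.2.2) pts1
    (fun _ _ hp => coord1_antiCoef _ hp) (by decide +kernel)

section

/-! ### The space of abelian relations of the web -/

theorem tuple0_apply' {D : Set Y5} {x : Y5} (hx : x ∈ D) (c : Fol → Fin 3 → ℂ) (f : Fol)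
    (v : Fin 1 → Y5) : tuple0 D c f x v = ∑ s, c f s * dlogU f s x (v 0) := by
  simp only [tuple0, Set.indicator_of_mem hx, oneForm_apply, sum_apply, smul_apply, smul_eq_mul]

theorem tuple1_apply' {D : Set Y5} {L : Fin 10 → Y5 → ℂ} {x : Y5} (hx : x ∈ D)
    (c : Fol → Fin 3 → Fin 3 → ℂ) (f : Fol) (v : Fin 1 → Y5) : tuple1 D L c f x v =
      ∑ a, ∑ b, c f a b * logU (fun k => L k x) f a * dlogU f b x (v 0) := by
  simp only [tuple1, Set.indicator_of_mem hx, oneForm_apply, sum_apply, smul_apply, smul_eq_mul]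

/-- `tuple0` as a linear map. -/
def lin0 (D : Set Y5) : (Fol → Fin 3 → ℂ) →ₗ[ℂ] Tuple 1 where
  toFun := tuple0 D
  map_add' c d := by
    ext f x v
    by_cases hx : x ∈ D
    · change _ = tuple0 D c f x v + tuple0 D d f x v
      simp only [tuple0_apply' hx, Pi.add_apply, add_mul, Finset.sum_add_distrib]
    · change _ = tuple0 D c f x v + tuple0 D d f x v
      simp [tuple0, hx]
  map_smul' t c := by
    ext f x v
    by_cases hx : x ∈ D
    · change _ = t * tuple0 D c f x v
      simp only [tuple0_apply' hx, Pi.smul_apply, smul_eq_mul, mul_assoc, Finset.mul_sum]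
    · change _ = t * tuple0 D c f x v
      simp [tuple0, hx]

/-- `tuple1` as a linear map. -/
def lin1 (D : Set Y5) (L : Fin 10 → Y5 → ℂ) : (Fol → Fin 3 → Fin 3 → ℂ) →ₗ[ℂ] Tuple 1 where
  toFun := tuple1 D L
  map_add' c d := by
    ext f x v
    by_cases hx : x ∈ D
    · change _ = tuple1 D L c f x v + tuple1 D L d f x v
      simp only [tuple1_apply' hx, Pi.add_apply, add_mul, Finset.sum_add_distrib]
    · change _ = tuple1 D L c f x v + tuple1 D L d f x v
      simp [tuple1, hx]
  map_smul' t c := by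
    ext f x v
    by_cases hx : x ∈ D
    · change _ = t * tuple1 D L c f x v
      simp only [tuple1_apply' hx, Pi.smul_apply, smul_eq_mul, mul_assoc, Finset.mul_sum]
    · change _ = t * tuple1 D L c f x v
      simp [tuple1, hx]

theorem tuple2_apply {D : Set Y5} (c : Fol → Fin 3 → Fin 3 → ℂ) (f : Fol) {x : Y5} (hx : x ∈ D)
    (v : Fin 2 → Y5) :
    tuple2 D c f x v = ∑ a, ∑ b, c f a b * wedge (dlogU f a x) (dlogU f b x) v := by
  rw [tuple2, Set.indicator_of_mem hx]
  simp [ContinuousAlternatingMap.sum_apply]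

/-- `tuple2` as a linear map. -/
def lin2 (D : Set Y5) : (Fol → Fin 3 → Fin 3 → ℂ) →ₗ[ℂ] Tuple 2 where
  toFun := tuple2 D
  map_add' c d := by
    ext f x v
    by_cases hx : x ∈ D
    · change _ = tuple2 D c f x v + tuple2 D d f x v
      simp only [tuple2_apply _ _ hx, Pi.add_apply, add_mul, Finset.sum_add_distrib]
    · change _ = tuple2 D c f x v + tuple2 D d f x v
      simp [tuple2, hx]
  map_smul' t c := by
    ext f x v
    by_cases hx : x ∈ D
    · change _ = t * tuple2 D c f x v
      simp only [tuple2_apply _ _ hx, Pi.smul_apply, smul_eq_mul, mul_assoc, Finset.mul_sum]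
    · change _ = t * tuple2 D c f x v
      simp [tuple2, hx]

/-- The coefficients of weight `0` of the abelian relations of the subweb `I`. -/
def K0I (I : Finset Fol) : Submodule ℂ (Fol → Fin 3 → ℂ) :=
  K0 ⊓ Submodule.pi {f | f ∉ I} fun _ => ⊥

/-- The coefficients of weight `1` of the abelian relations of the subweb `I`. -/
def K1I (I : Finset Fol) : Submodule ℂ (Fol → Fin 3 → Fin 3 → ℂ) :=
  K1 ⊓ Submodule.pi {f | f ∉ I} fun _ => ⊥

theorem mem_K0I {I : Finset Fol} {c : Fol → Fin 3 → ℂ} :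
    c ∈ K0I I ↔ c ∈ K0 ∧ ∀ f ∉ I, c f = 0 := by
  simp [K0I, Submodule.mem_pi]

theorem mem_K1I {I : Finset Fol} {c : Fol → Fin 3 → Fin 3 → ℂ} :
    c ∈ K1I I ↔ c ∈ K1 ∧ ∀ f ∉ I, c f = 0 := by
  simp [K1I, Submodule.mem_pi]

theorem transpose_mem_K1 {c : Fol → Fin 3 → Fin 3 → ℂ} (h : c ∈ K1) :
    (fun f a b => c f b a) ∈ K1 := fun k l => by
  rw [← h l k]
  refine Finset.sum_congr rfl fun f _ => ?_
  rw [quadCo, quadCo, Finset.sum_comm]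
  exact Finset.sum_congr rfl fun _ _ => Finset.sum_congr rfl fun _ _ => by ring

/-- The symmetric part of coefficients of weight `1`. -/
def symPart (c : Fol → Fin 3 → Fin 3 → ℂ) : Fol → Fin 3 → Fin 3 → ℂ :=
  fun f a b => (c f a b + c f b a) / 2

/-- The antisymmetric part of coefficients of weight `1`. -/
def antiPart (c : Fol → Fin 3 → Fin 3 → ℂ) : Fol → Fin 3 → Fin 3 → ℂ :=
  fun f a b => (c f a b - c f b a) / 2

theorem symPart_add_antiPart (c : Fol → Fin 3 → Fin 3 → ℂ) : symPart c + antiPart c = c := by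
  ext f a b
  simp only [Pi.add_apply, symPart, antiPart]
  ring

theorem symPart_mem {c : Fol → Fin 3 → Fin 3 → ℂ} (h : c ∈ K1) : symPart c ∈ KS := by
  refine ⟨?_, fun f a b => by simp only [symPart]; ring⟩
  have := K1.smul_mem (1 / 2) (K1.add_mem h (transpose_mem_K1 h))
  convert this using 1
  ext f a b
  simp [symPart]
  ring

theorem antiPart_mem {c : Fol → Fin 3 → Fin 3 → ℂ} (h : c ∈ K1) : antiPart c ∈ KA := by
  refine ⟨?_, fun f a b => by simp only [antiPart]; ring⟩
  have := K1.smul_mem (1 / 2) (K1.sub_mem h (transpose_mem_K1 h))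
  convert this using 1
  ext f a b
  simp [antiPart]
  ring

theorem disjoint_KS_KA : Disjoint KS KA := by
  refine Submodule.disjoint_def.2 fun c h1 h2 => ?_
  ext f a b
  have e1 := h1.2 f a b
  have e2 := h2.2 f a b
  rw [← e1] at e2
  simpa using self_eq_neg.1 e2

theorem sup_KS_KA : KS ⊔ KA = K1 := by
  refine le_antisymm (sup_le (fun c h => h.1) fun c h => h.1) fun c h => ?_
  rw [← symPart_add_antiPart c]
  exact Submodule.add_mem_sup (symPart_mem h) (antiPart_mem h)

theorem span_eq_of_indep {V : Type*} [AddCommGroup V] [Module ℂ V] [FiniteDimensional ℂ V] {n : ℕ}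
    {S : Submodule ℂ V} {v : Fin n → V} (hv : LinearIndependent ℂ v) (hS : ∀ j, v j ∈ S)
    (hn : Module.finrank ℂ S ≤ n) : Submodule.span ℂ (Set.range v) = S :=
  Submodule.eq_of_le_of_finrank_le (Submodule.span_le.2 (Set.range_subset_iff.2 hS))
    (by rw [finrank_span_eq_card hv, Fintype.card_fin]; exact hn)

instance (k : ℕ) (S : Submodule ℂ (Tuple k)) : Module.Free ℂ S := Module.Free.of_divisionRing ℂ S

namespace LogDom

variable {D : Set Y5} {L : Fin 10 → Y5 → ℂ} (h : LogDom D L)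
include h

theorem finite_AR : Module.Finite ℂ (AR 1 D Finset.univ) :=
  Module.rank_lt_aleph0_iff.1 ((rank_AR_univ_le h.isOpen h.conn h.sub).trans_lt
    (by exact_mod_cast Cardinal.natCast_lt_aleph0 (n := 35)))

theorem finrank_AR_le : Module.finrank ℂ (AR 1 D Finset.univ) ≤ 35 := by
  have := h.finite_AR
  have h1 := rank_AR_univ_le h.isOpen h.conn h.sub
  rw [← Module.finrank_eq_rank] at h1
  exact_mod_cast h1

/-- The abelian relation with given coefficients. -/
def toAR : K0 × K1 →ₗ[ℂ] AR 1 D Finset.univ :=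
  LinearMap.codRestrict _ ((lin0 D).comp (K0.subtype.comp (LinearMap.fst ℂ K0 K1)) +
    (lin1 D L).comp (K1.subtype.comp (LinearMap.snd ℂ K0 K1))) fun c =>
    h.logTuple_mem_AR c.1.2 c.2.2 (by simp)

theorem toAR_injective : Function.Injective h.toAR := by
  intro c d hcd
  have := logTuple_injective h.logSys subset_rfl h.sub (congrArg Subtype.val hcd :
    tuple0 D c.1 + tuple1 D L c.2 = tuple0 D d.1 + tuple1 D L d.2)
  exact Prod.ext (Subtype.ext this.1) (Subtype.ext this.2)

/-- The dimensions `20`, `5` and `10` of the explicit spaces of coefficients add up to the bound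
of the rank: all these spaces are spanned by the given bases, and all the abelian relations are
logarithmic. -/
theorem finrank_eq : Module.finrank ℂ K0 = 20 ∧ Module.finrank ℂ KS = 5 ∧
    Module.finrank ℂ KA = 10 ∧ Module.finrank ℂ (AR 1 D Finset.univ) = 35 := by
  have := h.finite_AR
  have h1 := LinearMap.finrank_le_finrank_of_injective h.toAR_injective
  rw [Module.finrank_prod] at h1
  have h2 := Submodule.finrank_sup_add_finrank_inf_eq KS KA
  rw [sup_KS_KA, disjoint_KS_KA.eq_bot, finrank_bot] at h2
  have h3 := h.finrank_AR_le
  have e0 : 20 ≤ Module.finrank ℂ K0 := by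
    have := Submodule.finrank_mono (Submodule.span_le.2 (Set.range_subset_iff.2 base0_mem))
    rwa [finrank_span_eq_card base0_indep] at this
  have eS : 5 ≤ Module.finrank ℂ KS := by
    have := Submodule.finrank_mono (Submodule.span_le.2 (Set.range_subset_iff.2 baseS_mem))
    rwa [finrank_span_eq_card baseS_indep] at this
  have eA : 10 ≤ Module.finrank ℂ KA := by
    have := Submodule.finrank_mono (Submodule.span_le.2 (Set.range_subset_iff.2 baseA_mem))
    rwa [finrank_span_eq_card baseA_indep] at this
  omega

theorem toAR_bijective : Function.Bijective h.toAR := by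
  have := h.finite_AR
  refine ⟨h.toAR_injective, ?_⟩
  rw [← LinearMap.range_eq_top]
  refine Submodule.eq_top_of_finrank_eq (K := ℂ) (V := AR 1 D Finset.univ) ?_
  rw [LinearMap.finrank_range_of_inj h.toAR_injective, Module.finrank_prod]
  have h2 := Submodule.finrank_sup_add_finrank_inf_eq KS KA
  rw [sup_KS_KA, disjoint_KS_KA.eq_bot, finrank_bot] at h2
  obtain ⟨e0, eS, eA, e⟩ := h.finrank_eq
  omega

/-- The abelian relations of the subwebs are logarithmic. -/
theorem mem_AR_iff {I : Finset Fol} {η : Tuple 1} :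
    η ∈ AR 1 D I ↔ ∃ c₀ ∈ K0I I, ∃ c₁ ∈ K1I I, η = tuple0 D c₀ + tuple1 D L c₁ := by
  constructor
  · intro hη
    have hη' : η ∈ AR 1 D Finset.univ :=
      ⟨hη.1, hη.2.1, fun f hf => absurd (Finset.mem_univ f) hf, hη.2.2.2⟩
    obtain ⟨c, hc⟩ := h.toAR_bijective.2 ⟨η, hη'⟩
    have hc : tuple0 D c.1 + tuple1 D L c.2 = η := congrArg Subtype.val hc
    rw [← hc] at hη
    have := (h.mem_of_logTuple_mem_AR hη).2
    exact ⟨c.1, mem_K0I.2 ⟨c.1.2, fun f hf => (this f hf).1⟩, c.2,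
      mem_K1I.2 ⟨c.2.2, fun f hf => (this f hf).2⟩, hc.symm⟩
  · rintro ⟨c₀, h0, c₁, h1, rfl⟩
    rw [mem_K0I] at h0
    rw [mem_K1I] at h1
    exact h.logTuple_mem_AR h0.1 h1.1 fun f hf => ⟨h0.2 f hf, h1.2 f hf⟩

theorem tuple0_mem_AR_iff {I : Finset Fol} {c : Fol → Fin 3 → ℂ} :
    tuple0 D c ∈ AR 1 D I ↔ c ∈ K0I I := by
  have e : tuple0 D c = tuple0 D c + tuple1 D L 0 := by
    rw [show tuple1 D L 0 = 0 from (lin1 D L).map_zero, add_zero]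
  constructor
  · intro H
    rw [e] at H
    have := h.mem_of_logTuple_mem_AR H
    exact mem_K0I.2 ⟨this.1.1, fun f hf => (this.2 f hf).1⟩
  · exact fun H => h.mem_AR_iff.2 ⟨c, H, 0, Submodule.zero_mem _, e⟩

theorem tuple1_mem_AR_iff {I : Finset Fol} {c : Fol → Fin 3 → Fin 3 → ℂ} :
    tuple1 D L c ∈ AR 1 D I ↔ c ∈ K1I I := by
  have e : tuple1 D L c = tuple0 D 0 + tuple1 D L c := by
    rw [show tuple0 D 0 = 0 from (lin0 D).map_zero, zero_add]
  constructor
  · intro H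
    rw [e] at H
    have := h.mem_of_logTuple_mem_AR H
    exact mem_K1I.2 ⟨this.1.2, fun f hf => (this.2 f hf).2⟩
  · exact fun H => h.mem_AR_iff.2 ⟨0, Submodule.zero_mem _, c, H, e⟩

theorem W0_eq (I : Finset Fol) : W0 D I = (K0I I).map (lin0 D) := by
  have e : Submodule.span ℂ (Set.range (tuple0 D)) = LinearMap.range (lin0 D) :=
    (Submodule.span_eq (LinearMap.range (lin0 D)))
  ext η
  rw [W0, Submodule.mem_inf, e]
  constructor
  · rintro ⟨h1, c, rfl⟩
    exact ⟨c, h.tuple0_mem_AR_iff.1 h1, rfl⟩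
  · rintro ⟨c, hc, rfl⟩
    exact ⟨h.tuple0_mem_AR_iff.2 hc, c, rfl⟩

theorem W1_eq (I : Finset Fol) : W1 D L I = (K1I I).map (lin1 D L) := by
  have e : Submodule.span ℂ (Set.range (tuple1 D L)) = LinearMap.range (lin1 D L) :=
    (Submodule.span_eq (LinearMap.range (lin1 D L)))
  ext η
  rw [W1, Submodule.mem_inf, e]
  constructor
  · rintro ⟨h1, c, rfl⟩
    exact ⟨c, h.tuple1_mem_AR_iff.1 h1, rfl⟩
  · rintro ⟨c, hc, rfl⟩
    exact ⟨h.tuple1_mem_AR_iff.2 hc, c, rfl⟩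

theorem AR_eq (I : Finset Fol) : AR 1 D I = W0 D I ⊔ W1 D L I := by
  rw [h.W0_eq, h.W1_eq]
  ext η
  rw [h.mem_AR_iff, Submodule.mem_sup]
  constructor
  · rintro ⟨c₀, h0, c₁, h1, rfl⟩
    exact ⟨_, ⟨c₀, h0, rfl⟩, _, ⟨c₁, h1, rfl⟩, rfl⟩
  · rintro ⟨_, ⟨c₀, h0, rfl⟩, _, ⟨c₁, h1, rfl⟩, rfl⟩
    exact ⟨c₀, h0, c₁, h1, rfl⟩

theorem lin0_injective : Function.Injective (lin0 D) := fun c d e =>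
  (logTuple_injective h.logSys subset_rfl h.sub
    (show tuple0 D c + tuple1 D L 0 = tuple0 D d + tuple1 D L 0 from
      congrArg (· + tuple1 D L 0) e)).1

theorem lin1_injective : Function.Injective (lin1 D L) := fun c d e =>
  (logTuple_injective h.logSys subset_rfl h.sub
    (show tuple0 D 0 + tuple1 D L c = tuple0 D 0 + tuple1 D L d from
      congrArg (tuple0 D 0 + ·) e)).2

theorem disjoint_range : Disjoint (LinearMap.range (lin0 D)) (LinearMap.range (lin1 D L)) := by
  refine Submodule.disjoint_def.2 ?_
  rintro _ ⟨c, rfl⟩ ⟨d, e⟩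
  have := logTuple_injective h.logSys subset_rfl h.sub
    (show tuple0 D c + tuple1 D L 0 = tuple0 D 0 + tuple1 D L d by
      rw [show tuple1 D L 0 = 0 from (lin1 D L).map_zero, add_zero,
        show tuple0 D 0 = 0 from (lin0 D).map_zero, zero_add]
      exact e.symm)
  rw [this.1, map_zero]

theorem finrank_AR (I : Finset Fol) :
    Module.finrank ℂ (AR 1 D I) = Module.finrank ℂ (K0I I) + Module.finrank ℂ (K1I I) := by
  have h1 := Submodule.finrank_sup_add_finrank_inf_eq ((K0I I).map (lin0 D))
    ((K1I I).map (lin1 D L))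
  rw [← h.W0_eq, ← h.W1_eq, ← h.AR_eq, h.W0_eq, h.W1_eq,
    (h.disjoint_range.mono (LinearMap.map_le_range) (LinearMap.map_le_range)).eq_bot, finrank_bot,
    add_zero] at h1
  rw [h1, LinearEquiv.finrank_eq (Submodule.equivMapOfInjective _ h.lin0_injective (K0I I)),
    LinearEquiv.finrank_eq (Submodule.equivMapOfInjective _ h.lin1_injective (K1I I))]

theorem finite_AR_subweb (I : Finset Fol) : Module.Finite ℂ (AR 1 D I) := by
  rw [h.AR_eq, h.W0_eq, h.W1_eq]
  infer_instance

theorem span_base0 : Submodule.span ℂ (Set.range fun j => cast0 (base0 j)) = K0 :=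
  span_eq_of_indep base0_indep base0_mem h.finrank_eq.1.le

theorem span_baseS : Submodule.span ℂ (Set.range fun j => symCoef (baseS j)) = KS :=
  span_eq_of_indep baseS_indep baseS_mem h.finrank_eq.2.1.le

theorem span_baseA : Submodule.span ℂ (Set.range fun j => antiCoef (baseA j)) = KA :=
  span_eq_of_indep baseA_indep baseA_mem h.finrank_eq.2.2.1.le

end LogDom

end

/-! ### The abelian relations of the five-subwebs -/

/-- The dimension of a space spanned by vectors `v j` is bounded by means of integral equations
satisfied by their linear combinations. -/
theorem finrank_le_nullity_of_span {V P : Type*} [AddCommGroup V] [Module ℂ V] {n : ℕ}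
    (v : Fin n → V) (φ : P → V →ₗ[ℂ] ℂ) (c : Fin n → P → ℤ) (pts : List P)
    (hc : ∀ j, ∀ p ∈ pts, φ p (v j) = c j p) {S : Submodule ℂ V}
    (hS : S ≤ Submodule.span ℂ (Set.range v)) (h0 : ∀ u ∈ S, ∀ p ∈ pts, φ p u = 0) :
    Module.finrank ℂ S ≤ nullity n (pts.map fun p => (List.finRange n).map fun j => c j p) := by
  have e : (S.comap (Fintype.linearCombination ℂ v)).map (Fintype.linearCombination ℂ v) = S := by
    rw [Submodule.map_comap_eq, Fintype.range_linearCombination, inf_eq_right]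
    exact hS
  rw [← e]
  refine (Submodule.finrank_map_le _ _).trans ?_
  have := finrank_le_nullity_of_coord (S.comap (Fintype.linearCombination ℂ v))
    (fun j => LinearMap.proj j) (List.finRange n)
    (fun g _ hg => funext fun j => hg j (List.mem_finRange j)) (pts.map fun p j => c j p)
    (fun g hg r hr => by
      obtain ⟨p, hp, rfl⟩ := List.mem_map.1 hr
      have h1 := h0 _ hg p hp
      rw [Fintype.linearCombination_apply, map_sum] at h1
      rw [← h1, ← List.ofFn_eq_map, List.sum_ofFn]
      exact Finset.sum_congr rfl fun j _ => by
        rw [map_smul, smul_eq_mul, hc j p hp, mul_comm]; rfl)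
  rw [List.length_finRange, List.map_map] at this
  exact this

/-- The foliations of `I`, in the order of `allFol`. -/
def listFol (I : Finset Fol) : List Fol := allFol.filter (· ∈ I)

theorem mem_listFol {I : Finset Fol} {f : Fol} : f ∈ listFol I ↔ f ∈ I := by
  simp [listFol, mem_allFol f]

theorem listFol_mem_sublistsLen {I : Finset Fol} (hI : I.card = 5) :
    listFol I ∈ List.sublistsLen 5 allFol := by
  refine List.mem_sublistsLen.2 ⟨List.filter_sublist, ?_⟩
  have h1 : (listFol I).Nodup := List.Nodup.filter _ (by decide +kernel)
  have h2 : (listFol I).toFinset = I := by ext f; rw [List.mem_toFinset, mem_listFol]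
  rw [← List.toFinset_card_of_nodup h1, h2, hI]

/-- Symmetric coefficients of abelian relations of `I`. -/
def KSI (I : Finset Fol) : Submodule ℂ (Fol → Fin 3 → Fin 3 → ℂ) :=
  KS ⊓ Submodule.pi {f | f ∉ I} fun _ => ⊥

/-- Antisymmetric coefficients of abelian relations of `I`. -/
def KAI (I : Finset Fol) : Submodule ℂ (Fol → Fin 3 → Fin 3 → ℂ) :=
  KA ⊓ Submodule.pi {f | f ∉ I} fun _ => ⊥

theorem mem_KSI {I : Finset Fol} {c : Fol → Fin 3 → Fin 3 → ℂ} :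
    c ∈ KSI I ↔ c ∈ KS ∧ ∀ f ∉ I, c f = 0 := by
  simp [KSI, Submodule.mem_pi]

theorem mem_KAI {I : Finset Fol} {c : Fol → Fin 3 → Fin 3 → ℂ} :
    c ∈ KAI I ↔ c ∈ KA ∧ ∀ f ∉ I, c f = 0 := by
  simp [KAI, Submodule.mem_pi]

theorem K1I_eq_sup (I : Finset Fol) : K1I I = KSI I ⊔ KAI I := by
  refine le_antisymm (fun c hc => ?_) (sup_le (fun c hc => ?_) fun c hc => ?_)
  · rw [mem_K1I] at hc
    rw [← symPart_add_antiPart c]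
    refine Submodule.add_mem_sup (mem_KSI.2 ⟨symPart_mem hc.1, fun f hf => ?_⟩)
      (mem_KAI.2 ⟨antiPart_mem hc.1, fun f hf => ?_⟩)
    · ext a b; simp [symPart, hc.2 f hf]
    · ext a b; simp [antiPart, hc.2 f hf]
  · exact mem_K1I.2 ⟨(mem_KSI.1 hc).1.1, (mem_KSI.1 hc).2⟩
  · exact mem_K1I.2 ⟨(mem_KAI.1 hc).1.1, (mem_KAI.1 hc).2⟩

/-- The indices in `pts1` relative to foliations outside of `l`. -/
def ptsOut (l : List Fol) : List (Fol × Fin 3 × Fin 3) := pts1.filter fun p => !l.contains p.1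

theorem mem_ptsOut {I : Finset Fol} {p : Fol × Fin 3 × Fin 3} (h : p ∈ ptsOut (listFol I)) :
    p ∈ pts1 ∧ p.1 ∉ I := by
  rw [ptsOut, List.mem_filter, Bool.not_eq_true', List.contains_eq_mem, decide_eq_false_iff_not,
    mem_listFol] at h
  exact h

/-- The rows of exponents of the foliations in `l`. -/
def rows0 (l : List Fol) : List (List ℤ) := (List.finRange 10).map fun k =>
  (l.flatMap fun f => [(f, (0 : Fin 3)), (f, 1), (f, 2)]).map fun p => expoTab p.1 p.2 k

theorem finrank_K0I_le (I : Finset Fol) : Module.finrank ℂ (K0I I) ≤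
    nullity (3 * (listFol I).length) (rows0 (listFol I)) := by
  have := finrank_le_nullity_of_coord (K0I I) coord0
    ((listFol I).flatMap fun f => [(f, (0 : Fin 3)), (f, 1), (f, 2)])
    (fun c hc h0 => by
      rw [mem_K0I] at hc
      ext f s
      by_cases hf : f ∈ I
      · refine h0 (f, s) (List.mem_flatMap.2 ⟨f, mem_listFol.2 hf, ?_⟩)
        fin_cases s <;> simp
      · rw [hc.2 f hf]; rfl)
    ((List.finRange 10).map fun k p => expoTab p.1 p.2 k)
    (fun c hc r hr => by
      obtain ⟨k, -, rfl⟩ := List.mem_map.1 hr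
      rw [mem_K0I] at hc
      rw [← hc.1 k]
      have h1 : (listFol I).Nodup := List.Nodup.filter _ (by decide +kernel)
      have h2 : (listFol I).toFinset = I := by ext f; rw [List.mem_toFinset, mem_listFol]
      have h3 : ∑ f, linCo c f k = ∑ f ∈ (listFol I).toFinset, linCo c f k := by
        rw [h2]
        refine (Finset.sum_subset (Finset.subset_univ _) fun f _ hf => ?_).symm
        simp [linCo, hc.2 f hf]
      rw [h3, List.sum_toFinset _ h1, List.map_flatMap, List.flatMap, List.sum_flatten,
        List.map_map]
      refine congrArg List.sum (List.map_congr_left fun f _ => ?_)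
      simp [linCo, Fin.sum_univ_three, coord0, expo_eq]
      ring)
  rw [List.map_map] at this
  refine this.trans (le_of_eq ?_)
  have e (l : List Fol) :
      (l.flatMap fun f => [(f, (0 : Fin 3)), (f, 1), (f, 2)]).length = 3 * l.length := by
    induction l with
    | nil => rfl
    | cons f l ih => simp only [List.flatMap_cons, List.length_append, ih, List.length_cons,
        List.length_nil]; ring
  rw [e]
  rfl

theorem finrank_le_nullity_sym (h : Submodule.span ℂ (Set.range fun j => symCoef (baseS j)) = KS)
    (I : Finset Fol) : Module.finrank ℂ (KSI I) ≤ nullity 5 ((ptsOut (listFol I)).map fun p =>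
      (List.finRange 5).map fun j => baseS j p.1 p.2.1 p.2.2) :=
  finrank_le_nullity_of_span _ (coord1 1) (fun j p => baseS j p.1 p.2.1 p.2.2) _
    (fun _ p hp => coord1_symCoef _ (mem_ptsOut hp).1) (h ▸ inf_le_left)
    fun c hc p hp => by simp [coord1, (mem_KSI.1 hc).2 p.1 (mem_ptsOut hp).2]

theorem finrank_le_nullity_anti (h : Submodule.span ℂ (Set.range fun j => antiCoef (baseA j)) = KA)
    (I : Finset Fol) : Module.finrank ℂ (KAI I) ≤ nullity 10 ((ptsOut (listFol I)).map fun p =>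
      (List.finRange 10).map fun j => baseA j p.1 p.2.1 p.2.2) :=
  finrank_le_nullity_of_span _ (coord1 2) (fun j p => baseA j p.1 p.2.1 p.2.2) _
    (fun _ p hp => coord1_antiCoef _ (mem_ptsOut hp).1) (h ▸ inf_le_left)
    fun c hc p hp => by simp [coord1, (mem_KAI.1 hc).2 p.1 (mem_ptsOut hp).2]

/-- The product of the signs of the foliations of the list. -/
def listSign (l : List Fol) : ℤˣ := (l.map Prod.snd).prod

theorem nullity_rows0 : ∀ l ∈ List.sublistsLen 5 allFol, nullity 15 (rows0 l) ≤
    if l.map Prod.fst = [0, 1, 2, 3, 4] ∧ listSign l = -1 then 6 else 5 := by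
  decide +kernel

theorem nullity_baseS : ∀ l ∈ List.sublistsLen 5 allFol, nullity 5 ((ptsOut l).map fun p =>
    (List.finRange 5).map fun j => baseS j p.1 p.2.1 p.2.2) = 0 := by
  decide +kernel

theorem nullity_baseA : ∀ l ∈ List.sublistsLen 5 allFol, nullity 10 ((ptsOut l).map fun p =>
    (List.finRange 10).map fun j => baseA j p.1 p.2.1 p.2.2) ≤
      if l.map Prod.fst = [0, 1, 2, 3, 4] ∧ listSign l = 1 then 1 else 0 := by
  decide +kernel

theorem listFol_signedSubweb : ∀ ε : Fin 5 → ℤˣ,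
    listFol (signedSubweb ε) = (List.finRange 5).map fun i => (i, ε i) := by
  decide +kernel

theorem card_signedSubweb (ε : Fin 5 → ℤˣ) : (signedSubweb ε).card = 5 := by
  rw [signedSubweb, Finset.card_image_of_injective _ fun i j h => congrArg Prod.fst h]
  rfl

theorem listSign_signedSubweb (ε : Fin 5 → ℤˣ) :
    listSign (listFol (signedSubweb ε)) = ∏ i, ε i := by
  rw [listFol_signedSubweb, listSign, List.map_map, ← List.ofFn_eq_map, List.prod_ofFn]
  rfl

theorem eq_signedSubweb {I : Finset Fol} (h : (listFol I).map Prod.fst = [0, 1, 2, 3, 4]) :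
    ∃ ε : Fin 5 → ℤˣ, I = signedSubweb ε := by
  have key (i : Fin 5) : ∃ e, (i, e) ∈ I := by
    have : i ∈ (listFol I).map Prod.fst := by rw [h]; fin_cases i <;> simp
    obtain ⟨⟨j, e⟩, hf, rfl⟩ := List.mem_map.1 this
    exact ⟨e, mem_listFol.1 hf⟩
  choose ε hε using key
  refine ⟨ε, (Finset.eq_of_subset_of_card_le (fun f hf => ?_) ?_).symm⟩
  · obtain ⟨i, -, rfl⟩ := Finset.mem_image.1 hf
    exact hε i
  · have h1 : (listFol I).Nodup := List.Nodup.filter _ (by decide +kernel)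
    have h2 : (listFol I).toFinset = I := by ext f; rw [List.mem_toFinset, mem_listFol]
    have h3 := congrArg List.length h
    rw [List.length_map] at h3
    rw [card_signedSubweb, ← h2, List.toFinset_card_of_nodup h1, h3]
    rfl

/-- The space `KSI I` vanishes when `I` has five elements. -/
theorem KSI_eq_bot (h : Submodule.span ℂ (Set.range fun j => symCoef (baseS j)) = KS)
    {I : Finset Fol} (hI : I.card = 5) : KSI I = ⊥ :=
  Submodule.finrank_eq_zero.1 (Nat.le_zero.1 ((finrank_le_nullity_sym h I).trans
    (nullity_baseS _ (listFol_mem_sublistsLen hI)).le))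

/-- Codes of bases of the abelian relations of weight `0` of the subwebs `W^ε`, in the order
given by `mask`. -/
def codesSigned : List (List ℕ) :=
  [[7703708, 7231396, 7155496, 5580832, 7686157], [7117510, 5580832, 7168137, 7345123,
    6662749, 11950882], [7155496, 6645198, 7167955, 7345123, 5639181, 11950700], [7173229,
    6111493, 7060726, 4104148, 7022740], [11773714, 7173229, 7135061, 8709725, 7646765,
    7015018], [11773714, 6645198, 7679659, 7167955, 6997467], [11773714, 5580832, 8703409,
    7168137, 6997285], [7703708, 5580832, 2575192, 7679659, 8703409, 8237413], [7703708,
    5580832, 2575192, 7679659, 8703409, 8237413], [11773714, 5580832, 8703409, 7168137,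
    6997285], [11773714, 6645198, 7679659, 7167955, 6997467], [11773714, 7173229, 7135061,
    8709725, 7646765, 7015018], [7173229, 6111493, 7060726, 4104148, 7022740], [7155496,
    6645198, 7167955, 7345123, 5639181, 11950700], [7117510, 5580832, 7168137, 7345123,
    6662749, 11950882], [7703708, 7231396, 7155496, 5580832, 7686157], [7231396, 7155496,
    2562070, 7692763, 7213845, 8716045], [2562070, 7117510, 2391400, 7168137, 5632861],
    [2562070, 7155496, 2391400, 7167955, 6656143], [11786836, 7173229, 3983619, 2448343,
    6662641, 11426737], [7173229, 3983619, 7135061, 2922169, 7015018], [2391400, 7167955,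
    6997467, 11426737, 5639177, 7150404], [2391400, 7168137, 6997285, 6662641, 10365287,
    7109788], [7686265, 8709729, 8772988, 7198502, 7109788], [7686265, 8709729, 8772988,
    7198502, 7109788], [2391400, 7168137, 6997285, 6662641, 10365287, 7109788], [2391400,
    7167955, 6997467, 11426737, 5639177, 7150404], [7173229, 3983619, 7135061, 2922169,
    7015018], [11786836, 7173229, 3983619, 2448343, 6662641, 11426737], [2562070, 7155496,
    2391400, 7167955, 6656143], [2562070, 7117510, 2391400, 7168137, 5632861], [7231396,
    7155496, 2562070, 7692763, 7213845, 8716045]]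

/-- A basis of the weight `0` coefficients of the subweb `W^ε`. -/
def baseSigned (ε : Fin 5 → ℤˣ) (j : ℕ) : Fol → Fin 3 → ℤ := fun f s =>
  if f.2 = ε f.1 then trit ((codesSigned.getD (mask ε) []).getD j 0) (3 * f.1 + s) else 0

/-- The number of elements of `baseSigned ε`. -/
def dimSigned (ε : Fin 5 → ℤˣ) : ℕ := if ∏ i, ε i = 1 then 5 else 6

theorem sum_baseSigned : ∀ (ε : Fin 5 → ℤˣ) (j : Fin 6) (l : Fin 10),
    (j : ℕ) < dimSigned ε → ∑ i, ∑ s, baseSigned ε j (i, ε i) s * expoTab (i, ε i) s l = 0 := by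
  decide +kernel

theorem nullity_baseSigned : ∀ ε : Fin 5 → ℤˣ, nullity (dimSigned ε) (pts0.map fun p =>
    (List.finRange (dimSigned ε)).map fun j : Fin (dimSigned ε) => baseSigned ε j p.1 p.2) = 0 := by
  decide +kernel

/-- The weight `1` coefficients attached to an even sign vector, in terms of orders of vanishing
along the corresponding divisor. -/
theorem coefA_eq : ∀ (ε : Fin 5 → ℤˣ) (f : Fol), ∏ i, ε i = 1 →
    coefA ε f 0 1 = (![1, -1, 1, -1, 1] f.1 : ℤ) * logU (ordZeta ε) f 2 ∧
    coefA ε f 0 2 = -((![1, -1, 1, -1, 1] f.1 : ℤ) * logU (ordZeta ε) f 1) ∧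
    coefA ε f 1 2 = (![1, -1, 1, -1, 1] f.1 : ℤ) * logU (ordZeta ε) f 0 := by
  decide +kernel

theorem coefA_mem_KA (ε : Fin 5 → ℤˣ) : antiCoef (coefA ε) ∈ KA := antiCoef_mem_KA <| by
  revert ε; decide +kernel

/-- The vector `coefA ε` is supported on the subweb `W^ε`. -/
theorem coefA_eq_zero : ∀ (ε : Fin 5 → ℤˣ) (f : Fol), f.2 ≠ ε f.1 →
    coefA ε f 0 1 = 0 ∧ coefA ε f 0 2 = 0 ∧ coefA ε f 1 2 = 0 := by
  decide +kernel

theorem coefA_ne_zero : ∀ (ε : Fin 5 → ℤˣ) (i : Fin 5), ∏ i, ε i = 1 →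
    (coefA ε (i, ε i) 0 1 ≠ 0 ∨ coefA ε (i, ε i) 0 2 ≠ 0 ∨ coefA ε (i, ε i) 1 2 ≠ 0) := by
  decide +kernel

theorem mem_signedSubweb {ε : Fin 5 → ℤˣ} {f : Fol} : f ∈ signedSubweb ε ↔ f.2 = ε f.1 := by
  rw [signedSubweb, Finset.mem_image]
  constructor
  · rintro ⟨i, -, rfl⟩; rfl
  · exact fun h => ⟨f.1, Finset.mem_univ _, Prod.ext rfl h.symm⟩

theorem coefA_mem_KAI (ε : Fin 5 → ℤˣ) : antiCoef (coefA ε) ∈ KAI (signedSubweb ε) := by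
  refine mem_KAI.2 ⟨coefA_mem_KA ε, fun f hf => ?_⟩
  obtain ⟨h1, h2, h3⟩ := coefA_eq_zero ε f fun h => hf (mem_signedSubweb.2 h)
  ext a b
  fin_cases a <;> fin_cases b <;> simp [antiCoef, h1, h2, h3]

theorem antiCoef_coefA_apply_ne_zero {ε : Fin 5 → ℤˣ} (hε : ∏ i, ε i = 1) (i : Fin 5) :
    antiCoef (coefA ε) (i, ε i) ≠ 0 := by
  intro h
  have h1 := congrFun (congrFun h 0) 1
  have h2 := congrFun (congrFun h 0) 2
  have h3 := congrFun (congrFun h 1) 2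
  simp [antiCoef] at h1 h2 h3
  rcases coefA_ne_zero ε i hε with H | H | H <;> exact H (by assumption)

theorem antiCoef_coefA_ne_zero {ε : Fin 5 → ℤˣ} (hε : ∏ i, ε i = 1) : antiCoef (coefA ε) ≠ 0 :=
  fun h => antiCoef_coefA_apply_ne_zero hε 0 (congrFun h _)

theorem wedge_swap (a b : Y5 →L[ℂ] ℂ) : wedge b a = -wedge a b := by
  ext v
  have hv : v = ![v 0, v 1] := by ext i; fin_cases i <;> rfl
  rw [hv]
  change _ = -(wedge a b ![v 0, v 1])
  rw [wedge_apply, wedge_apply]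
  ring

theorem wedge_self (a : Y5 →L[ℂ] ℂ) : wedge a a = 0 := by
  ext v
  have hv : v = ![v 0, v 1] := by ext i; fin_cases i <;> rfl
  rw [hv, wedge_apply, mul_comm, sub_self]
  rfl

/-- The value of `tuple2` for antisymmetric coefficients. -/
theorem tuple2_of_antisymm {D : Set Y5} {c : Fol → Fin 3 → Fin 3 → ℂ} {f : Fol}
    (hc : ∀ a b, c f a b = -c f b a) {x : Y5} (hx : x ∈ D) (v : Fin 2 → Y5) :
    tuple2 D c f x v = 2 * c f 0 1 * wedge (dlogU f 0 x) (dlogU f 1 x) v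
      + 2 * c f 0 2 * wedge (dlogU f 0 x) (dlogU f 2 x) v
      + 2 * c f 1 2 * wedge (dlogU f 1 x) (dlogU f 2 x) v := by
  rw [tuple2_apply c f hx]
  have sw (a b : Fin 3) : wedge (dlogU f b x) (dlogU f a x) v
      = -wedge (dlogU f a x) (dlogU f b x) v := by rw [wedge_swap]; rfl
  simp only [Fin.sum_univ_three, wedge_self, sw 0 1, sw 0 2, sw 1 2, hc 1 0, hc 2 0, hc 2 1]
  simp
  ring

/-- The derivative vanishes on symmetric coefficients. -/
theorem tuple2_eq_zero_of_symm (D : Set Y5) {c : Fol → Fin 3 → Fin 3 → ℂ}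
    (hc : ∀ f a b, c f a b = c f b a) : tuple2 D c = 0 := by
  ext f x v
  by_cases hx : x ∈ D
  · rw [tuple2_apply c f hx]
    have sw (a b : Fin 3) : wedge (dlogU f b x) (dlogU f a x) v
        = -wedge (dlogU f a x) (dlogU f b x) v := by rw [wedge_swap]; rfl
    simp only [Fin.sum_univ_three, wedge_self, sw 0 1, sw 0 2, sw 1 2, hc f 1 0, hc f 2 0, hc f 2 1]
    simp
    ring
  · simp [tuple2, hx]

theorem tuple2_coefA (D : Set Y5) {ε : Fin 5 → ℤˣ} (hε : ∏ i, ε i = 1) :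
    tuple2 D (antiCoef (coefA ε)) = residue D ε := by
  ext f x v
  by_cases hx : x ∈ D
  · rw [tuple2_of_antisymm ((coefA_mem_KA ε).2 f) hx, residue, Set.indicator_of_mem hx]
    obtain ⟨h1, h2, h3⟩ := coefA_eq ε f hε
    have hs : sgn f = ((![1, -1, 1, -1, 1] f.1 : ℤ) : ℂ) := by
      obtain ⟨i, e⟩ := f
      fin_cases i <;> simp [sgn]
    simp [antiCoef, h1, h2, h3, hs]
    ring
  · simp [tuple2, residue, hx]

/-- The map `tuple2` is injective on antisymmetric coefficients: in a relation
`α dlog U₀ ∧ dlog U₁ + β dlog U₀ ∧ dlog U₂ + γ dlog U₁ ∧ dlog U₂ = 0`, replacing `dlog U₂` by its value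
gives `α U₂ - β U₁ - γ U₀ = 0`, and the three coefficients are seen to be zero by differentiating. -/
theorem eq_zero_of_tuple2_eq_zero {D : Set Y5} (hD : IsOpen D) (hne : D.Nonempty) (hDY : D ⊆ Ystar)
    {c : Fol → Fin 3 → Fin 3 → ℂ} {f : Fol} (hc : ∀ a b, c f a b = -c f b a)
    (h : ∀ x ∈ D, tuple2 D c f x = 0) : c f = 0 := by
  -- otherwise `dlogU f 0 ∧ dlogU f 1` vanishes at `x`
  have key : ∀ x ∈ D, c f 0 1 * U f x 2 - c f 0 2 * U f x 1 - c f 1 2 * U f x 0 = 0 := by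
    intro x hx
    by_contra hE
    refine one_ne_zero (α := ℂ) (eq_zero_of_coframe (hDY hx) (f := f) (a := 1) (b := 0) fun v => ?_).1
    rw [one_mul, zero_mul, add_zero]
    by_contra hv
    have h1 (w : Y5) : dlogU f 0 x v * dlogU f 1 x w - dlogU f 0 x w * dlogU f 1 x v = 0 := by
      have h2 := congrArg (fun t : Y5 [⋀^Fin 2]→L[ℂ] ℂ => t ![v, w]) (h x hx)
      rw [show tuple2 D c f x ![v, w] = _ from tuple2_of_antisymm hc hx _] at h2
      rw [wedge_apply, wedge_apply, wedge_apply] at h2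
      have e1 := dlogU_two_apply (hDY hx) f v
      have e2 := dlogU_two_apply (hDY hx) f w
      refine (mul_eq_zero.1 (?_ : (c f 0 1 * U f x 2 - c f 0 2 * U f x 1 - c f 1 2 * U f x 0) *
        (dlogU f 0 x v * dlogU f 1 x w - dlogU f 0 x w * dlogU f 1 x v) = 0)).resolve_left hE
      replace h2 : 2 * c f 0 1 * (dlogU f 0 x v * dlogU f 1 x w - dlogU f 0 x w * dlogU f 1 x v)
          + 2 * c f 0 2 * (dlogU f 0 x v * dlogU f 2 x w - dlogU f 0 x w * dlogU f 2 x v)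
          + 2 * c f 1 2 * (dlogU f 1 x v * dlogU f 2 x w - dlogU f 1 x w * dlogU f 2 x v) = 0 := h2
      linear_combination (U f x 2 / 2) * h2 - (c f 0 2 * dlogU f 0 x v + c f 1 2 * dlogU f 1 x v) * e2
        + (c f 0 2 * dlogU f 0 x w + c f 1 2 * dlogU f 1 x w) * e1
    have := (eq_zero_of_coframe (hDY hx) (f := f) (a := -dlogU f 1 x v) (b := dlogU f 0 x v)
      fun w => by linear_combination h1 w).2
    exact hv this
  obtain ⟨x, hx⟩ := hne
  have hd (s : Fin 3) : HasFDerivAt (fun y => U f y s) (U f x s • dlogU f s x) x := by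
    have := ((analyticAt_U (hDY hx) f s).differentiableAt (𝕜 := ℂ)).hasFDerivAt
    rwa [dlogU, smul_inv_smul₀ (U_ne_zero (hDY hx) f s)]
  have hder := (((hd 2).const_mul (c f 0 1)).sub ((hd 1).const_mul (c f 0 2))).sub
    ((hd 0).const_mul (c f 1 2))
  have h0 : HasFDerivAt (fun y => c f 0 1 * U f y 2 - c f 0 2 * U f y 1 - c f 1 2 * U f y 0)
      (0 : Y5 →L[ℂ] ℂ) x := by
    refine (hasFDerivAt_const (0 : ℂ) x).congr_of_eventuallyEq ?_
    filter_upwards [hD.mem_nhds hx] with y hy using key y hy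
  have e := hder.unique h0
  obtain ⟨e0, e1⟩ := eq_zero_of_coframe (hDY hx) (f := f)
    (a := (c f 0 1 - c f 1 2) * U f x 0) (b := -(c f 0 1 + c f 0 2) * U f x 1) fun w => by
      have e2 := DFunLike.congr_fun e w
      have e3 := dlogU_two_apply (hDY hx) f w
      replace e2 : c f 0 1 * (U f x 2 * dlogU f 2 x w) - c f 0 2 * (U f x 1 * dlogU f 1 x w) -
        c f 1 2 * (U f x 0 * dlogU f 0 x w) = 0 := e2
      linear_combination e2 - c f 0 1 * e3
  have a0 := (mul_eq_zero.1 e0).resolve_right (U_ne_zero (hDY hx) f 0)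
  have a1 := (mul_eq_zero.1 e1).resolve_right (U_ne_zero (hDY hx) f 1)
  have hU : U f x 2 = 1 + U f x 0 - U f x 1 := rfl
  have k := key x hx
  rw [hU] at k
  have z01 : c f 0 1 = 0 := by linear_combination k + U f x 0 * (-a0) + U f x 1 * (-a1)
  have z12 : c f 1 2 = 0 := by linear_combination z01 - a0
  have z02 : c f 0 2 = 0 := by linear_combination -a1 - z01
  have dg (a : Fin 3) : c f a a = 0 := self_eq_neg.1 (hc a a)
  ext a b
  fin_cases a <;> fin_cases b <;> simp [dg, z01, z12, z02, hc 1 0, hc 2 0, hc 2 1]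

/-- Even sign vectors whose residues are independent. -/
def evenSigns (j : Fin 10) : Fin 5 → ℤˣ := fun i =>
  if Nat.testBit ([0, 24, 20, 12, 18, 10, 6, 17, 9, 5].getD j 0) i then -1 else 1

theorem prod_evenSigns : ∀ j, ∏ i, evenSigns j i = 1 := by decide +kernel

theorem coefA_evenSigns_indep : LinearIndependent ℂ fun j => antiCoef (coefA (evenSigns j)) :=
  linearIndependent_of_nullity _ (coord1 2) (fun j p => coefA (evenSigns j) p.1 p.2.1 p.2.2) pts1
    (fun _ _ hp => coord1_antiCoef _ hp) (by decide +kernel)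

/-- Triples whose symmetric relations are independent. -/
def triples (j : Fin 5) : Finset (Fin 5) :=
  ![{0, 1, 2}, {0, 1, 3}, {0, 1, 4}, {0, 2, 3}, {0, 2, 4}] j

theorem card_triples : ∀ j, (triples j).card = 3 := by decide +kernel

theorem coefS_triples_indep : LinearIndependent ℂ fun j => symCoef (coefS (triples j)) :=
  linearIndependent_of_nullity _ (coord1 1) (fun j p => coefS (triples j) p.1 p.2.1 p.2.2) pts1
    (fun _ _ hp => coord1_symCoef _ hp) (by decide +kernel)

theorem coefS_mem_KS {T : Finset (Fin 5)} (hT : T.card = 3) : symCoef (coefS T) ∈ KS :=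
  symCoef_mem_KS <| by revert T; decide +kernel

theorem coefS_eq_zero : ∀ (T : Finset (Fin 5)) (f : Fol), f.1 ∉ T → T.card = 3 →
    coefS T f 0 1 = 0 ∧ coefS T f 0 2 = 0 ∧ coefS T f 1 2 = 0 := by
  decide +kernel

theorem coefS_ne_zero : ∀ (T : Finset (Fin 5)) (f : Fol), f.1 ∈ T → T.card = 3 →
    ∃ p ∈ [((0 : Fin 3), (1 : Fin 3)), (0, 2), (1, 2)],
      coefS T f p.1 p.2 = 1 ∨ coefS T f p.1 p.2 = -1 := by
  decide +kernel

/-- The symmetric abelian relations of the six-subweb `pairSubweb T` form a line. -/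
theorem nullity_coefS : ∀ T : Finset (Fin 5), T.card = 3 →
    nullity 5 ((ptsOut (listFol (pairSubweb T))).map fun p =>
      (List.finRange 5).map fun j => baseS j p.1 p.2.1 p.2.2) ≤ 1 := by
  decide +kernel

/-- A five-subweb of `pairSubweb T` is none of the `W^ε`. -/
theorem fst_listFol_erase : ∀ (T : Finset (Fin 5)) (f : Fol), T.card = 3 → f.1 ∈ T →
    (listFol ((pairSubweb T).erase f)).map Prod.fst ≠ [0, 1, 2, 3, 4] := by
  decide +kernel

/-- The vectors `baseSigned ε` are coefficients of abelian relations of weight `0` of `W^ε`. -/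
theorem baseSigned_mem (ε : Fin 5 → ℤˣ) (j : Fin (dimSigned ε)) :
    cast0 (baseSigned ε j) ∈ K0I (signedSubweb ε) := by
  refine mem_K0I.2 ⟨cast0_mem_K0 fun l => ?_, fun f hf => ?_⟩
  · have h6 : (j : ℕ) < 6 := j.2.trans_le (by rw [dimSigned]; split_ifs <;> norm_num)
    rw [← sum_baseSigned ε ⟨j, h6⟩ l j.2]
    rw [← Finset.sum_image (f := fun f : Fol => ∑ s, baseSigned ε j f s * expoTab f s l)
      (g := fun i => ((i, ε i) : Fol)) fun i _ k _ h => congrArg Prod.fst h]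
    refine (Finset.sum_subset (Finset.subset_univ _) fun f _ hf => ?_).symm
    have : f.2 ≠ ε f.1 := fun h => hf (mem_signedSubweb.2 h)
    simp [baseSigned, this]
  · have : f.2 ≠ ε f.1 := fun h => hf (mem_signedSubweb.2 h)
    ext s
    simp [cast0, baseSigned, this]

theorem baseSigned_indep (ε : Fin 5 → ℤˣ) :
    LinearIndependent ℂ fun j : Fin (dimSigned ε) => cast0 (baseSigned ε j) :=
  linearIndependent_of_nullity _ coord0 (fun j p => baseSigned ε j p.1 p.2) pts0
    (fun _ _ _ => rfl) (nullity_baseSigned ε)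

theorem baseSigned_small (ε : Fin 5 → ℤˣ) (j : ℕ) (f : Fol) (s : Fin 3) :
    baseSigned ε j f s ∈ ({-1, 0, 1} : Set ℤ) := by
  rw [baseSigned]
  split_ifs
  · exact trit_mem _ _
  · simp

section

/-! ### Structure of the space of abelian relations -/

theorem extDeriv_totalD {k : ℕ} {D : Set Y5} (hD : IsOpen D) {θ : Tuple k} {f : Fol}
    (hθ : AnalyticOnNhd ℂ (θ f) D) {x : Y5} (hx : x ∈ D) : extDeriv (totalD D θ f) x = 0 := by
  have hev : totalD D θ f =ᶠ[nhds x] extDeriv (θ f) := by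
    filter_upwards [hD.mem_nhds hx] with y hy using Set.indicator_of_mem hy _
  rw [hev.extDeriv_eq]
  exact extDeriv_extDeriv_apply ((hθ x hx).contDiffAt (n := ⊤)) (by simp)

/-- The derivative of an abelian relation is an abelian relation. -/
theorem totalD_mem_AR {k : ℕ} {D : Set Y5} (hD : IsOpen D) {I : Finset Fol} {θ : Tuple k}
    (hθ : θ ∈ AR k D I) : totalD D θ ∈ AR (k + 1) D I := by
  obtain ⟨h1, h2, h3, h4, h5, h6⟩ := hθ
  have hev (f : Fol) {x : Y5} (hx : x ∈ D) : totalD D θ f =ᶠ[nhds x] extDeriv (θ f) := by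
    filter_upwards [hD.mem_nhds hx] with y hy using Set.indicator_of_mem hy _
  refine ⟨fun f x hx => ?_, fun f x hx => Set.indicator_of_notMem hx _, fun f hf => ?_,
    fun f x hx v hv => ?_, fun f x hx v hv => ?_, fun x => ?_⟩
  · refine AnalyticAt.congr ?_ (hev f hx).symm
    exact ((ContinuousAlternatingMap.alternatizeUncurryFinCLM ℂ Y5 ℂ).analyticAt _).comp
      (h1 f x hx).fderiv
  · ext x v
    by_cases hx : x ∈ D
    · rw [totalD, Set.indicator_of_mem hx, h3 f hf]
      have h := extDeriv_smul (𝕜 := ℂ) (0 : ℂ) (0 : Y5 → Y5 [⋀^Fin k]→L[ℂ] ℂ) (x := x)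
      rw [zero_smul, zero_smul] at h
      exact DFunLike.congr_fun h v
    · rw [totalD, Set.indicator_of_notMem hx]
      rfl
  · rw [totalD, Set.indicator_of_mem hx]
    exact h5 f x hx v hv
  · rw [extDeriv_totalD hD (h1 f) hx]
    rfl
  · by_cases hx : x ∈ D
    · simp only [totalD, Set.indicator_of_mem hx]
      have e : (fun y => ∑ f, θ f y) = 0 := funext h6
      have e1 := fderiv_fun_sum (𝕜 := ℂ) (u := Finset.univ) fun f _ => (h1 f x hx).differentiableAt
      rw [e, show fderiv ℂ (0 : Y5 → Y5 [⋀^Fin k]→L[ℂ] ℂ) x = 0 from fderiv_const_apply _] at e1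
      change ∑ f, ContinuousAlternatingMap.alternatizeUncurryFinCLM ℂ Y5 ℂ (fderiv ℂ (θ f) x) = 0
      rw [← map_sum, ← e1, map_zero]
    · exact Finset.sum_eq_zero fun f _ => Set.indicator_of_notMem hx _

theorem finrank_K1I (I : Finset Fol) : Module.finrank ℂ (K1I I) ≤
    Module.finrank ℂ (KSI I) + Module.finrank ℂ (KAI I) := by
  rw [K1I_eq_sup]
  exact Submodule.finrank_add_le_finrank_add_finrank _ _

theorem K0I_univ : K0I Finset.univ = K0 := by
  ext c; simp [mem_K0I]

theorem K1I_univ : K1I Finset.univ = K1 := by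
  ext c; simp [mem_K1I]

theorem symCoef_coefS_mem {T : Finset (Fin 5)} (hT : T.card = 3) :
    symCoef (coefS T) ∈ KSI (pairSubweb T) := by
  refine mem_KSI.2 ⟨coefS_mem_KS hT, fun f hf => ?_⟩
  obtain ⟨h1, h2, h3⟩ := coefS_eq_zero T f (fun H => hf (Finset.mem_product.2
    ⟨H, Finset.mem_univ _⟩)) hT
  ext a b
  fin_cases a <;> fin_cases b <;> simp [symCoef, h1, h2, h3]

theorem exists_coefS {T : Finset (Fin 5)} (hT : T.card = 3) {f : Fol} (hf : f ∈ pairSubweb T) :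
    ∃ a b : Fin 3, a < b ∧ (coefS T f a b = 1 ∨ coefS T f a b = -1) := by
  obtain ⟨⟨a, b⟩, hp, H⟩ := coefS_ne_zero T f (Finset.mem_product.1 hf).1 hT
  refine ⟨a, b, ?_, H⟩
  simp at hp
  rcases hp with ⟨rfl, rfl⟩ | ⟨rfl, rfl⟩ | ⟨rfl, rfl⟩ <;> decide

theorem coefS_ne {T : Finset (Fin 5)} (hT : T.card = 3) {f : Fol} (hf : f ∈ pairSubweb T) :
    symCoef (coefS T) f ≠ 0 := by
  intro H
  obtain ⟨a, b, hab, h1⟩ := exists_coefS hT hf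
  have := congrFun (congrFun H a) b
  rcases h1 with h1 | h1 <;> simp [symCoef, hab, h1] at this

theorem finrank_K0I_signed (ε : Fin 5 → ℤˣ) :
    Module.finrank ℂ (K0I (signedSubweb ε)) = dimSigned ε := by
  refine le_antisymm ?_ ?_
  · have h3 := finrank_K0I_le (signedSubweb ε)
    have hm := listFol_mem_sublistsLen (card_signedSubweb ε)
    rw [(List.mem_sublistsLen.1 hm).2] at h3
    refine h3.trans ((nullity_rows0 _ hm).trans ?_)
    rw [listSign_signedSubweb, dimSigned]
    rcases Int.units_eq_one_or (∏ i, ε i) with e | e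
    · rw [e, if_pos rfl, if_neg fun H => absurd H.2 (by decide)]
    · rw [e, if_neg (by decide : ¬(-1 : ℤˣ) = 1)]
      split_ifs <;> norm_num
  · have := Submodule.finrank_mono (Submodule.span_le.2 (Set.range_subset_iff.2
      (baseSigned_mem ε)))
    rwa [finrank_span_eq_card (baseSigned_indep ε), Fintype.card_fin] at this

namespace LogDom

variable {D : Set Y5} {L : Fin 10 → Y5 → ℂ} (h : LogDom D L)
include h

theorem totalD_tuple1 (c : Fol → Fin 3 → Fin 3 → ℂ) : totalD D (tuple1 D L c) = tuple2 D c := by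
  rw [← h.totalD_logTuple 0 c, show tuple0 D 0 = 0 from (lin0 D).map_zero, zero_add]

theorem totalD_tuple0 (c : Fol → Fin 3 → ℂ) : totalD D (tuple0 D c) = 0 := by
  have := h.totalD_logTuple c 0
  rwa [show tuple1 D L 0 = 0 from (lin1 D L).map_zero, add_zero,
    show tuple2 D 0 = 0 from (lin2 D).map_zero] at this

theorem finrank_AR_five {I : Finset Fol} (hI : I.card = 5) :
    Module.finrank ℂ (AR 1 D I) ≤ 6 ∧
    (Module.finrank ℂ (AR 1 D I) = 6 → ∃ ε : Fin 5 → ℤˣ, I = signedSubweb ε) := by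
  have h1 := finrank_K1I I
  rw [KSI_eq_bot h.span_baseS hI, finrank_bot, zero_add] at h1
  have h2 := (finrank_le_nullity_anti h.span_baseA I).trans
    (nullity_baseA _ (listFol_mem_sublistsLen hI))
  have h3 := finrank_K0I_le I
  rw [(List.mem_sublistsLen.1 (listFol_mem_sublistsLen hI)).2] at h3
  replace h3 := h3.trans (nullity_rows0 _ (listFol_mem_sublistsLen hI))
  have h4 := h.finrank_AR I
  by_cases hs : (listFol I).map Prod.fst = [0, 1, 2, 3, 4]
  · refine ⟨?_, fun _ => eq_signedSubweb hs⟩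
    rcases Int.units_eq_one_or (listSign (listFol I)) with e | e
    · rw [if_pos ⟨hs, e⟩] at h2
      rw [if_neg fun H => by rw [e] at H; exact absurd H.2 (by decide)] at h3
      omega
    · rw [if_neg fun H => by rw [e] at H; exact absurd H.2 (by decide)] at h2
      rw [if_pos ⟨hs, e⟩] at h3
      omega
  · rw [if_neg fun H => hs H.1] at h2 h3
    exact ⟨by omega, fun H => by omega⟩

theorem finrank_KAI_signed {ε : Fin 5 → ℤˣ} :
    Module.finrank ℂ (K1I (signedSubweb ε)) = if ∏ i, ε i = 1 then 1 else 0 := by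
  have h2 := (finrank_le_nullity_anti h.span_baseA (signedSubweb ε)).trans
    (nullity_baseA _ (listFol_mem_sublistsLen (card_signedSubweb ε)))
  rw [K1I_eq_sup, KSI_eq_bot h.span_baseS (card_signedSubweb ε), bot_sup_eq]
  rw [listSign_signedSubweb] at h2
  split_ifs with e
  · refine le_antisymm (h2.trans (by split_ifs <;> norm_num)) ?_
    rw [Nat.one_le_iff_ne_zero, Ne, Submodule.finrank_eq_zero]
    intro H
    have := coefA_mem_KAI ε
    rw [H] at this
    exact antiCoef_coefA_ne_zero e this
  · rw [if_neg fun H => e H.2] at h2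
    exact Nat.le_zero.1 h2

theorem finrank_AR_signed (ε : Fin 5 → ℤˣ) :
    Module.finrank ℂ (AR 1 D (signedSubweb ε)) = 6 := by
  rw [h.finrank_AR, finrank_K0I_signed, h.finrank_KAI_signed, dimSigned]
  split_ifs <;> rfl

theorem rank_AR_five {I : Finset Fol} (hI : I.card = 5) :
    Module.rank ℂ (AR 1 D I) ≤ 6 ∧
    (Module.rank ℂ (AR 1 D I) = 6 ↔ ∃ ε : Fin 5 → ℤˣ, I = signedSubweb ε) := by
  have := h.finite_AR_subweb I
  have h1 := h.finrank_AR_five hI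
  rw [← Module.finrank_eq_rank]
  refine ⟨by exact_mod_cast h1.1, fun e => h1.2 (by exact_mod_cast e), ?_⟩
  rintro ⟨ε, rfl⟩
  rw [h.finrank_AR_signed]
  rfl

theorem hasSmallLogBasis {n : ℕ} {I : Finset Fol} (c : Fin n → Fol → Fin 3 → ℤ)
    (hc : ∀ j f s, c j f s ∈ ({-1, 0, 1} : Set ℤ)) (hi : LinearIndependent ℂ fun j => cast0 (c j))
    (hm : ∀ j, cast0 (c j) ∈ K0I I) (hn : Module.finrank ℂ (K0I I) ≤ n) :
    HasSmallLogBasis D (W0 D I) n := by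
  refine ⟨c, hc, hi.map' (lin0 D) (LinearMap.ker_eq_bot.2 h.lin0_injective), ?_⟩
  rw [h.W0_eq, ← span_eq_of_indep hi hm hn, Submodule.map_span, ← Set.range_comp]
  rfl

theorem hasSmallLogBasis_signed (ε : Fin 5 → ℤˣ) :
    HasSmallLogBasis D (W0 D (signedSubweb ε)) (dimSigned ε) :=
  h.hasSmallLogBasis (fun j => baseSigned ε j) (fun j => baseSigned_small ε j) (baseSigned_indep ε)
    (baseSigned_mem ε) (finrank_K0I_signed ε).le

theorem AR_eq_W0_of_odd {ε : Fin 5 → ℤˣ} (hε : ∏ i, ε i = -1) :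
    AR 1 D (signedSubweb ε) = W0 D (signedSubweb ε) := by
  have h1 := h.finrank_KAI_signed (ε := ε)
  rw [hε, if_neg (by decide), Submodule.finrank_eq_zero] at h1
  rw [h.AR_eq, h.W1_eq, h1, Submodule.map_bot, sup_bot_eq]

theorem tuple1_mem_W1_iff {I : Finset Fol} {c : Fol → Fin 3 → Fin 3 → ℂ} :
    tuple1 D L c ∈ W1 D L I ↔ c ∈ K1I I := by
  rw [W1, Submodule.mem_inf, h.tuple1_mem_AR_iff]
  exact and_iff_left (Submodule.subset_span ⟨c, rfl⟩)

theorem tuple1_notMem_range {c : Fol → Fin 3 → Fin 3 → ℂ} (hc : c ≠ 0) :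
    tuple1 D L c ∉ LinearMap.range (lin0 D) := by
  intro H
  have := Submodule.disjoint_def.1 h.disjoint_range _ H ⟨c, rfl⟩
  exact hc (h.lin1_injective (this.trans (lin1 D L).map_zero.symm))

theorem W0_univ : W0 D Finset.univ = K0.map (lin0 D) := by rw [h.W0_eq, K0I_univ]

theorem W1_univ : W1 D L Finset.univ = K1.map (lin1 D L) := by rw [h.W1_eq, K1I_univ]

theorem isRationalOn_tuple0 (c : Fol → Fin 3 → ℂ) : IsRationalOn D (tuple0 D c) := by
  intro f v
  refine ⟨∑ i, MvPolynomial.C (v 0 i) * numer (fun j => (MvPolynomial.X j : MvPolynomial (Fin 5) ℂ))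
      (fun l => MvPolynomial.C (linCo c f l)) i,
    ∏ k, zetaR (fun j => (MvPolynomial.X j : MvPolynomial (Fin 5) ℂ)) k, ?_, fun x hx => ?_⟩
  · intro H
    have h1 := congrArg (MvPolynomial.eval basePt) H
    rw [map_prod, map_zero, Finset.prod_eq_zero_iff] at h1
    obtain ⟨k, -, hk⟩ := h1
    rw [map_zetaR] at hk
    simp only [MvPolynomial.eval_X, zetaR_eq] at hk
    exact basePt_mem k hk
  · have hx' := h.sub hx
    rw [map_prod, map_sum, tuple0_apply hx hx']
    simp only [map_mul, map_zetaR, map_numer, MvPolynomial.eval_X, MvPolynomial.eval_C, zetaR_eq]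
    have hv : v 0 = ∑ i, v 0 i • (Pi.single i 1 : Y5) := by
      ext j
      simp [Finset.sum_apply, Pi.single_apply]
    calc _ = (∏ k, zeta k x) * ∑ l, linCo c f l * ∑ i, v 0 i * dz l x (Pi.single i 1) := by
          congr 1
          refine Finset.sum_congr rfl fun l _ => ?_
          conv_lhs => rw [hv, map_sum]
          simp only [map_smul, smul_eq_mul]
      _ = ∑ i, v 0 i * ((∏ k, zeta k x) * ∑ l, linCo c f l * dz l x (Pi.single i 1)) := by
          simp only [Finset.mul_sum]
          rw [Finset.sum_comm]
          exact Finset.sum_congr rfl fun _ _ => Finset.sum_congr rfl fun _ _ => by ring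
      _ = _ := Finset.sum_congr rfl fun i _ => by
          rw [← numer_eq hx']

/-- The rational abelian relations are those of weight `0`, since the logarithms are independent over
the rational functions. -/
theorem mem_W0_iff_isRationalOn {η : Tuple 1} (hη : η ∈ AR 1 D Finset.univ) :
    η ∈ W0 D Finset.univ ↔ IsRationalOn D η := by
  rw [h.W0_univ]
  constructor
  · rintro ⟨c, -, rfl⟩
    exact h.isRationalOn_tuple0 c
  · intro H
    obtain ⟨c₀, h0, c₁, h1, rfl⟩ := h.mem_AR_iff.1 hη
    rw [K0I_univ] at h0
    have := eq_zero_of_isRationalOn h.logSys subset_rfl h.sub H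
    refine ⟨c₀, h0, ?_⟩
    rw [this, show tuple1 D L 0 = 0 from (lin1 D L).map_zero, add_zero]
    rfl

theorem AR1C_eq : AR1C D L coefA = KA.map (lin1 D L) := by
  rw [AR1C]
  refine le_antisymm (Submodule.span_le.2 ?_) ?_
  · rintro _ ⟨ε, -, rfl⟩
    exact ⟨_, coefA_mem_KA ε, rfl⟩
  · rw [← span_eq_of_indep coefA_evenSigns_indep (fun j => coefA_mem_KA _)
      h.finrank_eq.2.2.1.le, Submodule.map_span, Submodule.span_le]
    rintro _ ⟨_, ⟨j, rfl⟩, rfl⟩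
    exact Submodule.subset_span ⟨evenSigns j, prod_evenSigns j, rfl⟩

theorem AR1Sym_eq : AR1Sym D L coefS = KS.map (lin1 D L) := by
  rw [AR1Sym]
  refine le_antisymm (Submodule.span_le.2 ?_) ?_
  · rintro _ ⟨T, hT, rfl⟩
    exact ⟨_, coefS_mem_KS hT, rfl⟩
  · rw [← span_eq_of_indep coefS_triples_indep (fun j => coefS_mem_KS (card_triples j))
      h.finrank_eq.2.1.le, Submodule.map_span, Submodule.span_le]
    rintro _ ⟨_, ⟨j, rfl⟩, rfl⟩
    exact Submodule.subset_span ⟨triples j, card_triples j, rfl⟩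

theorem finrank_map_lin1 (S : Submodule ℂ (Fol → Fin 3 → Fin 3 → ℂ)) :
    Module.finrank ℂ (S.map (lin1 D L)) = Module.finrank ℂ S :=
  (LinearEquiv.finrank_eq (Submodule.equivMapOfInjective _ h.lin1_injective S)).symm

theorem finrank_W0 : Module.finrank ℂ (W0 D Finset.univ) = 20 := by
  rw [h.W0_univ, ← h.finrank_eq.1]
  exact (LinearEquiv.finrank_eq (Submodule.equivMapOfInjective _ h.lin0_injective K0)).symm

theorem W1_eq_sup : W1 D L Finset.univ = AR1Sym D L coefS ⊔ AR1C D L coefA := by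
  rw [h.W1_univ, ← sup_KS_KA, Submodule.map_sup, h.AR1Sym_eq, h.AR1C_eq]

theorem AR_eq_sup : W0 D Finset.univ ⊔ AR1Sym D L coefS ⊔ AR1C D L coefA = AR 1 D Finset.univ := by
  rw [sup_assoc, ← h.W1_eq_sup, h.AR_eq]

theorem iSupIndep_summands : iSupIndep ![W0 D Finset.univ, AR1Sym D L coefS, AR1C D L coefA] := by
  have key (c₀ : Fol → Fin 3 → ℂ) (s a : Fol → Fin 3 → Fin 3 → ℂ) (hs : s ∈ KS) (ha : a ∈ KA)
      (e : lin0 D c₀ + lin1 D L s + lin1 D L a = 0) :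
      lin0 D c₀ = 0 ∧ lin1 D L s = 0 ∧ lin1 D L a = 0 := by
    have e' : lin1 D L (-(s + a)) = lin0 D c₀ := by
      rw [map_neg, map_add]
      exact neg_eq_of_add_eq_zero_left (by rw [← e, add_assoc])
    have h1 := Submodule.disjoint_def.1 h.disjoint_range _ ⟨c₀, rfl⟩ ⟨_, e'⟩
    rw [h1] at e'
    have h2 : s + a = 0 := neg_eq_zero.1 (h.lin1_injective (e'.trans (lin1 D L).map_zero.symm))
    have h3 : s = 0 := Submodule.disjoint_def.1 disjoint_KS_KA s hs
      (by rw [eq_neg_of_add_eq_zero_left h2]; exact KA.neg_mem ha)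
    rw [h3, zero_add] at h2
    exact ⟨h1, by rw [h3, map_zero], by rw [h2, map_zero]⟩
  have hW : ∀ w ∈ W0 D Finset.univ, ∃ c₀, lin0 D c₀ = w := by
    rw [h.W0_univ]
    rintro _ ⟨c, -, rfl⟩
    exact ⟨c, rfl⟩
  rw [iSupIndep_iff_finsetSum_eq_zero_imp_eq_zero]
  intro s v hv e i hi
  have hw (i : Fin 3) : (if i ∈ s then v i else 0) ∈
      ![W0 D Finset.univ, AR1Sym D L coefS, AR1C D L coefA] i := by
    split_ifs with hi
    · exact hv i hi
    · exact Submodule.zero_mem _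
  have e' : ∑ i, (if i ∈ s then v i else 0) = 0 := by
    rw [Finset.sum_ite_mem, Finset.univ_inter]; exact e
  obtain ⟨c, hc⟩ := hW _ (hw 0)
  have hS : (if (1 : Fin 3) ∈ s then v 1 else 0) ∈ KS.map (lin1 D L) := h.AR1Sym_eq ▸ hw 1
  have hA : (if (2 : Fin 3) ∈ s then v 2 else 0) ∈ KA.map (lin1 D L) := h.AR1C_eq ▸ hw 2
  obtain ⟨b, hb, hb'⟩ := hS
  obtain ⟨a, ha, ha'⟩ := hA
  rw [Fin.sum_univ_three, ← hc, ← hb', ← ha'] at e'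
  obtain ⟨k0, k1, k2⟩ := key c b a hb ha e'
  rw [hc] at k0
  rw [hb'] at k1
  rw [ha'] at k2
  fin_cases i
  · exact (if_pos hi).symm.trans k0
  · exact (if_pos hi).symm.trans k1
  · exact (if_pos hi).symm.trans k2

/-- The kernel of the derivative is the space of the relations without antisymmetric part. -/
theorem mem_image_iff {η : Tuple 1} : η ∈ W0 D Finset.univ ⊔ AR1Sym D L coefS ↔
    η ∈ AR 1 D Finset.univ ∧ totalD D η = 0 := by
  rw [h.W0_univ, h.AR1Sym_eq, h.mem_AR_iff, K0I_univ, K1I_univ]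
  constructor
  · intro H
    obtain ⟨_, ⟨c₀, h0, rfl⟩, _, ⟨s, hs, rfl⟩, rfl⟩ := Submodule.mem_sup.1 H
    refine ⟨⟨c₀, h0, s, hs.1, rfl⟩, ?_⟩
    exact (h.totalD_logTuple c₀ s).trans (tuple2_eq_zero_of_symm D hs.2)
  · rintro ⟨⟨c₀, h0, c₁, h1, rfl⟩, H⟩
    rw [h.totalD_logTuple, ← symPart_add_antiPart c₁] at H
    have e : tuple2 D (symPart c₁ + antiPart c₁) = tuple2 D (symPart c₁) + tuple2 D (antiPart c₁) :=
      (lin2 D).map_add _ _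
    rw [e, tuple2_eq_zero_of_symm D (symPart_mem h1).2, zero_add] at H
    have : antiPart c₁ = 0 := funext fun f => eq_zero_of_tuple2_eq_zero h.isOpen h.conn.1 h.sub
      ((antiPart_mem h1).2 f) fun x _ => congrFun (congrFun H f) x
    refine Submodule.mem_sup.2 ⟨_, ⟨c₀, h0, rfl⟩, _, ⟨symPart c₁, symPart_mem h1, rfl⟩, ?_⟩
    rw [show symPart c₁ = c₁ by rw [← add_zero (symPart c₁), ← this, symPart_add_antiPart]]
    rfl

/-- The closed abelian relations are exact: the components `d Log U_{f,s}` and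
`d (Log U_{f,a} Log U_{f,b})` have explicit primitives. -/
theorem mem_image_iff' {η : Tuple 1} : η ∈ W0 D Finset.univ ⊔ AR1Sym D L coefS ↔
    ∃ θ ∈ AR 0 D Finset.univ, totalD D θ = η := by
  constructor
  · rw [h.W0_univ, h.AR1Sym_eq]
    intro H
    obtain ⟨_, ⟨c₀, h0, rfl⟩, _, ⟨s, hs, rfl⟩, rfl⟩ := Submodule.mem_sup.1 H
    exact h.exists_primitive h0 hs.1 hs.2
  · rintro ⟨θ, hθ, rfl⟩
    refine h.mem_image_iff.2 ⟨totalD_mem_AR h.isOpen hθ, ?_⟩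
    ext f x v
    by_cases hx : x ∈ D
    · rw [totalD, Set.indicator_of_mem hx, extDeriv_totalD h.isOpen (hθ.1 f) hx]
      rfl
    · rw [totalD, Set.indicator_of_notMem hx]
      rfl

theorem isComplete_iff {I : Finset Fol} {c : Fol → Fin 3 → Fin 3 → ℂ} :
    IsCompleteAR I (tuple1 D L c) ↔ ∀ f ∈ I, c f ≠ 0 := by
  refine forall₂_congr fun f _ => not_congr ⟨fun H => ?_, fun H => ?_⟩
  · refine (logTuple_eq_zero h.logSys subset_rfl h.sub (c₀ := 0) ?_).2
    rw [show tuple0 D 0 = 0 from (lin0 D).map_zero, zero_add]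
    exact H
  · ext x v
    by_cases hx : x ∈ D
    · rw [tuple1_apply' hx, H]; simp
    · simp [tuple1, hx]

/-- Proper subwebs of `pairSubweb T` have no abelian relation of weight `1`, as the five-subwebs of
`pairSubweb T` contain both foliations of some index. -/
theorem isIrreducible {T : Finset (Fin 5)} (hT : T.card = 3) {c : Fol → Fin 3 → Fin 3 → ℂ}
    (hc : c ≠ 0) : IsIrreducibleAR D (pairSubweb T) (tuple1 D L c) := by
  intro H
  refine h.tuple1_notMem_range hc ((iSup₂_le (fun J hJ => ?_) : _ ≤ LinearMap.range (lin0 D)) H)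
  obtain ⟨f, hf, hfJ⟩ := Finset.exists_of_ssubset hJ
  have hT6 : (pairSubweb T).card = 6 := by
    rw [pairSubweb, Finset.card_product, hT]
    rfl
  have h5 : ((pairSubweb T).erase f).card = 5 := by rw [Finset.card_erase_of_mem hf, hT6]
  have h0 : K1I J = ⊥ := by
    have h1 := finrank_K1I ((pairSubweb T).erase f)
    have h2 := (finrank_le_nullity_anti h.span_baseA _).trans
      (nullity_baseA _ (listFol_mem_sublistsLen h5))
    rw [if_neg fun H => fst_listFol_erase T f hT (Finset.mem_product.1 hf).1 H.1] at h2
    rw [KSI_eq_bot h.span_baseS h5, finrank_bot, zero_add, Nat.le_zero.1 h2, Nat.le_zero,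
      Submodule.finrank_eq_zero] at h1
    rw [eq_bot_iff, ← h1]
    intro c hc
    rw [mem_K1I] at hc ⊢
    exact ⟨hc.1, fun g hg => hc.2 g fun hgJ => hg (Finset.mem_erase.2
      ⟨fun e => hfJ (e ▸ hgJ), hJ.1 hgJ⟩)⟩
  rw [h.AR_eq, h.W0_eq, h.W1_eq, h0, Submodule.map_bot, sup_bot_eq]
  exact LinearMap.map_le_range

/-- The small symmetric coefficients of an abelian relation of a `pairSubweb` are determined up to
sign, as the space of symmetric coefficients of such relations is a line. -/
theorem symCoef_unique {T : Finset (Fin 5)} (hT : T.card = 3) {c : Fol → Fin 3 → Fin 3 → ℤ}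
    (hc : IsSmall c) (hm : symCoef c ∈ K1I (pairSubweb T)) (h0 : symCoef c ≠ 0) :
    symCoef c = symCoef (coefS T) ∨ symCoef c = -symCoef (coefS T) := by
  have hS : symCoef c ∈ KSI (pairSubweb T) := by
    rw [mem_K1I] at hm
    refine mem_KSI.2 ⟨⟨hm.1, fun f a b => ?_⟩, hm.2⟩
    rcases lt_trichotomy a b with h | rfl | h
    · simp [symCoef, h, h.not_gt]
    · rfl
    · simp [symCoef, h, h.not_gt]
  obtain ⟨i, hi⟩ : T.Nonempty := Finset.card_pos.1 (by rw [hT]; norm_num)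
  have hf : ((i, 1) : Fol) ∈ pairSubweb T := Finset.mem_product.2 ⟨hi, Finset.mem_univ _⟩
  have h1 : Module.finrank ℂ (KSI (pairSubweb T)) ≤ 1 :=
    (finrank_le_nullity_sym h.span_baseS _).trans (nullity_coefS T hT)
  obtain ⟨⟨v, hv⟩, hv1⟩ := finrank_le_one_iff.1 h1
  obtain ⟨r, hr⟩ := hv1 ⟨_, hS⟩
  obtain ⟨q, hq⟩ := hv1 ⟨_, symCoef_coefS_mem hT⟩
  have hr : r • v = symCoef c := congrArg Subtype.val hr
  have hq : q • v = symCoef (coefS T) := congrArg Subtype.val hq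
  have hq0 : q ≠ 0 := by
    rintro rfl
    exact coefS_ne hT hf (by rw [← hq, zero_smul]; rfl)
  have e : symCoef c = (r / q) • symCoef (coefS T) := by
    rw [← hq, smul_smul, div_mul_cancel₀ _ hq0, hr]
  obtain ⟨a, b, hab, h2⟩ := exists_coefS hT hf
  have e1 := congrFun (congrFun (congrFun e (i, 1)) a) b
  simp only [symCoef, if_pos hab, Pi.smul_apply, smul_eq_mul] at e1
  have h3 := hc (i, 1) a b
  have ht : r / q = 0 ∨ r / q = 1 ∨ r / q = -1 := by
    have : r / q = (c (i, 1) a b : ℂ) ∨ r / q = -(c (i, 1) a b : ℂ) := by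
      rcases h2 with h2 | h2
      · left; rw [e1, h2]; simp
      · right; rw [e1, h2]; simp
    generalize r / q = t at this
    rcases h3 with h3 | h3 | h3 <;> rw [h3] at this <;> push_cast at this <;> grind
  rcases ht with ht | ht | ht
  · rw [ht, zero_smul] at e
    exact absurd e h0
  · left; rw [e, ht, one_smul]
  · right; rw [e, ht, neg_one_smul]

end LogDom

end

/-! ### Abelian relations of degree two of the five-subwebs -/

/-- Linear independence of analytic vectors at one point of `Ystar` extends to a nonempty open
subset of every nonempty open set. -/
theorem exists_open_indep {m : ℕ} {P : Type*} [Fintype P] {v : Fin m → Y5 → P → ℂ}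
    (hv : ∀ j p, AnalyticOnNhd ℂ (fun x => v j x p) Ystar) {y : Y5} (hy : y ∈ Ystar)
    (hi : LinearIndependent ℂ fun j => v j y) {D : Set Y5} (hD : IsOpen D) (hne : D.Nonempty)
    (hDY : D ⊆ Ystar) : ∃ D' ⊆ D, IsOpen D' ∧ D'.Nonempty ∧
      ∀ x ∈ D', LinearIndependent ℂ fun j => v j x := by
  obtain ⟨g, hg⟩ := LinearMap.exists_leftInverse_of_injective
    (Fintype.linearCombination ℂ fun j => v j y)
    (LinearMap.ker_eq_bot.2 (linearIndependent_iff_injective_fintypeLinearCombination.1 hi))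
  have hgv (j : Fin m) : g (v j y) = Pi.single j 1 := by
    have := LinearMap.congr_fun hg (Pi.single j 1)
    rwa [LinearMap.comp_apply, Fintype.linearCombination_apply_single, one_smul] at this
  set F : Y5 → ℂ := fun x => (Matrix.of fun i => g (v i x)).det with hF
  have hFa : AnalyticOnNhd ℂ F Ystar := by
    intro x hx
    have h1 (i : Fin m) : AnalyticAt ℂ (fun x => g (v i x)) x :=
      (g.toContinuousLinearMap.analyticAt _).comp (analyticAt_pi_iff.2 fun p => hv i p x hx)
    simp only [hF, Matrix.det_apply]
    refine Finset.analyticAt_fun_sum _ fun σ _ => ?_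
    simp only [Units.smul_def, zsmul_eq_mul]
    exact analyticAt_const.mul (Finset.analyticAt_fun_prod _ fun i _ =>
      analyticAt_pi_iff.1 (h1 (σ i)) i)
  have hFy : F y ≠ 0 := by
    have : (Matrix.of fun i => g (v i y)) = 1 := by
      ext i j
      rw [Matrix.of_apply, hgv, Matrix.one_apply, Pi.single_apply]
      simp [eq_comm]
    rw [hF]
    simp only [this, Matrix.det_one]
    exact one_ne_zero
  obtain ⟨x, hx, hFx⟩ := exists_ne_zero hFa hy hFy hD hne hDY
  refine ⟨D ∩ F ⁻¹' {0}ᶜ, Set.inter_subset_left,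
    (hFa.continuousOn.mono hDY).isOpen_inter_preimage hD isOpen_compl_singleton, ⟨x, hx, hFx⟩,
    fun z hz => ?_⟩
  exact LinearIndependent.of_comp g (Matrix.linearIndependent_rows_of_det_ne_zero hz.2)

/-- The coordinates of `dlog U_{f,1} ∧ dlog U_{f,2}`. -/
def omVec (f : Fol) (x : Y5) (p : Fin 5 × Fin 5) : ℂ :=
  wedge (dlogU f 0 x) (dlogU f 1 x) ![Pi.single p.1 1, Pi.single p.2 1]

/-- An integral point at which explicit minors are computed. -/
def certPt : Fin 5 → ℤ := ![2, -2, 1, -4, -2]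

theorem certPt_mem : (fun j => (certPt j : ℂ)) ∈ Ystar := by
  intro k
  rw [← zetaR_eq]
  have h : ∀ k, zetaR certPt k ≠ 0 := by decide +kernel
  have := map_zetaR (Int.castRingHom ℂ) certPt k
  intro h0
  refine h k (Int.cast_injective (α := ℂ) ?_)
  rw [Int.cast_zero, ← h0]
  exact this

/-- The pairs `i < j` in `Fin 5`. -/
def pairs5 : List (Fin 5 × Fin 5) :=
  [(0, 1), (0, 2), (0, 3), (0, 4), (1, 2), (1, 3), (1, 4), (2, 3), (2, 4), (3, 4)]

/-- The values at `certPt` of the functions `omVec`, with denominators cleared. -/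
def omTab (f : Fol) : List ℤ :=
  if f.2 = 1 then
    ![[0, 0, 0, 0, 0, 0, 0, 4064256, 0, 2032128], [4064256, 0, 0, 4064256, 0, 0, 0, 0, 0,
      0], [0, 0, 0, 0, 8128512, 0, 0, -4064256, 0, 0], [0, 0, 0, -4064256, 0, 0, 0, 0, 0,
      2032128], [4064256, 0, 0, 0, -8128512, 0, 0, 0, 0, 0]] f.1
  else
    ![[2515968, 4257792, 1548288, 1161216, 4064256, 1935360, -2322432, 774144, -5806080,
      -2322432], [6193152, -17031168, -6193152, 9289728, -32514048, -7741440, 9289728,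
      -11225088, 23224320, 2322432], [2322432, -51093504, -18579456, 24385536, -65028096,
      -23224320, 27869184, -9289728, 69672960, 20901888], [2709504, -29804544, -10838016,
      16257024, -36578304, -13547520, 16257024, 2709504, 40642560, 16257024], [10838016,
      -29804544, -10838016, 24385536, -37933056, -13547520, 16257024, -677376, 40642560,
      14224896]] f.1

theorem omTab_eq : ∀ (f : Fol) (m : Fin 10), (omTab f).getD m 0 =
    numer certPt (expoTab f 0) (pairs5.getD m 0).1 * numer certPt (expoTab f 1) (pairs5.getD m 0).2 -
      numer certPt (expoTab f 0) (pairs5.getD m 0).2 *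
        numer certPt (expoTab f 1) (pairs5.getD m 0).1 := by
  decide +kernel

theorem numer_certPt (f : Fol) (s : Fin 3) (i : Fin 5) : ((numer certPt (expoTab f s) i : ℤ) : ℂ) =
    (∏ k, zeta k fun j => (certPt j : ℂ)) *
      dlogU f s (fun j => (certPt j : ℂ)) (Pi.single i 1) := by
  have h1 := map_numer (Int.castRingHom ℂ) certPt (expoTab f s) i
  have h2 := numer_eq certPt_mem (fun l => (expoTab f s l : ℂ)) i
  rw [dlogU_eq_sum certPt_mem]
  simp only [sum_apply, smul_apply, smul_eq_mul, expo_eq]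
  exact h1.trans h2

theorem omVec_certPt (f : Fol) (m : Fin 10) :
    (∏ k, zeta k fun j => (certPt j : ℂ)) ^ 2 * omVec f (fun j => (certPt j : ℂ)) (pairs5.getD m 0) =
      ((omTab f).getD m 0 : ℤ) := by
  rw [omTab_eq, omVec, wedge_apply]
  push_cast
  simp only [numer_certPt]
  ring

theorem omVec_indep {l : List Fol} (h : nullity l.length ((List.finRange 10).map fun m =>
    (List.finRange l.length).map fun j => (omTab (l.get j)).getD (m : Fin 10) 0) = 0) :
    LinearIndependent ℂ fun j : Fin l.length => omVec (l.get j) fun i => (certPt i : ℂ) := by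
  have h0 : (∏ k, zeta k fun j => (certPt j : ℂ)) ^ 2 ≠ 0 :=
    pow_ne_zero _ (Finset.prod_ne_zero_iff.2 fun k _ => certPt_mem k)
  exact linearIndependent_of_nullity _
    (fun m : Fin 10 => ((∏ k, zeta k fun j => (certPt j : ℂ)) ^ 2) •
      (LinearMap.proj (pairs5.getD m 0) : (Fin 5 × Fin 5 → ℂ) →ₗ[ℂ] ℂ))
    (fun j m => (omTab (l.get j)).getD m 0) (List.finRange 10)
    (fun j m _ => omVec_certPt (l.get j) m) h

/-- The foliations of a five-subweb, but the first one in the case of the subwebs `W^ε`, `ε`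
even. -/
def genericList (l : List Fol) : List Fol :=
  if l.map Prod.fst = [0, 1, 2, 3, 4] ∧ listSign l = 1 then l.tail else l

theorem nullity_omTab : ∀ l ∈ List.sublistsLen 5 allFol,
    nullity (genericList l).length ((List.finRange 10).map fun m =>
      (List.finRange (genericList l).length).map fun j =>
        (omTab ((genericList l).get j)).getD (m : Fin 10) 0) = 0 := by
  decide +kernel

theorem analyticOnNhd_omVec (f : Fol) (p : Fin 5 × Fin 5) :
    AnalyticOnNhd ℂ (fun x => omVec f x p) Ystar := by
  intro x hx
  have h (s : Fin 3) (i : Fin 5) : AnalyticAt ℂ (fun x => dlogU f s x (Pi.single i 1)) x :=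
    ((ContinuousLinearMap.apply ℂ ℂ (Pi.single i 1 : Y5)).analyticAt _).comp
      (analyticOnNhd_dlogU f s x hx)
  simp only [omVec, wedge_apply]
  exact ((h 0 _).mul (h 1 _)).sub ((h 0 _).mul (h 1 _))

theorem exists_open_omVec_indep {l : List Fol} (hl : l ∈ List.sublistsLen 5 allFol) {D : Set Y5}
    (hD : IsOpen D) (hne : D.Nonempty) (hDY : D ⊆ Ystar) :
    ∃ D' ⊆ D, IsOpen D' ∧ D'.Nonempty ∧ ∀ x ∈ D', LinearIndependent ℂ
      fun j : Fin (genericList l).length => omVec ((genericList l).get j) x :=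
  exists_open_indep (v := fun j => omVec ((genericList l).get j))
    (fun _ p => analyticOnNhd_omVec _ p) certPt_mem
    (omVec_indep (nullity_omTab l hl)) hD hne hDY

theorem eq_zero_of_omVec_indep {l : List Fol} (hl : l.Nodup) {x : Y5}
    (hi : LinearIndependent ℂ fun j : Fin l.length => omVec (l.get j) x)
    {ω : Fol → Y5 [⋀^Fin 2]→L[ℂ] ℂ}
    (hω : ∀ f, ∃ a : ℂ, ω f = a • wedge (dlogU f 0 x) (dlogU f 1 x)) (h0 : ∀ f ∉ l, ω f = 0)
    (hs : ∑ f, ω f = 0) : ∀ f, ω f = 0 := by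
  choose a ha using hω
  intro f
  by_cases hf : f ∈ l
  swap
  · exact h0 f hf
  have h1 : ∑ j : Fin l.length, a (l.get j) • omVec (l.get j) x = 0 := by
    ext p
    have h2 := DFunLike.congr_fun hs ![Pi.single p.1 1, Pi.single p.2 1]
    have h3 : ∑ f, ω f = ∑ f ∈ l.toFinset, ω f :=
      (Finset.sum_subset (Finset.subset_univ _) fun f _ hf =>
        h0 f fun h => hf (List.mem_toFinset.2 h)).symm
    rw [h3, List.sum_toFinset _ hl, ← Fin.sum_univ_fun_getElem,
      ContinuousAlternatingMap.sum_apply] at h2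
    rw [Finset.sum_apply]
    refine Eq.trans (Finset.sum_congr rfl fun j _ => ?_) h2
    rw [ha]
    rfl
  obtain ⟨j, rfl⟩ := List.get_of_mem hf
  rw [ha, Fintype.linearIndependent_iff.1 hi _ h1 j]
  exact zero_smul ℂ (wedge _ _)

/-- A two-form killing the tangent space of `f` is a multiple of `dlog U_{f,1} ∧ dlog U_{f,2}`. -/
theorem exists_eq_smul_wedge {x : Y5} (hx : x ∈ Ystar) {f : Fol} {ω : Y5 [⋀^Fin 2]→L[ℂ] ℂ}
    (h : ∀ v : Fin 2 → Y5, (∃ j, fderiv ℂ (U f) x (v j) = 0) → ω v = 0) :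
    ∃ a : ℂ, ω = a • wedge (dlogU f 0 x) (dlogU f 1 x) := by
  set φ : Y5 → Y5 →L[ℂ] ℂ := fun w => ω.toContinuousMultilinearMap.toContinuousLinearMap ![0, w] 0
  have hφ (v w : Y5) : φ w v = ω ![v, w] := by
    change ω (Function.update ![0, w] 0 v) = _
    congr 1
    ext i
    fin_cases i <;> rfl
  have hk (w : Y5) : Kills f x (φ w) := fun v h0 h1 => by
    rw [hφ]
    exact h _ ⟨0, (tangent_iff hx f v).2 ⟨h0, h1⟩⟩
  have sw (v w : Y5) : ω ![w, v] = -ω ![v, w] := by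
    have := ω.toAlternatingMap.map_swap ![v, w] (i := 0) (j := 1) (by decide)
    rw [show ![w, v] = ![v, w] ∘ Equiv.swap 0 1 by ext i; fin_cases i <;> rfl]
    exact this
  have key (v w : Y5) := co_spec hx (φ := fun _ => φ w) (hk w) v
  have hm := minor_ne_zero hx f
  refine ⟨ω ![logVec (pI f) x, logVec (pJ f) x] / minor f x, ?_⟩
  ext v
  have hv : v = ![v 0, v 1] := by ext i; fin_cases i <;> rfl
  rw [hv]
  change _ = ω ![logVec (pI f) x, logVec (pJ f) x] / minor f x *
    wedge (dlogU f 0 x) (dlogU f 1 x) ![v 0, v 1]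
  rw [wedge_apply, ← hφ, key (v 0) (v 1)]
  have kI := key (v 1) (logVec (pI f) x)
  have kJ := key (v 1) (logVec (pJ f) x)
  simp only [co, hφ, Matrix.cons_val_zero, Matrix.cons_val_one] at kI kJ ⊢
  rw [sw (v 1) (logVec (pI f) x), sw (v 1) (logVec (pJ f) x), kI, kJ,
    self_eq_neg.1 (sw (logVec (pI f) x) (logVec (pI f) x)),
    self_eq_neg.1 (sw (logVec (pJ f) x) (logVec (pJ f) x)),
    sw (logVec (pI f) x) (logVec (pJ f) x)]
  field_simp
  rw [minor]
  ring

/-- The five-subwebs other than the `W^ε`, `ε` even, have no nontrivial abelian relation of degree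
two, because the two-forms `dlog U_{f,1} ∧ dlog U_{f,2}` are generically independent. -/
theorem AR_two_eq_bot {D : Set Y5} (hD : IsOpen D) (hDY : D ⊆ Ystar) {I : Finset Fol}
    (hI : I.card = 5)
    (hs : ¬((listFol I).map Prod.fst = [0, 1, 2, 3, 4] ∧ listSign (listFol I) = 1)) :
    AR 2 D I = ⊥ := by
  rw [eq_bot_iff]
  intro η hη
  obtain ⟨h1, h2, h3, h4, -, h6⟩ := hη
  rw [Submodule.mem_bot]
  ext1 f
  by_contra hf
  obtain ⟨x₀, hx₀⟩ := Function.ne_iff.1 hf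
  have hx₀D : x₀ ∈ D := by
    by_contra hx
    exact hx₀ (h2 f x₀ hx)
  obtain ⟨D', hD', -, ⟨x, hx⟩, hi⟩ := exists_open_omVec_indep (listFol_mem_sublistsLen hI)
    (D := D ∩ η f ⁻¹' {0}ᶜ)
    ((h1 f).continuousOn.isOpen_inter_preimage hD isOpen_compl_singleton) ⟨x₀, hx₀D, hx₀⟩
    (Set.inter_subset_left.trans hDY)
  rw [genericList, if_neg hs] at hi
  refine (hD' hx).2 (eq_zero_of_omVec_indep (List.Nodup.filter _ (by decide +kernel)) (hi x hx)
    (fun f => exists_eq_smul_wedge (hDY (hD' hx).1) (h4 f x (hD' hx).1)) (fun f hf => ?_) (h6 x) f)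
  rw [h3 f fun H => hf (mem_listFol.2 H)]
  rfl

section

/-- Every point of `Ystar` has small neighborhoods with logarithms of the functions `ζ_k`. -/
theorem exists_logDom {D : Set Y5} (hD : IsOpen D) (hDY : D ⊆ Ystar) {x : Y5} (hx : x ∈ D) :
    ∃ B ⊆ D, x ∈ B ∧ ∃ L, LogDom B L := by
  have hev : ∀ᶠ y in nhds x, y ∈ D ∧ ∀ k, zeta k y / zeta k x ∈ Complex.slitPlane := by
    refine Filter.Eventually.and (hD.mem_nhds hx) (Filter.eventually_all.2 fun k => ?_)
    have hc : ContinuousAt (fun y => zeta k y / zeta k x) x :=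
      ((analyticOnNhd_zeta k Set.univ x trivial).continuousAt).div_const _
    refine hc.eventually (Complex.isOpen_slitPlane.mem_nhds ?_)
    change zeta k x / zeta k x ∈ Complex.slitPlane
    rw [div_self (hDY hx k)]
    exact Complex.one_mem_slitPlane
  obtain ⟨r, hr, hB⟩ := Metric.eventually_nhds_iff_ball.1 hev
  refine ⟨Metric.ball x r, fun y hy => (hB y hy).1, Metric.mem_ball_self hr,
    fun k y => Complex.log (zeta k y / zeta k x) + Complex.log (zeta k x), Metric.isOpen_ball,
    ⟨⟨x, Metric.mem_ball_self hr⟩, (convex_ball x r).isPreconnected⟩, fun k y hy => ?_,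
    fun k y hy => ?_⟩
  · refine AnalyticAt.add (AnalyticAt.clog ?_ ((hB y hy).2 k)) analyticAt_const
    exact (analyticOnNhd_zeta k Set.univ y trivial).div analyticAt_const (hDY hx k)
  · have h1 := hDY (hB y hy).1 k
    rw [Complex.exp_add, Complex.exp_log (div_ne_zero h1 (hDY hx k)), Complex.exp_log (hDY hx k),
      div_mul_cancel₀ _ (hDY hx k)]

theorem exists_logDom' : ∃ B L, LogDom B L := by
  obtain ⟨B, -, -, L, h⟩ := exists_logDom isOpen_Ystar subset_rfl basePt_mem
  exact ⟨B, L, h⟩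

/-- Being an abelian relation is a local property. -/
theorem mem_AR_of_local {k : ℕ} {D : Set Y5} {I : Finset Fol} {η : Tuple k}
    (hout : ∀ f, ∀ x ∉ D, η f x = 0)
    (h : ∀ x ∈ D, ∃ B ⊆ D, IsOpen B ∧ x ∈ B ∧ restrictTo B η ∈ AR k B I) : η ∈ AR k D I := by
  have key (x : Y5) (hx : x ∈ D) : ∃ B, IsOpen B ∧ x ∈ B ∧ restrictTo B η ∈ AR k B I ∧
      ∀ f, restrictTo B η f =ᶠ[nhds x] η f := by
    obtain ⟨B, -, hB, hxB, hη⟩ := h x hx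
    refine ⟨B, hB, hxB, hη, fun f => ?_⟩
    filter_upwards [hB.mem_nhds hxB] with y hy using Set.indicator_of_mem hy _
  refine ⟨fun f x hx => ?_, hout, fun f hf => ?_, fun f x hx v hv => ?_, fun f x hx v hv => ?_,
    fun x => ?_⟩
  · obtain ⟨B, -, hxB, hη, he⟩ := key x hx
    exact (hη.1 f x hxB).congr (he f)
  · ext1 x
    by_cases hx : x ∈ D
    · obtain ⟨B, -, -, hη, he⟩ := key x hx
      rw [← (he f).eq_of_nhds, hη.2.2.1 f hf]
    · exact hout f x hx
  · obtain ⟨B, -, hxB, hη, he⟩ := key x hx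
    rw [← (he f).eq_of_nhds]
    exact hη.2.2.2.1 f x hxB v hv
  · obtain ⟨B, -, hxB, hη, he⟩ := key x hx
    rw [← (he f).extDeriv_eq]
    exact hη.2.2.2.2.1 f x hxB v hv
  · by_cases hx : x ∈ D
    · obtain ⟨B, -, -, hη, he⟩ := key x hx
      rw [← hη.2.2.2.2.2 x]
      exact Finset.sum_congr rfl fun f _ => (he f).eq_of_nhds.symm
    · exact Finset.sum_eq_zero fun f _ => hout f x hx

theorem restrictTo_tuple2 {D B : Set Y5} (hB : B ⊆ D) (c : Fol → Fin 3 → Fin 3 → ℂ) :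
    restrictTo B (tuple2 D c) = tuple2 B c := by
  ext1 f
  rw [restrictTo, tuple2, Set.indicator_indicator, Set.inter_eq_left.2 hB]
  rfl

theorem tuple2_mem_AR {D : Set Y5} (hD : IsOpen D) (hDY : D ⊆ Ystar) {I : Finset Fol}
    {c : Fol → Fin 3 → Fin 3 → ℂ} (hc : c ∈ K1I I) : tuple2 D c ∈ AR 2 D I := by
  refine mem_AR_of_local (fun f x hx => Set.indicator_of_notMem hx _) fun x hx => ?_
  obtain ⟨B, hB, hxB, L, h⟩ := exists_logDom hD hDY hx
  refine ⟨B, hB, h.isOpen, hxB, ?_⟩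
  rw [restrictTo_tuple2 hB, ← h.totalD_tuple1]
  exact totalD_mem_AR h.isOpen (h.tuple1_mem_AR_iff.2 hc)

theorem residue_mem_AR {D : Set Y5} (hD : IsOpen D) (hDY : D ⊆ Ystar) {ε : Fin 5 → ℤˣ}
    (hε : ∏ i, ε i = 1) : residue D ε ∈ AR 2 D (signedSubweb ε) := by
  rw [← tuple2_coefA D hε]
  have := mem_KAI.1 (coefA_mem_KAI ε)
  exact tuple2_mem_AR hD hDY (mem_K1I.2 ⟨this.1.1, this.2⟩)

/-- If `ω` and `μ ω` are both closed modulo the foliation `f`, then `dμ` vanishes on the leaves of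
`f`. -/
theorem kills_fderiv_of_smul {ω : Y5 → Y5 [⋀^Fin 2]→L[ℂ] ℂ} {μ : Y5 → ℂ} {x : Y5} {f : Fol}
    (hx : x ∈ Ystar) (hμ : DifferentiableAt ℂ μ x) (hω : DifferentiableAt ℂ ω x)
    (h1 : ∀ v : Fin 3 → Y5, (∃ j, fderiv ℂ (U f) x (v j) = 0) → extDeriv ω x v = 0)
    (h2 : ∀ v : Fin 3 → Y5, (∃ j, fderiv ℂ (U f) x (v j) = 0) →
      extDeriv (fun y => μ y • ω y) x v = 0)
    (h3 : ∀ v : Fin 2 → Y5, (∃ j, fderiv ℂ (U f) x (v j) = 0) → ω x v = 0) (h0 : ω x ≠ 0) :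
    Kills f x (fderiv ℂ μ x) := by
  intro w w0 w1
  have hw := (tangent_iff hx f w).2 ⟨w0, w1⟩
  obtain ⟨v, hv⟩ := DFunLike.ne_iff.1 h0
  have e := h2 ![w, v 0, v 1] ⟨0, hw⟩
  rw [extDeriv, (hμ.hasFDerivAt.fun_smul hω.hasFDerivAt).fderiv,
    ContinuousAlternatingMap.alternatizeUncurryFin_add,
    ContinuousAlternatingMap.alternatizeUncurryFin_smul] at e
  have e1 := h1 ![w, v 0, v 1] ⟨0, hw⟩
  rw [extDeriv] at e1
  rw [ContinuousAlternatingMap.add_apply, ContinuousAlternatingMap.smul_apply, e1, smul_zero,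
    zero_add, ContinuousAlternatingMap.alternatizeUncurryFin_apply, Fin.sum_univ_three] at e
  have z1 : ω x (Fin.removeNth 1 ![w, v 0, v 1]) = 0 := h3 _ ⟨0, hw⟩
  have z2 : ω x (Fin.removeNth 2 ![w, v 0, v 1]) = 0 := h3 _ ⟨0, hw⟩
  have z0 : Fin.removeNth 0 ![w, v 0, v 1] = v := by ext i; fin_cases i <;> rfl
  simp [z1, z2, z0] at e
  exact e.resolve_right hv

/-- The components in the basis `dy_1, …, dy_5` of the four forms `dlog U_{f,s}`, `dlog U_{g,s}`,
`s = 1, 2`. -/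
def pairVec (f g : Fol) (m : Fin 4) (x : Y5) (i : Fin 5) : ℂ :=
  dlogU (![f, f, g, g] m) (![0, 1, 0, 1] m) x (Pi.single i 1)

theorem nullity_pair : ∀ e e' : ℤˣ, nullity 4 ((List.finRange 5).map fun i =>
    (List.finRange 4).map fun m => numer certPt
      (expoTab ((![(0, e), (0, e), (1, e'), (1, e')] : Fin 4 → Fol) m) (![0, 1, 0, 1] m)) i) = 0 := by
  decide +kernel

theorem pairVec_indep (e e' : ℤˣ) :
    LinearIndependent ℂ fun m => pairVec (0, e) (1, e') m fun j => (certPt j : ℂ) :=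
  linearIndependent_of_nullity _
    (fun i : Fin 5 => (∏ k, zeta k fun j => (certPt j : ℂ)) •
      (LinearMap.proj i : (Fin 5 → ℂ) →ₗ[ℂ] ℂ))
    (fun m i => numer certPt
      (expoTab ((![(0, e), (0, e), (1, e'), (1, e')] : Fin 4 → Fol) m) (![0, 1, 0, 1] m)) i)
    (List.finRange 5) (fun _ _ _ => (numer_certPt _ _ _).symm) (nullity_pair e e')

theorem eq_zero_of_kills {f g : Fol} {x : Y5} (hx : x ∈ Ystar)
    (hi : LinearIndependent ℂ fun m => pairVec f g m x) {φ : Y5 →L[ℂ] ℂ} (hf : Kills f x φ)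
    (hg : Kills g x φ) : φ = 0 := by
  have ef := co_spec hx (φ := fun _ => φ) hf
  have eg := co_spec hx (φ := fun _ => φ) hg
  set a := co f 0 (fun _ => φ) x
  set b := co f 1 (fun _ => φ) x
  have h := Fintype.linearIndependent_iff.1 hi
    ![a, b, -co g 0 (fun _ => φ) x, -co g 1 (fun _ => φ) x] (by
      ext i
      have e1 := ef (Pi.single i 1)
      have e2 := eg (Pi.single i 1)
      rw [e1] at e2
      simp [Fin.sum_univ_four, pairVec]
      linear_combination e2)
  have ha : a = 0 := h 0
  have hb : b = 0 := h 1
  ext v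
  rw [ef v, ha, hb]
  simp

/-- The abelian relations of degree two of a subweb `W^ε`, `ε` even, are the multiples of the
residue. Generically, the only relation between the two-forms `dlog U_{f,1} ∧ dlog U_{f,2}` is
given by the residue. Hence an abelian relation is `μ Res_ε` for some function `μ`, constant on the
leaves of all the foliations, hence constant. -/
theorem exists_eq_smul_residue {D : Set Y5} (hD : IsOpen D) (hc : IsConnected D) (hDY : D ⊆ Ystar)
    {ε : Fin 5 → ℤˣ} (hε : ∏ i, ε i = 1) {η : Tuple 2} (hη : η ∈ AR 2 D (signedSubweb ε)) :
    ∃ t : ℂ, η = t • residue D ε := by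
  have hR := residue_mem_AR hD hDY hε
  have hlist := listFol_signedSubweb ε
  have hgen : genericList (listFol (signedSubweb ε)) = (listFol (signedSubweb ε)).tail := by
    refine if_pos ⟨?_, by rw [listSign_signedSubweb, hε]⟩
    rw [hlist, List.map_map]
    rfl
  have hcons : listFol (signedSubweb ε) = (0, ε 0) :: (listFol (signedSubweb ε)).tail := by
    rw [hlist]
    rfl
  have hnd : (listFol (signedSubweb ε)).tail.Nodup :=
    (List.Nodup.filter _ (by decide +kernel)).sublist (List.tail_sublist _)
  -- on the small open set `D4`, the two-forms of four of the foliations are independent, two of the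
  -- foliations have transversal leaves, and the components of the residue do not vanish
  obtain ⟨D1, hD1, oD1, nD1, iD1⟩ := exists_open_omVec_indep
    (listFol_mem_sublistsLen (card_signedSubweb ε)) hD hc.1 hDY
  rw [hgen] at iD1
  obtain ⟨D2, hD2, oD2, nD2, iD2⟩ := exists_open_indep (v := pairVec (0, ε 0) (1, ε 1))
    (fun _ i x hx => ((ContinuousLinearMap.apply ℂ ℂ (Pi.single i 1 : Y5)).analyticAt _).comp
      (analyticOnNhd_dlogU _ _ x hx)) certPt_mem (pairVec_indep _ _) oD1 nD1 (hD1.trans hDY)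
  have hRne (B : Set Y5) (hBD : B ⊆ D) (oB : IsOpen B) (nB : B.Nonempty) (i : Fin 5) :
      ∃ B' ⊆ B, IsOpen B' ∧ B'.Nonempty ∧ ∀ x ∈ B', residue D ε (i, ε i) x ≠ 0 := by
    have : ∃ x ∈ B, residue D ε (i, ε i) x ≠ 0 := by
      by_contra! H
      refine antiCoef_coefA_apply_ne_zero hε i (eq_zero_of_tuple2_eq_zero oB nB (hBD.trans hDY)
        ((coefA_mem_KA ε).2 _) fun x hx => ?_)
      rw [← H x hx, ← tuple2_coefA D hε, tuple2, tuple2, Set.indicator_of_mem hx,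
        Set.indicator_of_mem (hBD hx)]
    obtain ⟨x, hx, hx0⟩ := this
    exact ⟨B ∩ residue D ε (i, ε i) ⁻¹' {0}ᶜ, Set.inter_subset_left,
      ((hR.1 _).continuousOn.mono hBD).isOpen_inter_preimage oB isOpen_compl_singleton,
      ⟨x, hx, hx0⟩, fun y hy => hy.2⟩
  obtain ⟨D3, hD3, oD3, nD3, iD3⟩ := hRne D2 (hD2.trans hD1) oD2 nD2 0
  obtain ⟨D4, hD4, oD4, ⟨x, hx⟩, iD4⟩ := hRne D3 (hD3.trans (hD2.trans hD1)) oD3 nD3 1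
  have hsub : D4 ⊆ D := hD4.trans (hD3.trans (hD2.trans hD1))
  obtain ⟨v, hv⟩ := DFunLike.ne_iff.1 (iD3 x (hD4 hx))
  have hana (θ : Tuple 2) (hθ : θ ∈ AR 2 D (signedSubweb ε)) {y : Y5} (hy : y ∈ D) :
      AnalyticAt ℂ (fun y => θ (0, ε 0) y v) y :=
    ((ContinuousAlternatingMap.apply ℂ Y5 ℂ v).analyticAt _).comp (hθ.1 _ y hy)
  have hev : ∀ᶠ y in nhds x, y ∈ D4 ∧ residue D ε (0, ε 0) y v ≠ 0 :=
    Filter.Eventually.and (oD4.mem_nhds hx) ((hana _ hR (hsub hx)).continuousAt.eventually_ne hv)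
  obtain ⟨r, hr, hB⟩ := Metric.eventually_nhds_iff_ball.1 hev
  set μ : Y5 → ℂ := fun y => η (0, ε 0) y v / residue D ε (0, ε 0) y v
  have hμ (y : Y5) (hy : y ∈ Metric.ball x r) : AnalyticAt ℂ μ y :=
    (hana _ hη (hsub (hB y hy).1)).div (hana _ hR (hsub (hB y hy).1)) (hB y hy).2
  have hprop (y : Y5) (hy : y ∈ Metric.ball x r) (f : Fol) : η f y = μ y • residue D ε f y := by
    have hyD := hsub (hB y hy).1
    have hexη (f : Fol) := exists_eq_smul_wedge (hDY hyD) (hη.2.2.2.1 f y hyD)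
    have hexR (f : Fol) := exists_eq_smul_wedge (hDY hyD) (hR.2.2.2.1 f y hyD)
    rw [← sub_eq_zero]
    refine eq_zero_of_omVec_indep hnd (iD1 y (hD2 (hD3 (hD4 (hB y hy).1))))
      (ω := fun f => η f y - μ y • residue D ε f y) (fun f => ?_) (fun f hf => ?_) ?_ f
    · obtain ⟨a, ha⟩ := hexη f
      obtain ⟨b, hb⟩ := hexR f
      refine ⟨a - μ y * b, ?_⟩
      rw [ha, hb]
      module
    · by_cases hfI : f ∈ listFol (signedSubweb ε)
      · rw [hcons, List.mem_cons] at hfI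
        obtain rfl := hfI.resolve_right hf
        obtain ⟨a, ha⟩ := hexη (0, ε 0)
        obtain ⟨b, hb⟩ := hexR (0, ε 0)
        have hb0 := (hB y hy).2
        have hμy : μ y = η (0, ε 0) y v / residue D ε (0, ε 0) y v := rfl
        rw [hb] at hb0
        have hb1 : b * wedge (dlogU (0, ε 0) 0 y) (dlogU (0, ε 0) 1 y) v ≠ 0 := hb0
        have hμ' : μ y = a / b := by
          rw [hμy, ha, hb]
          exact mul_div_mul_right _ _ (right_ne_zero_of_mul hb1)
        rw [hμ', ha, hb, smul_smul, div_mul_cancel₀ _ (left_ne_zero_of_mul hb1), sub_self]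
      · rw [mem_listFol] at hfI
        rw [hη.2.2.1 f hfI, hR.2.2.1 f hfI, sub_eq_zero]
        exact (smul_zero (A := Y5 [⋀^Fin 2]→L[ℂ] ℂ) (μ y)).symm
    · rw [Finset.sum_sub_distrib, ← Finset.smul_sum, hη.2.2.2.2.2 y, hR.2.2.2.2.2 y]
      simp
  -- `dμ` kills the leaves of two transversal foliations
  have hd (y : Y5) (hy : y ∈ Metric.ball x r) : fderiv ℂ μ y = 0 := by
    have hyD := hsub (hB y hy).1
    have hk (i : Fin 5) (hi : residue D ε (i, ε i) y ≠ 0) : Kills (i, ε i) y (fderiv ℂ μ y) := by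
      refine kills_fderiv_of_smul (hDY hyD) (hμ y hy).differentiableAt
        (hR.1 (i, ε i) y hyD).differentiableAt (hR.2.2.2.2.1 _ y hyD) (fun w hw => ?_)
        (hR.2.2.2.1 _ y hyD) hi
      have : (fun y => μ y • residue D ε (i, ε i) y) =ᶠ[nhds y] η (i, ε i) := by
        filter_upwards [Metric.isOpen_ball.mem_nhds hy] with z hz using (hprop z hz _).symm
      rw [this.extDeriv_eq]
      exact hη.2.2.2.2.1 _ y hyD w hw
    exact eq_zero_of_kills (hDY hyD) (iD2 y (hD3 (hD4 (hB y hy).1)))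
      (hk 0 (iD3 y (hD4 (hB y hy).1))) (hk 1 (iD4 y (hB y hy).1))
  have hconst (y : Y5) (hy : y ∈ Metric.ball x r) : μ y = μ x :=
    Metric.isOpen_ball.is_const_of_fderiv_eq_zero (convex_ball x r).isPreconnected
      (fun z hz => (hμ z hz).differentiableAt.differentiableWithinAt) hd hy
      (Metric.mem_ball_self hr)
  refine ⟨μ x, ?_⟩
  ext1 f
  have heq : Set.EqOn (η f) (fun y => μ x • residue D ε f y) D := by
    refine (hη.1 f).eqOn_of_preconnected_of_eventuallyEq
      ((analyticOnNhd_const (v := μ x)).smul (hR.1 f)) hc.2 (hsub hx) ?_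
    filter_upwards [Metric.isOpen_ball.mem_nhds (Metric.mem_ball_self hr)] with z hz
    rw [hprop z hz f, hconst z hz]
  ext1 y
  by_cases hy : y ∈ D
  · exact heq hy
  · change η f y = μ x • residue D ε f y
    rw [hη.2.1 f y hy, hR.2.1 f y hy]
    exact (smul_zero (A := Y5 [⋀^Fin 2]→L[ℂ] ℂ) (μ x)).symm

theorem span_coefA : Submodule.span ℂ (Set.range fun j => antiCoef (coefA (evenSigns j))) = KA := by
  obtain ⟨B, L, h⟩ := exists_logDom'
  exact span_eq_of_indep coefA_evenSigns_indep (fun j => coefA_mem_KA _) h.finrank_eq.2.2.1.le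

/-- The combinatorial abelian relations of degree two have antisymmetric constant coefficients. -/
theorem AR2C_eq {D : Set Y5} (hD : IsOpen D) (hc : IsConnected D) (hDY : D ⊆ Ystar) :
    AR2C D = KA.map (lin2 D) := by
  refine le_antisymm (iSup₂_le fun I hI => ?_) ?_
  · by_cases hs : (listFol I).map Prod.fst = [0, 1, 2, 3, 4] ∧ listSign (listFol I) = 1
    · obtain ⟨ε, rfl⟩ := eq_signedSubweb hs.1
      have hε := hs.2
      rw [listSign_signedSubweb] at hε
      intro η hη
      obtain ⟨t, rfl⟩ := exists_eq_smul_residue hD hc hDY hε hη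
      rw [← tuple2_coefA D hε]
      exact Submodule.smul_mem _ t ⟨_, coefA_mem_KA ε, rfl⟩
    · rw [AR_two_eq_bot hD hDY hI hs]
      exact bot_le
  · rw [← span_coefA, Submodule.map_span, Submodule.span_le]
    rintro _ ⟨_, ⟨j, rfl⟩, rfl⟩
    have h1 : residue D (evenSigns j) ∈ AR 2 D (signedSubweb (evenSigns j)) :=
      residue_mem_AR hD hDY (prod_evenSigns j)
    rw [← tuple2_coefA D (prod_evenSigns j)] at h1
    exact Submodule.mem_iSup_of_mem _ (Submodule.mem_iSup_of_mem (card_signedSubweb _) h1)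

/-- A submodule on which a linear map is injective is isomorphic to its image. -/
def mapEquiv {V W : Type*} [AddCommGroup V] [Module ℂ V] [AddCommGroup W] [Module ℂ W]
    (F : V →ₗ[ℂ] W) (S : Submodule ℂ V) (h : ∀ x ∈ S, F x = 0 → x = 0) : S ≃ₗ[ℂ] S.map F :=
  LinearEquiv.ofBijective (F.submoduleMap S)
    ⟨(injective_iff_map_eq_zero _).2 fun x hx => Subtype.ext (h x x.2 (congrArg Subtype.val hx)),
      F.submoduleMap_surjective S⟩

theorem lin2_eq_zero {D : Set Y5} (hD : IsOpen D) (hne : D.Nonempty) (hDY : D ⊆ Ystar)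
    (c : Fol → Fin 3 → Fin 3 → ℂ) (hc : c ∈ KA) (h : lin2 D c = 0) : c = 0 :=
  funext fun f => eq_zero_of_tuple2_eq_zero hD hne hDY (hc.2 f) fun x _ => congrFun (congrFun h f) x

/-- Antisymmetric coefficients, as coefficients of combinatorial abelian relations of degree
two. -/
def equivAR2C {D : Set Y5} (hD : IsOpen D) (hc : IsConnected D) (hDY : D ⊆ Ystar) :
    KA ≃ₗ[ℂ] AR2C D :=
  (mapEquiv (lin2 D) KA (lin2_eq_zero hD hc.1 hDY)).trans
    (LinearEquiv.ofEq _ _ (AR2C_eq hD hc hDY).symm)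

theorem equivAR2C_apply {D : Set Y5} (hD : IsOpen D) (hc : IsConnected D) (hDY : D ⊆ Ystar)
    (c : KA) : (equivAR2C hD hc hDY c : Tuple 2) = tuple2 D c := rfl

namespace LogDom

variable {D : Set Y5} {L : Fin 10 → Y5 → ℂ} (h : LogDom D L)

/-- Antisymmetric coefficients, as coefficients of abelian relations. -/
def equivAR1C : KA ≃ₗ[ℂ] AR1C D L coefA :=
  (mapEquiv (lin1 D L) KA fun _ _ e => h.lin1_injective (e.trans (map_zero _).symm)).trans
    (LinearEquiv.ofEq _ _ h.AR1C_eq.symm)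

theorem equivAR1C_apply (c : KA) : (h.equivAR1C c : Tuple 1) = tuple1 D L c := rfl

include h in
theorem exists_totalD_equiv :
    ∃ δ : AR1C D L coefA ≃ₗ[ℂ] AR2C D, ∀ η, (δ η : Tuple 2) = totalD D (η : Tuple 1) := by
  refine ⟨h.equivAR1C.symm.trans (equivAR2C h.isOpen h.conn h.sub), fun η => ?_⟩
  obtain ⟨c, rfl⟩ := h.equivAR1C.surjective η
  rw [LinearEquiv.trans_apply, LinearEquiv.symm_apply_apply, equivAR2C_apply, h.equivAR1C_apply,
    h.totalD_tuple1]

end LogDom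

end

/-! ### The action of the birational automorphisms -/

/-- The exponents in the monomials `± ∏ ζ_c ^ e_c` equal to the functions `ζ_j ∘ σ_k`. -/
def cremM (k : Fin 5) (j c : Fin 10) : ℤ :=
  trit ((![
    ![29497, 29534, 29554, 29523, 29577, 30252, 29740, 31711, 36057, 49207],
    ![29515, 29517, 29523, 29614, 29552, 29767, 31702, 30252, 36085, 49197],
    ![29608, 29534, 29443, 29461, 29515, 29677, 30253, 36004, 31702, 49207],
    ![29441, 29443, 29554, 29614, 29521, 29767, 30169, 31711, 49204, 36004],
    ![30253, 27583, 27346, 29308, 31549, 29281, 29525, 27337, 35842, 47020]] : Fin 5 → Fin 10 → ℕ) k j) c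

/-- The signs in the monomials `± ∏ ζ_c ^ e_c` equal to the functions `ζ_j ∘ σ_k`. -/
def cremSign (k : Fin 5) (j : Fin 10) : ℤ :=
  (![
    ![1, -1, -1, 1, -1, 1, 1, 1, -1, 1],
    ![1, -1, 1, -1, -1, 1, 1, 1, 1, -1],
    ![-1, -1, 1, -1, 1, -1, 1, 1, 1, 1],
    ![-1, 1, -1, -1, 1, 1, -1, 1, 1, 1],
    ![-1, 1, -1, -1, 1, 1, -1, 1, 1, 1]] : Fin 5 → Fin 10 → ℤ) k j

set_option maxHeartbeats 4000000 in
theorem zeta_cremona {x : Y5} (hx : x ∈ Ystar) (k : Fin 5) (j : Fin 10) :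
    zeta j (cremona k x) = cremSign k j * ∏ c, zeta c x ^ cremM k j c := by
  have h0 : x 0 ≠ 0 := hx 0
  have h1 : x 1 ≠ 0 := hx 1
  have h2 : x 2 ≠ 0 := hx 2
  have h3 : x 3 ≠ 0 := hx 3
  have h4 : x 4 ≠ 0 := hx 4
  have h5 : 1 + x 3 - x 2 * x 4 ≠ 0 := hx 5
  have h7 : 1 + x 2 - x 1 * x 3 ≠ 0 := hx 7
  fin_cases k <;> fin_cases j <;>
    simp [zeta, cremona, cremM, cremSign, trit, Fin.prod_univ_succ, -mul_eq_mul_left_iff,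
      -mul_eq_mul_right_iff] <;>
    (try generalize hp : 1 + x 3 - x 2 * x 4 = p at *) <;>
    (try generalize hq : 1 + x 2 - x 1 * x 3 = q at *) <;>
    field_simp <;> (try subst hp) <;> (try subst hq) <;> ring

theorem cremSign_sq : ∀ k j, cremSign k j * cremSign k j = 1 := by decide

theorem cremona_mem {x : Y5} (hx : x ∈ Ystar) (k : Fin 5) : cremona k x ∈ Ystar := fun j => by
  rw [zeta_cremona hx]
  refine mul_ne_zero (Int.cast_ne_zero.2 fun h => ?_)
    (Finset.prod_ne_zero_iff.2 fun c _ => zpow_ne_zero _ (hx c))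
  have := cremSign_sq k j
  rw [h] at this
  exact absurd this (by decide)

theorem cremona_apply (k j : Fin 5) (x : Y5) : cremona k x j = zeta (j.castAdd 5) (cremona k x) := by
  fin_cases j <;> rfl

theorem hasFDerivAt_zeta_cremona {x : Y5} (hx : x ∈ Ystar) (k : Fin 5) (j : Fin 10) :
    HasFDerivAt (fun y => zeta j (cremona k y))
      (zeta j (cremona k x) • ∑ c, (cremM k j c : ℂ) • dz c x) x := by
  have h1 : (fun y => zeta j (cremona k y)) =ᶠ[nhds x]
      fun y => cremSign k j * Complex.exp (∑ c, (cremM k j c : ℂ) * locLog x c y) := by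
    filter_upwards [isOpen_Ystar.mem_nhds hx] with y hy
    simp only [zeta_cremona hy, Complex.exp_sum, Complex.exp_int_mul, exp_locLog hx hy]
  have h2 : HasFDerivAt (fun y => ∑ c, (cremM k j c : ℂ) * locLog x c y)
      (∑ c, (cremM k j c : ℂ) • dz c x) x := by
    refine HasFDerivAt.fun_sum fun c _ => HasFDerivAt.const_mul ?_ _
    rw [← (fderiv_locLog hx c).self_of_nhds]
    exact (analyticAt_locLog hx c).differentiableAt.hasFDerivAt
  have h3 := (h2.cexp.const_mul (cremSign k j : ℂ)).congr_of_eventuallyEq h1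
  have h4 : zeta j (cremona k x) =
      cremSign k j * Complex.exp (∑ c, (cremM k j c : ℂ) * locLog x c x) := h1.self_of_nhds
  rw [h4, mul_smul]
  exact h3

theorem differentiableAt_cremona {x : Y5} (hx : x ∈ Ystar) (k : Fin 5) :
    DifferentiableAt ℂ (cremona k) x := by
  refine differentiableAt_pi.2 fun j => ?_
  simp only [cremona_apply]
  exact (hasFDerivAt_zeta_cremona hx k _).differentiableAt

theorem dz_cremona {x : Y5} (hx : x ∈ Ystar) (k : Fin 5) (j : Fin 10) (v : Y5) :
    dz j (cremona k x) (fderiv ℂ (cremona k) x v) = ∑ c, cremM k j c * dz c x v := by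
  have h1 := ((analyticOnNhd_zeta j Set.univ (cremona k x) trivial).differentiableAt.hasFDerivAt.comp
    x (differentiableAt_cremona hx k).hasFDerivAt).unique (hasFDerivAt_zeta_cremona hx k j)
  have h2 := congrArg (fun φ : Y5 →L[ℂ] ℂ => φ v) h1
  simp only [ContinuousLinearMap.comp_apply, smul_apply, sum_apply, smul_eq_mul] at h2
  rw [dz, smul_apply, h2, smul_eq_mul, inv_mul_cancel_left₀ (cremona_mem hx k j)]

/-- The matrices `S` with `d Log U_{g,s} ∘ dσ_k = ∑_t S_{s,t} d Log U_{f,t}`, `g = folPerm k f`. -/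
def pullMat (k : Fin 5) (f : Fol) : Fin 3 → Fin 3 → ℤ :=
  [![![1, 0, 0], ![0, 1, 0], ![0, 0, 1]], ![![0, 1, 0], ![1, 0, 0], ![0, 0, 1]],
    ![![1, -1, 0], ![0, -1, 0], ![0, -1, 1]], ![![1, 0, -1], ![0, 1, -1], ![0, 0, -1]]].getD
  (((![[0, 0, 1, 1, 1, 0, 0, 1, 1, 1], [1, 0, 0, 2, 2, 1, 0, 0, 2, 2],
    [2, 2, 0, 0, 1, 2, 2, 0, 0, 3], [1, 1, 1, 0, 0, 3, 3, 3, 0, 0],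
    [3, 3, 3, 0, 0, 1, 1, 1, 0, 0]] : Fin 5 → List ℕ) k).getD (folIdx f) 0) 0

theorem expo_pull (k : Fin 5) (f : Fol) (s : Fin 3) (c : Fin 10) :
    ∑ j, expo (folPerm k f) s j * cremM k j c = ∑ t, pullMat k f s t * expo f t c := by
  simp only [expo_eq]
  revert k f s c
  decide +kernel

theorem dlogU_cremona {x : Y5} (hx : x ∈ Ystar) (k : Fin 5) (f : Fol) (s : Fin 3) (v : Y5) :
    dlogU (folPerm k f) s (cremona k x) (fderiv ℂ (cremona k) x v) =
      ∑ t, pullMat k f s t * dlogU f t x v := by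
  simp only [dlogU_eq_sum hx, dlogU_eq_sum (cremona_mem hx k), sum_apply, smul_apply, smul_eq_mul,
    dz_cremona hx, Finset.mul_sum, ← mul_assoc]
  refine (Finset.sum_comm.trans (Finset.sum_congr rfl fun c _ => ?_)).trans Finset.sum_comm
  rw [← Finset.sum_mul, ← Finset.sum_mul]
  exact congrArg (· * _) (mod_cast expo_pull k f s c)

theorem lnAbs_cremona {x : Y5} (hx : x ∈ Ystar) (k : Fin 5) (j : Fin 10) :
    lnAbs j (cremona k x) = ∑ c, cremM k j c * lnAbs c x := by
  have h : ‖(cremSign k j : ℂ)‖ = 1 := by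
    have := congrArg (fun n : ℤ => ‖(n : ℂ)‖) (cremSign_sq k j)
    simp only [Int.cast_mul, norm_mul, Int.cast_one, norm_one] at this
    nlinarith [norm_nonneg (cremSign k j : ℂ)]
  rw [lnAbs, zeta_cremona hx, norm_mul, h, one_mul, norm_prod, Real.log_prod fun c _ =>
    norm_ne_zero_iff.2 (zpow_ne_zero _ (hx c))]
  simp [lnAbs, Real.log_zpow]

theorem logU_cremona {x : Y5} (hx : x ∈ Ystar) (k : Fin 5) (f : Fol) (s : Fin 3) :
    logU (fun c => lnAbs c (cremona k x)) (folPerm k f) s =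
      ∑ t, pullMat k f s t * logU (fun c => lnAbs c x) f t := by
  simp only [logU_eq_sum, zsmul_eq_mul, lnAbs_cremona hx, Finset.mul_sum, ← mul_assoc]
  refine (Finset.sum_comm.trans (Finset.sum_congr rfl fun c _ => ?_)).trans Finset.sum_comm
  rw [← Finset.sum_mul, ← Finset.sum_mul]
  exact congrArg (· * _) (mod_cast expo_pull k f s c)

/-- The action of `σ_k` on the coefficients of the tuples of weight `0`. -/
def pull0 {R : Type*} [CommRing R] (k : Fin 5) (c : Fol → Fin 3 → R) : Fol → Fin 3 → R := fun f t =>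
  ∑ s, c (folPerm k f) s * pullMat k f s t

/-- The action of `σ_k` on the coefficients of the tuples of weight `1` and of the `2`-forms. -/
def pull1 {R : Type*} [CommRing R] (k : Fin 5) (c : Fol → Fin 3 → Fin 3 → R) :
    Fol → Fin 3 → Fin 3 → R := fun f a b =>
  ∑ s, ∑ t, c (folPerm k f) s t * (pullMat k f s a * pullMat k f t b)

theorem pullback_logTuple (k : Fin 5) (c₀ : Fol → Fin 3 → ℂ) (c₁ : Fol → Fin 3 → Fin 3 → ℂ) :
    pullback k (tuple0 Ystar c₀ + tuple1 Ystar lnAbs c₁) =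
      tuple0 Ystar (pull0 k c₀) + tuple1 Ystar lnAbs (pull1 k c₁) := by
  ext f x v
  by_cases hx : x ∈ Ystar
  · have e (η θ : Tuple 1) (g : Fol) (y : Y5) (w : Fin 1 → Y5) :
        (η + θ) g y w = η g y w + θ g y w := rfl
    rw [pullback, if_pos hx, ContinuousAlternatingMap.compContinuousLinearMap_apply, e, e,
      tuple0_apply' hx, tuple1_apply' hx, tuple0_apply' (cremona_mem hx k),
      tuple1_apply' (cremona_mem hx k)]
    congr 1
    · simp only [Function.comp_apply, dlogU_cremona hx, pull0, Finset.mul_sum, Finset.sum_mul,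
        mul_assoc]
      exact Finset.sum_comm
    · simp only [Function.comp_apply, dlogU_cremona hx, logU_cremona hx, pull1, Fin.sum_univ_three]
      ring
  · have e (η θ : Tuple 1) (g : Fol) (y : Y5) : (η + θ) g y = η g y + θ g y := rfl
    simp [pullback, e, tuple0, tuple1, hx]

theorem pullback_tuple2 (k : Fin 5) (c : Fol → Fin 3 → Fin 3 → ℂ) :
    pullback k (tuple2 Ystar c) = tuple2 Ystar (pull1 k c) := by
  ext f x v
  by_cases hx : x ∈ Ystar
  · obtain ⟨a, b, rfl⟩ : ∃ a b, v = ![a, b] := ⟨v 0, v 1, by ext i; fin_cases i <;> rfl⟩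
    rw [pullback, if_pos hx, ContinuousAlternatingMap.compContinuousLinearMap_apply,
      tuple2_apply _ _ hx, tuple2_apply _ _ (cremona_mem hx k)]
    have e : (fderiv ℂ (cremona k) x : Y5 → Y5) ∘ ![a, b] =
        ![fderiv ℂ (cremona k) x a, fderiv ℂ (cremona k) x b] := by
      ext i; fin_cases i <;> rfl
    simp only [e, wedge_apply, dlogU_cremona hx, pull1, Fin.sum_univ_three]
    ring
  · simp [pullback, tuple2, hx]

section

/-! ### Irreducible integral representations -/

section

variable {n : ℕ}

/-- The linear map with integral matrix `M`. -/
def actM (M : Fin n → Fin n → ℤ) : (Fin n → ℂ) →ₗ[ℂ] (Fin n → ℂ) :=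
  Matrix.mulVecLin (Matrix.of fun i j => (M i j : ℂ))

theorem actM_apply (M : Fin n → Fin n → ℤ) (v : Fin n → ℂ) (i : Fin n) :
    actM M v i = ∑ j, M i j * v j := rfl

/-- The integral vector with the given list of coordinates. -/
def vec (n : ℕ) (l : List ℤ) : Fin n → ℂ := fun i => (l.getD i 0 : ℤ)

/-- The product of an integral matrix and a list of coordinates. -/
def listAct (M : Fin n → Fin n → ℤ) (l : List ℤ) : List ℤ :=
  (List.finRange n).map fun i => ((List.finRange n).map fun j => M i j * l.getD j 0).sum

theorem getD_listAct (M : Fin n → Fin n → ℤ) (l : List ℤ) (i : Fin n) :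
    (listAct M l).getD i 0 = ∑ j, M i j * l.getD j 0 := by
  simp [listAct, ← List.ofFn_eq_map, List.sum_ofFn]

theorem vec_listAct (M : Fin n → Fin n → ℤ) (l : List ℤ) :
    vec n (listAct M l) = actM M (vec n l) := by
  ext i
  rw [vec, getD_listAct, actM_apply]
  push_cast
  rfl

theorem sum_vec_listAct (M : Fin n → Fin n → ℤ) (l : List ℤ) (v : Fin n → ℂ) :
    ∑ j, vec n (listAct (fun i j => M j i) l) j * v j = ∑ i, vec n l i * actM M v i := by
  simp only [vec_listAct, actM_apply, Finset.sum_mul, Finset.mul_sum]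
  rw [Finset.sum_comm]
  exact Finset.sum_congr rfl fun _ _ => Finset.sum_congr rfl fun _ _ => by ring

variable (G : Fin 5 → Fin n → Fin n → ℤ)

/-- The coordinates of the image of `u` by a word in the generators. -/
def wordVec (w : List (Fin 5)) (u : List ℤ) : List ℤ := w.foldl (fun l k => listAct (G k) l) u

/-- The coordinates of the composition of a linear form with a word in the generators. -/
def wordCovec (w : List (Fin 5)) (u : List ℤ) : List ℤ :=
  w.foldl (fun l k => listAct (fun i j => G k j i) l) u

/-- The image of a vector by the product of the elements `1 + s g` for `(s, g)` in a list. -/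
def facVec (fs : List (ℤ × Fin 5)) (u : List ℤ) : List ℤ :=
  fs.foldr (fun p l => listAct (fun i j => (if i = j then 1 else 0) + p.1 * G p.2 i j) l) u

/-- The product of the elements `1 + s g` for `(s, g)` in a list. -/
def facM (fs : List (ℤ × Fin 5)) : (Fin n → ℂ) →ₗ[ℂ] (Fin n → ℂ) :=
  fs.foldr (fun p φ => actM (fun i j => (if i = j then 1 else 0) + p.1 * G p.2 i j) ∘ₗ φ) .id

theorem vec_facVec (fs : List (ℤ × Fin 5)) (u : List ℤ) :
    vec n (facVec G fs u) = facM G fs (vec n u) := by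
  induction fs with
  | nil => rfl
  | cons p fs ih =>
    change vec n (listAct _ (facVec G fs u)) = actM _ (facM G fs (vec n u))
    rw [vec_listAct, ih]

/-- The image of a vector by a word in the generators. -/
def wordM (w : List (Fin 5)) (v : Fin n → ℂ) : Fin n → ℂ := w.foldr (fun k v => actM (G k) v) v

theorem sum_wordCovec (w : List (Fin 5)) (u : List ℤ) (v : Fin n → ℂ) :
    ∑ j, vec n (wordCovec G w u) j * v j = ∑ j, vec n u j * wordM G w v j := by
  induction w generalizing u with
  | nil => rfl
  | cons k w ih =>
    change ∑ j, vec n (wordCovec G w (listAct _ u)) j * v j = _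
    rw [ih, sum_vec_listAct]
    rfl

/-- The subspace `U` is stable under the generators. -/
def IsInv (U : Submodule ℂ (Fin n → ℂ)) : Prop := ∀ k, ∀ v ∈ U, actM (G k) v ∈ U

variable {G}

theorem IsInv.wordM_mem {U : Submodule ℂ (Fin n → ℂ)} (h : IsInv G U) (w : List (Fin 5))
    {v : Fin n → ℂ} (hv : v ∈ U) : wordM G w v ∈ U := by
  induction w with
  | nil => exact hv
  | cons k w ih => exact h k _ ih

theorem IsInv.wordVec_mem {U : Submodule ℂ (Fin n → ℂ)} (h : IsInv G U) (w : List (Fin 5))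
    {u : List ℤ} (hu : vec n u ∈ U) : vec n (wordVec G w u) ∈ U := by
  induction w generalizing u with
  | nil => exact hu
  | cons k w ih =>
    refine ih ?_
    rw [vec_listAct]
    exact h k _ hu

theorem IsInv.facM_mem {U : Submodule ℂ (Fin n → ℂ)} (h : IsInv G U) (fs : List (ℤ × Fin 5))
    {v : Fin n → ℂ} (hv : v ∈ U) : facM G fs v ∈ U := by
  induction fs with
  | nil => exact hv
  | cons p fs ih =>
    have e (v : Fin n → ℂ) : actM (fun i j => (if i = j then 1 else 0) + p.1 * G p.2 i j) v =
        v + (p.1 : ℂ) • actM (G p.2) v := by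
      ext i
      simp [actM_apply, add_mul, Finset.sum_add_distrib, Finset.mul_sum, mul_assoc]
    change actM _ (facM G fs v) ∈ U
    rw [e]
    exact U.add_mem ih (U.smul_mem _ (h _ _ ih))

/-- A representation is irreducible if an element of the group algebra is of rank one, with an
image which generates the representation, and a kernel which contains no invariant subspace. -/
theorem IsInv.eq_bot_or_eq_top {U : Submodule ℂ (Fin n → ℂ)} (h : IsInv G U)
    (fs : List (ℤ × Fin 5)) (u φ : List ℤ) (ws : List (List (Fin 5)))
    (hE : ∀ j : Fin n, facVec G fs ((List.finRange n).map fun i => if i = j then 1 else 0) =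
      u.map (· * φ.getD j 0))
    (hφ : nullity n (ws.map fun w => (List.finRange n).map fun i : Fin n =>
      (wordCovec G w φ).getD i 0) = 0)
    (hu : nullity n (ws.map fun w => (List.finRange n).map fun i : Fin n =>
      (wordVec G w u).getD i 0) = 0) : U = ⊥ ∨ U = ⊤ := by
  -- the element acts as `v ↦ φ(v) u`
  have hE' (v : Fin n → ℂ) : facM G fs v = (∑ j, vec n φ j * v j) • vec n u := by
    have e1 (j : Fin n) : (Pi.single j 1 : Fin n → ℂ) =
        vec n ((List.finRange n).map fun i => if i = j then 1 else 0) := by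
      ext i
      simp [vec, ← List.ofFn_eq_map, Pi.single_apply]
    have e2 (j : Fin n) : facM G fs (Pi.single j 1) = vec n φ j • vec n u := by
      rw [e1, ← vec_facVec, hE]
      ext i
      by_cases hi : (i : ℕ) < u.length
      · simp [vec, hi]
        exact mul_comm _ _
      · simp [vec, hi]
    conv_lhs => rw [← Finset.univ_sum_single v]
    rw [map_sum, Finset.sum_smul]
    refine Finset.sum_congr rfl fun j _ => ?_
    rw [show (Pi.single j (v j) : Fin n → ℂ) = v j • Pi.single j 1 by
      rw [← Pi.single_smul, smul_eq_mul, mul_one], map_smul, e2, smul_smul, mul_comm]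
  refine or_iff_not_imp_left.2 fun hU => ?_
  obtain ⟨v, hv, hv0⟩ := Submodule.exists_mem_ne_zero_of_ne_bot hU
  -- some translate of `v` is not killed by `φ`
  have key : vec n u ∈ U := by
    by_contra hn
    refine hv0 (eq_zero_of_nullity (List.finRange n) (List.nodup_finRange n) List.mem_finRange
      (ws.map fun w i => (wordCovec G w φ).getD i 0) ?_ v ?_)
    · rw [List.length_finRange, List.map_map]; exact hφ
    · intro r hr
      obtain ⟨w, -, rfl⟩ := List.mem_map.1 hr
      refine (sum_wordCovec G w φ v).trans (by_contra fun h0 => hn ?_)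
      have := h.facM_mem fs (h.wordM_mem w hv)
      rw [hE'] at this
      exact (U.smul_mem_iff h0).1 this
  -- a linear form vanishing on `U` kills the translates of `u`
  by_contra htop
  obtain ⟨f, hf, hfU⟩ := U.exists_le_ker_of_lt_top (lt_top_iff_ne_top.2 htop)
  have h0 := eq_zero_of_nullity (List.finRange n) (List.nodup_finRange n) List.mem_finRange
    (ws.map fun w i => (wordVec G w u).getD i 0)
    (by rw [List.length_finRange, List.map_map]; exact hu) (fun i => f (Pi.single i 1)) fun r hr => by
      obtain ⟨w, -, rfl⟩ := List.mem_map.1 hr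
      have := hfU (h.wordVec_mem w key)
      rw [LinearMap.mem_ker, ← Finset.univ_sum_single (vec n (wordVec G w u)), map_sum] at this
      rw [← this]
      refine Finset.sum_congr rfl fun i _ => ?_
      rw [show (Pi.single i (vec n (wordVec G w u) i) : Fin n → ℂ) =
        vec n (wordVec G w u) i • Pi.single i 1 by
        rw [← Pi.single_smul, smul_eq_mul, mul_one], map_smul]
      rfl
  refine hf (LinearMap.pi_ext' fun i => LinearMap.ext_ring ?_)
  exact congrFun h0 i

end

/-! ### Specht modules -/

/-- The simple reflections in coordinates. -/
def reflVec (k : Fin 5) (x : Fin 5 → ℂ) : Fin 5 → ℂ :=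
  ![![x 1, x 0, x 2, x 3, x 4], ![x 0, x 2, x 1, x 3, x 4], ![x 0, x 1, x 3, x 2, x 4],
    ![x 0, x 1, x 2, x 4, x 3], ![x 0, x 1, x 2, -x 4, -x 3]] k

theorem simpleReflection_apply (k : Fin 5) (x : Fin 5 → ℂ) : simpleReflection k x = reflVec k x := by
  ext i
  fin_cases k <;> fin_cases i <;>
    simp [simpleReflection, Module.reflection_apply, simpleCoroot, simpleRoot, reflVec,
      Fin.sum_univ_five]

theorem gen_inv (k : Fin 5) : (gen k)⁻¹ = gen k := by
  refine inv_eq_of_mul_eq_one_left (Subtype.ext (LinearEquiv.ext fun x => ?_))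
  exact Module.involutive_reflection (simpleCoroot_simpleRoot k) x

theorem funRep_gen (k : Fin 5) (F : (Fin 5 → ℂ) → ℂ) (x : Fin 5 → ℂ) :
    funRep (gen k) F x = F (reflVec k x) := by
  rw [← simpleReflection_apply]
  change F (((gen k)⁻¹ : WD5).1 x) = _
  rw [gen_inv]
  rfl

/-- Induction on the elements of the Weyl group. -/
theorem WD5_induction {p : WD5 → Prop} (h1 : p 1) (hm : ∀ g h, p g → p h → p (g * h))
    (hg : ∀ k, p (gen k)) (w : WD5) : p w := by
  obtain ⟨w, hw⟩ := w
  have : ∀ w (hw : w ∈ WD5), p ⟨w, hw⟩ ∧ p ⟨w, hw⟩⁻¹ := fun w hw => by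
    induction hw using Subgroup.closure_induction with
    | mem x hx =>
      obtain ⟨k, rfl⟩ := hx
      exact ⟨hg k, (gen_inv k).symm ▸ hg k⟩
    | one => exact ⟨h1, (inv_one (G := WD5)).symm ▸ h1⟩
    | mul x y hx hy ihx ihy =>
      refine ⟨hm _ _ ihx.1 ihy.1, ?_⟩
      have := hm _ _ ihy.2 ihx.2
      rwa [← mul_inv_rev] at this
    | inv x hx ih => exact ⟨ih.2, by convert ih.1 using 1; exact Subtype.ext (inv_inv x)⟩
  exact (this w hw).1

theorem reflVec_castSucc (i : Fin 4) (x : Fin 5 → ℂ) :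
    reflVec i.castSucc x = fun j => x (Equiv.swap i.castSucc i.succ j) := by
  ext j
  fin_cases i <;> fin_cases j <;> rfl

/-- A space of functions stable under the generators is stable under the permutations of the
coordinates. -/
theorem comp_perm_mem {R : Submodule ℂ ((Fin 5 → ℂ) → ℂ)}
    (hR : ∀ k, ∀ F ∈ R, funRep (gen k) F ∈ R) (π : Equiv.Perm (Fin 5)) {F : (Fin 5 → ℂ) → ℂ}
    (hF : F ∈ R) : (fun x => F fun i => x (π i)) ∈ R := by
  have h : π ∈ Submonoid.closure (Set.range fun i : Fin 4 => Equiv.swap i.castSucc i.succ) :=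
    Equiv.Perm.mclosure_swap_castSucc_succ 4 ▸ Submonoid.mem_top π
  induction h using Submonoid.closure_induction generalizing F with
  | mem x hx =>
    obtain ⟨i, rfl⟩ := hx
    convert hR i.castSucc F hF using 1
    ext x
    rw [funRep_gen, reflVec_castSucc]
  | one => exact hF
  | mul π π' _ _ h h' => exact h (h' hF)

/-- Polynomials on which the generators act by integral matrices giving an irreducible
representation span the module attached to the partition of one of them. -/
theorem exists_equiv_spechtModule {n : ℕ} {G : Fin 5 → Fin n → Fin n → ℤ}
    {F : Fin n → (Fin 5 → ℂ) → ℂ}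
    (hF : ∀ k j x, F j (reflVec k x) = ∑ i, G k i j * F i x)
    (hG : ∀ U, IsInv G U → U = ⊥ ∨ U = ⊤) {d d' : YoungDiagram}
    {T : d.cells ⊕ d'.cells ≃ Fin 5} {j : Fin n} (hT : spechtPoly d d' T = F j) (hj : F j ≠ 0) :
    ∃ φ : (Fin n → ℂ) ≃ₗ[ℂ] (spechtModule d d').toSubmodule,
      ∀ k v, φ (actM (G k) v) = (spechtModule d d').toRepresentation (gen k) (φ v) := by
  let Ξ : (Fin n → ℂ) →ₗ[ℂ] ((Fin 5 → ℂ) → ℂ) := Fintype.linearCombination ℂ F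
  have hΞ1 (j : Fin n) : Ξ (Pi.single j 1) = F j := by
    simp [Ξ, Fintype.linearCombination_apply_single]
  have hΞ (k : Fin 5) (v : Fin n → ℂ) : Ξ (actM (G k) v) = funRep (gen k) (Ξ v) := by
    ext x
    rw [funRep_gen]
    simp only [Ξ, Fintype.linearCombination_apply, Finset.sum_apply, Pi.smul_apply, smul_eq_mul, hF,
      actM_apply, Finset.mul_sum, Finset.sum_mul]
    rw [Finset.sum_comm]
    exact Finset.sum_congr rfl fun _ _ => Finset.sum_congr rfl fun _ _ => by ring
  have hinj : LinearMap.ker Ξ = ⊥ := by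
    refine (hG (LinearMap.ker Ξ) fun k v hv => ?_).resolve_right fun h => hj ?_
    · rw [LinearMap.mem_ker, hΞ, LinearMap.mem_ker.1 hv, map_zero]
    · rw [← hΞ1]
      exact LinearMap.mem_ker.1 (h ▸ Submodule.mem_top)
  have hstab : ∀ k, ∀ E ∈ LinearMap.range Ξ, funRep (gen k) E ∈ LinearMap.range Ξ := by
    rintro k _ ⟨v, rfl⟩
    exact ⟨_, hΞ k v⟩
  have hFj : F j ∈ (spechtModule d d').toSubmodule :=
    Submodule.subset_span ⟨1, T, by rw [map_one, ← hT]; rfl⟩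
  have hrange : LinearMap.range Ξ = (spechtModule d d').toSubmodule := by
    apply le_antisymm
    · have := (hG ((spechtModule d d').toSubmodule.comap Ξ) fun k v hv => ?_).resolve_left fun h => ?_
      · rintro _ ⟨v, rfl⟩
        exact (this ▸ Submodule.mem_top : v ∈ (spechtModule d d').toSubmodule.comap Ξ)
      · rw [Submodule.mem_comap, hΞ]
        exact (spechtModule d d').apply_mem_toSubmodule _ hv
      · have h1 : (Pi.single j 1 : Fin n → ℂ) ∈ (spechtModule d d').toSubmodule.comap Ξ := by
          rw [Submodule.mem_comap, hΞ1]; exact hFj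
        rw [h, Submodule.mem_bot, Pi.single_eq_zero_iff] at h1
        exact one_ne_zero h1
    · refine Submodule.span_le.2 ?_
      rintro _ ⟨w, T', rfl⟩
      refine WD5_induction (p := fun w => ∀ E ∈ LinearMap.range Ξ, funRep w E ∈ LinearMap.range Ξ)
        ?_ ?_ hstab w _ ?_
      · intro E hE; rw [map_one]; exact hE
      · intro g h hg hh E hE
        rw [map_mul]; exact hg _ (hh _ hE)
      · obtain ⟨π, rfl⟩ : ∃ π : Equiv.Perm (Fin 5), T' = T.trans π :=
          ⟨T.symm.trans T', by ext; simp⟩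
        have h1 := comp_perm_mem hstab π (F := F j) ⟨_, hΞ1 j⟩
        rw [← hT] at h1
        exact h1
  refine ⟨(LinearEquiv.ofInjective Ξ (LinearMap.ker_eq_bot.1 hinj)).trans
    (LinearEquiv.ofEq _ _ hrange), fun k v => Subtype.ext (hΞ k v)⟩

end

/-! ### Three irreducible representations of the Weyl group -/

/-- Encodes the matrices `mat0`: the base `3` digits of the entries are the rows. -/
def codesMat0 : Fin 5 → List ℕ := ![
  [1743392202, 1743392203, 1743392218, 1743392227, 1743392362, 1743392443, 1743923641,
    1744986523, 1748175169, 1757741107, 1786438921, 1872532363, 1743392929, 1743394387,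
    1743398761, 1743411883, 1743451249, 1743569347, 2130812689, 2905653667],
  [1743392201, 1743392198, 1743392929, 1743394387, 1743398761, 1743411883, 1743392209,
    1743392227, 1743392281, 1743392443, 1743451249, 1743569347, 1744455082, 1744986523,
    1752958138, 1757741107, 2130812689, 2905653667, 1786438921, 1872532363],
  [1743392209, 1743392227, 1743392201, 1743392203, 1743392281, 1743392443, 1743392929,
    1743390742, 1743451249, 1743569347, 1743398761, 1743411883, 1743923641, 1742329318,
    1786438921, 1872532363, 1748175169, 1757741107, 2518233178, 2905653667],
  [1743392201, 1743392203, 1743392281, 1743392443, 1743392209, 1743392227, 1743398761,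
    1743411883, 1743392929, 1743394387, 1743451249, 1743274102, 1748175169, 1757741107,
    1743923641, 1744986523, 1786438921, 1657298758, 2130812689, 968551222],
  [1743392201, 1743392203, 1743392119, 1743391957, 1743392191, 1743392173, 1743385639,
    1743372517, 1743391471, 1743390013, 1743451249, 1743274102, 1738609231, 1729043293,
    1742860759, 1741797877, 1786438921, 1657298758, 2130812689, 968551222]]

/-- Encodes the matrices `matA`: the base `3` digits of the entries are the rows. -/
def codesMatA : Fin 5 → List ℕ := ![
  [29523, 29605, 29767, 30253, 29527, 29533, 29551, 27337, 22963, 9841],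
  [29527, 29525, 29515, 29497, 29443, 31711, 36085, 29767, 30253, 9841],
  [29523, 29533, 29527, 29497, 29767, 29605, 28795, 27337, 49207, 36085],
  [29523, 29521, 29551, 29533, 29443, 30253, 29767, 36085, 31711, 9841],
  [29523, 29521, 29497, 29515, 29443, 28795, 29281, 22963, 27337, 9841]]

/-- Encodes the matrices `matS`: the base `3` digits of the entries are the rows. -/
def codesMatS : Fin 5 → List ℕ := ![
  [48, 109, 130, 13, 202],
  [120, 130, 124, 202, 148],
  [43, 203, 31, 13, 202],
  [120, 148, 202, 124, 130],
  [120, 148, 202, 124, 130]]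

/-- The matrices of the generators acting on the space with basis `poly0`, or `base0`. -/
def mat0 (k : Fin 5) (i j : Fin 20) : ℤ := trit ((codesMat0 k).getD i 0) j

/-- The matrices of the generators acting on the space with basis `polyA`, or `baseA`. -/
def matA (k : Fin 5) (i j : Fin 10) : ℤ := trit ((codesMatA k).getD i 0) j

/-- The matrices of the generators acting on the space with basis `polyS`, or `baseS`. -/
def matS (k : Fin 5) (i j : Fin 5) : ℤ := trit ((codesMatS k).getD i 0) j

/-- The successive lists are the factors `1 ± s_k` of an element of the group algebra which acts with
rank one, a vector spanning its image, a linear form with the same kernel, and words in the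
generators by which the translates of that vector and of that form span the space and its dual. -/
theorem irreducible0 (U : Submodule ℂ (Fin 20 → ℂ)) (h : IsInv mat0 U) : U = ⊥ ∨ U = ⊤ :=
  h.eq_bot_or_eq_top [(-1, 3), (-1, 4), (-1, 0)]
    [0, 0, 0, 0, 0, 0, 0, 0, 0, 0, 0, -1, 0, 0, 0, 0, 0, 1, 0, 0]
    [0, 0, 0, 0, 0, 0, 0, 0, 0, 0, 2, -4, 0, 0, 0, 0, -2, 4, 0, 0]
    [[], [1], [2], [1, 2], [2, 1], [2, 3], [1, 2, 1], [1, 2, 3], [1, 2, 4], [2, 1, 0], [2, 1,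
      3], [1, 2, 1, 0], [1, 2, 1, 3], [1, 2, 1, 4], [1, 2, 3, 4], [2, 1, 0, 3], [2, 1, 3, 2],
      [1, 2, 1, 0, 3], [1, 2, 1, 0, 4], [2, 1, 0, 3, 2]]
    (by decide +kernel) (by decide +kernel) (by decide +kernel)

theorem irreducibleA (U : Submodule ℂ (Fin 10 → ℂ)) (h : IsInv matA U) : U = ⊥ ∨ U = ⊤ :=
  h.eq_bot_or_eq_top [(1, 2), (1, 0)]
    [0, 1, 1, 0, 1, 1, 0, 0, 0, 0]
    [0, 1, 1, 0, 1, 1, 0, 0, 0, 0]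
    [[], [1], [3], [4], [1, 3], [1, 4], [1, 3, 2], [1, 4, 2], [1, 3, 2, 4], [1, 4, 2, 3]]
    (by decide +kernel) (by decide +kernel) (by decide +kernel)

theorem irreducibleS (U : Submodule ℂ (Fin 5 → ℂ)) (h : IsInv matS U) : U = ⊥ ∨ U = ⊤ :=
  h.eq_bot_or_eq_top [(-1, 1), (1, 3)]
    [0, 1, -1, 1, -1]
    [0, 1, -1, 1, -1]
    [[], [0], [2], [0, 2], [2, 1]]
    (by decide +kernel) (by decide +kernel) (by decide +kernel)

/-- A basis of the module `V_{[2,21]}`. -/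
def poly0 (j : Fin 20) (x : Fin 5 → ℂ) : ℂ :=
  let t : Fin 5 × Fin 5 × Fin 5 := (![(0, 1, 2), (1, 2, 0), (0, 1, 3), (1, 3, 0), (0, 1, 4), (1, 4, 0), (0, 2, 3), (2, 3, 0),
      (0, 2, 4), (2, 4, 0), (0, 3, 4), (3, 4, 0), (1, 2, 3), (2, 3, 1), (1, 2, 4), (2, 4, 1),
      (1, 3, 4), (3, 4, 1), (2, 3, 4), (3, 4, 2)]) j
  x t.1 * x t.2.1 * x t.2.2 * (x t.1 ^ 2 - x t.2.1 ^ 2)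

/-- A basis of the module `V_{[11,111]}`. -/
def polyA (j : Fin 10) (x : Fin 5 → ℂ) : ℂ :=
  let t : Fin 5 × Fin 5 × Fin 5 × Fin 5 × Fin 5 := (![(0, 1, 2, 3, 4), (0, 2, 1, 3, 4), (0, 3, 1, 2, 4), (0, 4, 1, 2, 3), (1, 2, 0, 3, 4), (1,
      3, 0, 2, 4), (1, 4, 0, 2, 3), (2, 3, 0, 1, 4), (2, 4, 0, 1, 3), (3, 4, 0, 1, 2)]) j
  (x t.1 ^ 2 - x t.2.1 ^ 2) * (x t.2.2.1 ^ 2 - x t.2.2.2.1 ^ 2) *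
    (x t.2.2.1 ^ 2 - x t.2.2.2.2 ^ 2) * (x t.2.2.2.1 ^ 2 - x t.2.2.2.2 ^ 2) *
    (x t.2.2.1 * x t.2.2.2.1 * x t.2.2.2.2)

/-- A basis of the module `V_{[-,221]}`. -/
def polyS (j : Fin 5) (x : Fin 5 → ℂ) : ℂ :=
  let t : Fin 5 × Fin 5 × Fin 5 × Fin 5 × Fin 5 := (![(0, 1, 2, 3, 4), (0, 1, 3, 2, 4), (0, 2, 3, 1, 4), (0, 1, 4, 2, 3), (0, 2, 4, 1, 3)]) j
  (x t.1 ^ 2 - x t.2.1 ^ 2) * (x t.1 ^ 2 - x t.2.2.1 ^ 2) * (x t.2.1 ^ 2 - x t.2.2.1 ^ 2) *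
    (x t.2.2.2.1 ^ 2 - x t.2.2.2.2 ^ 2) * (x 0 * x 1 * x 2 * x 3 * x 4)

set_option maxHeartbeats 4000000 in
theorem polyS_reflVec (k : Fin 5) (j : Fin 5) (x : Fin 5 → ℂ) :
    polyS j (reflVec k x) = ∑ i, matS k i j * polyS i x := by
  fin_cases k <;> fin_cases j <;>
    simp [polyS, reflVec, Fin.sum_univ_succ, matS, codesMatS, trit] <;> ring

set_option maxHeartbeats 4000000 in
theorem polyA_reflVec (k : Fin 5) (j : Fin 10) (x : Fin 5 → ℂ) :
    polyA j (reflVec k x) = ∑ i, matA k i j * polyA i x := by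
  fin_cases k <;> fin_cases j <;>
    simp [polyA, reflVec, Fin.sum_univ_succ, matA, codesMatA, trit] <;> ring

/-- The even element of the pair of indices `i` such that the coefficient of `poly0 i` in the image
of `poly0 j` may be nonzero: the members of a pair involve the same product `x_a x_b x_c`. -/
def block0 (k : Fin 5) (j : Fin 20) : Fin 20 :=
  (![![0, 0, 2, 2, 4, 4, 12, 12, 14, 14, 16, 16, 6, 6, 8, 8, 10, 10, 18, 18],
    ![0, 0, 6, 6, 8, 8, 2, 2, 4, 4, 10, 10, 12, 12, 14, 14, 18, 18, 16, 16],
    ![2, 2, 0, 0, 4, 4, 6, 6, 10, 10, 8, 8, 12, 12, 16, 16, 14, 14, 18, 18],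
    ![0, 0, 4, 4, 2, 2, 8, 8, 6, 6, 10, 10, 14, 14, 12, 12, 16, 16, 18, 18],
    ![0, 0, 4, 4, 2, 2, 8, 8, 6, 6, 10, 10, 14, 14, 12, 12, 16, 16, 18, 18]] : Fin 5 → Fin 20 → Fin 20) k j

theorem mat0_eq_zero : ∀ k i j, i ≠ block0 k j ∧ i ≠ block0 k j + 1 → mat0 k i j = 0 := by
  decide +kernel

theorem block0_ne : ∀ k j, block0 k j ≠ block0 k j + 1 := by decide +kernel

set_option maxHeartbeats 8000000 in
theorem poly0_reflVec (k : Fin 5) (j : Fin 20) (x : Fin 5 → ℂ) :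
    poly0 j (reflVec k x) = ∑ i, mat0 k i j * poly0 i x := by
  rw [Fintype.sum_eq_add _ _ (block0_ne k j) fun i hi => by
    rw [mat0_eq_zero k i j hi, Int.cast_zero, zero_mul]]
  fin_cases k <;> fin_cases j <;>
    simp [poly0, reflVec, block0, mat0, codesMat0, trit] <;> ring

/-! ### Bases of the Specht modules -/

/-- An enumeration of the cells of a Young diagram. -/
def cellEquiv (d : YoungDiagram) {m : ℕ} (c : Fin m → ℕ × ℕ) (hc : ∀ i, c i ∈ d.cells)
    (hi : Function.Injective c) (hm : d.cells.card = m) : Fin m ≃ d.cells :=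
  Equiv.ofBijective (fun i => ⟨c i, hc i⟩) <| (Fintype.bijective_iff_injective_and_card _).2
    ⟨fun i j h => hi (congrArg Subtype.val h), by simp [hm]⟩

/-- The Specht polynomial of the filling which follows enumerations of the cells of the two
diagrams. -/
theorem spechtPoly_enum {d d' : YoungDiagram} {m m' : ℕ} {c : Fin m → ℕ × ℕ} {c' : Fin m' → ℕ × ℕ}
    (hc : ∀ i, c i ∈ d.cells) (hi : Function.Injective c) (hm : d.cells.card = m)
    (hc' : ∀ i, c' i ∈ d'.cells) (hi' : Function.Injective c') (hm' : d'.cells.card = m')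
    (f : Fin m ⊕ Fin m' ≃ Fin 5) {p : Fin m → Fin 5} {p' : Fin m' → Fin 5}
    (hp : ∀ i, f (.inl i) = p i) (hp' : ∀ i, f (.inr i) = p' i) (x : Fin 5 → ℂ) :
    spechtPoly d d' (((cellEquiv d c hc hi hm).symm.sumCongr
      (cellEquiv d' c' hc' hi' hm').symm).trans f) x =
    (∏ i, ∏ j, if (c i).2 = (c j).2 ∧ (c i).1 < (c j).1 then
      x (p i) ^ 2 - x (p j) ^ 2 else 1) *
    (∏ i, ∏ j, if (c' i).2 = (c' j).2 ∧ (c' i).1 < (c' j).1 then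
      x (p' i) ^ 2 - x (p' j) ^ 2 else 1) * ∏ i, x (p' i) := by
  rw [spechtPoly, columnProduct, columnProduct,
    ← ((cellEquiv d c hc hi hm).prodCongr (cellEquiv d c hc hi hm)).prod_comp,
    ← ((cellEquiv d' c' hc' hi' hm').prodCongr (cellEquiv d' c' hc' hi' hm')).prod_comp,
    ← (cellEquiv d' c' hc' hi' hm').prod_comp, Fintype.prod_prod_type, Fintype.prod_prod_type]
  simp only [Equiv.prodCongr_apply, Prod.map, Equiv.trans_apply, Equiv.sumCongr_apply, Sum.map_inl,
    Sum.map_inr, Equiv.symm_apply_apply, hp, hp']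
  rfl

theorem exists_equiv_specht0 :
    ∃ φ : (Fin 20 → ℂ) ≃ₗ[ℂ] (spechtModule (part [2]) (part [2, 1])).toSubmodule,
      ∀ k v, φ (actM (mat0 k) v) =
        (spechtModule (part [2]) (part [2, 1])).toRepresentation (gen k) (φ v) := by
  have h := spechtPoly_enum (d := part [2]) (d' := part [2, 1]) (m := 2) (m' := 3)
    (c := ![(0, 0), (0, 1)]) (c' := ![(0, 0), (1, 0), (0, 1)])
    (by decide +kernel) (by decide +kernel) (by decide +kernel) (by decide +kernel)
      (by decide +kernel) (by decide +kernel) finSumFinEquiv (p := ![0, 1]) (p' := ![2, 3, 4])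
      (by decide +kernel) (by decide +kernel)
  refine exists_equiv_spechtModule poly0_reflVec irreducible0 (j := 18)
    (funext fun x => (h x).trans ?_) ?_
  · simp [Fin.prod_univ_succ, poly0]; ring
  · -- the Specht polynomial does not vanish at `(1, 2, 3, 4, 5)`
    intro h0
    have := congrFun h0 ![1, 2, 3, 4, 5]
    simp [poly0] at this
    norm_num at this

theorem exists_equiv_spechtA :
    ∃ φ : (Fin 10 → ℂ) ≃ₗ[ℂ] (spechtModule (part [1, 1]) (part [1, 1, 1])).toSubmodule,
      ∀ k v, φ (actM (matA k) v) =
        (spechtModule (part [1, 1]) (part [1, 1, 1])).toRepresentation (gen k) (φ v) := by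
  have h := spechtPoly_enum (d := part [1, 1]) (d' := part [1, 1, 1]) (m := 2) (m' := 3)
    (c := ![(0, 0), (1, 0)]) (c' := ![(0, 0), (1, 0), (2, 0)])
      (by decide +kernel) (by decide +kernel) (by decide +kernel) (by decide +kernel)
      (by decide +kernel) (by decide +kernel) finSumFinEquiv (p := ![0, 1]) (p' := ![2, 3, 4])
      (by decide +kernel) (by decide +kernel)
  refine exists_equiv_spechtModule polyA_reflVec irreducibleA (j := 0)
    (funext fun x => (h x).trans ?_) ?_
  · simp [Fin.prod_univ_succ, polyA]; ring
  · intro h0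
    have := congrFun h0 ![1, 2, 3, 4, 5]
    simp [polyA] at this
    norm_num at this

theorem exists_equiv_spechtS :
    ∃ φ : (Fin 5 → ℂ) ≃ₗ[ℂ] (spechtModule (part []) (part [2, 2, 1])).toSubmodule,
      ∀ k v, φ (actM (matS k) v) =
        (spechtModule (part []) (part [2, 2, 1])).toRepresentation (gen k) (φ v) := by
  have h := spechtPoly_enum (d := part []) (d' := part [2, 2, 1]) (m := 0) (m' := 5)
    (c := ![]) (c' := ![(0, 0), (1, 0), (2, 0), (0, 1), (1, 1)])
      (by decide +kernel) (by decide +kernel) (by decide +kernel) (by decide +kernel)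
      (by decide +kernel) (by decide +kernel) finSumFinEquiv (p := ![]) (p' := ![0, 1, 2, 3, 4])
      (by decide +kernel) (by decide +kernel)
  refine exists_equiv_spechtModule polyS_reflVec irreducibleS (j := 0)
    (funext fun x => (h x).trans ?_) ?_
  · simp [Fin.prod_univ_succ, polyS]; ring
  · intro h0
    have := congrFun h0 ![1, 2, 3, 4, 5]
    simp [polyS] at this
    norm_num at this

/-! ### The action on the coefficients -/

/-- `pull0` as a linear map. -/
def pullL0 (k : Fin 5) : (Fol → Fin 3 → ℂ) →ₗ[ℂ] (Fol → Fin 3 → ℂ) where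
  toFun := pull0 k
  map_add' c d := by ext f t; simp [pull0, add_mul, Finset.sum_add_distrib]
  map_smul' a c := by ext f t; simp [pull0, mul_assoc, Finset.mul_sum]

/-- `pull1` as a linear map. -/
def pullL1 (k : Fin 5) : (Fol → Fin 3 → Fin 3 → ℂ) →ₗ[ℂ] (Fol → Fin 3 → Fin 3 → ℂ) where
  toFun := pull1 k
  map_add' c d := by ext f a b; simp [pull1, add_mul, Finset.sum_add_distrib]
  map_smul' t c := by ext f a b; simp [pull1, mul_assoc, Finset.mul_sum]

theorem map_linearCombination {V : Type*} [AddCommGroup V] [Module ℂ V] {n : ℕ} {P : V →ₗ[ℂ] V}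
    {b : Fin n → V} {M : Fin n → Fin n → ℤ} (h : ∀ j, P (b j) = ∑ i, (M i j : ℂ) • b i)
    (a : Fin n → ℂ) :
    P (Fintype.linearCombination ℂ b a) = Fintype.linearCombination ℂ b (actM M a) := by
  simp only [Fintype.linearCombination_apply, map_sum, map_smul, h, actM_apply, Finset.sum_smul,
    Finset.smul_sum, smul_smul]
  rw [Finset.sum_comm]
  exact Finset.sum_congr rfl fun _ _ => Finset.sum_congr rfl fun _ _ => by rw [mul_comm]

/-- The symmetric integral matrices with the given entries above the diagonal. -/
def symInt (c : Fol → Fin 3 → Fin 3 → ℤ) : Fol → Fin 3 → Fin 3 → ℤ :=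
  fun f a b => if a < b then c f a b else if b < a then c f b a else 0

/-- The antisymmetric integral matrices with the given entries above the diagonal. -/
def antiInt (c : Fol → Fin 3 → Fin 3 → ℤ) : Fol → Fin 3 → Fin 3 → ℤ :=
  fun f a b => if a < b then c f a b else if b < a then -c f b a else 0

theorem pull0_base0 : ∀ k j f t, pull0 k (base0 j) f t = ∑ i, mat0 k i j * base0 i f t := by
  decide +kernel

theorem pull1_baseS : ∀ k j f a b,
    pull1 k (symInt (baseS j)) f a b = ∑ i, matS k i j * symInt (baseS i) f a b := by
  decide +kernel

theorem pull1_baseA : ∀ k j f a b,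
    pull1 k (antiInt (baseA j)) f a b = ∑ i, matA k i j * antiInt (baseA i) f a b := by
  decide +kernel

theorem pullL0_base0 (k : Fin 5) (j : Fin 20) :
    pullL0 k (cast0 (base0 j)) = ∑ i, (mat0 k i j : ℂ) • cast0 (base0 i) := by
  ext f t
  have := congrArg (Int.cast : ℤ → ℂ) (pull0_base0 k j f t)
  simp only [Finset.sum_apply, Pi.smul_apply, smul_eq_mul]
  push_cast [pull0] at this
  exact this

theorem symCoef_eq (c : Fol → Fin 3 → Fin 3 → ℤ) (f : Fol) (a b : Fin 3) :
    symCoef c f a b = symInt c f a b := by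
  rw [symCoef, symInt]; split_ifs <;> simp

theorem antiCoef_eq (c : Fol → Fin 3 → Fin 3 → ℤ) (f : Fol) (a b : Fin 3) :
    antiCoef c f a b = antiInt c f a b * 2⁻¹ := by
  rw [antiCoef, antiInt]; split_ifs <;> simp [div_eq_mul_inv]

theorem pullL1_baseS (k : Fin 5) (j : Fin 5) :
    pullL1 k (symCoef (baseS j)) = ∑ i, (matS k i j : ℂ) • symCoef (baseS i) := by
  ext f a b
  have := congrArg (Int.cast : ℤ → ℂ) (pull1_baseS k j f a b)
  simp only [Finset.sum_apply, Pi.smul_apply, smul_eq_mul, symCoef_eq]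
  change pull1 k (symCoef (baseS j)) f a b = _
  simp only [pull1, symCoef_eq]
  push_cast [pull1] at this
  exact this

theorem pullL1_baseA (k : Fin 5) (j : Fin 10) :
    pullL1 k (antiCoef (baseA j)) = ∑ i, (matA k i j : ℂ) • antiCoef (baseA i) := by
  ext f a b
  have := congrArg (fun n : ℤ => (n : ℂ) * 2⁻¹) (pull1_baseA k j f a b)
  simp only [Finset.sum_apply, Pi.smul_apply, smul_eq_mul, antiCoef_eq]
  change pull1 k (antiCoef (baseA j)) f a b = _
  simp only [pull1, antiCoef_eq]
  push_cast [pull1, Finset.sum_mul] at this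
  simp only [mul_right_comm _ (2⁻¹ : ℂ), ← mul_assoc] at this ⊢
  exact this

/-- The weight `0` coefficients with given coordinates. -/
def comb0 : (Fin 20 → ℂ) →ₗ[ℂ] (Fol → Fin 3 → ℂ) :=
  Fintype.linearCombination ℂ fun j => cast0 (base0 j)

/-- The symmetric weight `1` coefficients with given coordinates. -/
def combS : (Fin 5 → ℂ) →ₗ[ℂ] (Fol → Fin 3 → Fin 3 → ℂ) :=
  Fintype.linearCombination ℂ fun j => symCoef (baseS j)

/-- The antisymmetric weight `1` coefficients with given coordinates. -/
def combA : (Fin 10 → ℂ) →ₗ[ℂ] (Fol → Fin 3 → Fin 3 → ℂ) :=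
  Fintype.linearCombination ℂ fun j => antiCoef (baseA j)

theorem range_comb0 : LinearMap.range comb0 = K0 := by
  obtain ⟨B, L, h⟩ := exists_logDom'
  rw [comb0, Fintype.range_linearCombination, h.span_base0]

theorem range_combS : LinearMap.range combS = KS := by
  obtain ⟨B, L, h⟩ := exists_logDom'
  rw [combS, Fintype.range_linearCombination, h.span_baseS]

theorem range_combA : LinearMap.range combA = KA := by
  obtain ⟨B, L, h⟩ := exists_logDom'
  rw [combA, Fintype.range_linearCombination, h.span_baseA]

theorem comb0_injective : Function.Injective comb0 :=
  linearIndependent_iff_injective_fintypeLinearCombination.1 base0_indep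

theorem combS_injective : Function.Injective combS :=
  linearIndependent_iff_injective_fintypeLinearCombination.1 baseS_indep

theorem combA_injective : Function.Injective combA :=
  linearIndependent_iff_injective_fintypeLinearCombination.1 baseA_indep

/-- Coordinates on the space of abelian relations. -/
abbrev Coords : Type := (Fin 20 → ℂ) × (Fin 5 → ℂ) × (Fin 10 → ℂ)

/-- The weight `1` coefficients with given coordinates. -/
def comb1 : (Fin 5 → ℂ) × (Fin 10 → ℂ) →ₗ[ℂ] (Fol → Fin 3 → Fin 3 → ℂ) := combS.coprod combA

theorem range_comb1 : LinearMap.range comb1 = K1 := by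
  rw [comb1, LinearMap.range_coprod, range_combS, range_combA, sup_KS_KA]

theorem comb1_injective : Function.Injective comb1 := by
  rw [← LinearMap.ker_eq_bot, comb1, LinearMap.ker_coprod_of_disjoint_range,
    LinearMap.ker_eq_bot.2 combS_injective, LinearMap.ker_eq_bot.2 combA_injective,
    Submodule.prod_bot]
  rw [range_combS, range_combA]
  exact disjoint_KS_KA

/-- The logarithmic tuple with given coordinates. -/
def logLin (D : Set Y5) (L : Fin 10 → Y5 → ℂ) : Coords →ₗ[ℂ] Tuple 1 :=
  (lin0 D ∘ₗ comb0).coprod (lin1 D L ∘ₗ comb1)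

theorem logLin_apply (D : Set Y5) (L : Fin 10 → Y5 → ℂ) (v : Coords) :
    logLin D L v = tuple0 D (comb0 v.1) + tuple1 D L (comb1 v.2) := rfl

theorem mem_range_logLin {D : Set Y5} {L : Fin 10 → Y5 → ℂ} {η : Tuple 1} :
    η ∈ LinearMap.range (logLin D L) ↔
      ∃ c₀ ∈ K0, ∃ c₁ ∈ K1, η = tuple0 D c₀ + tuple1 D L c₁ := by
  rw [← range_comb0, ← range_comb1]
  constructor
  · rintro ⟨v, rfl⟩
    exact ⟨_, ⟨v.1, rfl⟩, _, ⟨v.2, rfl⟩, rfl⟩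
  · rintro ⟨_, ⟨v, rfl⟩, _, ⟨w, rfl⟩, rfl⟩
    exact ⟨(v, w), rfl⟩

theorem logLin_injective {X D : Set Y5} {L : Fin 10 → Y5 → ℂ} (h : LogSys X L) (hXD : X ⊆ D)
    (hDY : D ⊆ Ystar) : Function.Injective (logLin D L) := fun v w e => by
  obtain ⟨h0, h1⟩ := logTuple_injective h hXD hDY e
  exact Prod.ext (comb0_injective h0) (comb1_injective h1)

/-- The action of the generators on the coordinates of the abelian relations. -/
def coordAct (k : Fin 5) : Coords →ₗ[ℂ] Coords :=
  (actM (mat0 k)).prodMap ((actM (matS k)).prodMap (actM (matA k)))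

theorem pull0_comb0 (k : Fin 5) (v : Fin 20 → ℂ) :
    pull0 k (comb0 v) = comb0 (actM (mat0 k) v) :=
  map_linearCombination (P := pullL0 k) (pullL0_base0 k) v

theorem pull1_combA (k : Fin 5) (v : Fin 10 → ℂ) :
    pull1 k (combA v) = combA (actM (matA k) v) :=
  map_linearCombination (P := pullL1 k) (pullL1_baseA k) v

theorem pull1_comb1 (k : Fin 5) (v : (Fin 5 → ℂ) × (Fin 10 → ℂ)) :
    pull1 k (comb1 v) = comb1 (actM (matS k) v.1, actM (matA k) v.2) := by
  change pullL1 k (combS v.1 + combA v.2) = combS _ + combA _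
  rw [map_add]
  exact congrArg₂ (· + ·) (map_linearCombination (P := pullL1 k) (pullL1_baseS k) v.1)
    (pull1_combA k v.2)

theorem pullback_logLin (k : Fin 5) (v : Coords) :
    pullback k (logLin Ystar lnAbs v) = logLin Ystar lnAbs (coordAct k v) := by
  rw [logLin_apply, pullback_logTuple, pull0_comb0, pull1_comb1]
  rfl

theorem realPts_subset : realPts ⊆ Ystar := fun _ hx => hx.1

theorem range_logLin_lnAbs : LinearMap.range (logLin Ystar lnAbs) = globalAR1 := by
  have hsum (η : Tuple 1) : (∑ f : Fol, LinearMap.proj f : Tuple 1 →ₗ[ℂ] Y5 → Y5 [⋀^Fin 1]→L[ℂ] ℂ) η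
      = fun x => ∑ f, η f x := by
    ext x v; simp [LinearMap.sum_apply, Finset.sum_apply]
  have hspan0 : Submodule.span ℂ (Set.range (tuple0 Ystar)) = LinearMap.range (lin0 Ystar) :=
    Submodule.span_eq (LinearMap.range (lin0 Ystar))
  have hspan1 : Submodule.span ℂ (Set.range (tuple1 Ystar lnAbs)) =
      LinearMap.range (lin1 Ystar lnAbs) := Submodule.span_eq (LinearMap.range (lin1 Ystar lnAbs))
  ext η
  rw [mem_range_logLin, globalAR1, Submodule.mem_inf, LinearMap.mem_ker, hsum, hspan0, hspan1]
  constructor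
  · rintro ⟨c₀, h0, c₁, h1, rfl⟩
    refine ⟨Submodule.add_mem_sup ⟨c₀, rfl⟩ ⟨c₁, rfl⟩, funext fun x => ?_⟩
    by_cases hx : x ∈ Ystar
    · ext v
      have e (f : Fol) : (tuple0 Ystar c₀ + tuple1 Ystar lnAbs c₁) f x v =
          tuple0 Ystar c₀ f x v + tuple1 Ystar lnAbs c₁ f x v := rfl
      simp only [ContinuousAlternatingMap.sum_apply, e, tuple0_apply hx hx, tuple1_apply hx hx,
        Finset.sum_add_distrib]
      refine (congrArg₂ (· + ·) (Finset.sum_comm.trans (Finset.sum_eq_zero fun l _ => ?_))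
        (Finset.sum_comm.trans (Finset.sum_eq_zero fun l _ => ?_))).trans (add_zero 0)
      · rw [← Finset.sum_mul, h0 l, zero_mul]
      · rw [← Finset.sum_mul, Finset.sum_comm, Finset.sum_eq_zero fun k _ => by
          rw [← Finset.sum_mul, h1 k l, zero_mul], zero_mul]
    · refine Finset.sum_eq_zero fun f _ => ?_
      have e : (tuple0 Ystar c₀ + tuple1 Ystar lnAbs c₁) f x =
          tuple0 Ystar c₀ f x + tuple1 Ystar lnAbs c₁ f x := rfl
      simp [e, tuple0, tuple1, hx]
  · rintro ⟨h1, h2⟩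
    obtain ⟨_, ⟨c₀, rfl⟩, _, ⟨c₁, rfl⟩, rfl⟩ := Submodule.mem_sup.1 h1
    obtain ⟨h3, h4⟩ := (sum_logTuple_eq_zero_iff logSys_lnAbs realPts_subset subset_rfl c₀ c₁).1
      fun x _ => congrFun h2 x
    exact ⟨c₀, h3, c₁, h4, rfl⟩

section

/-! ### The action on the abelian relations -/

section

variable {V W : Type*} [AddCommMonoid V] [Module ℂ V] [AddCommMonoid W] [Module ℂ W]

/-- A representation transported by a linear equivalence. -/
def conjRep (φ : V ≃ₗ[ℂ] W) (τ : Representation ℂ WD5 V) : Representation ℂ WD5 W where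
  toFun g := φ.toLinearMap ∘ₗ τ g ∘ₗ φ.symm.toLinearMap
  map_one' := by ext; simp
  map_mul' g g' := by ext; simp

theorem conjRep_apply (φ : V ≃ₗ[ℂ] W) (τ : Representation ℂ WD5 V) (g : WD5) (v : V) :
    conjRep φ τ g (φ v) = φ (τ g v) := by
  change φ (τ g (φ.symm (φ v))) = _
  rw [φ.symm_apply_apply]

/-- The product of two representations. -/
def prodRep (τ : Representation ℂ WD5 V) (τ' : Representation ℂ WD5 W) :
    Representation ℂ WD5 (V × W) where
  toFun g := (τ g).prodMap (τ' g)
  map_one' := by ext <;> simp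
  map_mul' g g' := by ext <;> simp

theorem prodRep_inl (τ : Representation ℂ WD5 V) (τ' : Representation ℂ WD5 W) (g : WD5) (v : V) :
    prodRep τ τ' g (v, 0) = (τ g v, 0) := Prod.ext rfl (map_zero (τ' g))

theorem prodRep_inr (τ : Representation ℂ WD5 V) (τ' : Representation ℂ WD5 W) (g : WD5) (w : W) :
    prodRep τ τ' g (0, w) = (0, τ' g w) := Prod.ext (map_zero (τ g)) rfl

theorem range_eq_submoduleOf {E : Type*} [AddCommMonoid E] [Module ℂ E] {A S : Submodule ℂ E}
    {j : V →ₗ[ℂ] A} (φ : W ≃ₗ[ℂ] V) {F : W →ₗ[ℂ] E} (hj : ∀ v, (j (φ v) : E) = F v)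
    (hS : S = LinearMap.range F) : LinearMap.range j = S.submoduleOf A := by
  subst hS
  ext η
  constructor
  · rintro ⟨y, rfl⟩
    obtain ⟨v, rfl⟩ := φ.surjective y
    exact ⟨v, (hj v).symm⟩
  · rintro ⟨v, e⟩
    exact ⟨φ v, Subtype.ext ((hj v).trans e)⟩

/-- A representation on which the generators act by integral matrices with no common invariant
subspace is irreducible. -/
theorem isSimpleOrder_of_equiv {n : ℕ} [NeZero n] {G : Fin 5 → Fin n → Fin n → ℤ}
    (hG : ∀ U, IsInv G U → U = ⊥ ∨ U = ⊤) {τ : Representation ℂ WD5 V} (φ : (Fin n → ℂ) ≃ₗ[ℂ] V)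
    (hφ : ∀ k v, φ (actM (G k) v) = τ (gen k) (φ v)) : IsSimpleOrder (Subrepresentation τ) where
  exists_pair_ne := ⟨⊥, ⊤, fun h => by
    have h1 : (⊥ : Submodule ℂ V) = ⊤ := congrArg Subrepresentation.toSubmodule h
    have h2 : φ (Pi.single 0 1) ∈ (⊥ : Submodule ℂ V) := h1 ▸ Submodule.mem_top
    rw [Submodule.mem_bot, LinearEquiv.map_eq_zero_iff, Pi.single_eq_zero_iff] at h2
    exact one_ne_zero h2⟩
  eq_bot_or_eq_top X := by
    refine (hG (X.toSubmodule.comap φ.toLinearMap) fun k v hv => ?_).imp (fun h => ?_) fun h => ?_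
    · change φ (actM (G k) v) ∈ X.toSubmodule
      rw [hφ]
      exact X.apply_mem_toSubmodule _ hv
    · refine Subrepresentation.toSubmodule_injective (eq_bot_iff.2 fun v hv => ?_)
      have : φ.symm v ∈ X.toSubmodule.comap φ.toLinearMap := by
        rw [Submodule.mem_comap]; simpa using hv
      rw [h, Submodule.mem_bot, LinearEquiv.map_eq_zero_iff] at this
      exact this
    · refine Subrepresentation.toSubmodule_injective (eq_top_iff.2 fun v _ => ?_)
      have : φ.symm v ∈ X.toSubmodule.comap φ.toLinearMap := h ▸ Submodule.mem_top
      rw [Submodule.mem_comap] at this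
      simpa using this

/-- The image of an irreducible representation by an equivariant embedding. -/
theorem exists_subrepresentation {n : ℕ} [NeZero n] {G : Fin 5 → Fin n → Fin n → ℤ}
    (hG : ∀ U, IsInv G U → U = ⊥ ∨ U = ⊤) {τ : Representation ℂ WD5 V} (φ : (Fin n → ℂ) ≃ₗ[ℂ] V)
    (hφ : ∀ k v, φ (actM (G k) v) = τ (gen k) (φ v)) {ρ : Representation ℂ WD5 W}
    (j : V →ₗ[ℂ] W) (hj : Function.Injective j) (hρ : ∀ g v, j (τ g v) = ρ g (j v))
    {S : Submodule ℂ W} (hS : LinearMap.range j = S) :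
    ∃ X : Subrepresentation ρ, X.toSubmodule = S ∧
      IsSimpleOrder (Subrepresentation X.toRepresentation) ∧
      Nonempty (X.toRepresentation.Equiv τ) := by
  subst hS
  let X : Subrepresentation ρ := ⟨LinearMap.range j, by
    rintro g _ ⟨v, rfl⟩
    exact ⟨_, hρ g v⟩⟩
  let ψ : V ≃ₗ[ℂ] X.toSubmodule := LinearEquiv.ofInjective j hj
  have hψ (g : WD5) (v : V) : ψ (τ g v) = X.toRepresentation g (ψ v) := Subtype.ext (hρ g v)
  have e : τ.Equiv X.toRepresentation := .mk ψ fun g => LinearMap.ext (hψ g)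
  exact ⟨X, rfl, isSimpleOrder_of_equiv hG (φ.trans ψ) fun k v =>
    (congrArg ψ (hφ k v)).trans (hψ _ _), ⟨e.symm⟩⟩

end

theorem isConnected_Ystar : IsConnected Ystar := ⟨⟨_, basePt_mem⟩, isPreconnected_Ystar⟩

namespace LogDom

variable {D : Set Y5} {L : Fin 10 → Y5 → ℂ} (h : LogDom D L)
include h

/-- The action of the Weyl group on the abelian relations of degree one, in terms of
representations with given matrices. -/
theorem exists_action {V₀ VS VA : Type*} [AddCommMonoid V₀] [Module ℂ V₀] [AddCommMonoid VS]
    [Module ℂ VS] [AddCommMonoid VA] [Module ℂ VA] {τ₀ : Representation ℂ WD5 V₀}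
    {τS : Representation ℂ WD5 VS} {τA : Representation ℂ WD5 VA}
    (φ₀ : (Fin 20 → ℂ) ≃ₗ[ℂ] V₀) (h₀ : ∀ k v, φ₀ (actM (mat0 k) v) = τ₀ (gen k) (φ₀ v))
    (φS : (Fin 5 → ℂ) ≃ₗ[ℂ] VS) (hS : ∀ k v, φS (actM (matS k) v) = τS (gen k) (φS v))
    (φA : (Fin 10 → ℂ) ≃ₗ[ℂ] VA) (hA : ∀ k v, φA (actM (matA k) v) = τA (gen k) (φA v)) :
    ∃ e : globalAR1 ≃ₗ[ℂ] AR 1 D Finset.univ,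
      (∀ (η : globalAR1) (c₀ : Fol → Fin 3 → ℂ) (c₁ : Fol → Fin 3 → Fin 3 → ℂ),
        (η : Tuple 1) = tuple0 Ystar c₀ + tuple1 Ystar lnAbs c₁ →
        (e η : Tuple 1) = tuple0 D c₀ + tuple1 D L c₁) ∧
      ∃ ρ : Representation ℂ WD5 (AR 1 D Finset.univ),
        (∀ k η, (e.symm (ρ (gen k) η) : Tuple 1) = pullback k (e.symm η : Tuple 1)) ∧
        ∃ X₀ X₁ X₂ : Subrepresentation ρ,
          X₀.toSubmodule = (W0 D Finset.univ).submoduleOf (AR 1 D Finset.univ) ∧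
          X₁.toSubmodule = (AR1Sym D L coefS).submoduleOf (AR 1 D Finset.univ) ∧
          X₂.toSubmodule = (AR1C D L coefA).submoduleOf (AR 1 D Finset.univ) ∧
          IsSimpleOrder (Subrepresentation X₀.toRepresentation) ∧
          IsSimpleOrder (Subrepresentation X₁.toRepresentation) ∧
          IsSimpleOrder (Subrepresentation X₂.toRepresentation) ∧
          Nonempty (X₀.toRepresentation.Equiv τ₀) ∧
          Nonempty (X₁.toRepresentation.Equiv τS) ∧
          Nonempty (X₂.toRepresentation.Equiv τA) := by
  have hr : LinearMap.range (logLin D L) = AR 1 D Finset.univ := by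
    ext η
    rw [mem_range_logLin, h.mem_AR_iff, K0I_univ, K1I_univ]
  let Ψ : Coords ≃ₗ[ℂ] AR 1 D Finset.univ :=
    (LinearEquiv.ofInjective _ (logLin_injective h.logSys subset_rfl h.sub)).trans
      (LinearEquiv.ofEq _ _ hr)
  let Φ : Coords ≃ₗ[ℂ] globalAR1 :=
    (LinearEquiv.ofInjective _ (logLin_injective logSys_lnAbs realPts_subset subset_rfl)).trans
      (LinearEquiv.ofEq _ _ range_logLin_lnAbs)
  have hΨ (v : Coords) : (Ψ v : Tuple 1) = logLin D L v := rfl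
  have hΦ (v : Coords) : (Φ v : Tuple 1) = logLin Ystar lnAbs v := rfl
  let Ω := (φ₀.prodCongr (φS.prodCongr φA)).symm.trans Ψ
  let τ := prodRep τ₀ (prodRep τS τA)
  have hΩ (v : Coords) : Ω (φ₀ v.1, φS v.2.1, φA v.2.2) = Ψ v :=
    congrArg Ψ ((φ₀.prodCongr (φS.prodCongr φA)).symm_apply_apply v)
  have hτ (k : Fin 5) (v : Coords) : conjRep Ω τ (gen k) (Ψ v) = Ψ (coordAct k v) := by
    rw [← hΩ, conjRep_apply, ← hΩ]
    refine congrArg Ω (Prod.ext ?_ (Prod.ext ?_ ?_))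
    exacts [(h₀ k v.1).symm, (hS k v.2.1).symm, (hA k v.2.2).symm]
  refine ⟨Φ.symm.trans Ψ, fun η c₀ c₁ hη => ?_, conjRep Ω τ, fun k η => ?_, ?_⟩
  · obtain ⟨v, rfl⟩ := Φ.surjective η
    rw [LinearEquiv.trans_apply, Φ.symm_apply_apply, hΨ, logLin_apply]
    rw [hΦ, logLin_apply] at hη
    obtain ⟨e0, e1⟩ := logTuple_injective logSys_lnAbs realPts_subset subset_rfl hη
    rw [e0, e1]
  · obtain ⟨v, rfl⟩ := Ψ.surjective η
    rw [hτ]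
    change (Φ (Ψ.symm (Ψ _)) : Tuple 1) = pullback k (Φ (Ψ.symm (Ψ v)) : Tuple 1)
    rw [Ψ.symm_apply_apply, Ψ.symm_apply_apply, hΦ, hΦ, pullback_logLin]
  · obtain ⟨X₀, e₀, s₀, n₀⟩ := exists_subrepresentation irreducible0 φ₀ h₀ (ρ := conjRep Ω τ)
      (Ω.toLinearMap ∘ₗ LinearMap.inl ℂ _ _) (Ω.injective.comp LinearMap.inl_injective)
      (fun g v => (congrArg Ω (prodRep_inl _ _ g v).symm).trans (conjRep_apply Ω τ g (v, 0)).symm)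
      (range_eq_submoduleOf (S := W0 D Finset.univ) φ₀ (F := lin0 D ∘ₗ comb0) (fun v => by
        have := congrArg Subtype.val (hΩ (v, 0, 0))
        rw [hΨ, map_zero, map_zero] at this
        refine this.trans ?_
        simp [logLin, comb1])
        (by rw [h.W0_univ, LinearMap.range_comp, range_comb0]))
    obtain ⟨X₁, e₁, s₁, n₁⟩ := exists_subrepresentation irreducibleS φS hS (ρ := conjRep Ω τ)
      (Ω.toLinearMap ∘ₗ LinearMap.inr ℂ _ _ ∘ₗ LinearMap.inl ℂ _ _)
      (Ω.injective.comp (LinearMap.inr_injective.comp LinearMap.inl_injective))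
      (fun g v => by
        refine Eq.trans (congrArg Ω ?_) (conjRep_apply Ω τ g (0, v, 0)).symm
        rw [prodRep_inr, prodRep_inl]
        rfl)
      (range_eq_submoduleOf (S := AR1Sym D L coefS) φS (F := lin1 D L ∘ₗ combS) (fun v => by
        have := congrArg Subtype.val (hΩ (0, v, 0))
        rw [hΨ, map_zero, map_zero] at this
        refine this.trans ?_
        simp [logLin, comb1])
        (by rw [h.AR1Sym_eq, LinearMap.range_comp, range_combS]))
    obtain ⟨X₂, e₂, s₂, n₂⟩ := exists_subrepresentation irreducibleA φA hA (ρ := conjRep Ω τ)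
      (Ω.toLinearMap ∘ₗ LinearMap.inr ℂ _ _ ∘ₗ LinearMap.inr ℂ _ _)
      (Ω.injective.comp (LinearMap.inr_injective.comp LinearMap.inr_injective))
      (fun g v => by
        refine Eq.trans (congrArg Ω ?_) (conjRep_apply Ω τ g (0, 0, v)).symm
        rw [prodRep_inr, prodRep_inr]
        rfl)
      (range_eq_submoduleOf (S := AR1C D L coefA) φA (F := lin1 D L ∘ₗ combA) (fun v => by
        have := congrArg Subtype.val (hΩ (0, 0, v))
        rw [hΨ, map_zero, map_zero] at this
        refine this.trans ?_
        simp [logLin, comb1])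
        (by rw [h.AR1C_eq, LinearMap.range_comp, range_combA]))
    exact ⟨X₀, X₁, X₂, e₀, e₁, e₂, s₀, s₁, s₂, n₀, n₁, n₂⟩

/-- The action of the Weyl group on the combinatorial abelian relations of degree two. -/
theorem exists_action_AR2C :
    ∃ e : AR2C Ystar ≃ₗ[ℂ] AR2C D,
      (∀ η, (e η : Tuple 2) = restrictTo D (η : Tuple 2)) ∧
      ∃ ρ : Representation ℂ WD5 (AR2C D),
        (∀ k η, (e.symm (ρ (gen k) η) : Tuple 2) = pullback k (e.symm η : Tuple 2)) ∧
        Nonempty (ρ.Equiv (spechtModule (part [1, 1]) (part [1, 1, 1])).toRepresentation) := by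
  obtain ⟨φ, hφ⟩ := exists_equiv_spechtA
  let ψ := equivAR2C h.isOpen h.conn h.sub
  let ψ' := equivAR2C isOpen_Ystar isConnected_Ystar subset_rfl
  let κ : (Fin 10 → ℂ) ≃ₗ[ℂ] KA :=
    (LinearEquiv.ofInjective combA combA_injective).trans (LinearEquiv.ofEq _ _ range_combA)
  let Ω := φ.symm.trans (κ.trans ψ)
  have hΩ (v : Fin 10 → ℂ) : Ω (φ v) = ψ (κ v) :=
    congrArg (fun v => ψ (κ v)) (φ.symm_apply_apply v)
  refine ⟨ψ'.symm.trans ψ, fun η => ?_,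
    conjRep Ω (spechtModule (part [1, 1]) (part [1, 1, 1])).toRepresentation, fun k η => ?_, ?_⟩
  · obtain ⟨c, rfl⟩ := ψ'.surjective η
    rw [LinearEquiv.trans_apply, ψ'.symm_apply_apply]
    exact (restrictTo_tuple2 h.sub _).symm
  · obtain ⟨c, rfl⟩ := ψ.surjective η
    obtain ⟨v, rfl⟩ := κ.surjective c
    rw [← hΩ, conjRep_apply, ← hφ, hΩ, hΩ]
    change (ψ' (ψ.symm (ψ _)) : Tuple 2) = pullback k (ψ' (ψ.symm (ψ _)) : Tuple 2)
    rw [ψ.symm_apply_apply, ψ.symm_apply_apply]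
    refine Eq.trans ?_ (pullback_tuple2 k (combA v)).symm
    rw [pull1_combA]
    rfl
  · refine ⟨.mk Ω.symm fun g => LinearMap.ext fun η => ?_⟩
    obtain ⟨v, rfl⟩ := Ω.surjective η
    change Ω.symm (conjRep Ω (spechtModule _ _).toRepresentation g (Ω v)) =
      (spechtModule _ _).toRepresentation g (Ω.symm (Ω v))
    rw [conjRep_apply, Ω.symm_apply_apply, Ω.symm_apply_apply]

end LogDom

end

end GMWeb

end

open GMWeb in
theorem mainTheorem2 :
    ∃ (A : (Fin 5 → ℤˣ) → Fol → Fin 3 → Fin 3 → ℤ)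
      (B : Finset (Fin 5) → Fol → Fin 3 → Fin 3 → ℤ),
      (∀ ε, IsSmall (A ε)) ∧ (∀ T, IsSmall (B T)) ∧
      ∀ (D : Set Y5) (L : Fin 10 → Y5 → ℂ), IsOpen D → IsConnected D →
        (∀ k, AnalyticOnNhd ℂ (L k) D) → (∀ k, ∀ x ∈ D, Complex.exp (L k x) = zeta k x) →
        -- 1. ranks of the 5-subwebs
        (∀ I : Finset Fol, I.card = 5 →
          Module.rank ℂ (AR 1 D I) ≤ 6 ∧
          (Module.rank ℂ (AR 1 D I) = 6 ↔ ∃ ε : Fin 5 → ℤˣ, I = signedSubweb ε)) ∧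
        -- 2. odd signs
        (∀ ε : Fin 5 → ℤˣ, ∏ i, ε i = -1 →
          HasSmallLogBasis D (AR 1 D (signedSubweb ε)) 6 ∧
          AR 1 D (signedSubweb ε) = W0 D (signedSubweb ε)) ∧
        -- 3. even signs
        (∀ ε : Fin 5 → ℤˣ, ∏ i, ε i = 1 →
          HasSmallLogBasis D (W0 D (signedSubweb ε)) 5 ∧
          tuple1 D L (antiCoef (A ε)) ∈ W1 D L (signedSubweb ε) ∧
          tuple1 D L (antiCoef (A ε)) ∉ W0 D (signedSubweb ε) ∧
          totalD D (tuple1 D L (antiCoef (A ε))) = residue D ε) ∧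
        -- 4. weight 0
        (HasSmallLogBasis D (W0 D Finset.univ) 20 ∧
          (∀ η ∈ AR 1 D Finset.univ, η ∈ W0 D Finset.univ ↔ IsRationalOn D η) ∧
          (∀ η ∈ W0 D Finset.univ, totalD D η = 0)) ∧
        -- 5. the derivative is an isomorphism from `AR¹_C` onto `AR²_C`
        (AR1C D L A ≤ AR 1 D Finset.univ ∧
          Module.finrank ℂ (AR1C D L A) = 10 ∧
          ∃ δ : AR1C D L A ≃ₗ[ℂ] AR2C D, ∀ η, (δ η : Tuple 2) = totalD D (η : Tuple 1)) ∧
        -- 6. the symmetric abelian relations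
        (∀ T : Finset (Fin 5), T.card = 3 →
          tuple1 D L (symCoef (B T)) ∈ W1 D L (pairSubweb T) ∧
          IsCompleteAR (pairSubweb T) (tuple1 D L (symCoef (B T))) ∧
          IsIrreducibleAR D (pairSubweb T) (tuple1 D L (symCoef (B T))) ∧
          ∀ c, IsSmall c → tuple1 D L (symCoef c) ∈ W1 D L (pairSubweb T) →
            IsCompleteAR (pairSubweb T) (tuple1 D L (symCoef c)) →
            IsIrreducibleAR D (pairSubweb T) (tuple1 D L (symCoef c)) →
            tuple1 D L (symCoef c) = tuple1 D L (symCoef (B T)) ∨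
            tuple1 D L (symCoef c) = -tuple1 D L (symCoef (B T))) ∧
        (AR1Sym D L B ≤ W1 D L Finset.univ ∧
          (∀ η ∈ AR1Sym D L B, ∃ θ ∈ AR 0 D Finset.univ, totalD D θ = η) ∧
          Module.finrank ℂ (AR1Sym D L B) = 5) ∧
        -- 7. the decomposition in direct sum
        (iSupIndep ![W0 D Finset.univ, AR1Sym D L B, AR1C D L A] ∧
          W0 D Finset.univ ⊔ AR1Sym D L B ⊔ AR1C D L A = AR 1 D Finset.univ ∧
          W1 D L Finset.univ = AR1Sym D L B ⊔ AR1C D L A ∧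
          (∀ η : Tuple 1, η ∈ W0 D Finset.univ ⊔ AR1Sym D L B ↔
            ∃ θ ∈ AR 0 D Finset.univ, totalD D θ = η) ∧
          (∀ η : Tuple 1, η ∈ W0 D Finset.univ ⊔ AR1Sym D L B ↔
            η ∈ AR 1 D Finset.univ ∧ totalD D η = 0) ∧
          Module.finrank ℂ (W0 D Finset.univ) = 20 ∧
          Module.finrank ℂ (AR 1 D Finset.univ) = 35) ∧
        -- 8. the decomposition into irreducible representations of the Weyl group
        (∃ e : globalAR1 ≃ₗ[ℂ] AR 1 D Finset.univ,
          (∀ (η : globalAR1) (c₀ : Fol → Fin 3 → ℂ) (c₁ : Fol → Fin 3 → Fin 3 → ℂ),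
            (η : Tuple 1) = tuple0 Ystar c₀ + tuple1 Ystar lnAbs c₁ →
            (e η : Tuple 1) = tuple0 D c₀ + tuple1 D L c₁) ∧
          ∃ ρ : Representation ℂ WD5 (AR 1 D Finset.univ),
            (∀ k η, (e.symm (ρ (gen k) η) : Tuple 1) = pullback k (e.symm η : Tuple 1)) ∧
            ∃ X₀ X₁ X₂ : Subrepresentation ρ,
              X₀.toSubmodule = (W0 D Finset.univ).submoduleOf (AR 1 D Finset.univ) ∧
              X₁.toSubmodule = (AR1Sym D L B).submoduleOf (AR 1 D Finset.univ) ∧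
              X₂.toSubmodule = (AR1C D L A).submoduleOf (AR 1 D Finset.univ) ∧
              -- the three summands are irreducible representations
              IsSimpleOrder (Subrepresentation X₀.toRepresentation) ∧
              IsSimpleOrder (Subrepresentation X₁.toRepresentation) ∧
              IsSimpleOrder (Subrepresentation X₂.toRepresentation) ∧
              Nonempty (X₀.toRepresentation.Equiv
                (spechtModule (part [2]) (part [2, 1])).toRepresentation) ∧
              Nonempty (X₁.toRepresentation.Equiv
                (spechtModule (part []) (part [2, 2, 1])).toRepresentation) ∧
              Nonempty (X₂.toRepresentation.Equiv
                (spechtModule (part [1, 1]) (part [1, 1, 1])).toRepresentation)) ∧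
        (∃ e : AR2C Ystar ≃ₗ[ℂ] AR2C D,
          (∀ η, (e η : Tuple 2) = restrictTo D (η : Tuple 2)) ∧
          ∃ ρ : Representation ℂ WD5 (AR2C D),
            (∀ k η, (e.symm (ρ (gen k) η) : Tuple 2) = pullback k (e.symm η : Tuple 2)) ∧
            Nonempty (ρ.Equiv
              (spechtModule (part [1, 1]) (part [1, 1, 1])).toRepresentation)) := by
  refine ⟨coefA, coefS, fun _ => isSmall_dec1 _, fun _ => isSmall_dec1 _,
    fun D L hD hc hL hexp => ?_⟩
  have h : LogDom D L := ⟨hD, hc, hL, hexp⟩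
  have hd (ε : Fin 5 → ℤˣ) := h.hasSmallLogBasis_signed ε
  refine ⟨fun I hI => h.rank_AR_five hI, fun ε hε => ?_, fun ε hε => ?_,
    ⟨h.hasSmallLogBasis base0 (fun j => ?_) base0_indep (fun j => ?_) ?_,
      fun η => h.mem_W0_iff_isRationalOn, fun η hη => ?_⟩,
    ⟨?_, ?_, h.exists_totalD_equiv⟩, fun T hT => ?_, ⟨?_, fun η hη => ?_, ?_⟩,
    ⟨h.iSupIndep_summands, h.AR_eq_sup, h.W1_eq_sup, fun η => h.mem_image_iff',
      fun η => h.mem_image_iff, h.finrank_W0, ?_⟩, ?_, h.exists_action_AR2C⟩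
  · have := hd ε
    -- `AR¹ = W₀` for odd signs, and `dimSigned ε = 6`
    rw [dimSigned, hε, if_neg (by decide)] at this
    exact ⟨(h.AR_eq_W0_of_odd hε).symm ▸ this, h.AR_eq_W0_of_odd hε⟩
  · have := hd ε
    rw [dimSigned, if_pos hε] at this
    have hA := mem_KAI.1 (coefA_mem_KAI ε)
    refine ⟨this, h.tuple1_mem_W1_iff.2 (mem_K1I.2 ⟨hA.1.1, hA.2⟩), fun H => ?_, ?_⟩
    · rw [h.W0_eq] at H
      obtain ⟨c, -, hc⟩ := H
      exact h.tuple1_notMem_range (antiCoef_coefA_ne_zero hε) ⟨c, hc⟩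
    · rw [h.totalD_tuple1, tuple2_coefA D hε]
  · exact fun f s => trit_mem _ _
  · rw [K0I_univ]; exact base0_mem j
  · rw [K0I_univ]; exact h.finrank_eq.1.le
  · rw [h.W0_univ] at hη
    obtain ⟨c, -, rfl⟩ := hη
    exact h.totalD_tuple0 c
  · rw [← h.AR_eq_sup]; exact le_sup_right
  · rw [h.AR1C_eq, h.finrank_map_lin1]; exact h.finrank_eq.2.2.1
  · have hS := mem_KSI.1 (symCoef_coefS_mem hT)
    have hne (f : Fol) (hf : f ∈ pairSubweb T) : symCoef (coefS T) f ≠ 0 := coefS_ne hT hf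
    obtain ⟨f, hf⟩ : (pairSubweb T).Nonempty := by
      rw [pairSubweb, ← Finset.card_pos, Finset.card_product, hT]; decide
    refine ⟨h.tuple1_mem_W1_iff.2 (mem_K1I.2 ⟨hS.1.1, hS.2⟩), h.isComplete_iff.2 hne,
      h.isIrreducible hT fun h0 => hne f hf (congrFun h0 f), fun c hc hm hcomp _ => ?_⟩
    refine (h.symCoef_unique hT hc (h.tuple1_mem_W1_iff.1 hm) fun h0 =>
      h.isComplete_iff.1 hcomp f hf (congrFun h0 f)).imp (fun e => by rw [e]) fun e => ?_
    rw [e]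
    exact (lin1 D L).map_neg _
  · rw [h.W1_eq_sup]; exact le_sup_left
  · exact h.mem_image_iff'.1 ((le_sup_right : _ ≤ W0 D Finset.univ ⊔ AR1Sym D L coefS) hη)
  · rw [h.AR1Sym_eq, h.finrank_map_lin1]; exact h.finrank_eq.2.1
  · exact h.finrank_eq.2.2.2
  · obtain ⟨φ₀, h₀⟩ := exists_equiv_specht0
    obtain ⟨φS, hS⟩ := exists_equiv_spechtS
    obtain ⟨φA, hA⟩ := exists_equiv_spechtA
    exact h.exists_action φ₀ h₀ φS hS φA hA
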